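/- **Setting.** Let $d\ge 2$; vectors in $\mathbb R^d$ are rows, $e_1$ is the first standard basis vector, $x_\perp=x-(x\cdot e_1)e_1$, $S=S_1^{d-1}$ is the unit sphere with surface measure $\mathrm{vol}_S$, and $\mathcal B_1^{d-1}$ is the open unit ball. Put $\mathcal S_-=\{(v,w)\in S\times S: v\cdot w<0\}$ and $\mathcal S_+=\{(v,w)\in S\times S: v\cdot w>0\}$. *Scattering map.* Let $\Theta=(\Theta_1,\Theta_2):\mathcal S_-\to\mathcal S_+$ be a $C^1$ map such that (i) $\Theta(vk,wk)=(\Theta_1(v,w)k,\Theta_2(v,w)k)$ for all $k\in O(d)$; (ii) $\Theta_1(v,w),\Theta_2(v,w)\in\mathrm{span}(v,w)$; (iii) $\Theta_1(v,-v)=-v$; (iv) for each $v$, $w\mapsto\Theta_1(v,w)$ is a $C^1$ diffeomorphism from $\{w\in S: v\cdot w<0\}$ onto an open set $\mathcal V_v\subset S$. Let $\beta^-_v$ be its inverse and $\beta^+_v(u)=\Theta_2(v,\beta^-_v(u))$ for $u\in\mathcal V_v$. Fix $R:S\to SO(d)$ with $vR(v)=e_1$ for all $v$, smooth on $S$ minus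 one point. *Transition density.* For $y\in\mathbb R^d\setminus\{0\}$ let $\nu_y$ be the natural probability measure on $\{\mathbb Z^dM: M\in SL(d,\mathbb Z)\backslash SL(d,\mathbb R),\ y\in\mathbb Z^dM\}$, that is, $\nu_y=\sum_{m\ge1}\frac{m^{-d}}{\zeta(d)}\nu_{y,m}$, where $\nu_{y,m}$ is the law of $\mathbb Z^d hM_{y/m}$ with $h$ distributed according to the invariant probability measure on $(SL(d,\mathbb Z)\cap H)\backslash H$, $H=\{g\in SL(d,\mathbb R): e_1g=e_1\}$, and $M_y\in SL(d,\mathbb R)$ satisfies $e_1M_y=y$. Put $\mathfrak Z(0,\xi,1)=\{x:0<x_1<\xi,\ \|x_\perp\|<1\}$, and for $\xi>0$, $w,z\in e_1^\perp$, $\|w\|<1$, let $$\Phi_0(\xi,w,z)=\nu_{y}\big(\{L: L\cap(\mathfrak Z(0,\xi,1)+z)=\emptyset\}\big),\qquad y=\xi e_1+w+z,$$ and $\Phi_0(0,w,z)=1$. The density $p(v_0;v_1,\xi,v_2)=p_{0,\beta^+_{v_0}}(v_1,\xi,v_2)$ is defined to be $0$ unless $v_1\in\mathcal V_{v_0}$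 and $v_2\in\mathcal V_{v_1}$, in which case $$p(v_0;v_1,\xi,v_2)\,d\mathrm{vol}_S(v_2)=\Phi_0\big(\xi,w,(\beta^+_{v_0}(v_1)R(v_1))_\perp\big)\,dw,\qquad w=-\beta^-_{e_1}(v_2R(v_1))_\perp\in\{0\}\times\mathcal B_1^{d-1},$$ where $dw$ is $(d-1)$-dimensional Lebesgue measure. *The extended process.* Let $\mathcal X^{(n)}$ be the set of all $(Q_0,v_0,\xi_1,v_1,\dots,\xi_n,v_n)\in\mathbb R^d\times S\times(\mathbb R_{\ge0}\times S)^n$ with $v_j\in\mathcal V_{v_{j-1}}$ for $j=1,\dots,n$, let $\sigma_n$ be its volume measure (product of Lebesgue and surface measures), and $\mathcal X=\mathcal X^{(1)}$. Let $L^1_{\mathrm{loc}}(\mathcal X,\sigma_1)$ be the space of ($\sigma_1$-classes of) real measurable functions on $\mathcal X$ that are integrable over every compact subset of $\overline{\mathcal X}$. For $f\in L^1_{\mathrm{loc}}(\mathcal X,\sigma_1)$ put $$d\nu_f^{(n)}=f(Q_0,v_0,\xi_1,v_1)\prod_{j=1}^{n-1}p(v_{j-1};v_j,\xi_{j+1},v_{j+1})\,d\sigma_n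 .$$ With $T_k=\xi_1+\dots+\xi_k$ and $$\widehat\Xi_k(t)=\Big(Q_0+\sum_{j=1}^k\xi_jv_{j-1}+(t-T_k)v_k,\ v_k,\ T_{k+1}-t,\ v_{k+1}\Big),$$ define, for $t_j\ge0$ and Borel sets $D_j\subset\mathcal X$, $$\mathbb P_f\big(\widehat\Xi(t_1)\in D_1,\dots,\widehat\Xi(t_M)\in D_M\big)=\sum_{\mathbf n\in\mathbb Z_{\ge0}^M}\nu_f^{(\max_j n_j+1)}\big(\{\widehat\Xi_{n_j}(t_j)\in D_j,\ T_{n_j}\le t_j\ (j=1,\dots,M)\}\big).$$ **Proposition.** 1. For every $t\ge0$ and $f\in L^1_{\mathrm{loc}}(\mathcal X,\sigma_1)$ there is exactly one $K_tf\in L^1_{\mathrm{loc}}(\mathcal X,\sigma_1)$ with $$\int_D K_tf\,d\sigma_1=\mathbb P_f(\widehat\Xi(t)\in D)\quad\text{for all bounded Borel sets }D\subset\mathcal X$$ (where the integrals and the sum defining the right-hand side converge absolutely). The maps $K_t$ are linear and form a semigroup on $L^1_{\mathrm{loc}}(\mathcal X,\sigma_1)$: $K_0=\mathrm{id}$ and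 $K_{s+t}=K_sK_t$ for all $s,t\ge0$. 2. $K_t$ maps $L^1(\mathcal X,\sigma_1)$ into itself, and $\{K_t\}_{t\ge0}$ is a strongly continuous contraction semigroup on $L^1(\mathcal X,\sigma_1)$: $\|K_t\|\le1$, and $t\mapsto K_tf$ is continuous from $\mathbb R_{\ge0}$ to $L^1(\mathcal X,\sigma_1)$ for each $f\in L^1(\mathcal X,\sigma_1)$. 3. $\widehat\Xi(t)$ is Markovian: on $L^1(\mathcal X,\sigma_1)$ each $K_t$ preserves positivity and satisfies $\int K_tf\,d\sigma_1=\int f\,d\sigma_1$, and for all $f\in L^1(\mathcal X,\sigma_1)$, $0\le t_1\le\dots\le t_M$ ($M\ge1$) and Borel sets $D_1,\dots,D_M\subset\mathcal X$, $$\mathbb P_f\big(\widehat\Xi(t_1)\in D_1,\dots,\widehat\Xi(t_M)\in D_M\big)=\int_{D_M}K_{t_M-t_{M-1}}\,\mathbf 1_{D_{M-1}}\cdots K_{t_2-t_1}\,\mathbf 1_{D_1}K_{t_1}f\,d\sigma_1$$ (again with absolute convergence on the left-hand side). -/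

import Mathlib

open MeasureTheory Set
open scoped NNReal ENNReal ContDiff RealInnerProductSpace

noncomputable section

namespace LorentzGas

/-! ### Euclidean space, the unit sphere and the cylinder -/

/-- Euclidean space `ℝ^d`; vectors are rows. -/
abbrev E (d : ℕ) := EuclideanSpace ℝ (Fin d)

/-- The unit sphere `S_1^{d-1}`. -/
abbrev Sph (d : ℕ) := Metric.sphere (0 : E d) 1

/-- The surface measure on the unit sphere. -/
def volSph (d : ℕ) : Measure (Sph d) := (volume : Measure (E d)).toSphere

/-- The first standard basis vector, as a point of the unit sphere. -/
def e1 (d : ℕ) [NeZero d] : Sph d := ⟨EuclideanSpace.single 0 1, by simp⟩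

instance (d : ℕ) [NeZero d] : Nonempty (Sph d) := ⟨e1 d⟩

/-- The direction `x / ‖x‖` of a nonzero vector (junk value `e1` at `0`). -/
def dir {d : ℕ} [NeZero d] (x : E d) : Sph d :=
  if h : x = 0 then e1 d else ⟨‖x‖⁻¹ • x, by simp [norm_smul, h]⟩

/-- The image `vK` of a unit vector `v` under an orthogonal map `K`. -/
def rot {d : ℕ} (K : E d ≃ₗᵢ[ℝ] E d) (v : Sph d) : Sph d := ⟨K v, by simp⟩

/-- The component `x_⊥ = x - (x · e₁) e₁` of `x` orthogonal to `e₁`. -/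
def perp {d : ℕ} [NeZero d] (x : E d) : E d := x - x 0 • (e1 d : E d)

/-- The open cylinder `{x : c₁ < x₁ < c₂, ‖(x₂, …, x_d)‖ < r}`. -/
def cylinder (d : ℕ) [NeZero d] (c₁ c₂ r : ℝ) : Set (E d) :=
  {x | c₁ < x 0 ∧ x 0 < c₂ ∧ ‖perp x‖ < r}

/-- `K : S_1^{d-1} → SO(d)` with `v K(v) = e₁` for all `v`, smooth on the sphere minus one point
(smoothness is expressed through the extension of `K` that is homogeneous of degree zero). -/
structure IsFrame {d : ℕ} [NeZero d] (K : Sph d → (E d ≃ₗᵢ[ℝ] E d)) : Prop where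
  det_eq_one : ∀ v, LinearMap.det ((K v).toLinearEquiv : E d →ₗ[ℝ] E d) = 1
  map_self : ∀ v : Sph d, K v v = e1 d
  smooth : ∃ p : Sph d, ContDiffOn ℝ ∞
    (fun x : E d => ((K (dir x)).toContinuousLinearEquiv : E d →L[ℝ] E d)) {x | x ≠ 0 ∧ dir x ≠ p}

/-! ### Scattering maps -/

/-- The set `𝒱_v` of all velocities `Θ₁(v, w)`, `v · w < 0`, into which `v` can be scattered. -/
def outVel {d : ℕ} (Θ : Sph d × Sph d → Sph d × Sph d) (v : Sph d) : Set (Sph d) :=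
  (fun w => (Θ (v, w)).1) '' {w | ⟪(v : E d), (w : E d)⟫ < 0}

/-- `β⁻_v(u)`, the inverse of `w ↦ Θ₁(v, w)` on the hemisphere `v · w < 0`; used for
`u ∈ 𝒱_v` only. -/
def betaMinus {d : ℕ} [NeZero d] (Θ : Sph d × Sph d → Sph d × Sph d) (v u : Sph d) : Sph d :=
  Function.invFunOn (fun w => (Θ (v, w)).1) {w | ⟪(v : E d), (w : E d)⟫ < 0} u

/-- `β⁺_v(u) = Θ₂(v, β⁻_v(u))`. -/
def betaPlus {d : ℕ} [NeZero d] (Θ : Sph d × Sph d → Sph d × Sph d) (v u : Sph d) : Sph d :=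
  (Θ (v, betaMinus Θ v u)).2

/-- The standing assumptions on a scattering map `Θ : 𝒮₋ → 𝒮₊`. A scattering map is represented
by a function on all pairs of unit vectors, of which only the values on
`𝒮₋ = {(v, w) : v · w < 0}` matter. Being `C¹` on a (relatively open) subset of a
product of spheres is expressed through the extension that is homogeneous of degree zero. -/
structure IsScatteringMap {d : ℕ} [NeZero d] (Θ : Sph d × Sph d → Sph d × Sph d) : Prop where
  mapsTo : ∀ v w : Sph d, ⟪(v : E d), (w : E d)⟫ < 0 →
    0 < ⟪((Θ (v, w)).1 : E d), ((Θ (v, w)).2 : E d)⟫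
  spherically_symmetric : ∀ (K : E d ≃ₗᵢ[ℝ] E d) (v w : Sph d), ⟪(v : E d), (w : E d)⟫ < 0 →
    Θ (rot K v, rot K w) = (rot K (Θ (v, w)).1, rot K (Θ (v, w)).2)
  mem_span : ∀ v w : Sph d, ⟪(v : E d), (w : E d)⟫ < 0 →
    ((Θ (v, w)).1 : E d) ∈ Submodule.span ℝ {(v : E d), (w : E d)} ∧
    ((Θ (v, w)).2 : E d) ∈ Submodule.span ℝ {(v : E d), (w : E d)}
  head_on : ∀ v : Sph d, (Θ (v, -v)).1 = -v
  contDiffOn : ContDiffOn ℝ 1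
    (fun x : E d × E d => (((Θ (dir x.1, dir x.2)).1 : E d), ((Θ (dir x.1, dir x.2)).2 : E d)))
    {x | ⟪x.1, x.2⟫ < 0}
  isOpen_outVel : ∀ v, IsOpen (outVel Θ v)
  injOn : ∀ v : Sph d, InjOn (fun w => (Θ (v, w)).1) {w | ⟪(v : E d), (w : E d)⟫ < 0}
  contDiffOn_inv : ∀ v : Sph d,
    ContDiffOn ℝ 1 (fun y : E d => (betaMinus Θ v (dir y) : E d)) {y | y ≠ 0 ∧ dir y ∈ outVel Θ v}

/-- The density `J(v, u)`, `u ∈ 𝒱_v`, of the `(d-1)`-dimensional Lebesgue measure `dw` on the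
unit ball with respect to `d vol(u)`, where `w` is the component of `-β⁻_v(u)` orthogonal to `v`.
With `ω = β⁻_v(u)` one has `dw = |v · ω| d vol(ω)`, and the Jacobian of `ω ↦ u = Θ₁(v, ω)` as a map
of the sphere equals the Jacobian at `ω` of its extension `x ↦ ‖x‖ Θ₁(v, x / ‖x‖)`. -/
def jac {d : ℕ} [NeZero d] (Θ : Sph d × Sph d → Sph d × Sph d) (v u : Sph d) : ℝ :=
  |⟪(v : E d), (betaMinus Θ v u : E d)⟫| /
    |(fderiv ℝ (fun x : E d => ‖x‖ • ((Θ (v, dir x)).1 : E d)) (betaMinus Θ v u : E d)).det|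

/-! ### Random lattices -/

/-- `SL(d, ℝ)`. -/
abbrev SLR (d : ℕ) := Matrix.SpecialLinearGroup (Fin d) ℝ

instance (d : ℕ) : MeasurableSpace (SLR d) := borel _

instance (d : ℕ) : BorelSpace (SLR d) := ⟨rfl⟩

instance (d : ℕ) : LocallyCompactSpace (SLR d) :=
  haveI : LocallyCompactSpace (Matrix (Fin d) (Fin d) ℝ) :=
    inferInstanceAs (LocallyCompactSpace (Fin d → Fin d → ℝ))
  Matrix.SpecialLinearGroup.isClosedEmbedding_val.locallyCompactSpace

/-- `SL(d, ℤ)` as a subgroup of `SL(d, ℝ)`. -/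
def SLZ (d : ℕ) : Subgroup (SLR d) :=
  (Matrix.SpecialLinearGroup.map (n := Fin d) (Int.castRingHom ℝ)).range

/-- The product `xM` of a row vector and a matrix. -/
def rowMul {d : ℕ} (x : E d) (M : SLR d) : E d :=
  WithLp.toLp 2 (Matrix.vecMul x.ofLp (M : Matrix (Fin d) (Fin d) ℝ))

/-- The space `X₁ = SL(d, ℤ) \ SL(d, ℝ)` of unimodular lattices `ℤ^d M`. -/
abbrev LatticeSpace (d : ℕ) := MulAction.orbitRel.Quotient (SLZ d) (SLR d)

/-- The event that the lattice `ℤ^d M` is disjoint from `A`. -/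
def avoids {d : ℕ} (A : Set (E d)) : Set (LatticeSpace d) :=
  {L | ∀ M : SLR d, (Quotient.mk _ M : LatticeSpace d) = L →
    ∀ k : Fin d → ℤ, rowMul (WithLp.toLp 2 fun i => (k i : ℝ)) M ∉ A}

lemma rowMul_one {d : ℕ} (x : E d) : rowMul x 1 = x := by simp [rowMul]

lemma rowMul_mul {d : ℕ} (x : E d) (M N : SLR d) :
    rowMul x (M * N) = rowMul (rowMul x M) N := by
  simp [rowMul, Matrix.vecMul_vecMul]

/-- The group `H = {g ∈ SL(d, ℝ) : e₁ g = e₁}`. -/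
def stabE1 (d : ℕ) [NeZero d] : Subgroup (SLR d) where
  carrier := {g | rowMul (e1 d : E d) g = e1 d}
  one_mem' := rowMul_one _
  mul_mem' := by
    intro a b ha hb
    simp only [mem_ofPred_eq] at ha hb ⊢
    rw [rowMul_mul, ha, hb]
  inv_mem' := by
    intro a ha
    simp only [mem_ofPred_eq] at ha ⊢
    conv_lhs => rw [← ha]
    rw [← rowMul_mul, mul_inv_cancel, rowMul_one]

lemma isClosed_stabE1 (d : ℕ) [NeZero d] : IsClosed (stabE1 d : Set (SLR d)) := by
  have hc : Continuous fun g : SLR d => rowMul (e1 d : E d) g := by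
    unfold rowMul
    have h : Continuous fun g : SLR d => (g : Matrix (Fin d) (Fin d) ℝ) := continuous_subtype_val
    fun_prop
  exact isClosed_eq hc continuous_const

instance (d : ℕ) [NeZero d] : LocallyCompactSpace (stabE1 d) :=
  (isClosed_stabE1 d).isClosedEmbedding_subtypeVal.locallyCompactSpace

/-- `SL(d, ℤ) ∩ H`, as a subgroup of `H`. -/
def stabZ (d : ℕ) [NeZero d] : Subgroup (stabE1 d) := (SLZ d).subgroupOf (stabE1 d)

open Classical in
/-- Haar measure of `H`, restricted to a fundamental domain for the left action of
`SL(d, ℤ) ∩ H` and normalized to total mass one: it represents the invariant probability measure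
on `(SL(d, ℤ) ∩ H) \ H`. -/
def haarStab (d : ℕ) [NeZero d] : Measure (stabE1 d) :=
  if h : ∃ F : Set (stabE1 d), IsFundamentalDomain (stabZ d) F (Measure.haar : Measure (stabE1 d))
  then ((Measure.haar : Measure (stabE1 d)) h.choose)⁻¹ • Measure.haar.restrict h.choose
  else 0

open Classical in
/-- A matrix `M_y ∈ SL(d, ℝ)` with `e₁ M_y = y`, for `y ≠ 0`. -/
def sect {d : ℕ} [NeZero d] (y : E d) : SLR d :=
  if h : ∃ M : SLR d, rowMul (e1 d : E d) M = y then h.choose else 1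

/-- The probability measure `ν_y` on `{ℤ^d M ∈ X₁ : y ∈ ℤ^d M}`, `y ≠ 0`: for `m = 1, 2, …`, with
probability `m^{-d} / ζ(d)` the vector `y` is `m` times a primitive vector of the lattice, and
in that case the lattice is `ℤ^d h M_{y/m}` with `h` Haar distributed on
`(SL(d, ℤ) ∩ H) \ H`. -/
def nuY {d : ℕ} [NeZero d] (y : E d) : Measure (LatticeSpace d) :=
  Measure.sum fun m : ℕ =>
    ENNReal.ofReal ((((m : ℝ) + 1) ^ d)⁻¹ / ∑' k : ℕ, (((k : ℝ) + 1) ^ d)⁻¹) •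
      Measure.map
        (fun h : stabE1 d =>
          (Quotient.mk _ ((h : SLR d) * sect (((m : ℝ) + 1)⁻¹ • y)) : LatticeSpace d))
        (haarStab d)

open Classical in
/-- `Φ_0(ξ, w, z)`: the `ν_y`-probability, `y = ξ e₁ + w + z`, that the lattice is disjoint from
the cylinder of length `ξ` and radius `1` shifted by `z`; it equals `1` for `ξ = 0`. -/
def Phi0 {d : ℕ} [NeZero d] (ξ : ℝ) (w z : E d) : ℝ :=
  if ξ = 0 then 1
  else (nuY (ξ • (e1 d : E d) + w + z) (avoids {x | x - z ∈ cylinder d 0 ξ 1})).toReal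

/-! ### The transition density -/

open Classical in
/-- The transition density `p_{0, β⁺_{v₀}}(v₁, ξ, v₂)`. -/
def transDens {d : ℕ} [NeZero d] (Θ : Sph d × Sph d → Sph d × Sph d)
    (K : Sph d → (E d ≃ₗᵢ[ℝ] E d)) (v₀ v₁ : Sph d) (ξ : ℝ) (v₂ : Sph d) : ℝ :=
  if v₁ ∈ outVel Θ v₀ ∧ v₂ ∈ outVel Θ v₁ then
    jac Θ v₁ v₂ *
      Phi0 ξ (-perp (betaMinus Θ (e1 d) (rot (K v₁) v₂) : E d))
        (perp (K v₁ (betaPlus Θ v₀ v₁ : E d)))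
  else 0

/-! ### The extended phase space and the spaces of densities -/

/-- Quadruples `(Q, V, ξ, V₊)`. -/
abbrev Phase (d : ℕ) := E d × Sph d × ℝ × Sph d

/-- The extended phase space `𝒳`. -/
def extPhase {d : ℕ} (Θ : Sph d × Sph d → Sph d × Sph d) : Set (Phase d) :=
  {z | 0 ≤ z.2.2.1 ∧ z.2.2.2 ∈ outVel Θ z.2.1}

/-- The measure `σ₁` on `𝒳`, as a measure on all quadruples which is carried by `𝒳`. -/
def sigma1 {d : ℕ} (Θ : Sph d × Sph d → Sph d × Sph d) : Measure (Phase d) :=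
  ((volume : Measure (E d)).prod
    ((volSph d).prod ((volume : Measure ℝ).prod (volSph d)))).restrict (extPhase Θ)

/-- `L¹(𝒳, σ₁)`. -/
abbrev L1 {d : ℕ} (Θ : Sph d × Sph d → Sph d × Sph d) := Lp ℝ 1 (sigma1 Θ)

/-- `L¹_loc(𝒳, σ₁)`: classes of measurable functions which are integrable over every compact
subset of the closure of `𝒳`. -/
def L1loc {d : ℕ} (Θ : Sph d × Sph d → Sph d × Sph d) :
    Submodule ℝ (Phase d →ₘ[sigma1 Θ] ℝ) where
  carrier := {f | ∀ C, IsCompact C → C ⊆ closure (extPhase Θ) → IntegrableOn f C (sigma1 Θ)}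
  zero_mem' := by
    intro C _ _
    refine (integrable_zero _ ℝ _).congr (ae_restrict_of_ae ?_)
    filter_upwards [AEEqFun.coeFn_zero (μ := sigma1 Θ) (α := Phase d) (β := ℝ)] with x hx
    simp [hx]
  add_mem' := by
    intro f g hf hg C hC hCX
    refine ((hf C hC hCX).add (hg C hC hCX)).congr (ae_restrict_of_ae ?_)
    filter_upwards [AEEqFun.coeFn_add f g] with x hx
    simp [hx]
  smul_mem' := by
    intro c f hf C hC hCX
    refine ((hf C hC hCX).smul c).congr (ae_restrict_of_ae ?_)
    filter_upwards [AEEqFun.coeFn_smul c f] with x hx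
    simp [hx]

/-- The inclusion of `L¹(𝒳, σ₁)` in `L¹_loc(𝒳, σ₁)`. -/
def toLoc {d : ℕ} {Θ : Sph d × Sph d → Sph d × Sph d} (f : L1 Θ) : L1loc Θ :=
  ⟨f, fun _ _ _ => (memLp_one_iff_integrable.1 (Lp.memLp f)).integrableOn⟩

/-- The restriction `1_D f` of `f ∈ L¹(𝒳, σ₁)` to a measurable set `D`. -/
def cut {d : ℕ} {Θ : Sph d × Sph d → Sph d × Sph d} {D : Set (Phase d)} (hD : MeasurableSet D)
    (f : L1 Θ) : L1 Θ :=
  ((Lp.memLp f).indicator hD).toLp _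

/-! ### Random paths and the process `Ξ̂` -/

/-- Tuples `(Q₀, v₀, ξ₁, v₁, …, ξ_n, v_n)`. -/
abbrev Path (d n : ℕ) := E d × Sph d × (Fin n → ℝ × Sph d)

namespace Path

variable {d n : ℕ}

/-- The velocity `v_k` (`0 ≤ k ≤ n`). -/
def vel (x : Path d n) : ℕ → Sph d
  | 0 => x.2.1
  | k + 1 => if h : k < n then (x.2.2 ⟨k, h⟩).2 else x.2.1

/-- The length `ξ_{k+1}` (`0 ≤ k < n`) of the free flight with velocity `v_k`. -/
def len (x : Path d n) (k : ℕ) : ℝ := if h : k < n then (x.2.2 ⟨k, h⟩).1 else 0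

/-- The collision time `T_k = ξ₁ + … + ξ_k`. -/
def time (x : Path d n) (k : ℕ) : ℝ := ∑ j ∈ Finset.range k, x.len j

/-- `Ξ̂_k(t)`: the extended state at time `t`, computed as if exactly `k` collisions had occurred
(used for `k < n`). -/
def state (x : Path d n) (k : ℕ) (t : ℝ) : Phase d :=
  (x.1 + ∑ j ∈ Finset.range k, x.len j • (x.vel j : E d) + (t - x.time k) • (x.vel k : E d),
    x.vel k, x.time (k + 1) - t, x.vel (k + 1))

end Path

/-- The set `𝒳^{(n)}`. -/
def pathSpace {d : ℕ} (Θ : Sph d × Sph d → Sph d × Sph d) (n : ℕ) : Set (Path d n) :=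
  {x | ∀ j < n, 0 ≤ x.len j ∧ x.vel (j + 1) ∈ outVel Θ (x.vel j)}

/-- The volume measure `σ_n` on `𝒳^{(n)}`. -/
def sigmaN {d : ℕ} (Θ : Sph d × Sph d → Sph d × Sph d) (n : ℕ) : Measure (Path d n) :=
  ((volume : Measure (E d)).prod
    ((volSph d).prod
      (Measure.pi fun _ : Fin n => (volume : Measure ℝ).prod (volSph d)))).restrict (pathSpace Θ n)

/-- The density of `ν_f^{(N+1)}` with respect to `σ_{N+1}`. -/
def pathDens {d : ℕ} [NeZero d] (Θ : Sph d × Sph d → Sph d × Sph d)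
    (K : Sph d → (E d ≃ₗᵢ[ℝ] E d)) (f : Phase d → ℝ) (N : ℕ) (x : Path d (N + 1)) : ℝ :=
  f (x.1, x.vel 0, x.len 0, x.vel 1) *
    ∏ j ∈ Finset.range N,
      transDens Θ K (x.vel j) (x.vel (j + 1)) (x.len (j + 1)) (x.vel (j + 2))

/-- The event `Ξ̂_{n_j}(t_j) ∈ D_j`, `T_{n_j} ≤ t_j` for all `j`, in terms of the first `N + 1` free
flights, where `n_j ≤ N`. -/
def visit {d : ℕ} {M : ℕ} (N : ℕ) (n : Fin M → ℕ) (t : Fin M → ℝ≥0) (D : Fin M → Set (Phase d)) :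
    Set (Path d (N + 1)) :=
  {x | ∀ j, x.state (n j) (t j) ∈ D j ∧ x.time (n j) ≤ t j}

/-- `s = P_f(Ξ̂(t₁) ∈ D₁, …, Ξ̂(t_M) ∈ D_M)`, defined as the sum over all `(n₁, …, n_M)` of the
`ν_f^{(n+1)}`-measures, `n = max n_j`, of the events `visit`; all integrals and the sum
converge absolutely. -/
def HasProb {d : ℕ} [NeZero d] (Θ : Sph d × Sph d → Sph d × Sph d)
    (K : Sph d → (E d ≃ₗᵢ[ℝ] E d)) (f : Phase d → ℝ) {M : ℕ} (t : Fin M → ℝ≥0)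
    (D : Fin M → Set (Phase d)) (s : ℝ) : Prop :=
  (∀ n : Fin M → ℕ, IntegrableOn (pathDens Θ K f (Finset.univ.sup n))
      (visit (Finset.univ.sup n) n t D) (sigmaN Θ (Finset.univ.sup n + 1))) ∧
  HasSum (fun n : Fin M → ℕ => ∫ x in visit (Finset.univ.sup n) n t D,
      pathDens Θ K f (Finset.univ.sup n) x ∂(sigmaN Θ (Finset.univ.sup n + 1))) s

/-- `g = K_t f`: the integral of `g` over any bounded Borel set `D ⊆ 𝒳` is
`P_f(Ξ̂(t) ∈ D)`. -/
def IsPropagated {d : ℕ} [NeZero d] (Θ : Sph d × Sph d → Sph d × Sph d)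
    (K : Sph d → (E d ≃ₗᵢ[ℝ] E d)) (t : ℝ≥0) (f g : L1loc Θ) : Prop :=
  ∀ D : Set (Phase d), MeasurableSet D → Bornology.IsBounded D → D ⊆ extPhase Θ →
    HasProb Θ K (f : Phase d →ₘ[sigma1 Θ] ℝ) (fun _ : Fin 1 => t) (fun _ => D)
      (∫ z in D, (g : Phase d →ₘ[sigma1 Θ] ℝ) z ∂(sigma1 Θ))

/-! ### Semigroups -/

/-- A strongly continuous semigroup of contractions on a normed space. -/
structure IsContractionSemigroup {B : Type*} [NormedAddCommGroup B] [NormedSpace ℝ B]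
    (U : ℝ≥0 → (B →L[ℝ] B)) : Prop where
  zero : U 0 = ContinuousLinearMap.id ℝ B
  add : ∀ s t, U (s + t) = (U s).comp (U t)
  norm_le_one : ∀ t, ‖U t‖ ≤ 1
  strongly_continuous : ∀ f, Continuous fun t => U t f

/-- The sub-density of the event `Ξ̂(t₀) ∈ D₀, …, Ξ̂(t_{k-1}) ∈ D_{k-1}` and of the state at time `t_k`,
for a Markov process with initial density `f` and transition operators `U`, i.e.
`U_{t_k - t_{k-1}} 1_{D_{k-1}} ⋯ U_{t₁ - t₀} 1_{D₀} U_{t₀} f`. -/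
def markovChain {d : ℕ} {Θ : Sph d × Sph d → Sph d × Sph d} (U : ℝ≥0 → (L1 Θ →L[ℝ] L1 Θ))
    (f : L1 Θ) (t : ℕ → ℝ≥0) {D : ℕ → Set (Phase d)} (hD : ∀ k, MeasurableSet (D k)) : ℕ → L1 Θ
  | 0 => U (t 0) f
  | k + 1 => U (t (k + 1) - t k) (cut (hD k) (markovChain U f t hD k))

end LorentzGas

end

/-!
# The kinetic transport process of the periodic Lorentz gas

*The transition density is a probability density.* This is the only point where lattices enter.
Integrate `Φ₀` over the half-infinite cylinder of all possible positions `y` of the next scatterer.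
The measures `ν_y`, averaged over `y`, are the fibres of the invariant measure on the space of
lattices: by unfolding a sum over the nonzero lattice vectors, each of which is a multiple of the
first row of a matrix in `SL(d, ℤ)`, one obtains Siegel's formula `lintegral_tsum_intVec`. So the
integral is the mean number of lattice vectors in the cylinder that have no other lattice vector of
the cylinder in front of them. For almost every lattice there is exactly one such vector, by
Minkowski's theorem (`existsUnique_first_vector`), and the integral equals one
(`lintegral_missProb`). The normalization requires that `SL(d, ℤ)` has finite covolume and that the
ratio of the two covolumes is `ζ(d)`. The former follows by induction on `d` from Siegel's formula
for the number of lattice vectors in a cube (`haar_fundDomain_SLZ_lt_top`), the latter by comparing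
the mean number of lattice vectors in a large cube with its volume (`fiberMeasure_fundDomain_eq`).
The position on the next scatterer is parametrized by the next velocity: the scattering map is a
diffeomorphism onto the set of outgoing velocities (`lintegral_outVel`), and a hemisphere with the
measure `|η₁| d vol(η)` projects to the unit ball (`lintegral_hemisphere_cylinder`). This gives
`lintegral_transRate`, and, since `Φ₀ ≤ 1`, a uniform bound on the density of the free path length
(`lintegral_transRate_le`).

*The process.* All further arguments use only the properties collected in `IsTransRate`. Let
`evolve Θ q g t z` be the expectation of `g` at time `t` for the process started at the state `z`,
as a sum over the number of collisions. Conditioning on the first collision gives the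
Chapman-Kolmogorov equation (`evolve_add`). The bound on the density of the path length makes the
probability of many collisions in a given time geometrically small (`atLeast_succ_le`), so no mass
escapes (`evolve_one`). Null sets are not charged, because the position is only translated
(`ae_evolve_eq_zero`), and the particle moves with speed one, so that a bounded set is reached only
from a bounded set (`evolve_eq_zero_of_notMem_phaseBox`). Conditioning on the earliest of several
times, and summing over all vectors of collision numbers, expresses the finite-dimensional
distributions through iterated transition operators (`tsum_hitProb`, `hasProb`).

*The propagators.* `K_t` is the operator dual to `evolve`. For a nonnegative locally integrable
density, the distribution at time `t` is absolutely continuous and finite on bounded sets, and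
`K_t f` is its Radon-Nikodym density (`exists_density`, `exists_propagates`). A locally integrable
density is determined by its integrals over bounded sets, which yields uniqueness, linearity and the
semigroup law (`isPropagated_iff`, `propagator_zero`, `propagator_add`). On integrable densities
conservation of mass makes `K_t` a contraction that preserves the integral. For strong continuity
it suffices to consider small `t`, where most states move by free flight, and translations are
continuous in the mean (`abs_integral_mul_evolve_sub_le`). By duality the iterated transition
operators in the finite-dimensional distributions become iterated propagators, which is the Markov
property (`hasProb_markovChain`).
-/

set_option linter.unusedSectionVars false

noncomputable section

namespace LorentzGas

/-! ### Strict fundamental domains and `SL(d, ℤ)` -/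

/-- A Borel set that meets every orbit of `Γ` exactly once, and only with one group element. -/
structure IsStrictFundamentalDomain (Γ : Type*) {X : Type*} [Group Γ] [MulAction Γ X]
    [MeasurableSpace X] (F : Set X) : Prop where
  measurableSet : MeasurableSet F
  existsUnique : ∀ x : X, ∃! γ : Γ, γ • x ∈ F

lemma IsStrictFundamentalDomain.isFundamentalDomain {Γ X : Type*} [Group Γ] [MulAction Γ X]
    [MeasurableSpace X] {F : Set X} (h : IsStrictFundamentalDomain Γ F) (μ : Measure X) :
    IsFundamentalDomain Γ F μ :=
  IsFundamentalDomain.mk' h.measurableSet.nullMeasurableSet h.existsUnique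

/-- A countable discrete subgroup of a second countable group has a strict fundamental domain:
cover the group by countably many open sets `V i` that contain at most one point of each orbit, and
take from each orbit its point in the first `V i` it meets. -/
theorem exists_isStrictFundamentalDomain {G : Type*} [Group G] [TopologicalSpace G]
    [IsTopologicalGroup G] [SecondCountableTopology G] [MeasurableSpace G] [BorelSpace G]
    (Γ : Subgroup G) [Countable Γ] {U : Set G} (hU : U ∈ nhds (1 : G))
    (h : ∀ γ : Γ, (γ : G) ∈ U → γ = 1) : ∃ F : Set G, IsStrictFundamentalDomain Γ F := by
  -- two points `a`, `γ a` of the same orbit in `V` force `γ ∈ U`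
  have key : ∀ g : G, ∃ V : Set G, IsOpen V ∧ g ∈ V ∧ ∀ a ∈ V, ∀ b ∈ V, a * b⁻¹ ∈ U := by
    intro g
    have hc : Continuous fun p : G × G => p.1 * p.2⁻¹ := by fun_prop
    have hm : (fun p : G × G => p.1 * p.2⁻¹) ⁻¹' U ∈ nhds (g, g) :=
      hc.continuousAt.preimage_mem_nhds (by simpa using hU)
    rw [nhds_prod_eq, Filter.mem_prod_self_iff] at hm
    obtain ⟨t, ht, hts⟩ := hm
    obtain ⟨V, hVt, hVo, hgV⟩ := mem_nhds_iff.1 ht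
    exact ⟨V, hVo, hgV, fun a ha b hb => hts (mk_mem_prod (hVt ha) (hVt hb))⟩
  choose V hVo hgV hV using key
  obtain ⟨s, hs, hcov⟩ := TopologicalSpace.countable_cover_nhds
    fun g => (hVo g).mem_nhds (hgV g)
  have hsn : s.Nonempty := by
    by_contra hne
    rw [not_nonempty_iff_eq_empty] at hne
    have : (1 : G) ∈ (∅ : Set G) := by
      have h1 : (1 : G) ∈ ⋃ x ∈ s, V x := by rw [hcov]; trivial
      simp [hne] at h1
    exact this
  obtain ⟨e, rfl⟩ := hs.exists_eq_range hsn
  have hcov' : ∀ x : G, ∃ i, x ∈ V (e i) := by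
    intro x
    have : x ∈ ⋃ x ∈ range e, V x := by rw [hcov]; trivial
    simpa using this
  refine ⟨⋃ i, V (e i) \ ⋃ j, ⋃ (_ : j < i), ⋃ γ : Γ, (fun x => γ • x) ⁻¹' V (e j), ?_, ?_⟩
  · refine MeasurableSet.iUnion fun i => (hVo _).measurableSet.diff ?_
    refine MeasurableSet.iUnion fun j => MeasurableSet.iUnion fun _ => MeasurableSet.iUnion fun γ =>
      ?_
    exact ((hVo _).preimage (continuous_const_smul γ)).measurableSet
  · intro x
    classical
    have hex : ∃ i, ∃ γ : Γ, γ • x ∈ V (e i) := by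
      obtain ⟨i, hi⟩ := hcov' x
      exact ⟨i, 1, by simpa using hi⟩
    -- a point of the orbit lies in the set iff it lies in the first `V (e i)` the orbit meets
    obtain ⟨γ, hγ⟩ := Nat.find_spec hex
    have hmem : ∀ δ : Γ, δ • x ∈ (⋃ i, V (e i) \ ⋃ j, ⋃ (_ : j < i), ⋃ γ : Γ,
        (fun x => γ • x) ⁻¹' V (e j)) ↔ δ • x ∈ V (e (Nat.find hex)) := by
      intro δ
      simp only [mem_iUnion, mem_sdiff, mem_preimage, not_exists]
      constructor
      · rintro ⟨i, hi, hi'⟩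
        have hle : Nat.find hex ≤ i := Nat.find_min' hex ⟨δ, hi⟩
        rcases hle.lt_or_eq with hlt | heq
        · exact absurd (by rw [smul_smul, mul_assoc, inv_mul_cancel, mul_one]; exact hγ)
            (hi' _ hlt (γ * δ⁻¹))
        · rwa [heq]
      · intro hδ
        refine ⟨_, hδ, fun j hj η hη => Nat.find_min hex hj ⟨η * δ, ?_⟩⟩
        rwa [mul_smul]
    refine ⟨γ, (hmem γ).2 hγ, fun δ hδ => ?_⟩
    have h1 := hV _ _ ((hmem δ).1 hδ) _ hγ
    have h2 : δ * γ⁻¹ = 1 := by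
      apply h
      have : (δ • x) * (γ • x)⁻¹ = ((δ * γ⁻¹ : Γ) : G) := by
        simp [Subgroup.smul_def, mul_assoc]
      rwa [this] at h1
    exact mul_inv_eq_one.1 h2

section SL

variable {d : ℕ}

instance : SecondCountableTopology (Matrix (Fin d) (Fin d) ℝ) :=
  inferInstanceAs (SecondCountableTopology (Fin d → Fin d → ℝ))

instance : SecondCountableTopology (SLR d) :=
  Matrix.SpecialLinearGroup.isClosedEmbedding_val.isEmbedding.secondCountableTopology

instance : T2Space (SLR d) :=
  Matrix.SpecialLinearGroup.isClosedEmbedding_val.isEmbedding.t2Space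

lemma continuous_slr_iff {X : Type*} [TopologicalSpace X] {f : X → SLR d} :
    Continuous f ↔ ∀ i j, Continuous fun x => (f x : Matrix (Fin d) (Fin d) ℝ) i j := by
  refine (Matrix.SpecialLinearGroup.isClosedEmbedding_val.isInducing.continuous_iff
    (f := f)).trans ?_
  constructor
  · intro h i j
    exact (continuous_apply_apply i j).comp h
  · intro h
    exact continuous_matrix h

lemma continuous_entry (i j : Fin d) :
    Continuous fun g : SLR d => (g : Matrix (Fin d) (Fin d) ℝ) i j :=
  continuous_slr_iff.1 continuous_id i j

@[fun_prop]
lemma continuous_rowMul : Continuous fun p : E d × SLR d => rowMul p.1 p.2 := by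
  unfold rowMul
  refine (PiLp.continuous_toLp 2 _).comp (continuous_pi fun j => ?_)
  simp only [Matrix.vecMul, dotProduct]
  refine continuous_finsetSum _ fun i _ => Continuous.mul ?_ ?_
  · fun_prop
  · exact (continuous_entry i j).comp continuous_snd

lemma rowMul_add (x y : E d) (g : SLR d) : rowMul (x + y) g = rowMul x g + rowMul y g := by
  simp [rowMul, Matrix.add_vecMul]

lemma rowMul_smul (c : ℝ) (x : E d) (g : SLR d) : rowMul (c • x) g = c • rowMul x g := by
  simp [rowMul, Matrix.smul_vecMul]

lemma rowMul_apply (x : E d) (g : SLR d) (j : Fin d) :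
    rowMul x g j = ∑ i, x i * (g : Matrix (Fin d) (Fin d) ℝ) i j := by
  simp [rowMul, Matrix.vecMul, dotProduct]

lemma rowMul_inv_cancel (x : E d) (g : SLR d) : rowMul (rowMul x g) g⁻¹ = x := by
  rw [← rowMul_mul, mul_inv_cancel, rowMul_one]

lemma rowMul_e1 [NeZero d] (g : SLR d) (j : Fin d) :
    rowMul (e1 d : E d) g j = (g : Matrix (Fin d) (Fin d) ℝ) 0 j := by
  simp [rowMul_apply, e1]

lemma mem_stabE1 [NeZero d] {g : SLR d} : g ∈ stabE1 d ↔ rowMul (e1 d : E d) g = e1 d := Iff.rfl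

instance : Countable (Matrix.SpecialLinearGroup (Fin d) ℤ) :=
  haveI : Countable (Matrix (Fin d) (Fin d) ℤ) := inferInstanceAs (Countable (Fin d → Fin d → ℤ))
  Subtype.countable

/-- The embedding of `SL(d, ℤ)` in `SL(d, ℝ)`. -/
def ofInt (d : ℕ) : Matrix.SpecialLinearGroup (Fin d) ℤ →* SLR d :=
  Matrix.SpecialLinearGroup.map (n := Fin d) (Int.castRingHom ℝ)

lemma ofInt_apply (γ : Matrix.SpecialLinearGroup (Fin d) ℤ) (i j : Fin d) :
    (ofInt d γ : Matrix (Fin d) (Fin d) ℝ) i j = (γ.1 i j : ℝ) := by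
  simp [ofInt]

lemma ofInt_injective : Function.Injective (ofInt d) := by
  intro a b h
  ext i j
  have := congrArg (fun g : SLR d => (g : Matrix (Fin d) (Fin d) ℝ) i j) h
  simpa [ofInt_apply] using this

lemma mem_SLZ {g : SLR d} : g ∈ SLZ d ↔ ∃ γ, ofInt d γ = g := Iff.rfl

instance : Countable (SLZ d) :=
  (MonoidHom.rangeRestrict_surjective
    (Matrix.SpecialLinearGroup.map (n := Fin d) (Int.castRingHom ℝ))).countable

/-- `SL(d, ℤ)` is discrete: near the identity matrix there is no other integer matrix. -/
lemma exists_nhds_SLZ : ∃ U ∈ nhds (1 : SLR d), ∀ γ : SLR d, γ ∈ SLZ d → γ ∈ U → γ = 1 := by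
  refine ⟨⋂ i, ⋂ j, {g : SLR d | |(g : Matrix (Fin d) (Fin d) ℝ) i j
    - (1 : Matrix (Fin d) (Fin d) ℝ) i j| < 1}, ?_, ?_⟩
  · refine Filter.iInter_mem.2 fun i => Filter.iInter_mem.2 fun j => ?_
    refine IsOpen.mem_nhds ?_ (by simp)
    exact isOpen_lt ((continuous_entry i j).sub continuous_const).abs continuous_const
  · rintro γ ⟨γ, rfl⟩ hγ
    ext i j
    simp only [mem_iInter, mem_ofPred_eq] at hγ
    have h := hγ i j
    change |((ofInt d γ : SLR d) : Matrix (Fin d) (Fin d) ℝ) i j - _| < 1 at h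
    change ((ofInt d γ : SLR d) : Matrix (Fin d) (Fin d) ℝ) i j = _
    rw [ofInt_apply] at h ⊢
    have e : (1 : Matrix (Fin d) (Fin d) ℝ) i j =
        (((1 : Matrix (Fin d) (Fin d) ℤ) i j : ℤ) : ℝ) := by
      simp [Matrix.one_apply]
    rw [e] at h
    rw [Matrix.SpecialLinearGroup.coe_one, e]
    have h' : |(γ.1 i j - (1 : Matrix (Fin d) (Fin d) ℤ) i j)| < 1 := by exact_mod_cast h
    have := Int.abs_lt_one_iff.1 h'
    exact_mod_cast sub_eq_zero.1 this

lemma exists_fundDomain_SLZ (d : ℕ) : ∃ F : Set (SLR d), IsStrictFundamentalDomain (SLZ d) F := by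
  obtain ⟨U, hU, h⟩ := exists_nhds_SLZ (d := d)
  exact exists_isStrictFundamentalDomain (SLZ d) hU fun γ hγ => Subtype.ext (h γ γ.2 hγ)

end SL

/-! ### `SL(d, ℝ)` is unimodular -/

section Unimodular

variable {d : ℕ} [NeZero d]

/-- The matrix `M` of positive determinant, rescaled to determinant one (junk value `1`
otherwise). -/
def normalizeDet (M : Fin d → Fin d → ℝ) : SLR d :=
  if h : 0 < (Matrix.of M).det then
    ⟨((Matrix.of M).det ^ (-(d : ℝ)⁻¹)) • Matrix.of M, by
      have hd : (d : ℝ) ≠ 0 := Nat.cast_ne_zero.2 (NeZero.ne d)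
      rw [Matrix.det_smul, Fintype.card_fin, ← Real.rpow_natCast, ← Real.rpow_mul h.le,
        neg_mul, inv_mul_cancel₀ hd, Real.rpow_neg_one, inv_mul_cancel₀ h.ne']⟩
  else 1

lemma coe_normalizeDet {M : Fin d → Fin d → ℝ} (h : 0 < (Matrix.of M).det) :
    (normalizeDet M : Matrix (Fin d) (Fin d) ℝ) =
      ((Matrix.of M).det ^ (-(d : ℝ)⁻¹)) • Matrix.of M := by
  exact congrArg Subtype.val (dif_pos h : normalizeDet M = _)

/-- The matrices of determinant in `(0, 1]`. -/
def detCone (d : ℕ) : Set (Fin d → Fin d → ℝ) :=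
  {M | 0 < (Matrix.of M).det ∧ (Matrix.of M).det ≤ 1}

lemma continuous_det_of : Continuous fun M : Fin d → Fin d → ℝ => (Matrix.of M).det :=
  Continuous.matrix_det (A := fun M : Fin d → Fin d → ℝ => Matrix.of M) continuous_id

lemma measurableSet_detCone : MeasurableSet (detCone d) :=
  (measurableSet_lt measurable_const continuous_det_of.measurable).inter
    (measurableSet_le continuous_det_of.measurable measurable_const)

lemma measurable_normalizeDet : Measurable (normalizeDet (d := d)) := by
  classical
  have hS : MeasurableSet {M : Fin d → Fin d → ℝ | 0 < (Matrix.of M).det} :=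
    measurableSet_lt measurable_const continuous_det_of.measurable
  refine measurable_of_restrict_of_restrict_compl hS ?_ ?_
  · refine Continuous.measurable (continuous_slr_iff.2 fun i j => ?_)
    have : (fun x : {M : Fin d → Fin d → ℝ | 0 < (Matrix.of M).det} =>
        ((({M : Fin d → Fin d → ℝ | 0 < (Matrix.of M).det}.domRestrict normalizeDet x : SLR d)) :
          Matrix (Fin d) (Fin d) ℝ) i j) =
        fun x => (Matrix.of x.1).det ^ (-(d : ℝ)⁻¹) * x.1 i j := by
      funext x
      change (normalizeDet x.1 : Matrix (Fin d) (Fin d) ℝ) i j = _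
      rw [coe_normalizeDet x.2]
      simp
    rw [this]
    refine Continuous.mul ?_ ((continuous_apply_apply i j).comp continuous_subtype_val)
    exact (continuous_det_of.comp continuous_subtype_val).rpow_const
      fun x => Or.inl (ne_of_gt x.2)
  · have : ({M : Fin d → Fin d → ℝ | 0 < (Matrix.of M).det}ᶜ.domRestrict (normalizeDet (d := d))) =
        fun _ => 1 := by
      funext x
      exact dif_neg x.2
    rw [this]
    exact measurable_const

/-- The cone measure on `SL(d, ℝ)`: the measure of `A` is the Lebesgue measure of the set of all
`tM`, `t ∈ (0, 1]`, `M ∈ A`. -/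
def coneMeasure (d : ℕ) [NeZero d] : Measure (SLR d) :=
  (volume.restrict (detCone d)).map normalizeDet

lemma coneMeasure_map {T : (Fin d → Fin d → ℝ) →ₗ[ℝ] (Fin d → Fin d → ℝ)}
    (hT : LinearMap.det T = 1) (hTd : ∀ M, (Matrix.of (T M)).det = (Matrix.of M).det)
    {τ : SLR d → SLR d} (hτ : Measurable τ)
    (h : ∀ M, 0 < (Matrix.of M).det → τ (normalizeDet M) = normalizeDet (T M)) :
    (coneMeasure d).map τ = coneMeasure d := by
  have hTm : Measurable T := T.continuous_of_finiteDimensional.measurable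
  have hmp : MeasurePreserving T (volume : Measure (Fin d → Fin d → ℝ)) volume := by
    refine ⟨hTm, ?_⟩
    rw [Measure.map_linearMap_addHaar_eq_smul_addHaar _ (by rw [hT]; exact one_ne_zero), hT]
    simp
  have hpre : T ⁻¹' (detCone d) = detCone d := by
    ext M
    simp [detCone, hTd]
  have hres := hmp.restrict_preimage (measurableSet_detCone (d := d))
  rw [hpre] at hres
  rw [coneMeasure, Measure.map_map hτ measurable_normalizeDet]
  have : (volume.restrict (detCone d)).map (τ ∘ normalizeDet) =
      (volume.restrict (detCone d)).map (normalizeDet ∘ T) := by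
    refine Measure.map_congr ?_
    filter_upwards [ae_restrict_mem measurableSet_detCone] with M hM using h M hM.1
  rw [this, ← Measure.map_map measurable_normalizeDet hTm, hres.map_eq]

lemma det_mulRight_pi (g : SLR d) : LinearMap.det
    (LinearMap.pi fun i => ((Matrix.vecMulLinear (g : Matrix (Fin d) (Fin d) ℝ)).comp
      (LinearMap.proj i)) : (Fin d → Fin d → ℝ) →ₗ[ℝ] (Fin d → Fin d → ℝ)) = 1 := by
  rw [LinearMap.det_pi]
  refine Finset.prod_eq_one fun i _ => ?_
  have : (Matrix.vecMulLinear (g : Matrix (Fin d) (Fin d) ℝ)) =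
      Matrix.toLin' (g : Matrix (Fin d) (Fin d) ℝ).transpose := by
    ext x j
    simp
  rw [this, LinearMap.det_toLin', Matrix.det_transpose, g.det_coe]

instance : (coneMeasure d).IsMulRightInvariant where
  map_mul_right_eq_self g := by
    have hof : ∀ M : Fin d → Fin d → ℝ, Matrix.of ((LinearMap.pi fun i =>
        ((Matrix.vecMulLinear (g : Matrix (Fin d) (Fin d) ℝ)).comp
        (LinearMap.proj i)) : (Fin d → Fin d → ℝ) →ₗ[ℝ] (Fin d → Fin d → ℝ)) M) =
        Matrix.of M * (g : Matrix (Fin d) (Fin d) ℝ) := by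
      intro M
      ext i j
      simp [Matrix.mul_apply, Matrix.vecMul, dotProduct]
    refine coneMeasure_map (det_mulRight_pi g) (fun M => ?_) (measurable_mul_const g)
      fun M hM => ?_
    · rw [hof, Matrix.det_mul, g.det_coe, mul_one]
    · have hM' := hM
      rw [← mul_one (Matrix.of M).det, ← g.det_coe, ← Matrix.det_mul, ← hof] at hM'
      refine Subtype.ext ?_
      rw [Matrix.SpecialLinearGroup.coe_mul, coe_normalizeDet hM, coe_normalizeDet hM', hof,
        Matrix.det_mul, g.det_coe]
      simp only [mul_one, Matrix.smul_mul]

instance : (coneMeasure d).IsMulLeftInvariant where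
  map_mul_left_eq_self g := by
    let e : (Fin d → Fin d → ℝ) ≃ₗ[ℝ] (Fin d → Fin d → ℝ) :=
      Matrix.transposeLinearEquiv (Fin d) (Fin d) ℝ ℝ
    let gt : SLR d := ⟨(g : Matrix (Fin d) (Fin d) ℝ).transpose, by
      rw [Matrix.det_transpose, g.det_coe]⟩
    let T := (e : (Fin d → Fin d → ℝ) →ₗ[ℝ] (Fin d → Fin d → ℝ)) ∘ₗ
      (LinearMap.pi fun i => ((Matrix.vecMulLinear (gt : Matrix (Fin d) (Fin d) ℝ)).comp
        (LinearMap.proj i)) : (Fin d → Fin d → ℝ) →ₗ[ℝ] (Fin d → Fin d → ℝ)) ∘ₗ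
      (e.symm : (Fin d → Fin d → ℝ) →ₗ[ℝ] (Fin d → Fin d → ℝ))
    have hdet : LinearMap.det T = 1 := by
      rw [LinearMap.det_conj, det_mulRight_pi]
    have hof : ∀ M : Fin d → Fin d → ℝ, Matrix.of (T M) =
        (g : Matrix (Fin d) (Fin d) ℝ) * Matrix.of M := by
      intro M
      ext i j
      change ∑ k, M k j * (g : Matrix (Fin d) (Fin d) ℝ).transpose k i = _
      rw [Matrix.mul_apply]
      exact Finset.sum_congr rfl fun k _ => mul_comm _ _
    refine coneMeasure_map hdet (fun M => ?_) (measurable_const_mul g)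
      fun M hM => ?_
    · rw [hof, Matrix.det_mul, g.det_coe, one_mul]
    · have hM' := hM
      rw [← one_mul (Matrix.of M).det, ← g.det_coe, ← Matrix.det_mul, ← hof] at hM'
      refine Subtype.ext ?_
      rw [Matrix.SpecialLinearGroup.coe_mul, coe_normalizeDet hM, coe_normalizeDet hM', hof,
        Matrix.det_mul, g.det_coe]
      simp only [one_mul, Matrix.mul_smul]

lemma exists_entry_bound {K : Set (SLR d)} (hK : IsCompact K) :
    ∃ C : ℝ, 0 ≤ C ∧ ∀ g ∈ K, ∀ i j, |(g : Matrix (Fin d) (Fin d) ℝ) i j| ≤ C := by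
  have h : ∀ i j, ∃ C : ℝ, ∀ g ∈ K, |(g : Matrix (Fin d) (Fin d) ℝ) i j| ≤ C := by
    intro i j
    obtain ⟨C, hC⟩ := hK.exists_bound_of_continuousOn (continuous_entry i j).continuousOn
    exact ⟨C, fun g hg => by simpa using hC g hg⟩
  choose C hC using h
  refine ⟨∑ i, ∑ j, |C i j|, by positivity, fun g hg i j => ?_⟩
  refine ((hC i j g hg).trans (le_abs_self _)).trans ?_
  exact (Finset.single_le_sum (f := fun j => |C i j|) (fun _ _ => abs_nonneg _)
    (Finset.mem_univ j)).trans (Finset.single_le_sum (f := fun i => ∑ j, |C i j|)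
    (fun _ _ => Finset.sum_nonneg fun _ _ => abs_nonneg _) (Finset.mem_univ i))

instance : IsFiniteMeasureOnCompacts (coneMeasure d) where
  lt_top_of_isCompact K hK := by
    obtain ⟨C, hC0, hC⟩ := exists_entry_bound hK
    rw [coneMeasure, Measure.map_apply measurable_normalizeDet hK.measurableSet,
      Measure.restrict_apply (measurable_normalizeDet hK.measurableSet)]
    refine (measure_mono (t := Metric.closedBall 0 C) ?_).trans_lt measure_closedBall_lt_top
    rintro M ⟨hM, hM0, hM1⟩
    rw [mem_closedBall_zero_iff, pi_norm_le_iff_of_nonneg hC0]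
    intro i
    rw [pi_norm_le_iff_of_nonneg hC0]
    intro j
    have h := hC _ hM i j
    rw [coe_normalizeDet hM0] at h
    have h1 : 1 ≤ (Matrix.of M).det ^ (-(d : ℝ)⁻¹) :=
      Real.one_le_rpow_of_pos_of_le_one_of_nonpos hM0 hM1 (by simp)
    simp only [Matrix.smul_apply, smul_eq_mul, abs_mul, Matrix.of_apply] at h
    rw [abs_of_nonneg (by linarith)] at h
    rw [Real.norm_eq_abs]
    nlinarith [abs_nonneg (M i j)]

lemma coneMeasure_ne_zero : coneMeasure d ≠ 0 := by
  rw [← Measure.measure_univ_ne_zero, coneMeasure, Measure.map_apply measurable_normalizeDet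
    MeasurableSet.univ, preimage_univ, Measure.restrict_apply_univ]
  have ho : IsOpen {M : Fin d → Fin d → ℝ | 0 < (Matrix.of M).det ∧ (Matrix.of M).det < 1} :=
    (isOpen_lt continuous_const continuous_det_of).inter
      (isOpen_lt continuous_det_of continuous_const)
  have hne : {M : Fin d → Fin d → ℝ | 0 < (Matrix.of M).det ∧ (Matrix.of M).det < 1}.Nonempty := by
    refine ⟨((2 : ℝ)⁻¹ • (1 : Matrix (Fin d) (Fin d) ℝ)), ?_⟩
    change 0 < ((2 : ℝ)⁻¹ • (1 : Matrix (Fin d) (Fin d) ℝ)).det ∧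
      ((2 : ℝ)⁻¹ • (1 : Matrix (Fin d) (Fin d) ℝ)).det < 1
    rw [Matrix.det_smul, Matrix.det_one, mul_one, Fintype.card_fin]
    exact ⟨by positivity, pow_lt_one₀ (by norm_num) (by norm_num) (NeZero.ne d)⟩
  refine (lt_of_lt_of_le (ho.measure_pos volume hne) (measure_mono ?_)).ne'
  exact fun M hM => ⟨hM.1, hM.2.le⟩

/-- A left Haar measure that is proportional to a nonzero right invariant measure is right
invariant. -/
lemma isMulRightInvariant_haar_of_exists {G : Type*} [Group G] [TopologicalSpace G]
    [IsTopologicalGroup G] [LocallyCompactSpace G] [SecondCountableTopology G]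
    [MeasurableSpace G] [BorelSpace G] (ν : Measure G) [IsFiniteMeasureOnCompacts ν]
    [ν.IsMulLeftInvariant] [ν.IsMulRightInvariant] (hν : ν ≠ 0) (μ : Measure G)
    [μ.IsHaarMeasure] : μ.IsMulRightInvariant := by
  have h := Measure.isMulLeftInvariant_eq_smul ν μ
  set c := Measure.haarScalarFactor ν μ
  have hc : c ≠ 0 := by
    intro hc
    rw [hc, zero_smul] at h
    exact hν h
  have h' : μ = c⁻¹ • ν := by
    rw [h, smul_smul, inv_mul_cancel₀ hc, one_smul]
  constructor
  intro g
  rw [h', Measure.map_smul, map_mul_right_eq_self]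

instance : (Measure.haar : Measure (SLR d)).IsMulRightInvariant :=
  isMulRightInvariant_haar_of_exists (coneMeasure d) coneMeasure_ne_zero _

end Unimodular

/-! ### The stabilizer of the first basis vector -/

section Stabilizer

variable {n : ℕ}

/-- The block matrix `(1 0; c A)`. -/
def affineBlock {R : Type*} [CommRing R] (A : Matrix (Fin n) (Fin n) R) (c : Fin n → R) :
    Matrix (Fin (n + 1)) (Fin (n + 1)) R :=
  Matrix.of (Fin.cons (Fin.cons 1 0) fun i => Fin.cons (c i) (A i))

section Block

variable {R : Type*} [CommRing R] (A : Matrix (Fin n) (Fin n) R) (c : Fin n → R)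

@[simp] lemma affineBlock_zero_zero : affineBlock A c 0 0 = 1 := rfl
@[simp] lemma affineBlock_zero_succ (j : Fin n) : affineBlock A c 0 j.succ = 0 := rfl
@[simp] lemma affineBlock_succ_zero (i : Fin n) : affineBlock A c i.succ 0 = c i := rfl
@[simp] lemma affineBlock_succ_succ (i j : Fin n) : affineBlock A c i.succ j.succ = A i j := rfl

lemma det_affineBlock : (affineBlock A c).det = A.det := by
  rw [Matrix.det_succ_row_zero, Fin.sum_univ_succ]
  have h : (affineBlock A c).submatrix Fin.succ (Fin.succAbove 0) = A := by
    ext i j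
    simp
  rw [h]
  simp

lemma affineBlock_mul (A' : Matrix (Fin n) (Fin n) R) (c' : Fin n → R) :
    affineBlock A c * affineBlock A' c' = affineBlock (A * A') (c + A.mulVec c') := by
  ext i j
  rw [Matrix.mul_apply, Fin.sum_univ_succ]
  refine Fin.cases ?_ (fun i => ?_) i <;> refine Fin.cases ?_ (fun j => ?_) j
  · simp
  · simp
  · simp [Matrix.mulVec, dotProduct]
  · simp [Matrix.mul_apply]

lemma eq_affineBlock {M : Matrix (Fin (n + 1)) (Fin (n + 1)) R} (h0 : M 0 0 = 1)
    (h1 : ∀ j : Fin n, M 0 j.succ = 0) :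
    M = affineBlock (M.submatrix Fin.succ Fin.succ) fun i => M i.succ 0 := by
  ext i j
  refine Fin.cases ?_ (fun i => ?_) i <;> refine Fin.cases ?_ (fun j => ?_) j <;> simp [h0, h1]

end Block

lemma mem_stabE1_iff {g : SLR (n + 1)} : g ∈ stabE1 (n + 1) ↔
    (g : Matrix (Fin (n + 1)) (Fin (n + 1)) ℝ) 0 0 = 1 ∧
      ∀ j : Fin n, (g : Matrix (Fin (n + 1)) (Fin (n + 1)) ℝ) 0 j.succ = 0 := by
  rw [mem_stabE1]
  constructor
  · intro h
    refine ⟨?_, fun j => ?_⟩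
    · rw [← rowMul_e1, h]; simp [e1]
    · rw [← rowMul_e1, h]; simp [e1]
  · rintro ⟨h0, h1⟩
    ext j
    rw [rowMul_e1]
    refine Fin.cases ?_ (fun j => ?_) j
    · rw [h0]; simp [e1]
    · rw [h1]; simp [e1]

/-- The stabilizer of `e₁` in `SL(n + 1, ℝ)` consists of the matrices `(1 0; c A)` with
`A ∈ SL(n, ℝ)` and `c ∈ ℝ^n`. -/
def stabHomeo (n : ℕ) : SLR n × (Fin n → ℝ) ≃ₜ stabE1 (n + 1) where
  toFun p := ⟨⟨affineBlock (p.1 : Matrix (Fin n) (Fin n) ℝ) p.2, by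
      rw [det_affineBlock, p.1.det_coe]⟩, mem_stabE1_iff.2 ⟨rfl, fun _ => rfl⟩⟩
  invFun h := (⟨(h : SLR (n + 1)).1.submatrix Fin.succ Fin.succ, by
      have h' := mem_stabE1_iff.1 h.2
      have := (h : SLR (n + 1)).det_coe
      rwa [eq_affineBlock h'.1 h'.2, det_affineBlock] at this⟩,
    fun i => (h : SLR (n + 1)).1 i.succ 0)
  left_inv p := rfl
  right_inv h := by
    have h' := mem_stabE1_iff.1 h.2
    exact Subtype.ext (Subtype.ext (eq_affineBlock h'.1 h'.2).symm)
  continuous_toFun := by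
    refine Continuous.subtype_mk (continuous_slr_iff.2 fun i j => ?_) _
    change Continuous fun p : SLR n × (Fin n → ℝ) =>
      affineBlock (p.1 : Matrix (Fin n) (Fin n) ℝ) p.2 i j
    refine Fin.cases ?_ (fun i => ?_) i <;> refine Fin.cases ?_ (fun j => ?_) j
    · exact continuous_const
    · exact continuous_const
    · exact (continuous_apply i).comp continuous_snd
    · exact (continuous_entry i j).comp continuous_fst
  continuous_invFun := by
    refine Continuous.prodMk (continuous_slr_iff.2 fun i j => ?_) (continuous_pi fun i => ?_)
    · exact (continuous_entry i.succ j.succ).comp continuous_subtype_val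
    · exact (continuous_entry i.succ 0).comp continuous_subtype_val

lemma coe_stabHomeo (p : SLR n × (Fin n → ℝ)) :
    ((stabHomeo n p : SLR (n + 1)) : Matrix (Fin (n + 1)) (Fin (n + 1)) ℝ) =
      affineBlock (p.1 : Matrix (Fin n) (Fin n) ℝ) p.2 := rfl

lemma stabHomeo_mul (p q : SLR n × (Fin n → ℝ)) :
    stabHomeo n p * stabHomeo n q = stabHomeo n
      (p.1 * q.1, p.2 + (p.1 : Matrix (Fin n) (Fin n) ℝ).mulVec q.2) :=
  Subtype.ext (Subtype.ext (affineBlock_mul _ _ _ _))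

/-- The product of Haar measure of `SL(n, ℝ)` and Lebesgue measure, as a measure on the stabilizer
of `e₁` in `SL(n + 1, ℝ)`. -/
def stabMeasure (n : ℕ) : Measure (stabE1 (n + 1)) :=
  ((Measure.haar : Measure (SLR n)).prod (volume : Measure (Fin n → ℝ))).map (stabHomeo n)

lemma measurePreserving_mulVec (g : SLR n) :
    MeasurePreserving (fun c : Fin n → ℝ => (g : Matrix (Fin n) (Fin n) ℝ).mulVec c) := by
  refine ⟨by fun_prop, ?_⟩
  have := Real.map_matrix_volume_pi_eq_smul_volume_pi (M := (g : Matrix (Fin n) (Fin n) ℝ))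
    (by rw [g.det_coe]; exact one_ne_zero)
  rw [g.det_coe] at this
  simpa using! this

lemma stabMeasure_apply (s : Set (stabE1 (n + 1))) : stabMeasure n s =
    ((Measure.haar : Measure (SLR n)).prod volume) (stabHomeo n ⁻¹' s) :=
  (stabHomeo n).toMeasurableEquiv.map_apply _

instance : (stabMeasure n).IsMulLeftInvariant where
  map_mul_left_eq_self h := by
    obtain ⟨p, rfl⟩ := (stabHomeo n).surjective h
    rw [stabMeasure, Measure.map_map (measurable_const_mul _) (stabHomeo n).measurable]
    have he : (fun x => stabHomeo n p * x) ∘ stabHomeo n = stabHomeo n ∘ fun q =>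
        (p.1 * q.1, p.2 + (p.1 : Matrix (Fin n) (Fin n) ℝ).mulVec q.2) := by
      funext q
      exact stabHomeo_mul p q
    have hm : MeasurePreserving (fun q : SLR n × (Fin n → ℝ) =>
        (p.1 * q.1, p.2 + (p.1 : Matrix (Fin n) (Fin n) ℝ).mulVec q.2))
        ((Measure.haar : Measure (SLR n)).prod volume)
        ((Measure.haar : Measure (SLR n)).prod volume) :=
      (measurePreserving_mul_left _ p.1).prod
        ((measurePreserving_add_left volume p.2).comp (measurePreserving_mulVec p.1))
    rw [he, ← Measure.map_map (stabHomeo n).measurable hm.measurable, hm.map_eq]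

instance [NeZero n] : (stabMeasure n).IsMulRightInvariant where
  map_mul_right_eq_self h := by
    obtain ⟨p, rfl⟩ := (stabHomeo n).surjective h
    rw [stabMeasure, Measure.map_map (measurable_mul_const _) (stabHomeo n).measurable]
    have he : (fun x => x * stabHomeo n p) ∘ stabHomeo n = stabHomeo n ∘ fun q =>
        (q.1 * p.1, q.2 + (q.1 : Matrix (Fin n) (Fin n) ℝ).mulVec p.2) := by
      funext q
      exact stabHomeo_mul q p
    have hc : Continuous fun q : SLR n × (Fin n → ℝ) =>
        q.2 + (q.1 : Matrix (Fin n) (Fin n) ℝ).mulVec p.2 := by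
      refine continuous_snd.add (continuous_pi fun i => ?_)
      simp only [Matrix.mulVec, dotProduct]
      exact continuous_finsetSum _ fun j _ =>
        ((continuous_entry i j).comp continuous_fst).mul continuous_const
    have hm : MeasurePreserving (fun q : SLR n × (Fin n → ℝ) =>
        (q.1 * p.1, q.2 + (q.1 : Matrix (Fin n) (Fin n) ℝ).mulVec p.2))
        ((Measure.haar : Measure (SLR n)).prod volume)
        ((Measure.haar : Measure (SLR n)).prod volume) :=
      (measurePreserving_mul_right Measure.haar p.1).skew_product
        (g := fun g c => c + (g : Matrix (Fin n) (Fin n) ℝ).mulVec p.2) hc.measurable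
        (Filter.Eventually.of_forall fun g => (measurePreserving_add_right volume _).map_eq)
    rw [he, ← Measure.map_map (stabHomeo n).measurable hm.measurable, hm.map_eq]

instance : SecondCountableTopology (stabE1 (n + 1)) :=
  TopologicalSpace.Subtype.secondCountableTopology _

instance : (stabMeasure n).IsHaarMeasure := by
  have : IsFiniteMeasureOnCompacts (stabMeasure n) := ⟨fun K hK => by
    rw [stabMeasure_apply]
    exact ((stabHomeo n).isCompact_preimage.2 hK).measure_lt_top⟩
  have : (stabMeasure n).IsOpenPosMeasure := ⟨fun U hU hne => by
    rw [stabMeasure_apply]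
    exact ((hU.preimage (stabHomeo n).continuous).measure_pos _
      (hne.preimage (stabHomeo n).surjective)).ne'⟩
  constructor

instance [NeZero n] : (Measure.haar : Measure (stabE1 (n + 1))).IsMulRightInvariant :=
  isMulRightInvariant_haar_of_exists (stabMeasure n) (NeZero.ne _) _

lemma exists_submatrix_mem_SLZ {p : SLR n × (Fin n → ℝ)}
    (h : (stabHomeo n p : SLR (n + 1)) ∈ SLZ (n + 1)) :
    p.1 ∈ SLZ n ∧ ∃ m : Fin n → ℤ, p.2 = fun i => (m i : ℝ) := by
  obtain ⟨δ, hδ⟩ := mem_SLZ.1 h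
  have he : ∀ i j, (δ.1 i j : ℝ) = affineBlock (p.1 : Matrix (Fin n) (Fin n) ℝ) p.2 i j := by
    intro i j
    rw [← coe_stabHomeo, ← hδ, ofInt_apply]
  have hδ' := eq_affineBlock (M := δ.1)
    (by exact_mod_cast (he 0 0).trans (affineBlock_zero_zero _ _))
    (fun j => by exact_mod_cast (he 0 j.succ).trans (affineBlock_zero_succ _ _ _))
  have hdet : (δ.1.submatrix Fin.succ Fin.succ).det = 1 := by
    have := δ.2
    rwa [hδ', det_affineBlock] at this
  refine ⟨mem_SLZ.2 ⟨⟨_, hdet⟩, ?_⟩, fun i => δ.1 i.succ 0, ?_⟩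
  · ext i j
    exact (ofInt_apply _ _ _).trans (he i.succ j.succ)
  · funext i
    exact (he i.succ 0).symm

lemma stabHomeo_mem_SLZ {A : SLR n} (hA : A ∈ SLZ n) (m : Fin n → ℤ) :
    (stabHomeo n (A, fun i => (m i : ℝ)) : SLR (n + 1)) ∈ SLZ (n + 1) := by
  obtain ⟨δ, rfl⟩ := mem_SLZ.1 hA
  refine mem_SLZ.2 ⟨⟨affineBlock δ.1 m, by rw [det_affineBlock, δ.2]⟩, ?_⟩
  ext i j
  refine (ofInt_apply _ _ _).trans ?_
  rw [coe_stabHomeo]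
  refine Fin.cases ?_ (fun i => ?_) i <;> refine Fin.cases ?_ (fun j => ?_) j
  · simp
  · simp
  · simp
  · simp [ofInt_apply]

/-- A fundamental domain of `SL(n, ℤ)` and the unit cube give a fundamental domain of the integer
points of the stabilizer of `e₁`. -/
lemma isStrictFundamentalDomain_stabZ {F : Set (SLR n)}
    (hF : IsStrictFundamentalDomain (SLZ n) F) :
    IsStrictFundamentalDomain (stabZ (n + 1))
      (stabHomeo n '' (F ×ˢ Set.pi univ fun _ => Ico (0 : ℝ) 1)) := by
  constructor
  · exact (stabHomeo n).toMeasurableEquiv.measurableEmbedding.measurableSet_image.2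
      (hF.measurableSet.prod (MeasurableSet.univ_pi fun _ => measurableSet_Ico))
  · intro h
    obtain ⟨q, rfl⟩ := (stabHomeo n).surjective h
    obtain ⟨γ, hγ, hγu⟩ := hF.existsUnique q.1
    set w := ((γ : SLR n) : Matrix (Fin n) (Fin n) ℝ).mulVec q.2 with hw
    refine ⟨⟨stabHomeo n (γ, fun i => ((-⌊w i⌋ : ℤ) : ℝ)), stabHomeo_mem_SLZ γ.2 _⟩, ?_, ?_⟩
    · refine ⟨_, ?_, (stabHomeo_mul _ _).symm⟩
      refine ⟨hγ, fun i _ => ?_⟩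
      have e : ((fun i => ((-⌊w i⌋ : ℤ) : ℝ)) + w) i = Int.fract (w i) := by
        rw [← Int.self_sub_floor, Pi.add_apply]
        push_cast
        ring
      change ((fun i => ((-⌊w i⌋ : ℤ) : ℝ)) + w) i ∈ _
      rw [e]
      exact ⟨Int.fract_nonneg _, Int.fract_lt_one _⟩
    · rintro ⟨δ, hδ⟩ hmem
      obtain ⟨p, rfl⟩ := (stabHomeo n).surjective δ
      obtain ⟨hp, m, hm⟩ := exists_submatrix_mem_SLZ hδ
      obtain ⟨r, hr, hre⟩ := hmem
      have hr' : r = (p.1 * q.1, p.2 + (p.1 : Matrix (Fin n) (Fin n) ℝ).mulVec q.2) :=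
        (stabHomeo n).injective (hre.trans (stabHomeo_mul p q))
      subst hr'
      have hpγ : (⟨p.1, hp⟩ : SLZ n) = γ := hγu _ hr.1
      have hp1 : p.1 = (γ : SLR n) := congrArg Subtype.val hpγ
      refine Subtype.ext (congrArg (stabHomeo n) (Prod.ext hp1 ?_))
      rw [hm]
      funext i
      have hi := hr.2 i (mem_univ i)
      simp only [hp1, hm, Pi.add_apply, ← hw] at hi
      have : -m i = ⌊w i⌋ := by
        rw [eq_comm, Int.floor_eq_iff]
        push_cast
        constructor <;> [linarith [hi.1]; linarith [hi.2]]
      change (m i : ℝ) = ((-⌊w i⌋ : ℤ) : ℝ)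
      rw [← this, neg_neg]

/-- Finite covolume of `SL(n, ℤ)` implies finite covolume of the integer points in the stabilizer of
`e₁` in `SL(n + 1, ℝ)`. -/
lemma exists_fundDomain_stabZ {F : Set (SLR n)} (hF : IsStrictFundamentalDomain (SLZ n) F)
    (hFt : (Measure.haar : Measure (SLR n)) F < ⊤) :
    ∃ F' : Set (stabE1 (n + 1)), IsStrictFundamentalDomain (stabZ (n + 1)) F' ∧
      (Measure.haar : Measure (stabE1 (n + 1))) F' < ⊤ := by
  refine ⟨_, isStrictFundamentalDomain_stabZ hF, ?_⟩
  rw [Measure.isMulLeftInvariant_eq_smul (Measure.haar : Measure (stabE1 (n + 1))) (stabMeasure n),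
    Measure.smul_apply, stabMeasure_apply]
  have : stabHomeo n ⁻¹'
      (stabHomeo n '' (F ×ˢ Set.pi univ fun _ => Ico (0 : ℝ) 1)) =
      F ×ˢ Set.pi univ fun _ => Ico (0 : ℝ) 1 :=
    preimage_image_eq _ (stabHomeo n).injective
  rw [this, Measure.prod_prod, Real.volume_pi_Ico]
  simpa [ENNReal.smul_def] using ENNReal.mul_lt_top ENNReal.coe_lt_top hFt

end Stabilizer

/-! ### Disintegration of Haar measure over the first row -/

lemma measurePreserving_rowMul {d : ℕ} (g : SLR d) :
    MeasurePreserving (fun x : E d => rowMul x g) := by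
  have h1 : MeasurePreserving (fun c : Fin d → ℝ =>
      Matrix.vecMul c (g : Matrix (Fin d) (Fin d) ℝ)) := by
    let gt : SLR d := ⟨(g : Matrix (Fin d) (Fin d) ℝ).transpose, by
      rw [Matrix.det_transpose, g.det_coe]⟩
    have := measurePreserving_mulVec gt
    have e : (fun c : Fin d → ℝ => (gt : Matrix (Fin d) (Fin d) ℝ).mulVec c) =
        fun c => Matrix.vecMul c (g : Matrix (Fin d) (Fin d) ℝ) := by
      funext c
      exact Matrix.mulVec_transpose _ _
    rwa [e] at this
  exact (PiLp.volume_preserving_toLp (Fin d)).comp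
    (h1.comp (PiLp.volume_preserving_ofLp (Fin d)))

lemma volume_coord_eq_zero {d : ℕ} (i : Fin d) : volume {y : E d | y i = 0} = 0 := by
  let S : Submodule ℝ (E d) := LinearMap.ker (EuclideanSpace.proj i : E d →L[ℝ] ℝ).toLinearMap
  have hS : ({y : E d | y i = 0}) = (S : Set (E d)) := by
    ext y
    simp [S]
  rw [hS]
  refine Measure.addHaar_submodule _ _ fun h => ?_
  have : EuclideanSpace.single i (1 : ℝ) ∈ S := by rw [h]; trivial
  simp [S] at this

lemma ae_coord_ne_zero {d : ℕ} (i : Fin d) : ∀ᵐ y : E d, y i ≠ 0 := by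
  rw [ae_iff]
  simpa using volume_coord_eq_zero i

lemma mul_inv_mem_stabE1 {d : ℕ} [NeZero d] {a b : SLR d}
    (h : rowMul (e1 d : E d) a = rowMul (e1 d : E d) b) : a * b⁻¹ ∈ stabE1 d := by
  rw [mem_stabE1, rowMul_mul, h, rowMul_inv_cancel]

section

variable {n : ℕ} [NeZero n]

/-- The first row of `triSect y` is `y`; the other rows are those of a diagonal matrix. -/
def triMat (y : E (n + 1)) : Matrix (Fin (n + 1)) (Fin (n + 1)) ℝ :=
  Matrix.of fun i j => if i = 0 then y j else
    if i = j then (if i = Fin.succ 0 then (y 0)⁻¹ else 1) else 0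

lemma det_triMat {y : E (n + 1)} (hy : y 0 ≠ 0) : (triMat y).det = 1 := by
  have h : (triMat y).BlockTriangular id := by
    intro i j hij
    have hij' : j < i := hij
    have hi : i ≠ 0 := fun h => by simp [h] at hij'
    simp [triMat, hi, hij'.ne']
  rw [Matrix.det_of_isUpperTriangular h, Fin.prod_univ_succ]
  have : ∀ i : Fin n, triMat y i.succ i.succ = if i = 0 then (y 0)⁻¹ else 1 := by
    intro i
    simp only [triMat, Matrix.of_apply, Fin.succ_ne_zero, if_true, if_false, Fin.succ_inj]
  simp only [this, Finset.prod_ite_eq', Finset.mem_univ, if_true]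
  simp [triMat, hy]

open Classical in
/-- An explicit measurable section `y ↦ M_y` with `e₁ M_y = y`, for `y₁ ≠ 0` (junk value `1`
otherwise). -/
def triSect (y : E (n + 1)) : SLR (n + 1) :=
  if h : y 0 ≠ 0 then ⟨triMat y, det_triMat h⟩ else 1

lemma coe_triSect {y : E (n + 1)} (hy : y 0 ≠ 0) :
    (triSect y : Matrix (Fin (n + 1)) (Fin (n + 1)) ℝ) = triMat y :=
  congrArg Subtype.val (dif_pos hy : triSect y = _)

lemma rowMul_triSect {y : E (n + 1)} (hy : y 0 ≠ 0) :
    rowMul (e1 (n + 1) : E (n + 1)) (triSect y) = y := by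
  ext j
  rw [rowMul_e1, coe_triSect hy]
  simp [triMat]

lemma measurable_triSect : Measurable (triSect (n := n)) := by
  classical
  have hS : MeasurableSet {y : E (n + 1) | y 0 ≠ 0} :=
    (measurableSet_singleton (0 : ℝ)).compl.preimage (by fun_prop)
  refine measurable_of_restrict_of_restrict_compl hS ?_ ?_
  · refine Continuous.measurable (continuous_slr_iff.2 fun i j => ?_)
    have : (fun x : {y : E (n + 1) | y 0 ≠ 0} => (({y : E (n + 1) | y 0 ≠ 0}.domRestrict triSect x :
        SLR (n + 1)) : Matrix (Fin (n + 1)) (Fin (n + 1)) ℝ) i j) = fun x => triMat x.1 i j := by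
      funext x
      change (triSect x.1 : Matrix (Fin (n + 1)) (Fin (n + 1)) ℝ) i j = _
      rw [coe_triSect x.2]
    rw [this]
    have hj : ∀ j, Continuous fun x : {y : E (n + 1) | y 0 ≠ 0} => x.1 j := fun j => by fun_prop
    simp only [triMat, Matrix.of_apply]
    split_ifs
    · exact hj j
    · exact (hj 0).inv₀ fun x => x.2
    · exact continuous_const
    · exact continuous_const
  · have : ({y : E (n + 1) | y 0 ≠ 0}ᶜ.domRestrict (triSect (n := n))) = fun _ => 1 := by
      funext x
      exact dif_neg x.2
    rw [this]
    exact measurable_const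

/-- Integration over a fibre `{g : e₁ g = y}` does not depend on the choice of a point in it. -/
lemma lintegral_fiber_eq (F : SLR (n + 1) → ℝ≥0∞) {a b : SLR (n + 1)}
    (h : rowMul (e1 (n + 1) : E (n + 1)) a = rowMul (e1 (n + 1) : E (n + 1)) b) :
    ∫⁻ x : stabE1 (n + 1), F (x * a) ∂Measure.haar =
      ∫⁻ x : stabE1 (n + 1), F (x * b) ∂Measure.haar := by
  rw [← lintegral_mul_right_eq_self (fun x : stabE1 (n + 1) => F (x * b))
    ⟨a * b⁻¹, mul_inv_mem_stabE1 h⟩]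
  simp [mul_assoc]

/-- The measure `dh dy` on `SL(n + 1, ℝ)`, in the coordinates `g = h M_y`, `e₁ h = e₁`. -/
def fiberMeasure (n : ℕ) [NeZero n] : Measure (SLR (n + 1)) :=
  ((volume : Measure (E (n + 1))).prod (Measure.haar : Measure (stabE1 (n + 1)))).map
    fun p => (p.2 : SLR (n + 1)) * triSect p.1

lemma measurable_fiberMap : Measurable fun p : E (n + 1) × stabE1 (n + 1) =>
    (p.2 : SLR (n + 1)) * triSect p.1 :=
  (measurable_subtype_coe.comp measurable_snd).mul (measurable_triSect.comp measurable_fst)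

lemma lintegral_fiberMeasure {F : SLR (n + 1) → ℝ≥0∞} (hF : Measurable F) :
    ∫⁻ g, F g ∂fiberMeasure n =
      ∫⁻ y : E (n + 1), ∫⁻ h : stabE1 (n + 1), F (h * triSect y) ∂Measure.haar := by
  rw [fiberMeasure, lintegral_map hF measurable_fiberMap, lintegral_prod]
  exact (hF.comp measurable_fiberMap).aemeasurable

instance : (fiberMeasure n).IsMulRightInvariant where
  map_mul_right_eq_self g := by
    refine Measure.ext_of_lintegral _ fun F hF => ?_
    rw [lintegral_map hF (measurable_mul_const g),
      lintegral_fiberMeasure (F := fun a => F (a * g)) (hF.comp (measurable_mul_const g)),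
      lintegral_fiberMeasure hF]
    have hm : Measurable fun y : E (n + 1) =>
        ∫⁻ h : stabE1 (n + 1), F (h * triSect y) ∂Measure.haar :=
      (hF.comp measurable_fiberMap).lintegral_prod_right'
    rw [← (measurePreserving_rowMul g).lintegral_comp hm]
    refine lintegral_congr_ae ?_
    filter_upwards [ae_coord_ne_zero (0 : Fin (n + 1)),
      (measurePreserving_rowMul g).quasiMeasurePreserving.ae (ae_coord_ne_zero (0 : Fin (n + 1)))]
      with y hy hyg
    simp only [mul_assoc]
    refine lintegral_fiber_eq F ?_
    rw [rowMul_mul, rowMul_triSect hy, rowMul_triSect hyg]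

instance : IsFiniteMeasureOnCompacts (fiberMeasure n) where
  lt_top_of_isCompact C hC := by
    let r : SLR (n + 1) → E (n + 1) := fun g => rowMul (e1 (n + 1) : E (n + 1)) g
    have hr : Continuous r := continuous_rowMul.comp (continuous_const.prodMk continuous_id)
    let K : Set (stabE1 (n + 1)) := Subtype.val ⁻¹' ((fun p : SLR (n + 1) × SLR (n + 1) =>
      p.1 * p.2⁻¹) '' (C ×ˢ C))
    have hK : IsCompact K := by
      refine (isClosed_stabE1 (n + 1)).isClosedEmbedding_subtypeVal.isCompact_preimage ?_
      exact (hC.prod hC).image (by fun_prop)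
    have hC' : IsCompact (r '' C) := hC.image hr
    rw [← lintegral_indicator_one hC.measurableSet,
      lintegral_fiberMeasure (measurable_one.indicator hC.measurableSet)]
    have hb : ∀ᵐ y : E (n + 1), ∫⁻ h : stabE1 (n + 1),
        C.indicator (1 : SLR (n + 1) → ℝ≥0∞) (h * triSect y) ∂Measure.haar ≤
        (r '' C).indicator (fun _ => Measure.haar K) y := by
      filter_upwards [ae_coord_ne_zero (0 : Fin (n + 1))] with y hy
      have hrow : ∀ h : stabE1 (n + 1),
          rowMul (e1 (n + 1) : E (n + 1)) (h * triSect y) = y := by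
        intro h
        rw [rowMul_mul, mem_stabE1.1 h.2, rowMul_triSect hy]
      by_cases hyC : y ∈ r '' C
      · obtain ⟨g, hg, hgy⟩ := hyC
        rw [indicator_of_mem (show y ∈ r '' C from ⟨g, hg, hgy⟩),
          lintegral_fiber_eq _ ((rowMul_triSect hy).trans hgy.symm),
          ← lintegral_indicator_one hK.measurableSet]
        refine lintegral_mono fun h => ?_
        by_cases hh : (h : SLR (n + 1)) * g ∈ C
        · have : h ∈ K := ⟨(h * g, g), ⟨hh, hg⟩, by simp⟩
          simp [hh, this]
        · simp [hh]
      · rw [indicator_of_notMem hyC, nonpos_iff_eq_zero, lintegral_eq_zero_iff']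
        · filter_upwards with h
          refine indicator_of_notMem (fun hh => hyC ⟨_, hh, hrow h⟩) _
        · exact ((measurable_one.indicator hC.measurableSet).comp
            (measurable_subtype_coe.mul_const _)).aemeasurable
    refine (lintegral_mono_ae hb).trans_lt ?_
    rw [lintegral_indicator hC'.measurableSet, setLIntegral_const]
    exact ENNReal.mul_lt_top hK.measure_lt_top hC'.measure_lt_top

/-- The measure `dh dy` is right invariant by construction; as `SL(n + 1, ℝ)` is unimodular, it is
left invariant too. -/
instance : (fiberMeasure n).IsMulLeftInvariant := by
  have : IsFiniteMeasureOnCompacts (fiberMeasure n).inv := ⟨fun K hK => by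
    rw [Measure.inv_apply]
    exact hK.inv.measure_lt_top⟩
  have h := Measure.isMulLeftInvariant_eq_smul (fiberMeasure n).inv
    (Measure.haar : Measure (SLR (n + 1)))
  have hr : (fiberMeasure n).inv.IsMulRightInvariant := by
    rw [h]
    infer_instance
  have := Measure.inv.instIsMulLeftInvariant (μ := (fiberMeasure n).inv)
  rwa [Measure.inv_inv] at this

lemma fiberMeasure_ne_zero : fiberMeasure n ≠ 0 := by
  rw [← Measure.measure_univ_ne_zero, fiberMeasure, Measure.map_apply measurable_fiberMap .univ,
    preimage_univ]
  exact (isOpen_univ.measure_pos _ univ_nonempty).ne'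

instance : SigmaFinite (fiberMeasure n) := by infer_instance

end

/-! ### Integer vectors and the orbits of `SL(d, ℤ)` -/

/-- An integer vector as a vector of `ℝ^d`. -/
def intVec {d : ℕ} (k : Fin d → ℤ) : E d := WithLp.toLp 2 fun i => (k i : ℝ)

@[simp] lemma intVec_apply {d : ℕ} (k : Fin d → ℤ) (i : Fin d) : intVec k i = k i := rfl

section

variable {n : ℕ} [NeZero n]

/-- Every nonzero integer vector is a positive multiple of the first row of a matrix in
`SL(n + 1, ℤ)`: take a basis of `ℤ^(n + 1)` adapted to the line through it (Smith normal form), and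
correct the sign of the determinant with another row. -/
lemma exists_eq_mul_row {k : Fin (n + 1) → ℤ} (hk : k ≠ 0) :
    ∃ (m : ℕ) (γ : Matrix.SpecialLinearGroup (Fin (n + 1)) ℤ),
      k = fun j => ((m : ℤ) + 1) * γ.1 0 j := by
  classical
  obtain ⟨r, snf⟩ := (Submodule.span ℤ {k}).smithNormalForm (Pi.basisFun ℤ (Fin (n + 1)))
  have hfin : Module.finrank ℤ (Submodule.span ℤ {k}) = 1 := by
    rw [← (LinearEquiv.toSpanNonzeroSingleton ℤ (Fin (n + 1) → ℤ) k hk).finrank_eq]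
    exact Module.finrank_self ℤ
  have hr : r = 1 := by
    rw [← hfin, Module.finrank_eq_card_basis snf.bN, Fintype.card_fin]
  subst hr
  set p := snf.f 0
  -- `k` is a multiple of a single vector of the adapted basis
  obtain ⟨c, hc⟩ : ∃ c : ℤ, k = c • snf.bM p := by
    let k' : Submodule.span ℤ {k} := ⟨k, Submodule.mem_span_singleton_self k⟩
    have h1 := snf.bN.sum_repr k'
    rw [Fin.sum_univ_one] at h1
    have h2 := congrArg Subtype.val h1
    refine ⟨snf.bN.repr k' 0 * snf.a 0, ?_⟩
    rw [mul_smul, ← snf.snf]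
    exact h2.symm
  have hc0 : c ≠ 0 := by
    rintro rfl
    exact hk (by simpa using hc)
  -- move that vector to the first row
  let b := snf.bM.reindex (Equiv.swap p 0)
  have hb0 : b 0 = snf.bM p := by simp [b]
  have hdet : IsUnit (Matrix.of fun i => b i).det := by
    have := (Pi.basisFun ℤ (Fin (n + 1))).isUnit_det b
    rwa [Pi.basisFun_det] at this
  set D := (Matrix.of fun i => b i).det with hD
  have hDD : D * D = 1 := Int.isUnit_mul_self hdet
  have hss : c.sign * c.sign = 1 := by
    rcases lt_or_gt_of_ne hc0 with h | h
    · simp [Int.sign_eq_neg_one_of_neg h]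
    · simp [Int.sign_eq_one_of_pos h]
  -- the first row is multiplied by the sign of `c`, the second one by the sign that makes the
  -- determinant equal to one
  let ε : Fin (n + 1) → ℤ := Fin.cons c.sign fun i => if i = 0 then c.sign * D else 1
  have hε : ∏ i, ε i = D := by
    rw [Fin.prod_univ_succ]
    simp only [ε, Fin.cons_zero, Fin.cons_succ, Finset.prod_ite_eq', Finset.mem_univ, if_true]
    rw [← mul_assoc, hss, one_mul]
  refine ⟨c.natAbs - 1, ⟨Matrix.of fun i j => ε i * (Matrix.of fun i => b i) i j, ?_⟩, ?_⟩
  · rw [Matrix.det_mul_column, hε, ← hD, hDD]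
  · funext j
    have h1 : 1 ≤ c.natAbs := Int.natAbs_pos.2 hc0
    have h2 : ((c.natAbs - 1 : ℕ) : ℤ) + 1 = c.natAbs := by omega
    rw [h2, hc]
    change c * snf.bM p j = (c.natAbs : ℤ) * (c.sign * b 0 j)
    rw [hb0, ← mul_assoc, mul_comm (c.natAbs : ℤ), Int.sign_mul_natAbs]

lemma dvd_of_mul_row_eq {m m' : ℤ} {γ γ' : Matrix.SpecialLinearGroup (Fin (n + 1)) ℤ}
    (h : ∀ j, m * γ.1 0 j = m' * γ'.1 0 j) : m' ∣ m := by
  have h1 : ∑ j, γ.1 0 j * (γ⁻¹).1 j 0 = 1 := by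
    have := congrArg (fun g : Matrix.SpecialLinearGroup (Fin (n + 1)) ℤ => g.1 0 0)
      (mul_inv_cancel γ)
    change (γ.1 * (γ⁻¹).1) 0 0 = (1 : Matrix (Fin (n + 1)) (Fin (n + 1)) ℤ) 0 0 at this
    rwa [Matrix.mul_apply, Matrix.one_apply_eq] at this
  refine ⟨∑ j, γ'.1 0 j * (γ⁻¹).1 j 0, ?_⟩
  rw [Finset.mul_sum]
  simp_rw [← mul_assoc, ← h, mul_assoc]
  rw [← Finset.mul_sum, h1, mul_one]

lemma eq_of_mul_row_eq {m m' : ℕ} {γ γ' : Matrix.SpecialLinearGroup (Fin (n + 1)) ℤ}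
    (h : ∀ j, ((m : ℤ) + 1) * γ.1 0 j = ((m' : ℤ) + 1) * γ'.1 0 j) : m = m' := by
  have h1 := dvd_of_mul_row_eq h
  have h2 := dvd_of_mul_row_eq fun j => (h j).symm
  have := Int.dvd_antisymm (by positivity) (by positivity) h1 h2
  omega

lemma rowMul_e1_ofInt (γ : Matrix.SpecialLinearGroup (Fin (n + 1)) ℤ) (m : ℕ) :
    intVec (fun j => ((m : ℤ) + 1) * γ.1 0 j) =
      ((m : ℝ) + 1) • rowMul (e1 (n + 1) : E (n + 1)) (ofInt (n + 1) γ) := by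
  ext j
  rw [intVec_apply, PiLp.smul_apply, rowMul_e1, ofInt_apply]
  simp

lemma ae_fiberMeasure_row_ne_zero :
    ∀ᵐ g ∂fiberMeasure n, rowMul (e1 (n + 1) : E (n + 1)) g 0 ≠ 0 := by
  have hm : Measurable fun g : SLR (n + 1) => rowMul (e1 (n + 1) : E (n + 1)) g 0 := by
    have : Continuous fun g : SLR (n + 1) => rowMul (e1 (n + 1) : E (n + 1)) g :=
      continuous_rowMul.comp (continuous_const.prodMk continuous_id)
    exact ((EuclideanSpace.proj (0 : Fin (n + 1)) : E (n + 1) →L[ℝ] ℝ).continuous.comp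
      this).measurable
  rw [fiberMeasure, ae_map_iff measurable_fiberMap.aemeasurable
    (p := fun g => rowMul (e1 (n + 1) : E (n + 1)) g 0 ≠ 0)
    (hm (measurableSet_singleton (0 : ℝ)).compl)]
  have h1 : ∀ᵐ p ∂((volume : Measure (E (n + 1))).prod
      (Measure.haar : Measure (stabE1 (n + 1)))), p.1 0 ≠ 0 :=
    Measure.quasiMeasurePreserving_fst.ae (ae_coord_ne_zero (0 : Fin (n + 1)))
  filter_upwards [h1] with p hp
  rwa [rowMul_mul, mem_stabE1.1 p.2.2, rowMul_triSect hp]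

/-- Almost every lattice has no nonzero vector with vanishing first coordinate. -/
lemma ae_fiberMeasure_intVec_ne_zero :
    ∀ᵐ g ∂fiberMeasure n, ∀ k : Fin (n + 1) → ℤ, k ≠ 0 → rowMul (intVec k) g 0 ≠ 0 := by
  rw [ae_all_iff]
  intro k
  by_cases hk : k = 0
  · simp [hk]
  · obtain ⟨m, γ, hγ⟩ := exists_eq_mul_row hk
    filter_upwards [(measurePreserving_mul_left (fiberMeasure n)
      (ofInt (n + 1) γ)).quasiMeasurePreserving.ae ae_fiberMeasure_row_ne_zero] with g hg _
    rw [hγ, rowMul_e1_ofInt, rowMul_smul, ← rowMul_mul]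
    exact mul_ne_zero (by positivity) hg

/-! ### Siegel's formula -/

/-- The points `h M_y`, `h ∈ F`, for a set `F` in the stabilizer of `e₁`. -/
def fiberSet (F : Set (stabE1 (n + 1))) : Set (SLR (n + 1)) :=
  (fun g => g * (triSect (rowMul (e1 (n + 1) : E (n + 1)) g))⁻¹) ⁻¹' (Subtype.val '' F)

lemma measurable_row : Measurable fun g : SLR (n + 1) => rowMul (e1 (n + 1) : E (n + 1)) g :=
  (continuous_rowMul.comp (continuous_const.prodMk continuous_id)).measurable

lemma measurableSet_fiberSet {F : Set (stabE1 (n + 1))} (hF : MeasurableSet F) :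
    MeasurableSet (fiberSet F) := by
  refine MeasurableSet.preimage ((isClosed_stabE1 (n + 1)).isClosedEmbedding_subtypeVal
    |>.measurableEmbedding.measurableSet_image.2 hF) ?_
  exact measurable_id.mul (measurable_triSect.comp measurable_row).inv

lemma mul_triSect_mem_fiberSet {F : Set (stabE1 (n + 1))} {y : E (n + 1)} (hy : y 0 ≠ 0)
    (h : stabE1 (n + 1)) : (h : SLR (n + 1)) * triSect y ∈ fiberSet F ↔ h ∈ F := by
  have : rowMul (e1 (n + 1) : E (n + 1)) (h * triSect y) = y := by
    rw [rowMul_mul, mem_stabE1.1 h.2, rowMul_triSect hy]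
  simp [fiberSet, this]

lemma mul_mem_fiberSet_iff {F : Set (stabE1 (n + 1))} {a g : SLR (n + 1)}
    (ha : a ∈ stabE1 (n + 1)) (hg : rowMul (e1 (n + 1) : E (n + 1)) g 0 ≠ 0) :
    a * g ∈ fiberSet F ↔ (⟨a, ha⟩ * ⟨g * (triSect (rowMul (e1 (n + 1) : E (n + 1)) g))⁻¹,
      mul_inv_mem_stabE1 (rowMul_triSect hg).symm⟩ : stabE1 (n + 1)) ∈ F := by
  have : rowMul (e1 (n + 1) : E (n + 1)) (a * g) = rowMul (e1 (n + 1) : E (n + 1)) g := by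
    rw [rowMul_mul, mem_stabE1.1 ha]
  simp only [fiberSet, mem_preimage, this, mul_assoc]
  constructor
  · rintro ⟨x, hx, hxe⟩
    have : x = ⟨a, ha⟩ * ⟨g * (triSect (rowMul (e1 (n + 1) : E (n + 1)) g))⁻¹,
      mul_inv_mem_stabE1 (rowMul_triSect hg).symm⟩ := Subtype.ext hxe
    rwa [this] at hx
  · intro h
    exact ⟨_, h, rfl⟩

/-- Each nonzero vector of the lattice `ℤ^(n + 1) g` arises from exactly one pair `(m, γ)` such that
`γ g` lies over the fundamental domain `F` of the stabilizer. -/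
lemma tsum_orbit_eq_tsum_intVec {F : Set (stabE1 (n + 1))}
    (hF : IsStrictFundamentalDomain (stabZ (n + 1)) F) {g : SLR (n + 1)}
    (hg : ∀ k : Fin (n + 1) → ℤ, k ≠ 0 → rowMul (intVec k) g 0 ≠ 0) (φ : E (n + 1) → ℝ≥0∞) :
    ∑' p : ℕ × Matrix.SpecialLinearGroup (Fin (n + 1)) ℤ,
      (fiberSet F).indicator (fun _ => φ (((p.1 : ℝ) + 1) •
        rowMul (e1 (n + 1) : E (n + 1)) (ofInt (n + 1) p.2 * g))) (ofInt (n + 1) p.2 * g) =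
      ∑' k : {k : Fin (n + 1) → ℤ // k ≠ 0}, φ (rowMul (intVec k.1) g) := by
  have hk0 : ∀ (m : ℕ) (γ : Matrix.SpecialLinearGroup (Fin (n + 1)) ℤ),
      (fun j => ((m : ℤ) + 1) * γ.1 0 j) ≠ 0 := by
    intro m γ h
    have h1 : ∀ j, γ.1 0 j = 0 := fun j => by
      have := congrFun h j
      rcases mul_eq_zero.1 this with h' | h'
      · omega
      · exact h'
    have h2 := γ.2
    rw [Matrix.det_eq_zero_of_row_eq_zero 0 h1] at h2
    exact zero_ne_one h2
  have hrow : ∀ γ : Matrix.SpecialLinearGroup (Fin (n + 1)) ℤ,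
      rowMul (e1 (n + 1) : E (n + 1)) (ofInt (n + 1) γ * g) 0 ≠ 0 := by
    intro γ
    have := hg _ (hk0 0 γ)
    rwa [rowMul_e1_ofInt, rowMul_smul, ← rowMul_mul, Nat.cast_zero, zero_add, one_smul] at this
  let S : Set (ℕ × Matrix.SpecialLinearGroup (Fin (n + 1)) ℤ) :=
    {p | ofInt (n + 1) p.2 * g ∈ fiberSet F}
  let e : S → {k : Fin (n + 1) → ℤ // k ≠ 0} := fun p =>
    ⟨fun j => ((p.1.1 : ℤ) + 1) * p.1.2.1 0 j, hk0 _ _⟩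
  -- `k` determines `m` as its content and the first row of `γ`, hence `γ` up to the integer points
  -- of the stabilizer; the fundamental domain `F` then singles out one `γ`
  have he : Function.Bijective e := by
    constructor
    · rintro ⟨⟨m, γ⟩, hp⟩ ⟨⟨m', γ'⟩, hp'⟩ h
      have h1 : ∀ j, ((m : ℤ) + 1) * γ.1 0 j = ((m' : ℤ) + 1) * γ'.1 0 j :=
        fun j => congrFun (congrArg Subtype.val h) j
      obtain rfl := eq_of_mul_row_eq h1
      have h2 : rowMul (e1 (n + 1) : E (n + 1)) (ofInt (n + 1) γ') =
          rowMul (e1 (n + 1) : E (n + 1)) (ofInt (n + 1) γ) := by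
        ext j
        rw [rowMul_e1, rowMul_e1, ofInt_apply, ofInt_apply]
        have := mul_left_cancel₀ (by omega) (h1 j)
        rw [this]
      have ha : ofInt (n + 1) (γ' * γ⁻¹) ∈ stabE1 (n + 1) := by
        rw [map_mul, map_inv]
        exact mul_inv_mem_stabE1 h2
      have hp2 : ofInt (n + 1) (γ' * γ⁻¹) * (ofInt (n + 1) γ * g) ∈ fiberSet F := by
        rw [map_mul, map_inv, mul_assoc, inv_mul_cancel_left]
        exact hp'
      rw [mul_mem_fiberSet_iff ha (hrow γ)] at hp2
      have hp1 : ofInt (n + 1) 1 * (ofInt (n + 1) γ * g) ∈ fiberSet F := by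
        rw [map_one, one_mul]
        exact hp
      rw [mul_mem_fiberSet_iff (by rw [map_one]; exact one_mem _) (hrow γ)] at hp1
      obtain ⟨η, hη, hηu⟩ := hF.existsUnique
        ⟨ofInt (n + 1) γ * g * (triSect (rowMul (e1 (n + 1) : E (n + 1))
          (ofInt (n + 1) γ * g)))⁻¹, mul_inv_mem_stabE1 (rowMul_triSect (hrow γ)).symm⟩
      have u1 := hηu ⟨⟨ofInt (n + 1) (γ' * γ⁻¹), ha⟩, ⟨_, rfl⟩⟩ hp2
      have u2 := hηu ⟨⟨ofInt (n + 1) 1, by rw [map_one]; exact one_mem _⟩, ⟨_, rfl⟩⟩ hp1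
      have u3 := ofInt_injective (congrArg (fun x : stabZ (n + 1) => ((x : stabE1 (n + 1)) :
        SLR (n + 1))) (u1.trans u2.symm))
      have : γ = γ' := (mul_inv_eq_one.1 u3).symm
      subst this
      rfl
    · rintro ⟨k, hk⟩
      obtain ⟨m, γ, rfl⟩ := exists_eq_mul_row hk
      obtain ⟨η, hη, -⟩ := hF.existsUnique
        ⟨ofInt (n + 1) γ * g * (triSect (rowMul (e1 (n + 1) : E (n + 1))
          (ofInt (n + 1) γ * g)))⁻¹, mul_inv_mem_stabE1 (rowMul_triSect (hrow γ)).symm⟩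
      obtain ⟨⟨a, ha⟩, δ, hδ⟩ := η
      change ofInt (n + 1) δ = a at hδ
      subst hδ
      refine ⟨⟨(m, δ * γ), ?_⟩, ?_⟩
      · change ofInt (n + 1) (δ * γ) * g ∈ fiberSet F
        rw [map_mul, mul_assoc, mul_mem_fiberSet_iff ha (hrow γ)]
        exact hη
      · refine Subtype.ext (funext fun j => ?_)
        change ((m : ℤ) + 1) * (δ * γ).1 0 j = ((m : ℤ) + 1) * γ.1 0 j
        congr 1
        have h3 : ((δ * γ).1 0 j : ℝ) = (γ.1 0 j : ℝ) := by
          rw [← ofInt_apply, ← ofInt_apply, ← rowMul_e1, ← rowMul_e1, map_mul, rowMul_mul,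
            mem_stabE1.1 ha]
        exact_mod_cast h3
  rw [← (Equiv.ofBijective e he).tsum_eq]
  have hS : ∀ p : ℕ × Matrix.SpecialLinearGroup (Fin (n + 1)) ℤ,
      (fiberSet F).indicator (fun _ => φ (((p.1 : ℝ) + 1) •
        rowMul (e1 (n + 1) : E (n + 1)) (ofInt (n + 1) p.2 * g))) (ofInt (n + 1) p.2 * g) =
      S.indicator (fun p => φ (((p.1 : ℝ) + 1) •
        rowMul (e1 (n + 1) : E (n + 1)) (ofInt (n + 1) p.2 * g))) p := by
    intro p
    by_cases hp : ofInt (n + 1) p.2 * g ∈ fiberSet F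
    · rw [indicator_of_mem hp, indicator_of_mem (show p ∈ S from hp)]
    · rw [indicator_of_notMem hp, indicator_of_notMem (show p ∉ S from hp)]
  simp_rw [hS]
  rw [← tsum_subtype S]
  refine tsum_congr fun p => ?_
  change _ = φ (rowMul (intVec fun j => ((p.1.1 : ℤ) + 1) * p.1.2.1 0 j) g)
  rw [rowMul_e1_ofInt, rowMul_smul, rowMul_mul]

/-- Siegel's formula: unfolding the sum over the nonzero lattice vectors, for a function of a
vector and a lattice. -/
theorem lintegral_tsum_intVec {F : Set (SLR (n + 1))}
    (hF : IsStrictFundamentalDomain (SLZ (n + 1)) F) {F' : Set (stabE1 (n + 1))}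
    (hF' : IsStrictFundamentalDomain (stabZ (n + 1)) F') {φ : E (n + 1) × SLR (n + 1) → ℝ≥0∞}
    (hφ : Measurable φ) (hinv : ∀ y g, ∀ γ ∈ SLZ (n + 1), φ (y, γ * g) = φ (y, g)) :
    ∫⁻ g in F, ∑' k : {k : Fin (n + 1) → ℤ // k ≠ 0}, φ (rowMul (intVec k.1) g, g)
      ∂fiberMeasure n =
    ∑' m : ℕ, ∫⁻ y : E (n + 1), ∫⁻ h in F', φ (((m : ℝ) + 1) • y, h * triSect y)
      ∂Measure.haar := by
  let Ψ : ℕ → SLR (n + 1) → ℝ≥0∞ := fun m => (fiberSet F').indicator fun g =>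
    φ (((m : ℝ) + 1) • rowMul (e1 (n + 1) : E (n + 1)) g, g)
  have hΨm : ∀ m, Measurable (Ψ m) := fun m =>
    (hφ.comp ((measurable_row.const_smul ((m : ℝ) + 1)).prodMk measurable_id)).indicator
      (measurableSet_fiberSet hF'.measurableSet)
  have h1 : ∀ m : ℕ, ∫⁻ y : E (n + 1), ∫⁻ h in F', φ (((m : ℝ) + 1) • y, h * triSect y)
      ∂Measure.haar = ∫⁻ g, Ψ m g ∂fiberMeasure n := by
    intro m
    rw [lintegral_fiberMeasure (hΨm m)]
    refine lintegral_congr_ae ?_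
    filter_upwards [ae_coord_ne_zero (0 : Fin (n + 1))] with y hy
    rw [← lintegral_indicator hF'.measurableSet]
    refine lintegral_congr fun h => ?_
    have hrow : rowMul (e1 (n + 1) : E (n + 1)) (h * triSect y) = y := by
      rw [rowMul_mul, mem_stabE1.1 h.2, rowMul_triSect hy]
    by_cases hh : h ∈ F'
    · simp [Ψ, hh, (mul_triSect_mem_fiberSet hy h).2 hh, hrow]
    · simp [Ψ, hh, mt (mul_triSect_mem_fiberSet hy h).1 hh]
  simp_rw [h1]
  -- fold the integral over `SL(n + 1, ℝ)` onto the fundamental domain `F` of `SL(n + 1, ℤ)`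
  have h2 : ∀ m, ∫⁻ g, Ψ m g ∂fiberMeasure n =
      ∑' γ : Matrix.SpecialLinearGroup (Fin (n + 1)) ℤ,
        ∫⁻ g in F, Ψ m (ofInt (n + 1) γ * g) ∂fiberMeasure n := by
    intro m
    rw [(hF.isFundamentalDomain (fiberMeasure n)).lintegral_eq_tsum'']
    let e : Matrix.SpecialLinearGroup (Fin (n + 1)) ℤ ≃ SLZ (n + 1) :=
      (MonoidHom.ofInjective (ofInt_injective (d := n + 1))).toEquiv
    rw [← e.tsum_eq]
    rfl
  simp_rw [h2]
  rw [← ENNReal.tsum_prod (f := fun m γ =>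
    ∫⁻ g in F, Ψ m (ofInt (n + 1) γ * g) ∂fiberMeasure n), ← lintegral_tsum]
  · refine lintegral_congr_ae (ae_restrict_of_ae ?_)
    filter_upwards [ae_fiberMeasure_intVec_ne_zero (n := n)] with g hg
    rw [← tsum_orbit_eq_tsum_intVec hF' hg fun y => φ (y, g)]
    refine tsum_congr fun p => ?_
    simp only [Ψ]
    by_cases hp : ofInt (n + 1) p.2 * g ∈ fiberSet F'
    · rw [indicator_of_mem hp, indicator_of_mem hp, hinv _ _ _ (mem_SLZ.2 ⟨p.2, rfl⟩)]
    · rw [indicator_of_notMem hp, indicator_of_notMem hp]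
  · exact fun p => ((hΨm p.1).comp (measurable_const_mul _)).aemeasurable

end

/-! ### Counting lattice points -/

section Counting

open scoped Pointwise

variable {d : ℕ}

/-- The linear map `x ↦ x g` in coordinates. -/
def rowMulLin (g : SLR d) : (Fin d → ℝ) →ₗ[ℝ] E d where
  toFun x := rowMul (WithLp.toLp 2 x) g
  map_add' x y := by rw [WithLp.toLp_add, rowMul_add]
  map_smul' c x := by rw [WithLp.toLp_smul, rowMul_smul]; rfl

lemma measurePreserving_rowMulLin (g : SLR d) : MeasurePreserving (rowMulLin g) :=
  (measurePreserving_rowMul g).comp (PiLp.volume_preserving_toLp (Fin d))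

lemma mem_span_basisFun_iff {x : Fin d → ℝ} :
    x ∈ Submodule.span ℤ (range (Pi.basisFun ℝ (Fin d))) ↔
      ∃ k : Fin d → ℤ, x = fun i => (k i : ℝ) := by
  rw [Module.Basis.mem_span_iff_repr_mem]
  constructor
  · intro h
    choose k hk using h
    exact ⟨k, funext fun i => by simpa using (hk i).symm⟩
  · rintro ⟨k, rfl⟩ i
    exact ⟨k i, by simp⟩

/-- Minkowski's theorem for unimodular lattices. -/
lemma exists_intVec_mem (g : SLR d) {s : Set (E d)} (hsymm : ∀ x ∈ s, -x ∈ s) (hconv : Convex ℝ s)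
    (hvol : 2 ^ d < volume s) : ∃ k : Fin d → ℤ, k ≠ 0 ∧ rowMul (intVec k) g ∈ s := by
  have hfund := ZSpan.isAddFundamentalDomain' (Pi.basisFun ℝ (Fin d)) volume
  have hvolF : volume (ZSpan.fundamentalDomain (Pi.basisFun ℝ (Fin d))) = 1 := by
    have h1 : Matrix.of (Pi.basisFun ℝ (Fin d)) = 1 := by
      ext i j
      simp [Matrix.one_apply, Pi.single_apply, eq_comm]
    rw [ZSpan.volume_fundamentalDomain, h1]
    simp
  have hpre : volume (rowMulLin g ⁻¹' s) = volume s :=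
    (measurePreserving_rowMulLin g).measure_preimage (hconv.nullMeasurableSet _)
  have hc : Countable (Submodule.span ℤ (range (Pi.basisFun ℝ (Fin d)))).toAddSubgroup :=
    inferInstanceAs (Countable (Submodule.span ℤ (range (Pi.basisFun ℝ (Fin d)))))
  obtain ⟨x, hx, hxs⟩ := exists_ne_zero_mem_lattice_of_measure_mul_two_pow_lt_measure
    (s := rowMulLin g ⁻¹' s) hfund
    (fun x hx => by rw [mem_preimage, map_neg]; exact hsymm _ hx)
    (hconv.linear_preimage _) (by rw [hvolF, one_mul, hpre]; simpa using hvol)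
  obtain ⟨k, hk⟩ := mem_span_basisFun_iff.1 x.2
  refine ⟨k, ?_, ?_⟩
  · rintro rfl
    refine hx (Subtype.ext ?_)
    rw [hk]
    funext i
    simp
  · rw [hk] at hxs
    exact hxs

lemma lintegral_comp_smul {c : ℝ} (hc : 0 < c) {f : E d → ℝ≥0∞} (hf : Measurable f) :
    ∫⁻ y, f (c • y) = (ENNReal.ofReal (c ^ d))⁻¹ * ∫⁻ y, f y := by
  have h := Measure.map_addHaar_smul (volume : Measure (E d)) hc.ne'
  rw [← lintegral_map hf (measurable_const_smul c), h, lintegral_smul_measure]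
  simp [ENNReal.ofReal_inv_of_pos (pow_pos hc d), abs_of_pos (inv_pos.2 (pow_pos hc d))]

/-- The open unit cube. -/
def unitCube (d : ℕ) : Set (E d) := {x | ∀ i, 0 < x i ∧ x i < 1}

/-- The open cube of side length two centred at the origin. -/
def symCube (d : ℕ) : Set (E d) := {x | ∀ i, |x i| < 1}

lemma isOpen_unitCube : IsOpen (unitCube d) := by
  simp only [unitCube, ofPred_forall]
  refine isOpen_iInter_of_finite fun i => ?_
  have hc : Continuous fun x : E d => x i := by fun_prop
  exact (isOpen_lt continuous_const hc).inter (isOpen_lt hc continuous_const)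

lemma isOpen_symCube : IsOpen (symCube d) := by
  simp only [symCube, ofPred_forall]
  exact isOpen_iInter_of_finite fun i => isOpen_lt (by fun_prop) (by fun_prop)

lemma volume_unitCube : volume (unitCube d) = 1 := by
  have : WithLp.ofLp ⁻¹' (Set.pi univ fun _ => Ioo (0 : ℝ) 1) = unitCube d := by
    ext x
    simp [unitCube]
  rw [← this, (PiLp.volume_preserving_ofLp (Fin d)).measure_preimage
    (MeasurableSet.univ_pi fun _ => measurableSet_Ioo).nullMeasurableSet, Real.volume_pi_Ioo]
  simp

lemma volume_symCube_lt_top : volume (symCube d) < ⊤ := by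
  have : symCube d ⊆ WithLp.ofLp ⁻¹' (Set.pi univ fun _ => Ioo (-1 : ℝ) 1) := by
    intro x hx i _
    exact abs_lt.1 (hx i)
  refine (measure_mono this).trans_lt ?_
  rw [(PiLp.volume_preserving_ofLp (Fin d)).measure_preimage
    (MeasurableSet.univ_pi fun _ => measurableSet_Ioo).nullMeasurableSet, Real.volume_pi_Ioo]
  exact ENNReal.prod_lt_top fun _ _ => ENNReal.ofReal_lt_top

lemma convex_unitCube : Convex ℝ (unitCube d) := by
  intro x hx y hy a b ha hb hab i
  have h1 := hx i
  have h2 := hy i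
  simp only [PiLp.add_apply, PiLp.smul_apply, smul_eq_mul]
  constructor
  · rcases ha.lt_or_eq with h | h
    · nlinarith [mul_pos h h1.1, mul_nonneg hb h2.1.le]
    · have : b = 1 := by linarith
      rw [← h, this]; linarith
  · rcases ha.lt_or_eq with h | h
    · nlinarith [mul_pos h (sub_pos.2 h1.2), mul_nonneg hb (sub_nonneg.2 h2.2.le)]
    · have : b = 1 := by linarith
      rw [← h, this]; linarith

lemma finite_intVec_mem_of_bounded (g : SLR d) {s : Set (E d)} (hs : Bornology.IsBounded s) :
    {k : Fin d → ℤ | rowMul (intVec k) g ∈ s}.Finite := by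
  -- the vectors `k = (k g) g⁻¹` lie in the image of a compact set
  have hK : IsCompact ((fun x : E d => rowMul x g⁻¹) '' closure s) :=
    (Metric.isCompact_of_isClosed_isBounded isClosed_closure hs.closure).image
      (continuous_rowMul.comp (continuous_id.prodMk continuous_const))
  obtain ⟨C, hC⟩ := hK.isBounded.exists_norm_le
  have hfin : (Set.pi univ fun _ : Fin d => {m : ℤ | |(m : ℝ)| ≤ C}).Finite := by
    refine Set.Finite.pi fun _ => ?_
    refine (Set.finite_Icc (-⌈C⌉) ⌈C⌉).subset fun m hm => ?_
    have h1 : |(m : ℝ)| ≤ C := hm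
    have h2 := abs_le.1 (h1.trans (Int.le_ceil C))
    exact ⟨by exact_mod_cast h2.1, by exact_mod_cast h2.2⟩
  refine hfin.subset fun k hk i _ => ?_
  have h1 := hC (intVec k) ⟨_, subset_closure hk, rowMul_inv_cancel _ _⟩
  have h2 := (PiLp.norm_apply_le (intVec k) i).trans h1
  simpa using h2

/-- The number of lattice points in the open cube of side length `r` is at most `r ^ d` times the
number of lattice points in the symmetric cube: split the cube into `r ^ d` unit cubes, and take
differences of points in the same unit cube. -/
lemma tsum_unitCube_le (g : SLR d) {r : ℕ} (hr : 0 < r) :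
    ∑' k : Fin d → ℤ, (unitCube d).indicator (1 : E d → ℝ≥0∞) ((r : ℝ)⁻¹ • rowMul (intVec k) g) ≤
      (r : ℝ≥0∞) ^ d *
        ∑' k : Fin d → ℤ, (symCube d).indicator (1 : E d → ℝ≥0∞) (rowMul (intVec k) g) := by
  classical
  have hr' : (0 : ℝ) < r := Nat.cast_pos.2 hr
  -- the translates of the half-open unit cube that tile the cube of side length `r`
  let cell : (Fin d → Fin r) → Set (E d) := fun c =>
    {x | ∀ i, (c i : ℝ) ≤ x i ∧ x i < (c i : ℝ) + 1}
  have h1 : ∀ k : Fin d → ℤ,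
      (unitCube d).indicator (1 : E d → ℝ≥0∞) ((r : ℝ)⁻¹ • rowMul (intVec k) g) ≤
      ∑ c, (cell c).indicator (1 : E d → ℝ≥0∞) (rowMul (intVec k) g) := by
    intro k
    by_cases hk : (r : ℝ)⁻¹ • rowMul (intVec k) g ∈ unitCube d
    · have hb : ∀ i, 0 < rowMul (intVec k) g i ∧ rowMul (intVec k) g i < r := by
        intro i
        have h1 := hk i
        simp only [PiLp.smul_apply, smul_eq_mul] at h1
        refine ⟨pos_of_mul_pos_right h1.1 (inv_pos.2 hr').le, ?_⟩
        have := h1.2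
        rwa [inv_mul_lt_iff₀ hr', mul_one] at this
      let c : Fin d → Fin r := fun i => ⟨⌊rowMul (intVec k) g i⌋₊,
        (Nat.floor_lt (hb i).1.le).2 (hb i).2⟩
      have hc : rowMul (intVec k) g ∈ cell c := fun i =>
        ⟨Nat.floor_le (hb i).1.le, Nat.lt_floor_add_one _⟩
      rw [indicator_of_mem hk]
      refine le_trans ?_ (Finset.single_le_sum (fun _ _ => zero_le) (Finset.mem_univ c))
      rw [indicator_of_mem hc]
      rfl
    · rw [indicator_of_notMem hk]
      exact zero_le
  have h2 : ∀ c, ∑' k : Fin d → ℤ, (cell c).indicator (1 : E d → ℝ≥0∞) (rowMul (intVec k) g) ≤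
      ∑' k : Fin d → ℤ, (symCube d).indicator (1 : E d → ℝ≥0∞) (rowMul (intVec k) g) := by
    intro c
    by_cases hne : ∃ k₀ : Fin d → ℤ, rowMul (intVec k₀) g ∈ cell c
    · obtain ⟨k₀, hk₀⟩ := hne
      -- the difference of two points of a cell lies in the symmetric cube
      rw [← (Equiv.addRight k₀).tsum_eq]
      refine ENNReal.tsum_le_tsum fun k => ?_
      by_cases hk : rowMul (intVec (k + k₀)) g ∈ cell c
      · have : rowMul (intVec k) g ∈ symCube d := by
          intro i
          have e : intVec (k + k₀) = intVec k + intVec k₀ := by ext; simp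
          have h3 := hk i
          have h4 := hk₀ i
          rw [e, rowMul_add, PiLp.add_apply] at h3
          rw [abs_lt]
          constructor <;> linarith [h3.1, h3.2, h4.1, h4.2]
        rw [indicator_of_mem this]
        exact indicator_le_self' (fun _ _ => zero_le) _
      · rw [Equiv.coe_addRight, indicator_of_notMem hk]
        exact zero_le
    · have : ∀ k : Fin d → ℤ, (cell c).indicator (1 : E d → ℝ≥0∞) (rowMul (intVec k) g) = 0 :=
        fun k => indicator_of_notMem (fun h => hne ⟨k, h⟩) _
      simp [this]
  calc _ ≤ ∑' k : Fin d → ℤ, ∑ c, (cell c).indicator (1 : E d → ℝ≥0∞) (rowMul (intVec k) g) :=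
        ENNReal.tsum_le_tsum h1
    _ = ∑ c, ∑' k : Fin d → ℤ, (cell c).indicator (1 : E d → ℝ≥0∞) (rowMul (intVec k) g) :=
        Summable.tsum_finsetSum fun _ _ => ENNReal.summable
    _ ≤ ∑ _c : Fin d → Fin r,
        ∑' k : Fin d → ℤ, (symCube d).indicator (1 : E d → ℝ≥0∞) (rowMul (intVec k) g) :=
        Finset.sum_le_sum fun c _ => h2 c
    _ = _ := by simp

/-- The number of lattice points in a large cube is asymptotic to its volume. -/
lemma tendsto_tsum_unitCube (g : SLR d) :
    Filter.Tendsto (fun r : ℕ => (∑' k : Fin d → ℤ, (unitCube d).indicator (1 : E d → ℝ≥0∞)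
      ((r : ℝ)⁻¹ • rowMul (intVec k) g)) / (r : ℝ≥0∞) ^ d) Filter.atTop (nhds 1) := by
  classical
  -- count integer points in dilates of the preimage of the cube, a convex body of volume one
  set s : Set (Fin d → ℝ) := rowMulLin g ⁻¹' unitCube d with hs
  have hgc : Continuous (rowMulLin g) := (rowMulLin g).continuous_of_finiteDimensional
  have hconv : Convex ℝ s := convex_unitCube.linear_preimage _
  have hmeas : MeasurableSet s := (isOpen_unitCube.preimage hgc).measurableSet
  have hvol : volume s = 1 := by
    rw [hs, (measurePreserving_rowMulLin g).measure_preimage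
      isOpen_unitCube.measurableSet.nullMeasurableSet, volume_unitCube]
  have hbQ : Bornology.IsBounded (unitCube d) := by
    have : unitCube d ⊆ (fun x : Fin d → ℝ => (WithLp.toLp 2 x : E d)) ''
        (Set.pi univ fun _ => Icc (0 : ℝ) 1) :=
      fun x hx => ⟨x.ofLp, fun i _ => ⟨(hx i).1.le, (hx i).2.le⟩, rfl⟩
    refine Bornology.IsBounded.subset (IsCompact.isBounded ?_) this
    exact (isCompact_univ_pi fun _ => isCompact_Icc).image (PiLp.continuous_toLp 2 _)
  have hbs : Bornology.IsBounded s := by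
    have : s ⊆ (fun x : E d => (rowMul x g⁻¹).ofLp) '' closure (unitCube d) := fun x hx =>
      ⟨rowMulLin g x, subset_closure hx, by
        change (rowMul (rowMul (WithLp.toLp 2 x) g) g⁻¹).ofLp = x
        rw [rowMul_inv_cancel]⟩
    refine Bornology.IsBounded.subset (IsCompact.isBounded ?_) this
    refine (Metric.isCompact_of_isClosed_isBounded isClosed_closure hbQ.closure).image ?_
    exact (PiLp.continuous_ofLp 2 _).comp
      (continuous_rowMul.comp (continuous_id.prodMk continuous_const))
  have key := tendsto_card_div_pow_atTop_volume s hbs hmeas (hconv.addHaar_frontier _)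
  have hv1 : volume.real s = 1 := by simp [measureReal_def, hvol]
  rw [hv1, Fintype.card_fin] at key
  have key2 := (ENNReal.continuous_ofReal.tendsto 1).comp key
  rw [ENNReal.ofReal_one] at key2
  refine key2.congr' ?_
  filter_upwards [Filter.eventually_gt_atTop 0] with r hr
  have hr' : (0 : ℝ) < r := Nat.cast_pos.2 hr
  let T : Set (Fin d → ℤ) := {k | (r : ℝ)⁻¹ • rowMul (intVec k) g ∈ unitCube d}
  have hT : ∀ k : Fin d → ℤ, (unitCube d).indicator (1 : E d → ℝ≥0∞)
      ((r : ℝ)⁻¹ • rowMul (intVec k) g) = T.indicator 1 k := by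
    intro k
    by_cases hk : (r : ℝ)⁻¹ • rowMul (intVec k) g ∈ unitCube d
    · rw [indicator_of_mem hk, indicator_of_mem (show k ∈ T from hk)]; rfl
    · rw [indicator_of_notMem hk, indicator_of_notMem (show k ∉ T from hk)]
  have hTfin : T.Finite := by
    have := finite_intVec_mem_of_bounded g (hbQ.smul₀ (r : ℝ))
    refine this.subset fun k hk => ?_
    exact ⟨_, hk, smul_inv_smul₀ hr'.ne' _⟩
  -- the integer points of the dilated body correspond to the lattice points of the cube
  have hcard : Nat.card ↑(s ∩ (r : ℝ)⁻¹ • (Submodule.span ℤ (range (Pi.basisFun ℝ (Fin d))) :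
      Set (Fin d → ℝ))) = Nat.card T := by
    have h1 : ∀ k : T, ((r : ℝ)⁻¹ • fun i => (k.1 i : ℝ)) ∈ s ∩ (r : ℝ)⁻¹ •
        (Submodule.span ℤ (range (Pi.basisFun ℝ (Fin d))) : Set (Fin d → ℝ)) := by
      intro k
      refine ⟨?_, Set.smul_mem_smul_set (mem_span_basisFun_iff.2 ⟨k.1, rfl⟩)⟩
      change rowMul (WithLp.toLp 2 ((r : ℝ)⁻¹ • fun i => (k.1 i : ℝ))) g ∈ unitCube d
      rw [WithLp.toLp_smul, rowMul_smul]
      exact k.2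
    refine (Nat.card_congr (Equiv.ofBijective (fun k : T => ⟨_, h1 k⟩) ⟨?_, ?_⟩)).symm
    · rintro ⟨k, hk⟩ ⟨k', hk'⟩ h
      refine Subtype.ext (funext fun i => ?_)
      have h1 := congrFun (congrArg Subtype.val h) i
      simpa [hr'.ne'] using h1
    · rintro ⟨x, hx, hx'⟩
      obtain ⟨y, hy, rfl⟩ := hx'
      obtain ⟨k, rfl⟩ := mem_span_basisFun_iff.1 hy
      refine ⟨⟨k, ?_⟩, rfl⟩
      change rowMul (WithLp.toLp 2 ((r : ℝ)⁻¹ • fun i => (k i : ℝ))) g ∈ unitCube d at hx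
      rw [WithLp.toLp_smul, rowMul_smul] at hx
      exact hx
  rw [Function.comp_apply, hcard, ENNReal.ofReal_div_of_pos (by positivity),
    ENNReal.ofReal_natCast, ENNReal.ofReal_pow hr'.le, ENNReal.ofReal_natCast]
  congr 1
  simp_rw [hT]
  have h2 : ∑' k : Fin d → ℤ, T.indicator (1 : (Fin d → ℤ) → ℝ≥0∞) k = ∑' _ : T, 1 :=
    (tsum_subtype T 1).symm
  have := hTfin.to_subtype
  rw [h2, ENNReal.tsum_set_one, Set.encard, ENat.card_eq_coe_natCard]
  exact (ENat.toENNReal_coe _).symm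

end Counting

/-! ### Finite covolume and Siegel's mean value theorem -/

/-- The value `ζ(d)`, as an extended nonnegative real. -/
def zetaSum (d : ℕ) : ℝ≥0∞ := ∑' m : ℕ, (ENNReal.ofReal (((m : ℝ) + 1) ^ d))⁻¹

lemma summable_zeta {d : ℕ} (hd : 2 ≤ d) : Summable fun k : ℕ => (((k : ℝ) + 1) ^ d)⁻¹ := by
  have := (summable_nat_add_iff 1).2 (Real.summable_nat_pow_inv.2 hd)
  simpa using this

lemma zetaSum_eq {d : ℕ} (hd : 2 ≤ d) :
    zetaSum d = ENNReal.ofReal (∑' k : ℕ, (((k : ℝ) + 1) ^ d)⁻¹) := by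
  rw [ENNReal.ofReal_tsum_of_nonneg (fun _ => by positivity) (summable_zeta hd)]
  exact tsum_congr fun m => (ENNReal.ofReal_inv_of_pos (by positivity)).symm

lemma zetaSum_lt_top {d : ℕ} (hd : 2 ≤ d) : zetaSum d < ⊤ := by
  rw [zetaSum_eq hd]
  exact ENNReal.ofReal_lt_top

lemma zetaSum_ne_zero {d : ℕ} (hd : 2 ≤ d) : zetaSum d ≠ 0 := by
  rw [zetaSum_eq hd, Ne, ENNReal.ofReal_eq_zero, not_le]
  exact (summable_zeta hd).tsum_pos (fun _ => by positivity) 0 (by positivity)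

section

variable {n : ℕ} [NeZero n]

lemma two_le_succ : 2 ≤ n + 1 := by
  have := NeZero.pos n
  omega

/-- Siegel's formula for a function of the lattice vector alone. -/
lemma lintegral_tsum_intVec_vector {F : Set (SLR (n + 1))}
    (hF : IsStrictFundamentalDomain (SLZ (n + 1)) F) {F' : Set (stabE1 (n + 1))}
    (hF' : IsStrictFundamentalDomain (stabZ (n + 1)) F') {f : E (n + 1) → ℝ≥0∞}
    (hf : Measurable f) :
    ∫⁻ g in F, ∑' k : {k : Fin (n + 1) → ℤ // k ≠ 0}, f (rowMul (intVec k.1) g)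
      ∂fiberMeasure n = zetaSum (n + 1) * (Measure.haar F' * ∫⁻ y, f y) := by
  rw [lintegral_tsum_intVec hF hF' (φ := fun p => f p.1) (hf.comp measurable_fst)
    fun _ _ _ _ => rfl, zetaSum, ← ENNReal.tsum_mul_right]
  refine tsum_congr fun m => ?_
  simp only [lintegral_const, Measure.restrict_apply_univ]
  have hm : Measurable fun y : E (n + 1) => f (((m : ℝ) + 1) • y) :=
    hf.comp (measurable_const_smul _)
  rw [lintegral_mul_const _ hm, lintegral_comp_smul (by positivity) hf]
  ring

lemma fiberMeasure_fundDomain_lt_top {F : Set (SLR (n + 1))}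
    (hF : IsStrictFundamentalDomain (SLZ (n + 1)) F) {F' : Set (stabE1 (n + 1))}
    (hF' : IsStrictFundamentalDomain (stabZ (n + 1)) F')
    (hF't : (Measure.haar : Measure (stabE1 (n + 1))) F' < ⊤) : fiberMeasure n F < ⊤ := by
  obtain ⟨r, hr⟩ : ∃ r : ℝ, 2 ^ (n + 1) < volume (Metric.ball (0 : E (n + 1)) r) := by
    have h1 : Filter.Tendsto (fun r : ℕ => volume (Metric.ball (0 : E (n + 1)) r)) Filter.atTop
        (nhds (volume (⋃ r : ℕ, Metric.ball (0 : E (n + 1)) r))) :=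
      tendsto_measure_iUnion_atTop fun a b hab =>
        Metric.ball_subset_ball (by exact_mod_cast hab)
    rw [Metric.iUnion_ball_nat, measure_univ_of_isAddLeftInvariant] at h1
    obtain ⟨r, hr⟩ := ((tendsto_order.1 h1).1 (2 ^ (n + 1))
      (ENNReal.pow_lt_top (by simp))).exists
    exact ⟨r, hr⟩
  set B := Metric.ball (0 : E (n + 1)) r with hB
  have h1 : fiberMeasure n F ≤ ∫⁻ g in F, ∑' k : {k : Fin (n + 1) → ℤ // k ≠ 0},
      B.indicator (1 : E (n + 1) → ℝ≥0∞) (rowMul (intVec k.1) g) ∂fiberMeasure n := by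
    rw [← setLIntegral_one]
    refine lintegral_mono fun g => ?_
    obtain ⟨k, hk, hkB⟩ := exists_intVec_mem g (fun x hx => by simpa [B] using hx)
      (convex_ball 0 r) hr
    refine le_trans ?_ (ENNReal.le_tsum ⟨k, hk⟩)
    rw [indicator_of_mem hkB]
    rfl
  refine h1.trans_lt ?_
  rw [lintegral_tsum_intVec_vector hF hF' (measurable_one.indicator measurableSet_ball),
    lintegral_indicator_one measurableSet_ball]
  exact ENNReal.mul_lt_top (zetaSum_lt_top two_le_succ)
    (ENNReal.mul_lt_top hF't measure_ball_lt_top)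

/-- `SL(n, ℤ)` has finite covolume in `SL(n, ℝ)`, by induction on `n`: by Siegel's formula and
Minkowski's theorem the covolume is bounded by that of the integer points of the stabilizer of
`e₁`. -/
theorem haar_fundDomain_SLZ_lt_top : ∀ (n : ℕ) [NeZero n] (F : Set (SLR n)),
    IsStrictFundamentalDomain (SLZ n) F → (Measure.haar : Measure (SLR n)) F < ⊤
  | 1, _, F, _ => by
    have : Subsingleton (SLR 1) := ⟨fun a b => by
      have h : ∀ g : SLR 1, (g : Matrix (Fin 1) (Fin 1) ℝ) 0 0 = 1 := fun g =>
        (Matrix.det_fin_one _).symm.trans g.det_coe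
      ext i j
      rw [Subsingleton.elim i 0, Subsingleton.elim j 0]
      exact (h a).trans (h b).symm⟩
    exact (Set.toFinite F).isCompact.measure_lt_top
  | n + 2, _, F, hF => by
    obtain ⟨F₁, hF₁⟩ := exists_fundDomain_SLZ (n + 1)
    obtain ⟨F', hF', hF't⟩ := exists_fundDomain_stabZ hF₁
      (haar_fundDomain_SLZ_lt_top (n + 1) F₁ hF₁)
    -- the measure `dh dy` and Haar measure differ by a nonzero finite factor
    have h := fiberMeasure_fundDomain_lt_top (n := n + 1) hF hF' hF't
    have hc := Measure.isMulLeftInvariant_eq_smul (fiberMeasure (n + 1))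
      (Measure.haar : Measure (SLR (n + 1 + 1)))
    have hc0 : Measure.haarScalarFactor (fiberMeasure (n + 1))
        (Measure.haar : Measure (SLR (n + 1 + 1))) ≠ 0 := by
      intro h0
      rw [h0, zero_smul] at hc
      exact fiberMeasure_ne_zero hc
    rw [hc, Measure.smul_apply, ENNReal.smul_def, smul_eq_mul] at h
    rcases ENNReal.mul_lt_top_iff.1 h with h | h | h
    · exact h.2
    · exact absurd (ENNReal.coe_eq_zero.1 h) hc0
    · rw [h]; exact ENNReal.zero_lt_top

lemma exists_fundDomain_stabZ_lt_top (n : ℕ) [NeZero n] :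
    ∃ F' : Set (stabE1 (n + 1)), IsStrictFundamentalDomain (stabZ (n + 1)) F' ∧
      (Measure.haar : Measure (stabE1 (n + 1))) F' < ⊤ := by
  obtain ⟨F₁, hF₁⟩ := exists_fundDomain_SLZ n
  exact exists_fundDomain_stabZ hF₁ (haar_fundDomain_SLZ_lt_top n F₁ hF₁)

lemma tsum_ne_zero_eq_of_zero {α : Type*} [DecidableEq α] (z : α) {f : α → ℝ≥0∞} (h0 : f z = 0) :
    ∑' k : {k : α // k ≠ z}, f k = ∑' k, f k := by
  refine tsum_subtype_eq_of_support_subset (s := {k | k ≠ z}) fun k hk h => hk ?_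
  rw [h, h0]

lemma measurable_rowMul_left (k : E (n + 1)) : Measurable fun g : SLR (n + 1) => rowMul k g :=
  (continuous_rowMul.comp (continuous_const.prodMk continuous_id)).measurable

lemma measurable_indicator_unitCube :
    Measurable ((unitCube (n + 1)).indicator (1 : E (n + 1) → ℝ≥0∞)) :=
  measurable_one.indicator isOpen_unitCube.measurableSet

lemma measurable_indicator_symCube :
    Measurable ((symCube (n + 1)).indicator (1 : E (n + 1) → ℝ≥0∞)) :=
  measurable_one.indicator isOpen_symCube.measurableSet

/-- The number of lattice points in the open cube of side length `r`, divided by its volume. -/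
def cubeDensity (r : ℕ) (g : SLR (n + 1)) : ℝ≥0∞ :=
  (∑' k : Fin (n + 1) → ℤ, (unitCube (n + 1)).indicator (1 : E (n + 1) → ℝ≥0∞)
      ((r : ℝ)⁻¹ • rowMul (intVec k) g)) / (r : ℝ≥0∞) ^ (n + 1)

lemma measurable_cubeDensity (r : ℕ) : Measurable (cubeDensity (n := n) r) := by
  refine Measurable.div_const ?_ _
  refine Measurable.tsum fun k => ?_
  exact measurable_indicator_unitCube.comp
    ((measurable_rowMul_left (intVec k)).const_smul ((r : ℝ)⁻¹))

lemma intVec_zero {d : ℕ} : intVec (0 : Fin d → ℤ) = 0 := by ext; simp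

lemma zero_rowMul {d : ℕ} (g : SLR d) : rowMul (0 : E d) g = 0 := by
  simpa using rowMul_smul 0 0 g

lemma cubeDensity_eq (r : ℕ) (g : SLR (n + 1)) :
    cubeDensity r g = ∑' k : {k : Fin (n + 1) → ℤ // k ≠ 0},
      (unitCube (n + 1)).indicator (1 : E (n + 1) → ℝ≥0∞) ((r : ℝ)⁻¹ • rowMul (intVec k.1) g) *
        ((r : ℝ≥0∞) ^ (n + 1))⁻¹ := by
  classical
  rw [cubeDensity, div_eq_mul_inv, ENNReal.tsum_mul_right]
  congr 1
  refine (tsum_ne_zero_eq_of_zero (f := fun k : Fin (n + 1) → ℤ =>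
    (unitCube (n + 1)).indicator (1 : E (n + 1) → ℝ≥0∞) ((r : ℝ)⁻¹ • rowMul (intVec k) g)) 0
    ?_).symm
  rw [intVec_zero, zero_rowMul, smul_zero]
  refine indicator_of_notMem (fun h => ?_) _
  simpa using (h 0).1

lemma lintegral_cubeDensity {F : Set (SLR (n + 1))}
    (hF : IsStrictFundamentalDomain (SLZ (n + 1)) F) {F' : Set (stabE1 (n + 1))}
    (hF' : IsStrictFundamentalDomain (stabZ (n + 1)) F') {r : ℕ} (hr : 0 < r) :
    ∫⁻ g in F, cubeDensity r g ∂fiberMeasure n = zetaSum (n + 1) * Measure.haar F' := by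
  have hr' : (0 : ℝ) < r := Nat.cast_pos.2 hr
  have hm : Measurable fun y : E (n + 1) =>
      (unitCube (n + 1)).indicator (1 : E (n + 1) → ℝ≥0∞) ((r : ℝ)⁻¹ • y) :=
    measurable_indicator_unitCube.comp (measurable_const_smul _)
  simp_rw [cubeDensity_eq]
  have h := lintegral_tsum_intVec_vector hF hF' (hm.mul_const (((r : ℝ≥0∞) ^ (n + 1))⁻¹))
  rw [h, lintegral_mul_const _ hm,
    lintegral_comp_smul (inv_pos.2 hr') measurable_indicator_unitCube,
    lintegral_indicator_one isOpen_unitCube.measurableSet, volume_unitCube, mul_one, inv_pow,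
    ENNReal.ofReal_inv_of_pos (by positivity), inv_inv, ENNReal.ofReal_pow hr'.le,
    ENNReal.ofReal_natCast, ENNReal.mul_inv_cancel, mul_one]
  · exact pow_ne_zero _ (Nat.cast_ne_zero.2 hr.ne')
  · exact ENNReal.pow_ne_top (ENNReal.natCast_ne_top r)

lemma cubeDensity_le {r : ℕ} (hr : 0 < r) (g : SLR (n + 1)) :
    cubeDensity r g ≤ 1 + ∑' k : {k : Fin (n + 1) → ℤ // k ≠ 0},
      (symCube (n + 1)).indicator (1 : E (n + 1) → ℝ≥0∞) (rowMul (intVec k.1) g) := by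
  classical
  refine ENNReal.div_le_of_le_mul' ((tsum_unitCube_le g hr).trans ?_)
  gcongr
  rw [ENNReal.tsum_eq_add_tsum_ite (f := fun k : Fin (n + 1) → ℤ =>
    (symCube (n + 1)).indicator (1 : E (n + 1) → ℝ≥0∞) (rowMul (intVec k) g)) 0]
  gcongr
  · exact indicator_le_self' (fun _ _ => zero_le) _
  · rw [← tsum_ne_zero_eq_of_zero (0 : Fin (n + 1) → ℤ) (by simp)]
    refine le_of_eq (tsum_congr fun k => ?_)
    rw [if_neg k.2]

/-- The constant in Siegel's mean value theorem: the covolume of `SL(n + 1, ℤ)` is `ζ(n + 1)` times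
that of the integer points of the stabilizer of `e₁`. Both sides are the limit of the mean
number of lattice points in a large cube, divided by its volume. -/
theorem fiberMeasure_fundDomain_eq {F : Set (SLR (n + 1))}
    (hF : IsStrictFundamentalDomain (SLZ (n + 1)) F) {F' : Set (stabE1 (n + 1))}
    (hF' : IsStrictFundamentalDomain (stabZ (n + 1)) F')
    (hF't : (Measure.haar : Measure (stabE1 (n + 1))) F' < ⊤) :
    fiberMeasure n F = zetaSum (n + 1) * Measure.haar F' := by
  have hV := fiberMeasure_fundDomain_lt_top hF hF' hF't
  have hlim : Filter.Tendsto (fun r => ∫⁻ g in F, cubeDensity r g ∂fiberMeasure n) Filter.atTop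
      (nhds (∫⁻ _ in F, 1 ∂fiberMeasure n)) := by
    -- the dominating function has a finite integral by Siegel's formula
    refine tendsto_lintegral_filter_of_dominated_convergence
      (fun g => 1 + ∑' k : {k : Fin (n + 1) → ℤ // k ≠ 0},
        (symCube (n + 1)).indicator (1 : E (n + 1) → ℝ≥0∞) (rowMul (intVec k.1) g))
      (Filter.Eventually.of_forall measurable_cubeDensity) ?_ ?_ ?_
    · filter_upwards [Filter.eventually_gt_atTop 0] with r hr
      exact Filter.Eventually.of_forall fun g => cubeDensity_le hr g
    · rw [lintegral_add_left measurable_const,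
        lintegral_tsum_intVec_vector hF hF' measurable_indicator_symCube,
        lintegral_indicator_one isOpen_symCube.measurableSet, setLIntegral_one]
      exact (ENNReal.add_lt_top.2 ⟨hV, ENNReal.mul_lt_top (zetaSum_lt_top two_le_succ)
        (ENNReal.mul_lt_top hF't volume_symCube_lt_top)⟩).ne
    · exact Filter.Eventually.of_forall fun g => tendsto_tsum_unitCube g
  rw [setLIntegral_one] at hlim
  refine tendsto_nhds_unique hlim (tendsto_const_nhds.congr' ?_)
  filter_upwards [Filter.eventually_gt_atTop 0] with r hr
    using (lintegral_cubeDensity hF hF' hr).symm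

end

/-! ### The first lattice point in a half-infinite cylinder -/

section Perp

variable {d : ℕ} [NeZero d]

@[simp] lemma e1_zero : (e1 d : E d) 0 = 1 := by simp [e1]

@[simp] lemma perp_zero_coord (x : E d) : perp x 0 = 0 := by simp [perp]

lemma perp_eq_self {x : E d} (hx : x 0 = 0) : perp x = x := by simp [perp, hx]

lemma perp_sub (x y : E d) : perp (x - y) = perp x - perp y := by
  simp [perp, sub_smul]; abel

lemma perp_add (x y : E d) : perp (x + y) = perp x + perp y := by
  simp [perp, add_smul]; abel

lemma perp_smul (c : ℝ) (x : E d) : perp (c • x) = c • perp x := by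
  simp [perp, smul_sub, smul_smul]

lemma eq_smul_e1_add_perp (x : E d) : x = x 0 • (e1 d : E d) + perp x := by simp [perp]

@[fun_prop] lemma continuous_perp : Continuous (perp (d := d)) := by
  unfold perp
  fun_prop

lemma perp_apply_of_ne {x : E d} {i : Fin d} (hi : i ≠ 0) : perp x i = x i := by
  simp [perp, e1, hi]

/-- The half-infinite cylinder with axis direction `e₁` and cross section the unit ball
around `z`. -/
def halfCylinder (z : E d) : Set (E d) := {y | 0 < y 0 ∧ ‖perp y - z‖ < 1}

lemma isOpen_halfCylinder (z : E d) : IsOpen (halfCylinder z) := by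
  have h1 : Continuous fun y : E d => y 0 := by fun_prop
  have h2 : Continuous fun y : E d => ‖perp y - z‖ := by fun_prop
  exact (isOpen_lt continuous_const h1).inter (isOpen_lt h2 continuous_const)

/-- The matrices `g` whose lattice `ℤ^d g` is disjoint from `A`. -/
def avoidSet (A : Set (E d)) : Set (SLR d) := {g | ∀ k : Fin d → ℤ, rowMul (intVec k) g ∉ A}

/-- The triples `(ξ, z, g)` such that the lattice `ℤ^d g` is disjoint from the cylinder of length
`ξ` and radius one, shifted by `z`. -/
def avoidTriples (d : ℕ) [NeZero d] : Set (ℝ × E d × SLR d) :=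
  {p | p.2.2 ∈ avoidSet {x | x - p.2.1 ∈ cylinder d 0 p.1 1}}

lemma measurableSet_avoidTriples : MeasurableSet (avoidTriples d) := by
  have : avoidTriples d = ⋂ k : Fin d → ℤ, {p : ℝ × E d × SLR d |
      0 < (rowMul (intVec k) p.2.2 - p.2.1) 0 ∧ (rowMul (intVec k) p.2.2 - p.2.1) 0 < p.1 ∧
        ‖perp (rowMul (intVec k) p.2.2 - p.2.1)‖ < 1}ᶜ := by
    ext p
    simp [avoidTriples, avoidSet, cylinder]
  rw [this]
  refine MeasurableSet.iInter fun k => MeasurableSet.compl ?_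
  have h0 : Continuous fun p : ℝ × E d × SLR d => rowMul (intVec k) p.2.2 - p.2.1 :=
    (continuous_rowMul.comp (continuous_const.prodMk (continuous_snd.comp continuous_snd))).sub
      (continuous_fst.comp continuous_snd)
  have h1 : Continuous fun p : ℝ × E d × SLR d => (rowMul (intVec k) p.2.2 - p.2.1) 0 :=
    (EuclideanSpace.proj (0 : Fin d) : E d →L[ℝ] ℝ).continuous.comp h0
  exact ((isOpen_lt continuous_const h1).inter ((isOpen_lt h1 continuous_fst).inter
    (isOpen_lt (continuous_perp.comp h0).norm continuous_const))).measurableSet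

lemma rowMul_intVec_ofInt (k : Fin d → ℤ) (γ : Matrix.SpecialLinearGroup (Fin d) ℤ) :
    rowMul (intVec k) (ofInt d γ) = intVec (Matrix.vecMul k γ.1) := by
  ext j
  simp [rowMul_apply, ofInt_apply, Matrix.vecMul, dotProduct]

lemma mul_mem_avoidSet_iff {A : Set (E d)} {γ g : SLR d} (hγ : γ ∈ SLZ d) :
    γ * g ∈ avoidSet A ↔ g ∈ avoidSet A := by
  have key : ∀ {γ g : SLR d}, γ ∈ SLZ d → g ∈ avoidSet A → γ * g ∈ avoidSet A := by
    intro γ g hγ hg k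
    obtain ⟨δ, rfl⟩ := mem_SLZ.1 hγ
    rw [rowMul_mul, rowMul_intVec_ofInt]
    exact hg _
  refine ⟨fun h => ?_, key hγ⟩
  have := key (inv_mem hγ) h
  rwa [inv_mul_cancel_left] at this

lemma mk_mem_avoids_iff {A : Set (E d)} {g : SLR d} :
    (Quotient.mk _ g : LatticeSpace d) ∈ avoids A ↔ g ∈ avoidSet A := by
  constructor
  · intro h
    exact h g rfl
  · intro h M hM k
    obtain ⟨γ, hγ⟩ := MulAction.orbitRel_apply.1 (Quotient.exact hM)
    have : M ∈ avoidSet A := by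
      rw [← hγ]
      exact (mul_mem_avoidSet_iff γ.2).2 h
    exact this k

lemma intVec_sub (k k' : Fin d → ℤ) : intVec (k - k') = intVec k - intVec k' := by
  ext; simp

lemma rowMul_sub (x y : E d) (g : SLR d) : rowMul (x - y) g = rowMul x g - rowMul y g := by
  have := rowMul_add (x - y) y g
  rw [sub_add_cancel] at this
  rw [this, add_sub_cancel_right]

end Perp

section

variable {n : ℕ} [NeZero n]

/-- By Minkowski's theorem, a lattice with no nonzero vector in the hyperplane `x₁ = 0` has
a vector in the half-infinite cylinder. -/
lemma exists_mem_halfCylinder {z : E (n + 1)} (hz : ‖z‖ < 1) {g : SLR (n + 1)}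
    (hg : ∀ k : Fin (n + 1) → ℤ, k ≠ 0 → rowMul (intVec k) g 0 ≠ 0) :
    ∃ k : Fin (n + 1) → ℤ, rowMul (intVec k) g ∈ halfCylinder z := by
  -- the box `|x₁| < N`, `|xᵢ| < δ` lies over the cross section of the cylinder, and has
  -- large volume
  set δ : ℝ := (1 - ‖z‖) / (n + 1) with hδ
  have hδ0 : 0 < δ := div_pos (by linarith) (by positivity)
  let a : ℕ → Fin (n + 1) → ℝ := fun N i => if i = 0 then N else δ
  let B : ℕ → Set (E (n + 1)) := fun N => {x | ∀ i, |x i| < a N i}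
  have hvol : ∀ N, volume (B N) = ENNReal.ofReal (2 * N) * ENNReal.ofReal (2 * δ) ^ n := by
    intro N
    have : WithLp.ofLp ⁻¹' (Set.pi univ fun i => Ioo (-a N i) (a N i)) = B N := by
      ext x
      simp [B, abs_lt]
    rw [← this, (PiLp.volume_preserving_ofLp (Fin (n + 1))).measure_preimage
      (MeasurableSet.univ_pi fun _ => measurableSet_Ioo).nullMeasurableSet, Real.volume_pi_Ioo,
      Fin.prod_univ_succ]
    simp [a, Fin.succ_ne_zero, two_mul]
  obtain ⟨N, hN⟩ : ∃ N : ℕ, 2 ^ (n + 1) < volume (B N) := by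
    obtain ⟨N, hN⟩ := exists_nat_gt ((2 : ℝ) ^ (n + 1) / (2 * (2 * δ) ^ n))
    refine ⟨N, ?_⟩
    rw [hvol, ← ENNReal.ofReal_pow (by positivity), ← ENNReal.ofReal_mul (by positivity),
      show (2 : ℝ≥0∞) ^ (n + 1) = ENNReal.ofReal ((2 : ℝ) ^ (n + 1)) by
        rw [ENNReal.ofReal_pow (by norm_num)]; simp]
    refine (ENNReal.ofReal_lt_ofReal_iff_of_nonneg (by positivity)).2 ?_
    rw [div_lt_iff₀ (by positivity)] at hN
    linarith
  have hconv : Convex ℝ (B N) := by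
    intro x hx y hy s t hs ht hst i
    rw [PiLp.add_apply, PiLp.smul_apply, PiLp.smul_apply, smul_eq_mul, smul_eq_mul]
    have h1 := abs_lt.1 (hx i)
    have h2 := abs_lt.1 (hy i)
    have := (convex_Ioo (-a N i) (a N i)) h1 h2 hs ht hst
    exact abs_lt.2 this
  obtain ⟨k, hk0, hk⟩ := exists_intVec_mem g (s := B N) (fun x hx i => by simpa using hx i) hconv hN
  have hperp : ∀ x ∈ B N, ‖perp x - z‖ < 1 := by
    intro x hx
    have h1 : ‖perp x‖ ≤ n * δ := by
      rw [show perp x = ∑ i, EuclideanSpace.single i (perp x i) from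
        (EuclideanSpace.basisFun (Fin (n + 1)) ℝ).sum_repr (perp x) |>.symm.trans
          (Finset.sum_congr rfl fun i _ => by ext; simp [EuclideanSpace.basisFun_apply])]
      refine (norm_sum_le _ _).trans ?_
      rw [Fin.sum_univ_succ, perp_zero_coord]
      simp only [PiLp.norm_single, norm_zero, zero_add]
      refine (Finset.sum_le_sum (g := fun _ => δ) fun i _ => ?_).trans (by simp)
      rw [perp_apply_of_ne (Fin.succ_ne_zero i), Real.norm_eq_abs]
      simpa [a, Fin.succ_ne_zero] using (hx i.succ).le
    have h2 : (n + 1) * δ = 1 - ‖z‖ := by rw [hδ]; field_simp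
    have := norm_sub_le (perp x) z
    nlinarith
  -- of `k` and `-k`, one has a positive first coordinate
  rcases lt_or_gt_of_ne (hg k hk0) with h | h
  · refine ⟨-k, ?_⟩
    have e : rowMul (intVec (-k)) g = -rowMul (intVec k) g := by
      have := rowMul_smul (-1) (intVec k) g
      rw [neg_one_smul, neg_one_smul] at this
      rw [← this]
      congr 1
      ext; simp
    rw [e]
    refine ⟨by simpa using h, hperp _ fun i => by simpa using hk i⟩
  · exact ⟨k, h, hperp _ hk⟩

/-- A generic lattice has exactly one vector in the half-infinite cylinder such that the part of
the cylinder in front of this vector contains no lattice vector. -/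
lemma existsUnique_first_vector {z : E (n + 1)} (hz0 : z 0 = 0) (hz : ‖z‖ < 1) {g : SLR (n + 1)}
    (hg : ∀ k : Fin (n + 1) → ℤ, k ≠ 0 → rowMul (intVec k) g 0 ≠ 0) :
    ∃! k : Fin (n + 1) → ℤ, rowMul (intVec k) g ∈ halfCylinder z ∧
      (rowMul (intVec k) g 0, z, g) ∈ avoidTriples (n + 1) := by
  have hmem : ∀ (k k' : Fin (n + 1) → ℤ), rowMul (intVec k') g -
      z ∈ cylinder (n + 1) 0 (rowMul (intVec k) g 0) 1 ↔ rowMul (intVec k') g ∈ halfCylinder z ∧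
        rowMul (intVec k') g 0 < rowMul (intVec k) g 0 := by
    intro k k'
    simp only [cylinder, halfCylinder, mem_ofPred_eq, perp_sub, perp_eq_self hz0,
      PiLp.sub_apply, hz0, sub_zero]
    tauto
  obtain ⟨k₁, hk₁⟩ := exists_mem_halfCylinder hz hg
  let T : Set (Fin (n + 1) → ℤ) := {k | rowMul (intVec k) g ∈ halfCylinder z ∧
    rowMul (intVec k) g 0 ≤ rowMul (intVec k₁) g 0}
  -- finitely many lattice points lie in the part of the cylinder in front of `k₁`; the first of
  -- them is unique since two with equal first coordinates would differ by a vector of the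
  -- hyperplane
  have hT : T.Finite := by
    refine (finite_intVec_mem_of_bounded g (Metric.isBounded_closedBall (x := 0)
      (r := rowMul (intVec k₁) g 0 + (1 + ‖z‖)))).subset ?_
    rintro k ⟨⟨h0, h1⟩, h2⟩
    rw [mem_ofPred_eq, mem_closedBall_zero_iff]
    have e1n : ‖(e1 (n + 1) : E (n + 1))‖ = 1 := by simp
    have h3 : ‖perp (rowMul (intVec k) g)‖ ≤ 1 + ‖z‖ := by
      have := norm_add_le (perp (rowMul (intVec k) g) - z) z
      rw [sub_add_cancel] at this
      linarith
    rw [eq_smul_e1_add_perp (rowMul (intVec k) g)]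
    refine (norm_add_le _ _).trans (add_le_add ?_ h3)
    rw [norm_smul, e1n, mul_one, Real.norm_eq_abs, abs_of_pos h0]
    exact h2
  obtain ⟨k₀, hk₀, hmin⟩ := Set.exists_min_image T (fun k => rowMul (intVec k) g 0) hT
    ⟨k₁, hk₁, le_rfl⟩
  refine ⟨k₀, ⟨hk₀.1, fun k' hk' => ?_⟩, ?_⟩
  · obtain ⟨h1, h2⟩ := (hmem k₀ k').1 hk'
    exact absurd (hmin k' ⟨h1, h2.le.trans hk₀.2⟩) (not_le.2 h2)
  · rintro k ⟨hk, hav⟩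
    have h1 : rowMul (intVec k) g 0 ≤ rowMul (intVec k₀) g 0 := by
      by_contra hlt
      exact hav k₀ ((hmem k k₀).2 ⟨hk₀.1, not_le.1 hlt⟩)
    have h2 := hmin k ⟨hk, h1.trans hk₀.2⟩
    by_contra hne
    refine hg (k - k₀) (sub_ne_zero.2 hne) ?_
    rw [intVec_sub, rowMul_sub, PiLp.sub_apply, sub_eq_zero]
    exact le_antisymm h1 h2

end

/-! ### The distribution of the free path length is a probability -/

section

variable {n : ℕ} [NeZero n]

lemma indicator_one_congr {α β : Type*} {s : Set α} {t : Set β} {a : α} {b : β}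
    (h : a ∈ s ↔ b ∈ t) : s.indicator (1 : α → ℝ≥0∞) a = t.indicator 1 b := by
  by_cases ha : a ∈ s
  · rw [indicator_of_mem ha, indicator_of_mem (h.1 ha)]; rfl
  · rw [indicator_of_notMem ha, indicator_of_notMem (mt h.2 ha)]

instance countable_stabZ : Countable (stabZ (n + 1)) :=
  Function.Injective.countable (f := fun γ : stabZ (n + 1) =>
    (⟨(γ.1 : SLR (n + 1)), γ.2⟩ : SLZ (n + 1))) fun a b h => by
      have := congrArg Subtype.val h
      exact Subtype.ext (Subtype.ext this)

lemma lintegral_haarStab {F' : Set (stabE1 (n + 1))}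
    (hF' : IsStrictFundamentalDomain (stabZ (n + 1)) F') {f : stabE1 (n + 1) → ℝ≥0∞}
    (hinv : ∀ (γ : stabZ (n + 1)) h, f (γ • h) = f h) :
    ∫⁻ h, f h ∂haarStab (n + 1) =
      ((Measure.haar : Measure (stabE1 (n + 1))) F')⁻¹ * ∫⁻ h in F', f h ∂Measure.haar := by
  have h : ∃ F : Set (stabE1 (n + 1)), IsFundamentalDomain (stabZ (n + 1)) F
      (Measure.haar : Measure (stabE1 (n + 1))) := ⟨F', hF'.isFundamentalDomain _⟩
  rw [haarStab, dif_pos h, lintegral_smul_measure, smul_eq_mul,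
    h.choose_spec.measure_eq (hF'.isFundamentalDomain _),
    h.choose_spec.setLIntegral_eq (hF'.isFundamentalDomain _) f hinv]

instance isProbabilityMeasure_haarStab : IsProbabilityMeasure (haarStab (n + 1)) := by
  obtain ⟨F', hF', hF't⟩ := exists_fundDomain_stabZ_lt_top n
  refine ⟨?_⟩
  rw [← lintegral_one, lintegral_haarStab hF' fun _ _ => rfl, setLIntegral_one]
  exact ENNReal.inv_mul_cancel
    ((hF'.isFundamentalDomain Measure.haar).measure_ne_zero (NeZero.ne _)) hF't.ne

/-- The normalized Haar measure on `(SL(d, ℤ) ∩ H) \ H` is invariant under right translations. -/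
lemma lintegral_haarStab_mul_right {f : stabE1 (n + 1) → ℝ≥0∞}
    (hinv : ∀ (γ : stabZ (n + 1)) h, f (γ • h) = f h) (c : stabE1 (n + 1)) :
    ∫⁻ h, f (h * c) ∂haarStab (n + 1) = ∫⁻ h, f h ∂haarStab (n + 1) := by
  obtain ⟨F', hF', -⟩ := exists_fundDomain_stabZ_lt_top n
  let F'' : Set (stabE1 (n + 1)) := (fun h => h * c⁻¹) ⁻¹' F'
  have hF'' : IsStrictFundamentalDomain (stabZ (n + 1)) F'' := by
    refine ⟨hF'.measurableSet.preimage (measurable_mul_const _), fun x => ?_⟩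
    have := hF'.existsUnique (x * c⁻¹)
    simp only [F'', mem_preimage, Subgroup.smul_def, smul_eq_mul, mul_assoc] at this ⊢
    exact this
  have hc : ∀ (γ : stabZ (n + 1)) h, f (γ • h * c) = f (h * c) := fun γ h => by
    rw [← hinv γ (h * c)]
    simp only [Subgroup.smul_def, smul_eq_mul, mul_assoc]
  rw [lintegral_haarStab hF' hc, lintegral_haarStab hF'' hinv,
    (hF'.isFundamentalDomain Measure.haar).measure_eq (hF''.isFundamentalDomain Measure.haar),
    ← lintegral_indicator hF'.measurableSet, ← lintegral_indicator hF''.measurableSet,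
    ← lintegral_mul_right_eq_self (fun x => F''.indicator f x) c]
  congr 2
  funext x
  by_cases hx : x ∈ F'
  · rw [indicator_of_mem hx, indicator_of_mem]
    simpa [F''] using hx
  · rw [indicator_of_notMem hx, indicator_of_notMem]
    simpa [F''] using hx

/-- The weight `m^{-d} / ζ(d)` of the vectors of index `m` (shifted by one). -/
def zetaWeight (d m : ℕ) : ℝ≥0∞ :=
  ENNReal.ofReal ((((m : ℝ) + 1) ^ d)⁻¹ / ∑' k : ℕ, (((k : ℝ) + 1) ^ d)⁻¹)

lemma zetaWeight_eq {d : ℕ} (hd : 2 ≤ d) (m : ℕ) :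
    zetaWeight d m = (ENNReal.ofReal (((m : ℝ) + 1) ^ d))⁻¹ * (zetaSum d)⁻¹ := by
  have h : 0 < ∑' k : ℕ, (((k : ℝ) + 1) ^ d)⁻¹ :=
    (summable_zeta hd).tsum_pos (fun _ => by positivity) 0 (by positivity)
  rw [zetaWeight, zetaSum_eq hd, ENNReal.ofReal_div_of_pos h,
    ENNReal.ofReal_inv_of_pos (by positivity), div_eq_mul_inv]

lemma tsum_zetaWeight {d : ℕ} (hd : 2 ≤ d) : ∑' m, zetaWeight d m = 1 := by
  simp_rw [zetaWeight_eq hd]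
  rw [ENNReal.tsum_mul_right]
  exact ENNReal.mul_inv_cancel (zetaSum_ne_zero hd) (zetaSum_lt_top hd).ne

/-- The `ν_y`-probability that the lattice is disjoint from the cylinder of length `ξ` and radius
one shifted by `z`, computed with the measurable section `triSect`. -/
def missProb (ξ : ℝ) (z y : E (n + 1)) : ℝ≥0∞ :=
  ∑' m : ℕ, zetaWeight (n + 1) m * haarStab (n + 1)
    {h | (ξ, z, (h : SLR (n + 1)) * triSect (((m : ℝ) + 1)⁻¹ • y)) ∈ avoidTriples (n + 1)}

lemma measurable_missProb :
    Measurable fun p : ℝ × E (n + 1) × E (n + 1) => missProb p.1 p.2.1 p.2.2 := by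
  refine Measurable.tsum fun m => Measurable.const_mul ?_ _
  have h : Measurable fun p : (ℝ × E (n + 1) × E (n + 1)) × stabE1 (n + 1) =>
      (p.1.1, p.1.2.1, (p.2 : SLR (n + 1)) * triSect (((m : ℝ) + 1)⁻¹ • p.1.2.2)) := by
    refine (measurable_fst.comp measurable_fst).prodMk
      ((measurable_fst.comp (measurable_snd.comp measurable_fst)).prodMk ?_)
    exact (measurable_subtype_coe.comp measurable_snd).mul (measurable_triSect.comp
      ((measurable_snd.comp (measurable_snd.comp measurable_fst)).const_smul ((m : ℝ) + 1)⁻¹))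
  exact measurable_measure_prodMk_left (measurableSet_avoidTriples.preimage h)

lemma missProb_le_one (ξ : ℝ) (z y : E (n + 1)) : missProb ξ z y ≤ 1 := by
  rw [← tsum_zetaWeight (two_le_succ (n := n))]
  exact ENNReal.tsum_le_tsum fun m => mul_le_of_le_one_right' prob_le_one

lemma measurableSet_avoidSet_cylinder (z : E (n + 1)) (ξ : ℝ) :
    MeasurableSet (avoidSet {x | x - z ∈ cylinder (n + 1) 0 ξ 1}) :=
  measurableSet_avoidTriples.preimage
    (measurable_const.prodMk (measurable_const.prodMk measurable_id))

lemma exists_rowMul_eq {y : E (n + 1)} (hy : y 0 ≠ 0) :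
    rowMul (e1 (n + 1) : E (n + 1)) (sect y) = y := by
  have h : ∃ M : SLR (n + 1), rowMul (e1 (n + 1) : E (n + 1)) M = y := ⟨_, rowMul_triSect hy⟩
  rw [sect, dif_pos h]
  exact h.choose_spec

/-- The measure `ν_y` does not depend on the choice of the section `y ↦ M_y`, because the measure on
`(SL(d, ℤ) ∩ H) \ H` is right invariant; so it may be computed with the measurable section. -/
lemma nuY_avoids {y : E (n + 1)} (hy : y 0 ≠ 0) (z : E (n + 1)) (ξ : ℝ) :
    nuY y (avoids {x | x - z ∈ cylinder (n + 1) 0 ξ 1}) = missProb ξ z y := by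
  set A : Set (E (n + 1)) := {x | x - z ∈ cylinder (n + 1) 0 ξ 1} with hA
  have hmA : MeasurableSet (avoidSet A) := measurableSet_avoidSet_cylinder z ξ
  have hms : MeasurableSet (avoids A) := by
    refine measurableSet_quotient.2 ?_
    convert! hmA using 1
    ext g
    exact mk_mem_avoids_iff
  rw [nuY, Measure.sum_apply _ hms]
  refine tsum_congr fun m => ?_
  rw [Measure.smul_apply, smul_eq_mul]
  refine congrArg (zetaWeight (n + 1) m * ·) ?_
  set y' : E (n + 1) := ((m : ℝ) + 1)⁻¹ • y with hy'
  have hy0 : y' 0 ≠ 0 := by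
    rw [hy', PiLp.smul_apply, smul_eq_mul]
    exact mul_ne_zero (by positivity) hy
  have hmeas : ∀ a : SLR (n + 1), Measurable fun h : stabE1 (n + 1) => (h : SLR (n + 1)) * a :=
    fun a => (measurable_mul_const a).comp measurable_subtype_coe
  have hmk : Measurable fun h : stabE1 (n + 1) =>
      (Quotient.mk _ ((h : SLR (n + 1)) * sect y') : LatticeSpace (n + 1)) :=
    measurable_quot_mk.comp (hmeas _)
  rw [Measure.map_apply hmk hms]
  let f : stabE1 (n + 1) → ℝ≥0∞ := fun h =>
    (avoidSet A).indicator 1 ((h : SLR (n + 1)) * triSect y')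
  have hinv : ∀ (γ : stabZ (n + 1)) h, f (γ • h) = f h := by
    intro γ h
    have hγ : ((γ : stabE1 (n + 1)) : SLR (n + 1)) ∈ SLZ (n + 1) := γ.2
    have := mul_mem_avoidSet_iff (A := A) (g := (h : SLR (n + 1)) * triSect y') hγ
    refine indicator_one_congr ?_
    simpa only [Subgroup.smul_def, smul_eq_mul, Subgroup.coe_mul, mul_assoc] using this
  have hc := lintegral_haarStab_mul_right hinv ⟨sect y' * (triSect y')⁻¹, mul_inv_mem_stabE1
    ((exists_rowMul_eq hy0).trans (rowMul_triSect hy0).symm)⟩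
  have h1 : ∀ a : SLR (n + 1), ∫⁻ h : stabE1 (n + 1),
      (avoidSet A).indicator 1 ((h : SLR (n + 1)) * a) ∂haarStab (n + 1) =
        haarStab (n + 1) {h | (h : SLR (n + 1)) * a ∈ avoidSet A} := fun a => by
    exact lintegral_indicator_one (hmA.preimage (hmeas a))
  have h2 : ∫⁻ h, f h ∂haarStab (n + 1) =
    haarStab (n + 1) {h | (h : SLR (n + 1)) * triSect y' ∈ avoidSet A} := h1 _
  change _ = haarStab (n + 1) {h | (h : SLR (n + 1)) * triSect y' ∈ avoidSet A}
  rw [← h2, ← hc]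
  simp only [f, Subgroup.coe_mul, mul_assoc, inv_mul_cancel, mul_one]
  rw [h1]
  congr 1
  ext h
  exact mk_mem_avoids_iff

lemma Phi0_eq {ξ : ℝ} (hξ : 0 < ξ) {w z : E (n + 1)} (hw : w 0 = 0) (hz : z 0 = 0) :
    Phi0 ξ w z = (missProb ξ z (ξ • (e1 (n + 1) : E (n + 1)) + w + z)).toReal := by
  rw [Phi0, if_neg hξ.ne', nuY_avoids]
  simp [hw, hz, hξ.ne']

lemma Phi0_nonneg {d : ℕ} [NeZero d] (ξ : ℝ) (w z : E d) : 0 ≤ Phi0 ξ w z := by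
  rw [Phi0]
  split_ifs
  · exact zero_le_one
  · exact ENNReal.toReal_nonneg

lemma ofReal_Phi0_eq {ξ : ℝ} (hξ : 0 < ξ) {w z : E (n + 1)} (hw : w 0 = 0) (hz : z 0 = 0) :
    ENNReal.ofReal (Phi0 ξ w z) = missProb ξ z (ξ • (e1 (n + 1) : E (n + 1)) + w + z) := by
  rw [Phi0_eq hξ hw hz,
    ENNReal.ofReal_toReal ((missProb_le_one _ _ _).trans_lt ENNReal.one_lt_top).ne]

/-- The free path length and the position on the next scatterer have a probability distribution:
by Siegel's formula the total mass is the mean number of vectors `y` of the half-infinite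
cylinder that are first, and almost every lattice has exactly one. -/
theorem lintegral_missProb {z : E (n + 1)} (hz0 : z 0 = 0) (hz : ‖z‖ < 1) :
    ∫⁻ y in halfCylinder z, missProb (y 0) z y = 1 := by
  obtain ⟨F, hF⟩ := exists_fundDomain_SLZ (n + 1)
  obtain ⟨F', hF', hF't⟩ := exists_fundDomain_stabZ_lt_top n
  let T : Set (E (n + 1) × SLR (n + 1)) :=
    {p | p.1 ∈ halfCylinder z ∧ (p.1 0, z, p.2) ∈ avoidTriples (n + 1)}
  have hcoord : Measurable fun y : E (n + 1) => y 0 := by fun_prop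
  have hT : MeasurableSet T :=
    ((isOpen_halfCylinder z).measurableSet.preimage measurable_fst).inter
      (measurableSet_avoidTriples.preimage ((hcoord.comp measurable_fst).prodMk
        (measurable_const.prodMk measurable_snd)))
  let φ : E (n + 1) × SLR (n + 1) → ℝ≥0∞ := T.indicator 1
  have hφ : Measurable φ := measurable_one.indicator hT
  have hinv : ∀ y g, ∀ γ ∈ SLZ (n + 1), φ (y, γ * g) = φ (y, g) := by
    intro y g γ hγ
    have := mul_mem_avoidSet_iff (A := {x | x - z ∈ cylinder (n + 1) 0 (y 0) 1}) (g := g) hγ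
    exact indicator_one_congr (and_congr_right fun _ => this)
  let G : ℕ → E (n + 1) → ℝ≥0∞ := fun m y =>
    ∫⁻ h, φ (((m : ℝ) + 1) • y, h * triSect y) ∂haarStab (n + 1)
  have hGm : ∀ m, Measurable (G m) := fun m => by
    refine Measurable.lintegral_prod_right'
      (f := fun p : E (n + 1) × stabE1 (n + 1) => φ (((m : ℝ) + 1) • p.1, p.2 * triSect p.1)) ?_
    exact hφ.comp ((measurable_fst.const_smul ((m : ℝ) + 1)).prodMk
      ((measurable_subtype_coe.comp measurable_snd).mul (measurable_triSect.comp measurable_fst)))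
  -- the density as a sum over the index `m`, to which Siegel's formula applies after `y = m y'`
  have h1 : ∀ y, (halfCylinder z).indicator (fun y => missProb (y 0) z y) y =
      ∑' m : ℕ, zetaWeight (n + 1) m * G m (((m : ℝ) + 1)⁻¹ • y) := by
    intro y
    have hs : ∀ m : ℕ, ((m : ℝ) + 1) • ((m : ℝ) + 1)⁻¹ • y = y := fun m =>
      smul_inv_smul₀ (by positivity) y
    by_cases hy : y ∈ halfCylinder z
    · rw [indicator_of_mem hy, missProb]
      refine tsum_congr fun m => ?_
      congr 1
      have hm : Measurable fun h : stabE1 (n + 1) =>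
          (y, (h : SLR (n + 1)) * triSect (((m : ℝ) + 1)⁻¹ • y)) :=
        measurable_const.prodMk ((measurable_mul_const _).comp measurable_subtype_coe)
      simp only [G, hs]
      have : ∀ h : stabE1 (n + 1), φ (y, (h : SLR (n + 1)) * triSect (((m : ℝ) + 1)⁻¹ • y)) =
          ({h : stabE1 (n + 1) | (y 0, z, (h : SLR (n + 1)) * triSect (((m : ℝ) + 1)⁻¹ • y)) ∈
            avoidTriples (n + 1)}).indicator 1 h := fun h =>
        indicator_one_congr (and_iff_right hy)
      simp_rw [this]
      rw [lintegral_indicator_one]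
      convert! hT.preimage hm using 1
      ext h
      simp [T, hy]
    · rw [indicator_of_notMem hy]
      refine (ENNReal.tsum_eq_zero.2 fun m => ?_).symm
      simp [G, hs, φ, T, hy]
  have h2 : ∀ m : ℕ, ∫⁻ y, zetaWeight (n + 1) m * G m (((m : ℝ) + 1)⁻¹ • y) =
      (zetaSum (n + 1))⁻¹ * ∫⁻ y, G m y := by
    intro m
    have hpos : (0 : ℝ) < ((m : ℝ) + 1) ^ (n + 1) := by positivity
    have hm : Measurable fun y => G m (((m : ℝ) + 1)⁻¹ • y) :=
      (hGm m).comp (measurable_const_smul _)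
    rw [lintegral_const_mul _ hm, lintegral_comp_smul (by positivity) (hGm m),
      zetaWeight_eq two_le_succ, inv_pow, ENNReal.ofReal_inv_of_pos hpos, inv_inv, mul_comm,
      mul_assoc, mul_left_comm, ← mul_assoc, ← mul_assoc,
      mul_assoc (∫⁻ y, G m y), ENNReal.mul_inv_cancel, mul_one, mul_comm]
    · exact (ENNReal.ofReal_pos.2 hpos).ne'
    · exact ENNReal.ofReal_ne_top
  have h3 : ∀ m y, G m y = (Measure.haar F')⁻¹ *
      ∫⁻ h in F', φ (((m : ℝ) + 1) • y, h * triSect y) ∂Measure.haar := by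
    intro m y
    refine lintegral_haarStab hF' fun γ h => ?_
    have hγ : ((γ : stabE1 (n + 1)) : SLR (n + 1)) ∈ SLZ (n + 1) := γ.2
    rw [← hinv _ (h * triSect y) _ hγ]
    simp only [Subgroup.smul_def, smul_eq_mul, Subgroup.coe_mul, mul_assoc]
  have h4 : ∀ m : ℕ, Measurable fun y : E (n + 1) =>
      ∫⁻ h in F', φ (((m : ℝ) + 1) • y, h * triSect y) ∂Measure.haar := fun m => by
    refine Measurable.lintegral_prod_right'
      (f := fun p : E (n + 1) × stabE1 (n + 1) => φ (((m : ℝ) + 1) • p.1, p.2 * triSect p.1)) ?_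
    exact hφ.comp ((measurable_fst.const_smul ((m : ℝ) + 1)).prodMk
      ((measurable_subtype_coe.comp measurable_snd).mul (measurable_triSect.comp measurable_fst)))
  -- exactly one term of the sum is equal to one
  have h5 : ∫⁻ g in F, ∑' k : {k : Fin (n + 1) → ℤ // k ≠ 0}, φ (rowMul (intVec k.1) g, g)
      ∂fiberMeasure n = fiberMeasure n F := by
    rw [← setLIntegral_one]
    refine lintegral_congr_ae (ae_restrict_of_ae ?_)
    filter_upwards [ae_fiberMeasure_intVec_ne_zero (n := n)] with g hg
    obtain ⟨k₀, hk₀, huniq⟩ := existsUnique_first_vector hz0 hz hg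
    have hk0 : k₀ ≠ 0 := by
      rintro rfl
      have := hk₀.1.1
      rw [intVec_zero, zero_rowMul] at this
      simp at this
    rw [tsum_eq_single ⟨k₀, hk0⟩]
    · exact indicator_of_mem (show (_, g) ∈ T from hk₀) _
    · intro k hk
      exact indicator_of_notMem
        (show (_, g) ∉ T from fun h => hk (Subtype.ext (huniq k.1 h))) _
  rw [← lintegral_indicator (isOpen_halfCylinder z).measurableSet]
  simp_rw [h1]
  have h6 : ∀ m : ℕ, Measurable fun y => zetaWeight (n + 1) m * G m (((m : ℝ) + 1)⁻¹ • y) :=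
    fun m => ((hGm m).comp (measurable_const_smul _)).const_mul _
  rw [lintegral_tsum fun m => (h6 m).aemeasurable]
  simp_rw [h2, h3]
  simp_rw [lintegral_const_mul _ (h4 _)]
  rw [ENNReal.tsum_mul_left, ENNReal.tsum_mul_left, ← lintegral_tsum_intVec hF hF' hφ hinv, h5,
    fiberMeasure_fundDomain_eq hF hF' hF't, mul_left_comm (Measure.haar F')⁻¹,
    ENNReal.inv_mul_cancel ((hF'.isFundamentalDomain Measure.haar).measure_ne_zero (NeZero.ne _))
      hF't.ne, mul_one]
  exact ENNReal.inv_mul_cancel (zetaSum_ne_zero two_le_succ) (zetaSum_lt_top two_le_succ).ne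

end

/-! ### Integration over the unit sphere -/

section Dir

variable {d : ℕ} [NeZero d]

lemma dir_of_ne {x : E d} (hx : x ≠ 0) : (dir x : E d) = ‖x‖⁻¹ • x := by
  rw [dir, dif_neg hx]

lemma sph_ne_zero (v : Sph d) : (v : E d) ≠ 0 := by
  intro h
  have := norm_eq_of_mem_sphere v
  rw [h, norm_zero] at this
  exact zero_ne_one this

@[simp] lemma norm_sph (v : Sph d) : ‖(v : E d)‖ = 1 := norm_eq_of_mem_sphere v

@[simp] lemma dir_sph (v : Sph d) : dir (v : E d) = v :=
  Subtype.ext (by rw [dir_of_ne (sph_ne_zero v), norm_sph, inv_one, one_smul])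

lemma dir_smul {c : ℝ} (hc : 0 < c) (x : E d) : dir (c • x) = dir x := by
  by_cases hx : x = 0
  · simp [hx]
  · refine Subtype.ext ?_
    rw [dir_of_ne hx, dir_of_ne (smul_ne_zero hc.ne' hx), norm_smul, Real.norm_eq_abs,
      abs_of_pos hc, smul_smul, mul_inv, mul_right_comm, inv_mul_cancel₀ hc.ne', one_mul]

lemma norm_smul_dir {x : E d} (hx : x ≠ 0) : ‖x‖ • (dir x : E d) = x := by
  rw [dir_of_ne hx, smul_inv_smul₀ (norm_ne_zero_iff.2 hx)]

lemma measurable_dir : Measurable (dir (d := d)) := by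
  refine measurable_of_restrict_of_restrict_compl (measurableSet_singleton (0 : E d)) ?_ ?_
  · have : (({0} : Set (E d)).domRestrict dir) = fun _ => dir (0 : E d) := by
      funext x
      exact congrArg dir x.2
    rw [this]
    exact measurable_const
  · have hc : (fun x : (({0} : Set (E d))ᶜ : Set (E d)) => (dir x.1 : E d)) =
        fun x => ‖x.1‖⁻¹ • x.1 := by
      funext x
      exact dir_of_ne x.2
    have h : Continuous fun x : (({0} : Set (E d))ᶜ : Set (E d)) => (dir x.1 : E d) := by
      rw [hc]
      exact (continuous_subtype_val.norm.inv₀ fun x => norm_ne_zero_iff.2 x.2).smul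
        continuous_subtype_val
    exact (continuous_induced_rng.2 h).measurable

open scoped Pointwise in
/-- The surface measure of a set is `d` times the volume of the cone over it. -/
lemma volSph_eq : volSph d = (d : ℝ≥0∞) • (volume.restrict (Metric.ball (0 : E d) 1)).map dir := by
  ext s hs
  rw [volSph, Measure.toSphere_apply' _ hs, finrank_euclideanSpace_fin, Measure.smul_apply,
    smul_eq_mul, Measure.map_apply measurable_dir hs,
    Measure.restrict_apply (hs.preimage measurable_dir)]
  congr 1
  rw [← measure_sdiff_null (s := dir ⁻¹' s ∩ Metric.ball (0 : E d) 1)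
    (measure_singleton (0 : E d))]
  congr 1
  ext x
  simp only [mem_smul, mem_image, mem_sdiff, mem_inter_iff, mem_preimage, mem_ball_zero_iff,
    mem_singleton_iff]
  constructor
  · rintro ⟨c, hc, y, ⟨v, hv, rfl⟩, rfl⟩
    rw [dir_smul hc.1, dir_sph, norm_smul, norm_sph, Real.norm_eq_abs, abs_of_pos hc.1, mul_one]
    exact ⟨⟨hv, hc.2⟩, smul_ne_zero hc.1.ne' (sph_ne_zero v)⟩
  · rintro ⟨⟨h1, h2⟩, h3⟩
    exact ⟨‖x‖, ⟨norm_pos_iff.2 h3, h2⟩, dir x, ⟨dir x, h1, rfl⟩, norm_smul_dir h3⟩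

lemma lintegral_volSph {g : Sph d → ℝ≥0∞} (hg : Measurable g) :
    ∫⁻ v, g v ∂volSph d = d * ∫⁻ x in Metric.ball (0 : E d) 1, g (dir x) := by
  rw [volSph_eq, lintegral_smul_measure, lintegral_map hg measurable_dir, smul_eq_mul]

instance : IsFiniteMeasure (volSph d) := inferInstanceAs (IsFiniteMeasure (Measure.toSphere _))

lemma continuous_rot (K : E d ≃ₗᵢ[ℝ] E d) : Continuous (rot K) :=
  Continuous.subtype_mk (K.continuous.comp continuous_subtype_val) _

/-- The surface measure is invariant under orthogonal maps. -/
lemma lintegral_volSph_rot (K : E d ≃ₗᵢ[ℝ] E d) {g : Sph d → ℝ≥0∞} (hg : Measurable g) :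
    ∫⁻ v, g (rot K v) ∂volSph d = ∫⁻ v, g v ∂volSph d := by
  have hgr : Measurable fun v => g (rot K v) := hg.comp (continuous_rot K).measurable
  have hgd : Measurable fun x => g (dir x) := hg.comp measurable_dir
  rw [lintegral_volSph hgr, lintegral_volSph hg,
    ← K.measurePreserving.setLIntegral_comp_preimage Metric.isOpen_ball.measurableSet hgd]
  congr 1
  have : K ⁻¹' Metric.ball 0 1 = Metric.ball (0 : E d) 1 := by ext; simp
  rw [this]
  refine lintegral_congr_ae (ae_restrict_of_ae ?_)
  filter_upwards [Measure.ae_ne volume (0 : E d)] with x hx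
  have : rot K (dir x) = dir (K x) := Subtype.ext (by
    have hKx : K x ≠ 0 := by simpa using hx
    rw [dir_of_ne hKx, LinearIsometryEquiv.norm_map]
    change K (dir x : E d) = _
    rw [dir_of_ne hx, map_smul])
  simp only [this]

lemma e1_inner (x : E d) : ⟪(e1 d : E d), x⟫ = x 0 := by
  simp [e1, EuclideanSpace.inner_single_left]

lemma norm_sq_eq (x : E d) : ‖x‖ ^ 2 = x 0 ^ 2 + ‖perp x‖ ^ 2 := by
  have h : ⟪x 0 • (e1 d : E d), perp x⟫ = 0 := by
    rw [real_inner_smul_left, e1_inner, perp_zero_coord, mul_zero]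
  conv_lhs => rw [eq_smul_e1_add_perp x, norm_add_sq_real, h, norm_smul, norm_sph]
  simp

end Dir

section Polar

variable {n : ℕ} [NeZero n]

/-- The identification of `ℝ × ℝ^n` with `ℝ^{n+1}`. -/
def consVec (p : ℝ × E n) : E (n + 1) := WithLp.toLp 2 (Fin.cons p.1 p.2.ofLp)

@[simp] lemma consVec_zero (p : ℝ × E n) : consVec p 0 = p.1 := rfl

@[simp] lemma consVec_succ (p : ℝ × E n) (i : Fin n) : consVec p i.succ = p.2 i := rfl

lemma perp_consVec (p : ℝ × E n) : perp (consVec p) = consVec (0, p.2) := by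
  ext i
  refine Fin.cases (by simp) (fun i => ?_) i
  rw [perp_apply_of_ne (Fin.succ_ne_zero i), consVec_succ, consVec_succ]

lemma norm_consVec_zero (w : E n) : ‖consVec (0, w)‖ = ‖w‖ := by
  rw [EuclideanSpace.norm_eq, EuclideanSpace.norm_eq, Fin.sum_univ_succ]
  simp

lemma smul_e1_sub_consVec (ξ : ℝ) (w : E n) :
    ξ • (e1 (n + 1) : E (n + 1)) - consVec (0, w) = consVec (ξ, -w) := by
  ext i
  refine Fin.cases (by simp) (fun i => ?_) i
  simp [e1, Fin.succ_ne_zero]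

lemma smul_consVec_zero (c : ℝ) (w : E n) : c • consVec (0, w) = consVec (0, c • w) := by
  ext i
  refine Fin.cases (by simp) (fun i => by simp) i

lemma measurePreserving_consVec : MeasurePreserving (consVec (n := n)) := by
  have h1 := ((volume_preserving_piFinSuccAbove (fun _ : Fin (n + 1) => ℝ) 0).symm
    (MeasurableEquiv.piFinSuccAbove (fun _ : Fin (n + 1) => ℝ) 0))
  have h2 := (PiLp.volume_preserving_toLp (Fin (n + 1))).comp
    (h1.comp ((MeasurePreserving.id (volume : Measure ℝ)).prod
      (PiLp.volume_preserving_ofLp (Fin n))))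
  convert! h2 using 1
  funext p
  ext i
  refine Fin.cases ?_ (fun i => ?_) i
  · simp [MeasurableEquiv.piFinSuccAbove, Fin.insertNthEquiv]
  · simp [MeasurableEquiv.piFinSuccAbove, Fin.insertNthEquiv]

/-- `x ↦ ‖x‖ e₁ + x_⊥`. -/
def normPerp (x : E (n + 1)) : E (n + 1) := ‖x‖ • (e1 (n + 1) : E (n + 1)) + perp x

@[simp] lemma normPerp_zero (x : E (n + 1)) : normPerp x 0 = ‖x‖ := by simp [normPerp]

@[simp] lemma perp_normPerp (x : E (n + 1)) : perp (normPerp x) = perp x := by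
  rw [normPerp, perp_add, perp_smul, perp_eq_self (perp_zero_coord x)]
  simp [perp]

/-- The derivative of `normPerp`, a transvection up to scaling. -/
def normPerpDeriv (x : E (n + 1)) : E (n + 1) →L[ℝ] E (n + 1) :=
  ContinuousLinearMap.id ℝ _ + (‖x‖⁻¹ • innerSL ℝ x -
    (EuclideanSpace.proj 0 : E (n + 1) →L[ℝ] ℝ)).smulRight (e1 (n + 1) : E (n + 1))

lemma hasFDerivAt_normPerp {x : E (n + 1)} (hx : x ≠ 0) :
    HasFDerivAt normPerp (normPerpDeriv x) x := by
  have h1 : HasFDerivAt (fun y : E (n + 1) => ‖y‖) (‖x‖⁻¹ • innerSL ℝ x) x := by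
    have h := (hasStrictFDerivAt_norm_sq x).hasFDerivAt.sqrt (by simpa using hx)
    simp only [Real.sqrt_sq (norm_nonneg _)] at h
    convert! h using 1
    ext y
    simp
    field_simp
  have h2 : HasFDerivAt (fun y : E (n + 1) => y 0)
      (EuclideanSpace.proj 0 : E (n + 1) →L[ℝ] ℝ) x :=
    (EuclideanSpace.proj 0 : E (n + 1) →L[ℝ] ℝ).hasFDerivAt
  have h3 := (h1.smul_const (e1 (n + 1) : E (n + 1))).add
    ((hasFDerivAt_id x).sub (h2.smul_const (e1 (n + 1) : E (n + 1))))
  convert! h3 using 1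
  ext y i
  simp [normPerpDeriv]
  ring

lemma det_normPerpDeriv {x : E (n + 1)} : (normPerpDeriv x).det = x 0 / ‖x‖ := by
  have := LinearMap.transvection.det
    ((‖x‖⁻¹ • innerSL ℝ x - (EuclideanSpace.proj 0 : E (n + 1) →L[ℝ] ℝ) :
      E (n + 1) →L[ℝ] ℝ) : E (n + 1) →ₗ[ℝ] ℝ) (e1 (n + 1) : E (n + 1))
  refine Eq.trans ?_ (this.trans ?_)
  · rw [ContinuousLinearMap.det]
    congr 1
  · have h : ⟪x, (e1 (n + 1) : E (n + 1))⟫ = x 0 := by rw [real_inner_comm, e1_inner]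
    simp [h]
    ring

lemma injOn_normPerp : InjOn (normPerp (n := n)) {x | x 0 < 0} := by
  intro x hx y hy hxy
  have h1 : ‖x‖ = ‖y‖ := by rw [← normPerp_zero, hxy, normPerp_zero]
  have h2 : perp x = perp y := by rw [← perp_normPerp, hxy, perp_normPerp]
  have h3 := norm_sq_eq x
  rw [h1, h2, norm_sq_eq y] at h3
  have h4 : x 0 = y 0 := by
    simp only [mem_ofPred_eq] at hx hy
    nlinarith
  rw [eq_smul_e1_add_perp x, eq_smul_e1_add_perp y, h4, h2]

lemma image_normPerp : normPerp '' (Metric.ball (0 : E (n + 1)) 1 ∩ {x | x 0 < 0}) =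
    {y | ‖perp y‖ < y 0 ∧ y 0 < 1} := by
  ext y
  constructor
  · rintro ⟨x, ⟨hx1, hx0⟩, rfl⟩
    rw [mem_ofPred_eq, perp_normPerp, normPerp_zero]
    refine ⟨?_, by simpa using hx1⟩
    have := norm_sq_eq x
    have h0 : 0 < x 0 ^ 2 := sq_pos_of_neg hx0
    exact lt_of_pow_lt_pow_left₀ 2 (norm_nonneg _) (by linarith)
  · rintro ⟨h1, h2⟩
    have hy0 : 0 ≤ y 0 := (norm_nonneg _).trans h1.le
    have h3 : 0 < y 0 ^ 2 - ‖perp y‖ ^ 2 := by nlinarith [norm_nonneg (perp y)]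
    set s := Real.sqrt (y 0 ^ 2 - ‖perp y‖ ^ 2)
    have hs : s ^ 2 = y 0 ^ 2 - ‖perp y‖ ^ 2 := Real.sq_sqrt h3.le
    have hs0 : 0 < s := Real.sqrt_pos.2 h3
    set x : E (n + 1) := -s • (e1 (n + 1) : E (n + 1)) + perp y
    have hx0 : x 0 = -s := by simp [x]
    have hxp : perp x = perp y := by
      rw [perp_add, perp_smul, perp_eq_self (perp_zero_coord y)]
      simp [perp]
    have hxn : ‖x‖ = y 0 := by
      have := norm_sq_eq x
      rw [hx0, hxp, neg_sq, hs] at this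
      exact (pow_left_inj₀ (norm_nonneg _) hy0 two_ne_zero).1 (by linarith)
    refine ⟨x, ⟨by simpa [hxn] using h2, by simpa [hx0] using hs0⟩, ?_⟩
    rw [normPerp, hxn, hxp, ← eq_smul_e1_add_perp]

end Polar

variable {n : ℕ} [NeZero n]

lemma measurable_perp {d : ℕ} [NeZero d] : Measurable (perp (d := d)) := continuous_perp.measurable

lemma measurable_coord {d : ℕ} (i : Fin d) : Measurable fun x : E d => x i :=
  (EuclideanSpace.proj i : E d →L[ℝ] ℝ).continuous.measurable

lemma measurable_consVec : Measurable (consVec (n := n)) :=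
  measurePreserving_consVec.measurable

lemma lintegral_eq_lintegral_consVec {f : E (n + 1) → ℝ≥0∞} (hf : Measurable f) :
    ∫⁻ y, f y = ∫⁻ r : ℝ, ∫⁻ w : E n, f (consVec (r, w)) := by
  have hm : Measurable fun p : ℝ × E n => f (consVec p) := hf.comp measurable_consVec
  rw [← measurePreserving_consVec.lintegral_comp hf, Measure.volume_eq_prod,
    lintegral_prod _ hm.aemeasurable]

lemma perp_dir {x : E (n + 1)} (hx : x ≠ 0) : perp (dir x : E (n + 1)) = ‖x‖⁻¹ • perp x := by
  rw [dir_of_ne hx, perp_smul]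

lemma lintegral_pow_Ioo (n : ℕ) :
    ∫⁻ r in Ioo (0 : ℝ) 1, ENNReal.ofReal (r ^ n) = ((n + 1 : ℕ) : ℝ≥0∞)⁻¹ := by
  have h := integral_pow (a := 0) (b := 1) n
  rw [intervalIntegral.integral_of_le zero_le_one, integral_Ioc_eq_integral_Ioo] at h
  rw [← ofReal_integral_eq_lintegral_ofReal, h]
  · rw [one_pow, zero_pow (Nat.succ_ne_zero n), sub_zero, one_div,
      ENNReal.ofReal_inv_of_pos (by positivity)]
    congr 1
    exact_mod_cast ENNReal.ofReal_natCast (n + 1)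
  · exact ((continuous_pow n).integrableOn_Icc).mono_set Ioo_subset_Icc_self
  · exact (ae_restrict_iff' measurableSet_Ioo).2 (Filter.Eventually.of_forall fun r hr =>
      pow_nonneg hr.1.le n)

/-- The measure `|η₁| d vol(η)` on the hemisphere `η₁ < 0` projects to Lebesgue measure
on the unit ball of `e₁^⊥`. -/
lemma lintegral_hemisphere_perp (ξ : ℝ) {F : E (n + 1) → ℝ≥0∞} (hF : Measurable F) :
    ∫⁻ η in {η : Sph (n + 1) | (η : E (n + 1)) 0 < 0}, ENNReal.ofReal |(η : E (n + 1)) 0| *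
        F (ξ • (e1 (n + 1) : E (n + 1)) - perp (η : E (n + 1))) ∂volSph (n + 1) =
      ∫⁻ u in Metric.ball (0 : E n) 1, F (consVec (ξ, u)) := by
  have hc0 : Measurable fun η : Sph (n + 1) => (η : E (n + 1)) 0 :=
    (measurable_coord 0).comp measurable_subtype_coe
  have hS : MeasurableSet {η : Sph (n + 1) | (η : E (n + 1)) 0 < 0} :=
    measurableSet_lt hc0 measurable_const
  have hS' : MeasurableSet {x : E (n + 1) | x 0 < 0} :=
    measurableSet_lt (measurable_coord 0) measurable_const
  have hball : MeasurableSet (Metric.ball (0 : E (n + 1)) 1) := Metric.isOpen_ball.measurableSet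
  let g : Sph (n + 1) → ℝ≥0∞ := {η : Sph (n + 1) | (η : E (n + 1)) 0 < 0}.indicator fun η =>
    ENNReal.ofReal |(η : E (n + 1)) 0| *
        F (ξ • (e1 (n + 1) : E (n + 1)) - perp (η : E (n + 1)))
  have hg : Measurable g := by
    refine Measurable.indicator ?_ hS
    refine (ENNReal.measurable_ofReal.comp hc0.norm).mul (hF.comp (measurable_const.sub ?_))
    exact measurable_perp.comp measurable_subtype_coe
  let G : E (n + 1) → ℝ≥0∞ := fun y => F (ξ • (e1 (n + 1) : E (n + 1)) - (y 0)⁻¹ • perp y)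
  have hG : Measurable G := hF.comp (measurable_const.sub
    ((measurable_coord 0).inv.smul measurable_perp))
  -- in polar coordinates, `|η₁|` is the Jacobian determinant of `normPerp`
  have h1 : ∀ x : E (n + 1), g (dir x) = {x : E (n + 1) | x 0 < 0}.indicator (fun x =>
      ENNReal.ofReal |(normPerpDeriv x).det| * G (normPerp x)) x := by
    intro x
    by_cases hx : x 0 < 0
    · have hx0 : x ≠ 0 := by
        rintro rfl
        simp at hx
      have hn : 0 < ‖x‖ := norm_pos_iff.2 hx0
      have hd0 : (dir x : E (n + 1)) 0 = x 0 / ‖x‖ := by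
        rw [dir_of_ne hx0, PiLp.smul_apply, smul_eq_mul, div_eq_inv_mul]
      have hmem : dir x ∈ {η : Sph (n + 1) | (η : E (n + 1)) 0 < 0} := by
        rw [mem_ofPred_eq, hd0]
        exact div_neg_of_neg_of_pos hx hn
      rw [indicator_of_mem (show x ∈ {x : E (n + 1) | x 0 < 0} from hx)]
      simp only [g, G]
      rw [indicator_of_mem hmem, hd0, perp_dir hx0, det_normPerpDeriv, normPerp_zero,
        perp_normPerp]
    · rw [indicator_of_notMem (show x ∉ {x : E (n + 1) | x 0 < 0} from hx)]
      refine indicator_of_notMem (fun h => hx ?_) _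
      by_cases hx0 : x = 0
      · subst hx0
        simp only [mem_ofPred_eq, dir, dif_pos, e1_zero] at h
        exact absurd h (by norm_num)
      · rw [mem_ofPred_eq, dir_of_ne hx0, PiLp.smul_apply, smul_eq_mul] at h
        exact (pos_iff_neg_of_mul_neg h).1 (inv_pos.2 (norm_pos_iff.2 hx0))
  rw [← lintegral_indicator hS, lintegral_volSph hg]
  simp_rw [h1]
  rw [setLIntegral_indicator hS', inter_comm,
    ← lintegral_image_eq_lintegral_abs_det_fderiv_mul volume (hball.inter hS')
      (fun x hx => (hasFDerivAt_normPerp (by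
        rintro rfl
        simpa using hx.2)).hasFDerivWithinAt)
      (injOn_normPerp.mono inter_subset_right), image_normPerp]
  have hT : MeasurableSet {y : E (n + 1) | ‖perp y‖ < y 0 ∧ y 0 < 1} :=
    (measurableSet_lt measurable_perp.norm (measurable_coord 0)).inter
      (measurableSet_lt (measurable_coord 0) measurable_const)
  let H : E n → ℝ≥0∞ := (Metric.ball (0 : E n) 1).indicator fun u => F (consVec (ξ, -u))
  have hH : Measurable H := (hF.comp (measurable_consVec.comp
    (measurable_const.prodMk measurable_neg))).indicator Metric.isOpen_ball.measurableSet
  -- `normPerp` maps the half ball onto a cone, whose slices are balls of radius `r < 1`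
  have h2 : ∀ r (w : E n), {y : E (n + 1) | ‖perp y‖ < y 0 ∧ y 0 < 1}.indicator G (consVec (r, w)) =
      (Ioo (0 : ℝ) 1).indicator (fun r => H (r⁻¹ • w)) r := by
    intro r w
    by_cases hr : r ∈ Ioo (0 : ℝ) 1
    · rw [indicator_of_mem hr]
      have hmem : consVec (r, w) ∈ {y : E (n + 1) | ‖perp y‖ < y 0 ∧ y 0 < 1} ↔
          r⁻¹ • w ∈ Metric.ball (0 : E n) 1 := by
        rw [mem_ofPred_eq, perp_consVec, norm_consVec_zero, consVec_zero, mem_ball_zero_iff,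
          norm_smul, Real.norm_eq_abs, abs_of_pos (inv_pos.2 hr.1), inv_mul_lt_iff₀ hr.1, mul_one]
        exact and_iff_left hr.2
      by_cases hw : r⁻¹ • w ∈ Metric.ball (0 : E n) 1
      · simp only [H]
        rw [indicator_of_mem (hmem.2 hw), indicator_of_mem hw]
        simp only [G]
        rw [consVec_zero, perp_consVec, smul_consVec_zero, smul_e1_sub_consVec]
      · simp only [H]
        rw [indicator_of_notMem (mt hmem.1 hw), indicator_of_notMem hw]
    · rw [indicator_of_notMem hr]
      refine indicator_of_notMem (fun h => hr ?_) _
      rw [mem_ofPred_eq, consVec_zero] at h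
      exact ⟨(norm_nonneg _).trans_lt h.1, h.2⟩
  rw [← lintegral_indicator hT, lintegral_eq_lintegral_consVec (hG.indicator hT)]
  simp_rw [h2]
  have h3 : ∀ r, ∫⁻ w : E n, (Ioo (0 : ℝ) 1).indicator (fun r => H (r⁻¹ • w)) r =
      (Ioo (0 : ℝ) 1).indicator (fun r => ENNReal.ofReal (r ^ n) * ∫⁻ u, H u) r := by
    intro r
    by_cases hr : r ∈ Ioo (0 : ℝ) 1
    · simp only [indicator_of_mem hr]
      rw [lintegral_comp_smul (inv_pos.2 hr.1) hH, inv_pow,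
        ENNReal.ofReal_inv_of_pos (pow_pos hr.1 n), inv_inv]
    · simp only [indicator_of_notMem hr, lintegral_zero]
  simp_rw [h3]
  rw [lintegral_indicator measurableSet_Ioo, lintegral_mul_const _ (by fun_prop), lintegral_pow_Ioo,
    ← mul_assoc, ENNReal.mul_inv_cancel (Nat.cast_ne_zero.2 (Nat.succ_ne_zero n))
      (ENNReal.natCast_ne_top _), one_mul]
  have h4 : ∀ u : E n, H u = 
      (Metric.ball (0 : E n) 1).indicator (fun u => F (consVec (ξ, u))) (-u) := by
    intro u
    simp only [H, indicator, mem_ball_zero_iff, norm_neg]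
  simp_rw [h4]
  rw [lintegral_neg_eq_self, lintegral_indicator Metric.isOpen_ball.measurableSet]

/-- Integration over the half-infinite cylinder, with the cross section parametrized by a
hemisphere. -/
theorem lintegral_hemisphere_cylinder {F : E (n + 1) → ℝ≥0∞} (hF : Measurable F) :
    ∫⁻ ξ in Ioi (0 : ℝ), ∫⁻ η in {η : Sph (n + 1) | (η : E (n + 1)) 0 < 0},
      ENNReal.ofReal |(η : E (n + 1)) 0| *
        F (ξ • (e1 (n + 1) : E (n + 1)) - perp (η : E (n + 1))) ∂volSph (n + 1) =
      ∫⁻ y in halfCylinder 0, F y := by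
  simp_rw [lintegral_hemisphere_perp _ hF]
  rw [← lintegral_indicator (isOpen_halfCylinder _).measurableSet,
    lintegral_eq_lintegral_consVec (hF.indicator (isOpen_halfCylinder 0).measurableSet),
    ← lintegral_indicator measurableSet_Ioi]
  refine lintegral_congr fun ξ => ?_
  by_cases hξ : ξ ∈ Ioi (0 : ℝ)
  · rw [indicator_of_mem hξ, ← lintegral_indicator Metric.isOpen_ball.measurableSet]
    refine lintegral_congr fun u => ?_
    have hmem : u ∈ Metric.ball (0 : E n) 1 ↔ consVec (ξ, u) ∈ halfCylinder (0 : E (n + 1)) := by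
      rw [halfCylinder, mem_ofPred_eq, perp_consVec, sub_zero, norm_consVec_zero, consVec_zero,
        mem_ball_zero_iff]
      exact (and_iff_right hξ).symm
    by_cases hu : u ∈ Metric.ball (0 : E n) 1
    · rw [indicator_of_mem hu, indicator_of_mem (hmem.1 hu)]
    · rw [indicator_of_notMem hu, indicator_of_notMem (mt hmem.2 hu)]
  · rw [indicator_of_notMem hξ]
    refine (lintegral_eq_zero_of_ae_eq_zero ?_).symm
    refine Filter.Eventually.of_forall fun u => indicator_of_notMem (fun h => hξ ?_) _
    exact h.1

/-! ### Scattering maps: measurability and change of variables -/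

variable {d : ℕ} [NeZero d] {Θ : Sph d × Sph d → Sph d × Sph d}

/-- The set `𝒮₋` of pairs `(v, w)` with `v · w < 0`. -/
def inPairs (d : ℕ) : Set (Sph d × Sph d) := {p | ⟪(p.1 : E d), (p.2 : E d)⟫ < 0}

/-- The set of pairs `(v, u)` with `u ∈ 𝒱_v`. -/
def outPairs (Θ : Sph d × Sph d → Sph d × Sph d) : Set (Sph d × Sph d) := {p | p.2 ∈ outVel Θ p.1}

lemma continuous_sph_inner : Continuous fun p : Sph d × Sph d => ⟪(p.1 : E d), (p.2 : E d)⟫ :=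
  (continuous_subtype_val.comp continuous_fst).inner (continuous_subtype_val.comp continuous_snd)

lemma isOpen_inPairs : IsOpen (inPairs d) := isOpen_lt continuous_sph_inner continuous_const

lemma isOpen_inner_lt : IsOpen {x : E d × E d | ⟪x.1, x.2⟫ < 0} :=
  isOpen_lt (by fun_prop) continuous_const

instance : PolishSpace (Sph d) := Metric.isClosed_sphere.polishSpace

namespace IsScatteringMap

lemma continuousOn_fst (hΘ : IsScatteringMap Θ) : ContinuousOn (fun p => (Θ p).1) (inPairs d) := by
  rw [Topology.IsInducing.subtypeVal.continuousOn_iff]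
  have h := (continuous_fst.comp_continuousOn hΘ.contDiffOn.continuousOn).comp
    (f := fun p : Sph d × Sph d => ((p.1 : E d), (p.2 : E d))) (s := inPairs d)
    (by fun_prop) (fun p hp => hp)
  refine h.congr fun p _ => ?_
  simp

lemma continuousOn_snd (hΘ : IsScatteringMap Θ) : ContinuousOn (fun p => (Θ p).2) (inPairs d) := by
  rw [Topology.IsInducing.subtypeVal.continuousOn_iff]
  have h := (continuous_snd.comp_continuousOn hΘ.contDiffOn.continuousOn).comp
    (f := fun p : Sph d × Sph d => ((p.1 : E d), (p.2 : E d))) (s := inPairs d)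
    (by fun_prop) (fun p hp => hp)
  refine h.congr fun p _ => ?_
  simp

lemma betaMinus_apply (hΘ : IsScatteringMap Θ) {v ω' : Sph d} (h : ⟪(v : E d), (ω' : E d)⟫ < 0) :
    betaMinus Θ v (Θ (v, ω')).1 = ω' :=
  (hΘ.injOn v).leftInvOn_invFunOn h

lemma _root_.LorentzGas.betaMinus_inner_lt {v u : Sph d} (h : u ∈ outVel Θ v) :
    ⟪(v : E d), (betaMinus Θ v u : E d)⟫ < 0 :=
  Function.invFunOn_mem h

lemma _root_.LorentzGas.apply_betaMinus {v u : Sph d} (h : u ∈ outVel Θ v) :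
    (Θ (v, betaMinus Θ v u)).1 = u :=
  Function.invFunOn_eq h

lemma measurableSet_image (hΘ : IsScatteringMap Θ) {s : Set (Sph d × Sph d)}
    (hs : MeasurableSet s) (hsub : s ⊆ inPairs d) :
    MeasurableSet ((fun p => (p.1, (Θ p).1)) '' s) := by
  refine hs.image_of_continuousOn_injOn
    (continuous_fst.continuousOn.prodMk (hΘ.continuousOn_fst.mono hsub)) ?_
  rintro ⟨v, a⟩ ha ⟨v', b⟩ hb hab
  simp only [Prod.mk.injEq] at hab
  obtain ⟨rfl, h⟩ := hab
  exact congrArg (Prod.mk v) (hΘ.injOn v (hsub ha) (hsub hb) h)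

lemma _root_.LorentzGas.outPairs_eq :
    outPairs Θ = (fun p => (p.1, (Θ p).1)) '' inPairs d := by
  ext ⟨v, u⟩
  constructor
  · rintro ⟨a, ha, h⟩
    exact ⟨(v, a), ha, Prod.ext rfl h⟩
  · rintro ⟨⟨v', a⟩, ha, h⟩
    simp only [Prod.mk.injEq] at h
    obtain ⟨rfl, rfl⟩ := h
    exact ⟨a, ha, rfl⟩

lemma measurableSet_outPairs (hΘ : IsScatteringMap Θ) : MeasurableSet (outPairs Θ) := by
  rw [outPairs_eq]
  exact hΘ.measurableSet_image isOpen_inPairs.measurableSet subset_rfl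

/-- By the Lusin-Souslin theorem the inverse `β⁻` is jointly measurable. -/
lemma measurable_betaMinus (hΘ : IsScatteringMap Θ) :
    Measurable fun p : Sph d × Sph d => betaMinus Θ p.1 p.2 := by
  intro B hB
  have h1 : MeasurableSet (((fun p : Sph d × Sph d => (p.1, (Θ p).1)) ''
      (inPairs d ∩ Prod.snd ⁻¹' B))) :=
    hΘ.measurableSet_image (isOpen_inPairs.measurableSet.inter (hB.preimage measurable_snd))
      inter_subset_left
  have h2 : MeasurableSet ((outPairs Θ)ᶜ ∩
      {_p : Sph d × Sph d | Classical.choice (inferInstance : Nonempty (Sph d)) ∈ B}) :=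
    hΘ.measurableSet_outPairs.compl.inter (MeasurableSet.const _)
  convert! h1.union h2 using 1
  ext ⟨v, u⟩
  simp only [mem_preimage, mem_union, mem_image, mem_inter_iff, mem_compl_iff, mem_ofPred_eq]
  by_cases h : u ∈ outVel Θ v
  · constructor
    · intro hb
      exact Or.inl ⟨(v, betaMinus Θ v u), ⟨betaMinus_inner_lt h, hb⟩,
        Prod.ext rfl (apply_betaMinus h)⟩
    · rintro (⟨⟨v', a⟩, ⟨ha, haB⟩, hab⟩ | ⟨hn, -⟩)
      · simp only [Prod.mk.injEq] at hab
        obtain ⟨rfl, rfl⟩ := hab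
        rwa [hΘ.betaMinus_apply ha]
      · exact absurd h hn
  · have hb : betaMinus Θ v u = Classical.choice (inferInstance : Nonempty (Sph d)) :=
      Function.invFunOn_neg h
    rw [hb]
    constructor
    · exact fun hB => Or.inr ⟨h, hB⟩
    · rintro (⟨⟨v', a⟩, ⟨ha, -⟩, hab⟩ | ⟨-, hB⟩)
      · simp only [Prod.mk.injEq] at hab
        obtain ⟨rfl, rfl⟩ := hab
        exact absurd ⟨a, ha, rfl⟩ h
      · exact hB

end IsScatteringMap

/-- The extension `x ↦ ‖x‖ Θ₁(v, x / ‖x‖)` of `Θ₁(v, ·)`, homogeneous of degree one. -/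
def radialExt (Θ : Sph d × Sph d → Sph d × Sph d) (v : Sph d) (x : E d) : E d :=
  ‖x‖ • ((Θ (v, dir x)).1 : E d)

/-- The Jacobian of `radialExt` at `x`. -/
def radialJac (Θ : Sph d × Sph d → Sph d × Sph d) (v : Sph d) (x : E d) : ℝ :=
  (fderiv ℝ (radialExt Θ v) x).det

lemma jac_eq (v u : Sph d) : jac Θ v u =
    |⟪(v : E d), (betaMinus Θ v u : E d)⟫| / |radialJac Θ v (betaMinus Θ v u)| := rfl

lemma jac_nonneg (v u : Sph d) : 0 ≤ jac Θ v u := by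
  rw [jac_eq]
  positivity

lemma norm_radialExt (v : Sph d) (x : E d) : ‖radialExt Θ v x‖ = ‖x‖ := by
  rw [radialExt, norm_smul, norm_sph, norm_norm, mul_one]

lemma dir_radialExt (v : Sph d) {x : E d} (hx : x ≠ 0) :
    dir (radialExt Θ v x) = (Θ (v, dir x)).1 := by
  rw [radialExt, dir_smul (norm_pos_iff.2 hx), dir_sph]

lemma radialExt_smul (v : Sph d) {c : ℝ} (hc : 0 < c) (x : E d) :
    radialExt Θ v (c • x) = c • radialExt Θ v x := by
  rw [radialExt, radialExt, dir_smul hc, norm_smul, Real.norm_eq_abs, abs_of_pos hc, smul_smul]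

lemma radialJac_smul (v : Sph d) {c : ℝ} (hc : 0 < c) (x : E d) :
    radialJac Θ v (c • x) = radialJac Θ v x := by
  have h := fderiv_comp_smul (𝕜 := ℝ) (f := radialExt Θ v) (x := x) c
  have h2 : (fun y => radialExt Θ v (c • y)) = c • radialExt Θ v := by
    funext y
    exact radialExt_smul v hc y
  rw [h2, fderiv_const_smul_field] at h
  rw [radialJac, radialJac, smul_right_injective _ hc.ne' h]

lemma inner_dir_lt_iff {v : Sph d} {x : E d} (hx : x ≠ 0) :
    ⟪(v : E d), (dir x : E d)⟫ < 0 ↔ ⟪(v : E d), x⟫ < 0 := by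
  conv_rhs => rw [← norm_smul_dir hx, real_inner_smul_right]
  exact (mul_neg_iff.trans (by simp [norm_pos_iff.2 hx, (norm_nonneg x).not_gt])).symm

lemma ne_zero_of_inner_lt {v x : E d} (h : ⟪v, x⟫ < 0) : x ≠ 0 := by
  rintro rfl
  simp at h

lemma continuousAt_dir {x : E d} (hx : x ≠ 0) : ContinuousAt (dir (d := d)) x := by
  rw [Topology.IsInducing.subtypeVal.continuousAt_iff]
  have h : ContinuousAt (fun x : E d => ‖x‖⁻¹ • x) x :=
    (continuous_norm.continuousAt.inv₀ (norm_ne_zero_iff.2 hx)).smul continuousAt_id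
  refine h.congr ?_
  filter_upwards [isOpen_ne.mem_nhds hx] with y hy using (dir_of_ne hy).symm

namespace IsScatteringMap

lemma contDiffOn_radialExt (hΘ : IsScatteringMap Θ) : ContDiffOn ℝ 1
    (fun p : E d × E d => ‖p.2‖ • ((Θ (dir p.1, dir p.2)).1 : E d)) {x | ⟪x.1, x.2⟫ < 0} := by
  have h1 : ContDiffOn ℝ 1 (fun p : E d × E d => ‖p.2‖) {x | ⟪x.1, x.2⟫ < 0} := fun p hp =>
    (contDiff_snd.contDiffAt.norm ℝ (ne_zero_of_inner_lt hp)).contDiffWithinAt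
  exact h1.smul (contDiff_fst.comp_contDiffOn hΘ.contDiffOn)

lemma hasFDerivAt_radialExt (hΘ : IsScatteringMap Θ)
    {v : Sph d} {x : E d} (hx : ⟪(v : E d), x⟫ < 0) :
    HasFDerivAt (radialExt Θ v)
      ((fderiv ℝ (fun p : E d × E d => ‖p.2‖ • ((Θ (dir p.1, dir p.2)).1 : E d)) (v, x)).comp
        (ContinuousLinearMap.inr ℝ (E d) (E d))) x := by
  have hmem : ((v : E d), x) ∈ {x : E d × E d | ⟪x.1, x.2⟫ < 0} := hx
  have h1 := ((hΘ.contDiffOn_radialExt.contDiffAt (isOpen_inner_lt.mem_nhds hmem)).differentiableAt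
    one_ne_zero).hasFDerivAt
  have h2 := h1.comp x (hasFDerivAt_prodMk_right (𝕜 := ℝ) (v : E d) x)
  convert! h2 using 1
  funext y
  simp [radialExt]

lemma continuousOn_radialJac (hΘ : IsScatteringMap Θ) :
    ContinuousOn (fun p : Sph d × Sph d => radialJac Θ p.1 p.2) (inPairs d) := by
  have h1 := hΘ.contDiffOn_radialExt.continuousOn_fderiv_of_isOpen isOpen_inner_lt le_rfl
  have h2 := h1.comp (f := fun p : Sph d × Sph d => ((p.1 : E d), (p.2 : E d))) (s := inPairs d)
    (by fun_prop) (fun p hp => hp)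
  have h3 : ContinuousOn (fun p : Sph d × Sph d =>
      (((fderiv ℝ (fun p : E d × E d => ‖p.2‖ • ((Θ (dir p.1, dir p.2)).1 : E d))
        ((p.1 : E d), (p.2 : E d))).comp (ContinuousLinearMap.inr ℝ (E d) (E d)))).det)
      (inPairs d) :=
    ContinuousLinearMap.continuous_det.comp_continuousOn (h2.clm_comp continuousOn_const)
  refine h3.congr fun p hp => ?_
  rw [radialJac, (hΘ.hasFDerivAt_radialExt hp).fderiv]

open Classical in
lemma measurable_jac (hΘ : IsScatteringMap Θ) :
    Measurable ((outPairs Θ).indicator fun p => jac Θ p.1 p.2) := by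
  have h1 : Measurable ((inPairs d).indicator fun p : Sph d × Sph d => radialJac Θ p.1 p.2) := by
    have := hΘ.continuousOn_radialJac.measurable_piecewise
      (g := fun _ => (0 : ℝ)) continuousOn_const isOpen_inPairs.measurableSet
    rwa [show (fun _ => (0 : ℝ)) = (0 : Sph d × Sph d → ℝ) from rfl, piecewise_eq_indicator]
      at this
  have h2 : Measurable fun p : Sph d × Sph d => (p.1, betaMinus Θ p.1 p.2) :=
    measurable_fst.prodMk hΘ.measurable_betaMinus
  have h3 : Measurable fun p : Sph d × Sph d => |⟪(p.1 : E d), (betaMinus Θ p.1 p.2 : E d)⟫| /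
      |(inPairs d).indicator (fun p : Sph d × Sph d => radialJac Θ p.1 p.2)
        (p.1, betaMinus Θ p.1 p.2)| :=
    (continuous_sph_inner.measurable.comp h2).norm.div (h1.comp h2).norm
  convert! h3.indicator hΘ.measurableSet_outPairs using 1
  funext p
  by_cases hp : p ∈ outPairs Θ
  · rw [indicator_of_mem hp, indicator_of_mem hp, indicator_of_mem, jac_eq]
    exact betaMinus_inner_lt hp
  · rw [indicator_of_notMem hp, indicator_of_notMem hp]

lemma isOpen_cone (hΘ : IsScatteringMap Θ)
    (v : Sph d) : IsOpen {y : E d | y ≠ 0 ∧ dir y ∈ outVel Θ v} := by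
  rw [isOpen_iff_mem_nhds]
  rintro y ⟨hy, hyv⟩
  filter_upwards [isOpen_ne.mem_nhds hy,
    (continuousAt_dir hy).preimage_mem_nhds ((hΘ.isOpen_outVel v).mem_nhds hyv)] with x hx hxv
  exact ⟨hx, hxv⟩

lemma radialJac_ne_zero (hΘ : IsScatteringMap Θ) {v : Sph d} {x : E d} (hx : ⟪(v : E d), x⟫ < 0) :
    radialJac Θ v x ≠ 0 := by
  have hx0 := ne_zero_of_inner_lt hx
  have h1 := hΘ.hasFDerivAt_radialExt hx
  have hmem : radialExt Θ v x ∈ {y : E d | y ≠ 0 ∧ dir y ∈ outVel Θ v} := by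
    refine ⟨?_, ?_⟩
    · rw [← norm_ne_zero_iff, norm_radialExt]
      exact norm_ne_zero_iff.2 hx0
    · rw [dir_radialExt v hx0]
      exact ⟨dir x, (inner_dir_lt_iff hx0).2 hx, rfl⟩
  have h2 : DifferentiableAt ℝ (fun y : E d => ‖y‖ • (betaMinus Θ v (dir y) : E d))
      (radialExt Θ v x) :=
    (contDiffAt_norm ℝ hmem.1).differentiableAt (n := 1) one_ne_zero |>.smul
      (((hΘ.contDiffOn_inv v).contDiffAt ((hΘ.isOpen_cone v).mem_nhds hmem)).differentiableAt
        one_ne_zero)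
  have h3 := h2.hasFDerivAt.comp x h1
  have h4 : (fun y : E d => ‖y‖ • (betaMinus Θ v (dir y) : E d)) ∘ radialExt Θ v =ᶠ[nhds x] id := by
    have ho : IsOpen {y : E d | ⟪(v : E d), y⟫ < 0} := isOpen_lt (by fun_prop) continuous_const
    filter_upwards [ho.mem_nhds hx] with y hy
    have hy0 := ne_zero_of_inner_lt hy
    rw [Function.comp_apply, norm_radialExt, dir_radialExt v hy0,
      hΘ.betaMinus_apply ((inner_dir_lt_iff hy0).2 hy), norm_smul_dir hy0, id]
  have h5 := (h4.hasFDerivAt_iff.1 h3).unique (hasFDerivAt_id x)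
  intro h0
  have h6 := congrArg ContinuousLinearMap.det h5
  rw [radialJac, h1.fderiv] at h0
  rw [ContinuousLinearMap.det, ContinuousLinearMap.toLinearMap_comp, LinearMap.det_comp] at h6
  change _ * ContinuousLinearMap.det _ = _ at h6
  rw [h0, mul_zero] at h6
  simp [ContinuousLinearMap.det] at h6

/-- Substitution `u = Θ₁(v, η)`: the measure `J(v, u) d vol(u)` on `𝒱_v` corresponds to
`|v · η| d vol(η)`. -/
theorem lintegral_outVel (hΘ : IsScatteringMap Θ)
    (v : Sph d) {g : Sph d → ℝ≥0∞} (hg : Measurable g) :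
    ∫⁻ u in outVel Θ v, ENNReal.ofReal (jac Θ v u) * g (betaMinus Θ v u) ∂volSph d =
      ∫⁻ η in {η : Sph d | ⟪(v : E d), (η : E d)⟫ < 0},
        ENNReal.ofReal |⟪(v : E d), (η : E d)⟫| * g η ∂volSph d := by
  have hin : Continuous fun η : Sph d => ⟪(v : E d), (η : E d)⟫ :=
    continuous_const.inner continuous_subtype_val
  have hS : MeasurableSet {η : Sph d | ⟪(v : E d), (η : E d)⟫ < 0} :=
    (isOpen_lt hin continuous_const).measurableSet
  have hO : MeasurableSet (outVel Θ v) := (hΘ.isOpen_outVel v).measurableSet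
  have hH : IsOpen {y : E d | ⟪(v : E d), y⟫ < 0} := isOpen_lt (by fun_prop) continuous_const
  have hball : MeasurableSet (Metric.ball (0 : E d) 1) := Metric.isOpen_ball.measurableSet
  let L : Sph d → ℝ≥0∞ := (outVel Θ v).indicator fun u =>
    ENNReal.ofReal (jac Θ v u) * g (betaMinus Θ v u)
  have hL : Measurable L := by
    have h1 : Measurable fun u => (outPairs Θ).indicator (fun p => jac Θ p.1 p.2) (v, u) :=
      hΘ.measurable_jac.comp (measurable_const.prodMk measurable_id)
    have h2 : Measurable fun u => betaMinus Θ v u :=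
      Measurable.comp (g := fun p : Sph d × Sph d => betaMinus Θ p.1 p.2)
        (f := fun u => (v, u)) hΘ.measurable_betaMinus measurable_prodMk_left
    have h12 : Measurable fun u => ENNReal.ofReal ((outPairs Θ).indicator
        (fun p => jac Θ p.1 p.2) (v, u)) * g (betaMinus Θ v u) :=
      h1.ennreal_ofReal.mul (hg.comp h2)
    have heq : L = (outVel Θ v).indicator fun u => ENNReal.ofReal ((outPairs Θ).indicator
        (fun p => jac Θ p.1 p.2) (v, u)) * g (betaMinus Θ v u) :=
      indicator_congr fun u hu => by rw [indicator_of_mem (show (v, u) ∈ outPairs Θ from hu)]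
    rw [heq]
    exact h12.indicator hO
  let M : Sph d → ℝ≥0∞ := {η : Sph d | ⟪(v : E d), (η : E d)⟫ < 0}.indicator fun η =>
    ENNReal.ofReal |⟪(v : E d), (η : E d)⟫| * g η
  have hM : Measurable M :=
    ((ENNReal.measurable_ofReal.comp hin.measurable.norm).mul hg).indicator hS
  rw [← lintegral_indicator hO, ← lintegral_indicator hS, lintegral_volSph hL, lintegral_volSph hM]
  congr 1
  -- change variables in the cones over the two sides, by means of the homogeneous extension of
  -- `Θ₁(v, ·)`, which maps one onto the other
  have himg : radialExt Θ v '' (Metric.ball 0 1 ∩ {y : E d | ⟪(v : E d), y⟫ < 0}) =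
      Metric.ball 0 1 ∩ {y : E d | y ≠ 0 ∧ dir y ∈ outVel Θ v} := by
    ext y
    constructor
    · rintro ⟨x, ⟨hx1, hx⟩, rfl⟩
      have hx0 := ne_zero_of_inner_lt hx
      refine ⟨by simpa [norm_radialExt] using hx1, ?_, ?_⟩
      · rw [← norm_ne_zero_iff, norm_radialExt]
        exact norm_ne_zero_iff.2 hx0
      · rw [dir_radialExt v hx0]
        exact ⟨dir x, (inner_dir_lt_iff hx0).2 hx, rfl⟩
    · rintro ⟨hy1, hy0, a, ha, hay⟩
      have hn : 0 < ‖y‖ := norm_pos_iff.2 hy0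
      refine ⟨‖y‖ • (a : E d), ⟨by simpa [norm_smul] using hy1, ?_⟩, ?_⟩
      · rw [mem_ofPred_eq, real_inner_smul_right]
        exact mul_neg_of_pos_of_neg hn ha
      · rw [radialExt, dir_smul hn, dir_sph, norm_smul, norm_sph, norm_norm, mul_one]
        simp only at hay
        rw [hay, norm_smul_dir hy0]
  have hinj : InjOn (radialExt Θ v) (Metric.ball 0 1 ∩ {y : E d | ⟪(v : E d), y⟫ < 0}) := by
    rintro x ⟨-, hx⟩ y ⟨-, hy⟩ hxy
    have hx0 := ne_zero_of_inner_lt hx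
    have hy0 := ne_zero_of_inner_lt hy
    have h1 : dir x = dir y := by
      refine hΘ.injOn v ((inner_dir_lt_iff hx0).2 hx) ((inner_dir_lt_iff hy0).2 hy) ?_
      simp only
      rw [← dir_radialExt v hx0, ← dir_radialExt v hy0, hxy]
    rw [← norm_smul_dir hx0, ← norm_smul_dir hy0, h1, ← norm_radialExt (Θ := Θ) v x, hxy,
      norm_radialExt]
  have h1 : ∫⁻ y in Metric.ball (0 : E d) 1, L (dir y) =
      ∫⁻ y in Metric.ball 0 1 ∩ {y : E d | y ≠ 0 ∧ dir y ∈ outVel Θ v}, L (dir y) := by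
    rw [← lintegral_indicator hball,
      ← lintegral_indicator (hball.inter (hΘ.isOpen_cone v).measurableSet)]
    refine lintegral_congr_ae ?_
    filter_upwards [Measure.ae_ne volume (0 : E d)] with y hy
    by_cases hb : y ∈ Metric.ball (0 : E d) 1
    · rw [indicator_of_mem hb]
      by_cases ho : dir y ∈ outVel Θ v
      · rw [indicator_of_mem (show y ∈ Metric.ball 0 1 ∩
            {y : E d | y ≠ 0 ∧ dir y ∈ outVel Θ v} from ⟨hb, hy, ho⟩)]
      · rw [indicator_of_notMem fun h => ho h.2.2]
        exact indicator_of_notMem ho _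
    · rw [indicator_of_notMem hb, indicator_of_notMem fun h => hb h.1]
  rw [h1, ← himg, lintegral_image_eq_lintegral_abs_det_fderiv_mul volume
    (hball.inter hH.measurableSet)
    (fun x hx => (hΘ.hasFDerivAt_radialExt hx.2).differentiableAt.hasFDerivAt.hasFDerivWithinAt)
    hinj, ← lintegral_indicator hball, ← lintegral_indicator (hball.inter hH.measurableSet)]
  refine lintegral_congr_ae ?_
  filter_upwards [Measure.ae_ne volume (0 : E d)] with x hx0
  by_cases hb : x ∈ Metric.ball (0 : E d) 1
  · rw [indicator_of_mem hb]
    by_cases hx : ⟪(v : E d), x⟫ < 0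
    · have hdx := (inner_dir_lt_iff hx0).2 hx
      have hj : radialJac Θ v (dir x) = radialJac Θ v x := by
        conv_rhs => rw [← norm_smul_dir hx0]
        exact (radialJac_smul v (norm_pos_iff.2 hx0) _).symm
      -- the Jacobian cancels against the denominator of `jac`
      have hj0 : 0 < |radialJac Θ v x| := abs_pos.2 (hΘ.radialJac_ne_zero hx)
      rw [indicator_of_mem (show x ∈ _ ∩ _ from ⟨hb, hx⟩), dir_radialExt v hx0]
      simp only [L, M]
      rw [indicator_of_mem (show (Θ (v, dir x)).1 ∈ outVel Θ v from ⟨dir x, hdx, rfl⟩),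
        indicator_of_mem (show dir x ∈ {η : Sph d | ⟪(v : E d), (η : E d)⟫ < 0} from hdx),
        hΘ.betaMinus_apply hdx, jac_eq, hΘ.betaMinus_apply hdx, hj, ← mul_assoc]
      change ENNReal.ofReal |radialJac Θ v x| * _ * _ = _
      rw [← ENNReal.ofReal_mul hj0.le, mul_div_cancel₀ _ hj0.ne']
    · rw [indicator_of_notMem (show x ∉ _ ∩ _ from fun h => hx h.2)]
      exact (indicator_of_notMem (show dir x ∉ {η : Sph d | ⟪(v : E d), (η : E d)⟫ < 0} from
        fun h => hx ((inner_dir_lt_iff hx0).1 h)) _).symm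
  · rw [indicator_of_notMem hb, indicator_of_notMem fun h => hb h.1]

end IsScatteringMap

/-! ### The transition density as a probability kernel -/

variable {n : ℕ} [NeZero n] {Θ : Sph (n + 1) × Sph (n + 1) → Sph (n + 1) × Sph (n + 1)}
  {R : Sph (n + 1) → (E (n + 1) ≃ₗᵢ[ℝ] E (n + 1))}

lemma IsFrame.measurable_apply (hR : IsFrame R) :
    Measurable fun q : Sph (n + 1) × E (n + 1) => R q.1 q.2 := by
  obtain ⟨p, hp⟩ := hR.smooth
  have hS : MeasurableSet {q : Sph (n + 1) × E (n + 1) | q.1 = p} :=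
    (measurableSet_singleton p).preimage measurable_fst
  refine measurable_of_restrict_of_restrict_compl hS ?_ ?_
  · have : ({q : Sph (n + 1) × E (n + 1) | q.1 = p}.domRestrict fun q => R q.1 q.2) =
        fun q => R p q.1.2 := by
      funext q
      change R q.1.1 q.1.2 = _
      rw [q.2]
    rw [this]
    exact ((R p).continuous.comp (continuous_snd.comp continuous_subtype_val)).measurable
  · refine Continuous.measurable (continuousOn_iff_continuous_domRestrict.1 ?_)
    have h1 := hp.continuousOn.comp (f := fun q : Sph (n + 1) × E (n + 1) => (q.1 : E (n + 1)))
      (s := {q | q.1 = p}ᶜ) (by fun_prop) fun q hq => ⟨sph_ne_zero q.1, by simpa using hq⟩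
    have h2 := h1.clm_apply (g := fun q : Sph (n + 1) × E (n + 1) => q.2) (by fun_prop)
    refine h2.congr fun q _ => ?_
    simp

lemma IsScatteringMap.betaMinus_rot (hΘ : IsScatteringMap Θ) {K : E (n + 1) ≃ₗᵢ[ℝ] E (n + 1)}
    {v u : Sph (n + 1)} (hK : K v = e1 (n + 1)) (hu : u ∈ outVel Θ v) :
    betaMinus Θ (e1 (n + 1)) (rot K u) = rot K (betaMinus Θ v u) := by
  have h1 : rot K v = e1 (n + 1) := Subtype.ext hK
  have h2 := betaMinus_inner_lt hu
  have h3 := hΘ.spherically_symmetric K v _ h2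
  have h4 : (Θ (e1 (n + 1), rot K (betaMinus Θ v u))).1 = rot K u := by
    rw [← h1, h3, apply_betaMinus hu]
  rw [← h4]
  refine hΘ.betaMinus_apply ?_
  rw [← h1]
  change ⟪K v, K (betaMinus Θ v u : E (n + 1))⟫ < 0
  rwa [LinearIsometryEquiv.inner_map_map]

/-- The exit position, in the frame of the outgoing velocity. -/
def exitPos (Θ : Sph (n + 1) × Sph (n + 1) → Sph (n + 1) × Sph (n + 1))
    (R : Sph (n + 1) → (E (n + 1) ≃ₗᵢ[ℝ] E (n + 1))) (v₀ v₁ : Sph (n + 1)) : E (n + 1) :=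
  perp (R v₁ (betaPlus Θ v₀ v₁ : E (n + 1)))

lemma exitPos_zero (v₀ v₁ : Sph (n + 1)) : exitPos Θ R v₀ v₁ 0 = 0 := perp_zero_coord _

lemma IsFrame.apply_zero_coord (hR : IsFrame R) (v : Sph (n + 1)) (x : E (n + 1)) :
    R v x 0 = ⟪(v : E (n + 1)), x⟫ := by
  rw [← e1_inner, ← hR.map_self v, LinearIsometryEquiv.inner_map_map]

lemma norm_exitPos_lt (hΘ : IsScatteringMap Θ) (hR : IsFrame R) {v₀ v₁ : Sph (n + 1)}
    (h : v₁ ∈ outVel Θ v₀) : ‖exitPos Θ R v₀ v₁‖ < 1 := by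
  have h1 := hΘ.mapsTo v₀ _ (betaMinus_inner_lt h)
  rw [apply_betaMinus h] at h1
  change 0 < ⟪(v₁ : E (n + 1)), (betaPlus Θ v₀ v₁ : E (n + 1))⟫ at h1
  have h2 := norm_sq_eq (R v₁ (betaPlus Θ v₀ v₁ : E (n + 1)))
  rw [LinearIsometryEquiv.norm_map, norm_sph, hR.apply_zero_coord, one_pow] at h2
  have h3 : ‖exitPos Θ R v₀ v₁‖ ^ 2 < 1 ^ 2 := by
    rw [exitPos, one_pow]
    nlinarith
  exact lt_of_pow_lt_pow_left₀ 2 zero_le_one h3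

lemma measurable_missProb_comp {α : Type*} [MeasurableSpace α] {a : α → ℝ} {z y : α → E (n + 1)}
    (ha : Measurable a) (hz : Measurable z) (hy : Measurable y) :
    Measurable fun x => missProb (a x) (z x) (y x) :=
  Measurable.comp (g := fun p : ℝ × E (n + 1) × E (n + 1) => missProb p.1 p.2.1 p.2.2)
    (f := fun x => (a x, z x, y x)) measurable_missProb (ha.prodMk (hz.prodMk hy))

/-- The density of the free path length and the next impact parameter, as a function on the
half-infinite cylinder. -/
def cylDens (z y : E (n + 1)) : ℝ≥0∞ := missProb (y 0) z (y + z)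

lemma measurable_cylDens (z : E (n + 1)) : Measurable (cylDens z) :=
  measurable_missProb_comp (measurable_coord 0) measurable_const (measurable_id.add_const z)

lemma lintegral_cylDens {z : E (n + 1)} (hz0 : z 0 = 0) (hz : ‖z‖ < 1) :
    ∫⁻ y in halfCylinder 0, cylDens z y = 1 := by
  have hm : Measurable fun y : E (n + 1) => missProb (y 0) z y :=
    measurable_missProb_comp (measurable_coord 0) measurable_const measurable_id
  rw [← lintegral_missProb hz0 hz, ← lintegral_indicator (isOpen_halfCylinder _).measurableSet,
    ← lintegral_indicator (isOpen_halfCylinder _).measurableSet,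
    ← lintegral_add_right_eq_self ((halfCylinder z).indicator _) z]
  refine lintegral_congr fun y => ?_
  have hmem : y ∈ halfCylinder (0 : E (n + 1)) ↔ y + z ∈ halfCylinder z := by
    rw [halfCylinder, halfCylinder, mem_ofPred_eq, mem_ofPred_eq, perp_add, perp_eq_self hz0,
      add_sub_cancel_right, sub_zero, PiLp.add_apply, hz0, add_zero]
  by_cases hy : y ∈ halfCylinder (0 : E (n + 1))
  · rw [indicator_of_mem hy, indicator_of_mem (hmem.1 hy), cylDens, PiLp.add_apply, hz0, add_zero]
  · rw [indicator_of_notMem hy, indicator_of_notMem (mt hmem.2 hy)]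

/-- The transition density, with values in `[0, ∞]` and restricted to positive path
lengths. -/
def transRate (Θ : Sph (n + 1) × Sph (n + 1) → Sph (n + 1) × Sph (n + 1))
    (R : Sph (n + 1) → (E (n + 1) ≃ₗᵢ[ℝ] E (n + 1))) (v₀ v₁ : Sph (n + 1)) (ξ : ℝ)
    (v₂ : Sph (n + 1)) : ℝ≥0∞ :=
  (Ioi (0 : ℝ)).indicator (fun ξ => ENNReal.ofReal (transDens Θ R v₀ v₁ ξ v₂)) ξ

lemma transDens_nonneg (v₀ v₁ : Sph (n + 1)) (ξ : ℝ) (v₂ : Sph (n + 1)) :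
    0 ≤ transDens Θ R v₀ v₁ ξ v₂ := by
  rw [transDens]
  split_ifs
  · exact mul_nonneg (jac_nonneg _ _) (Phi0_nonneg _ _ _)
  · exact le_rfl

lemma transRate_of_pos {v₀ v₁ : Sph (n + 1)} {ξ : ℝ} {v₂ : Sph (n + 1)} (hξ : 0 < ξ) :
    transRate Θ R v₀ v₁ ξ v₂ = ENNReal.ofReal (transDens Θ R v₀ v₁ ξ v₂) :=
  indicator_of_mem (show ξ ∈ Ioi (0 : ℝ) from hξ) _

lemma transRate_of_nonpos {v₀ v₁ : Sph (n + 1)} {ξ : ℝ} {v₂ : Sph (n + 1)} (hξ : ξ ≤ 0) :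
    transRate Θ R v₀ v₁ ξ v₂ = 0 :=
  indicator_of_notMem (fun h : ξ ∈ Ioi (0 : ℝ) => absurd hξ (not_le.2 h)) _

lemma transRate_of_notMem {v₀ v₁ : Sph (n + 1)} {ξ : ℝ} {v₂ : Sph (n + 1)}
    (h : ¬(v₁ ∈ outVel Θ v₀ ∧ v₂ ∈ outVel Θ v₁)) : transRate Θ R v₀ v₁ ξ v₂ = 0 := by
  rw [transRate, indicator_apply_eq_zero]
  intro _
  rw [transDens, if_neg h, ENNReal.ofReal_zero]

lemma transRate_eq (hΘ : IsScatteringMap Θ) (hR : IsFrame R) {v₀ v₁ v₂ : Sph (n + 1)} {ξ : ℝ}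
    (hξ : 0 < ξ) (h₁ : v₁ ∈ outVel Θ v₀) (h₂ : v₂ ∈ outVel Θ v₁) :
    transRate Θ R v₀ v₁ ξ v₂ = ENNReal.ofReal (jac Θ v₁ v₂) *
      cylDens (exitPos Θ R v₀ v₁) (ξ • (e1 (n + 1) : E (n + 1)) -
        perp (R v₁ (betaMinus Θ v₁ v₂ : E (n + 1)))) := by
  rw [transRate_of_pos hξ, transDens, if_pos ⟨h₁, h₂⟩, ENNReal.ofReal_mul (jac_nonneg _ _),
    hΘ.betaMinus_rot (hR.map_self v₁) h₂, ofReal_Phi0_eq hξ (by simp) (perp_zero_coord _), cylDens]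
  congr 1
  have : (ξ • (e1 (n + 1) : E (n + 1)) - perp (R v₁ (betaMinus Θ v₁ v₂ : E (n + 1)))) 0 = ξ := by
    simp
  rw [this, sub_eq_add_neg]
  rfl

open Classical in
lemma measurable_transRate (hΘ : IsScatteringMap Θ) (hR : IsFrame R) :
    Measurable fun p : (Sph (n + 1) × Sph (n + 1)) × ℝ × Sph (n + 1) =>
      transRate Θ R p.1.1 p.1.2 p.2.1 p.2.2 := by
  have hβ : ∀ {f g : (Sph (n + 1) × Sph (n + 1)) × ℝ × Sph (n + 1) → Sph (n + 1)},
      Measurable f → Measurable g → Measurable fun p => betaMinus Θ (f p) (g p) := by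
    intro f g hf hg
    exact Measurable.comp (g := fun p : Sph (n + 1) × Sph (n + 1) => betaMinus Θ p.1 p.2)
      (f := fun p => (f p, g p)) hΘ.measurable_betaMinus (hf.prodMk hg)
  have m0 : Measurable fun p : (Sph (n + 1) × Sph (n + 1)) × ℝ × Sph (n + 1) => p.1.1 := by fun_prop
  have m1 : Measurable fun p : (Sph (n + 1) × Sph (n + 1)) × ℝ × Sph (n + 1) => p.1.2 := by fun_prop
  have mξ : Measurable fun p : (Sph (n + 1) × Sph (n + 1)) × ℝ × Sph (n + 1) => p.2.1 := by fun_prop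
  have m2 : Measurable fun p : (Sph (n + 1) × Sph (n + 1)) × ℝ × Sph (n + 1) => p.2.2 := by fun_prop
  -- a measurable function that agrees with `β⁺` where it matters
  let T : Sph (n + 1) × Sph (n + 1) → Sph (n + 1) :=
    (inPairs (n + 1)).piecewise (fun p => (Θ p).2) fun _ => e1 (n + 1)
  have hT : Measurable T := hΘ.continuousOn_snd.measurable_piecewise continuousOn_const
    isOpen_inPairs.measurableSet
  let z : (Sph (n + 1) × Sph (n + 1)) × ℝ × Sph (n + 1) → E (n + 1) := fun p =>
    perp (R p.1.2 (T (p.1.1, betaMinus Θ p.1.1 p.1.2) : E (n + 1)))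
  have hz : Measurable z := measurable_perp.comp (hR.measurable_apply.comp (m1.prodMk
    (measurable_subtype_coe.comp (hT.comp (m0.prodMk (hβ m0 m1))))))
  let y : (Sph (n + 1) × Sph (n + 1)) × ℝ × Sph (n + 1) → E (n + 1) := fun p =>
    p.2.1 • (e1 (n + 1) : E (n + 1)) - perp (R p.1.2 (betaMinus Θ p.1.2 p.2.2 : E (n + 1)))
  have hy : Measurable y := (mξ.smul_const _).sub (measurable_perp.comp
    (hR.measurable_apply.comp (m1.prodMk (measurable_subtype_coe.comp (hβ m1 m2)))))
  let S : Set ((Sph (n + 1) × Sph (n + 1)) × ℝ × Sph (n + 1)) :=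
    {p | 0 < p.2.1} ∩ ({p | (p.1.1, p.1.2) ∈ outPairs Θ} ∩ {p | (p.1.2, p.2.2) ∈ outPairs Θ})
  have hS : MeasurableSet S := (measurableSet_lt measurable_const mξ).inter
    ((hΘ.measurableSet_outPairs.preimage (m0.prodMk m1)).inter
      (hΘ.measurableSet_outPairs.preimage (m1.prodMk m2)))
  have hF : Measurable fun p : (Sph (n + 1) × Sph (n + 1)) × ℝ × Sph (n + 1) =>
      ENNReal.ofReal ((outPairs Θ).indicator (fun p => jac Θ p.1 p.2) (p.1.2, p.2.2)) *
        missProb ((y p) 0) (z p) (y p + z p) :=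
    (hΘ.measurable_jac.comp (m1.prodMk m2)).ennreal_ofReal.mul
      (measurable_missProb_comp ((measurable_coord 0).comp hy) hz (hy.add hz))
  convert! hF.indicator hS using 1
  funext p
  by_cases hp : p ∈ S
  · obtain ⟨h0, h1, h2⟩ := id hp
    rw [indicator_of_mem hp, indicator_of_mem (show (p.1.2, p.2.2) ∈ outPairs Θ from h2),
      transRate_eq hΘ hR h0 h1 h2]
    have hTp : T (p.1.1, betaMinus Θ p.1.1 p.1.2) = betaPlus Θ p.1.1 p.1.2 :=
      piecewise_eq_of_mem _ _ _ (betaMinus_inner_lt h1)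
    simp only [cylDens, exitPos, z, y, hTp]
  · rw [indicator_of_notMem hp]
    by_cases h0 : 0 < p.2.1
    · exact transRate_of_notMem fun h => hp ⟨h0, h.1, h.2⟩
    · exact transRate_of_nonpos (not_lt.1 h0)

/-- The substitution `v₂ ↦ β⁻` turns the integral over the velocities after the next collision into
an integral over a hemisphere, rotated by the frame to that around `-e₁`. -/
lemma lintegral_transRate_eq (hΘ : IsScatteringMap Θ) (hR : IsFrame R) {v₀ v₁ : Sph (n + 1)}
    {ξ : ℝ} (hξ : 0 < ξ) (h₁ : v₁ ∈ outVel Θ v₀) :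
    ∫⁻ v₂, transRate Θ R v₀ v₁ ξ v₂ ∂volSph (n + 1) =
      ∫⁻ η in {η : Sph (n + 1) | (η : E (n + 1)) 0 < 0}, ENNReal.ofReal |(η : E (n + 1)) 0| *
        cylDens (exitPos Θ R v₀ v₁) (ξ • (e1 (n + 1) : E (n + 1)) - perp (η : E (n + 1)))
        ∂volSph (n + 1) := by
  have hO : MeasurableSet (outVel Θ v₁) := (hΘ.isOpen_outVel v₁).measurableSet
  let g : Sph (n + 1) → ℝ≥0∞ := fun η => cylDens (exitPos Θ R v₀ v₁)
    (ξ • (e1 (n + 1) : E (n + 1)) - perp (η : E (n + 1)))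
  have hg : Measurable g := (measurable_cylDens _).comp
    (measurable_const.sub (measurable_perp.comp measurable_subtype_coe))
  have hc0 : Measurable fun η : Sph (n + 1) => (η : E (n + 1)) 0 :=
    (measurable_coord 0).comp measurable_subtype_coe
  have hS : MeasurableSet {η : Sph (n + 1) | (η : E (n + 1)) 0 < 0} :=
    measurableSet_lt hc0 measurable_const
  have hgK : Measurable fun η => g (rot (R v₁) η) := hg.comp (continuous_rot (R v₁)).measurable
  have hin : Measurable fun η : Sph (n + 1) => ⟪(v₁ : E (n + 1)), (η : E (n + 1))⟫ :=
    (continuous_const.inner continuous_subtype_val).measurable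
  have hm : Measurable ({η : Sph (n + 1) | (η : E (n + 1)) 0 < 0}.indicator fun η =>
      ENNReal.ofReal |(η : E (n + 1)) 0| * g η) :=
    ((ENNReal.measurable_ofReal.comp hc0.norm).mul hg).indicator hS
  have h1 : ∫⁻ v₂, transRate Θ R v₀ v₁ ξ v₂ ∂volSph (n + 1) =
      ∫⁻ u in outVel Θ v₁, ENNReal.ofReal (jac Θ v₁ u) * g (rot (R v₁) (betaMinus Θ v₁ u))
        ∂volSph (n + 1) := by
    rw [← lintegral_indicator hO]
    refine lintegral_congr fun u => ?_
    by_cases hu : u ∈ outVel Θ v₁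
    · rw [indicator_of_mem hu, transRate_eq hΘ hR hξ h₁ hu]
      rfl
    · rw [indicator_of_notMem hu, transRate_of_notMem fun h => hu h.2]
  rw [h1, hΘ.lintegral_outVel v₁ hgK, ← lintegral_indicator hS,
    ← lintegral_volSph_rot (R v₁) hm,
    ← lintegral_indicator (measurableSet_lt hin measurable_const)]
  refine lintegral_congr fun η => ?_
  have h2 : (rot (R v₁) η : E (n + 1)) 0 = ⟪(v₁ : E (n + 1)), (η : E (n + 1))⟫ :=
    hR.apply_zero_coord v₁ η
  by_cases h : ⟪(v₁ : E (n + 1)), (η : E (n + 1))⟫ < 0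
  · rw [indicator_of_mem (show η ∈ {η : Sph (n + 1) | ⟪(v₁ : E (n + 1)), (η : E (n + 1))⟫ < 0}
      from h),
      indicator_of_mem (show rot (R v₁) η ∈ {η : Sph (n + 1) | (η : E (n + 1)) 0 < 0} from
        h2.trans_lt h), h2]
  · rw [indicator_of_notMem
        (show η ∉ {η : Sph (n + 1) | ⟪(v₁ : E (n + 1)), (η : E (n + 1))⟫ < 0} from h),
      indicator_of_notMem (show rot (R v₁) η ∉ {η : Sph (n + 1) | (η : E (n + 1)) 0 < 0} from
        fun h' => h (h2.symm.trans_lt h'))]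

/-- The transition density is a probability density. -/
theorem lintegral_transRate (hΘ : IsScatteringMap Θ) (hR : IsFrame R) {v₀ v₁ : Sph (n + 1)}
    (h₁ : v₁ ∈ outVel Θ v₀) :
    ∫⁻ ξ, ∫⁻ v₂, transRate Θ R v₀ v₁ ξ v₂ ∂volSph (n + 1) = 1 := by
  rw [← lintegral_cylDens (exitPos_zero v₀ v₁) (norm_exitPos_lt hΘ hR h₁),
    ← lintegral_hemisphere_cylinder (measurable_cylDens _), ← lintegral_indicator measurableSet_Ioi]
  refine lintegral_congr fun ξ => ?_
  by_cases hξ : ξ ∈ Ioi (0 : ℝ)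
  · rw [indicator_of_mem hξ, lintegral_transRate_eq hΘ hR hξ h₁]
  · rw [indicator_of_notMem hξ]
    simp [transRate_of_nonpos (not_lt.1 hξ)]

/-- The density of the free path length is bounded. -/
theorem lintegral_transRate_le (hΘ : IsScatteringMap Θ) (hR : IsFrame R) (v₀ v₁ : Sph (n + 1))
    (ξ : ℝ) : ∫⁻ v₂, transRate Θ R v₀ v₁ ξ v₂ ∂volSph (n + 1) ≤ volSph (n + 1) univ := by
  by_cases h₁ : v₁ ∈ outVel Θ v₀
  · by_cases hξ : 0 < ξ
    · rw [lintegral_transRate_eq hΘ hR hξ h₁, ← lintegral_one]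
      refine (setLIntegral_le_lintegral _ _).trans (lintegral_mono fun η => ?_)
      refine mul_le_one' ?_ (missProb_le_one _ _ _)
      rw [← ENNReal.ofReal_one]
      refine ENNReal.ofReal_le_ofReal ?_
      exact (PiLp.norm_apply_le (η : E (n + 1)) 0).trans (norm_sph η).le
    · simp [transRate_of_nonpos (not_lt.1 hξ)]
  · simp [transRate_of_notMem fun h => h₁ h.1]

/-! ### Random paths: the tail of a path -/

section Tail

variable {d : ℕ}

/-- The path that starts with the free flight of `z` and continues with `y`. -/
def mkPath {N : ℕ} (z : Phase d) (y : Fin N → ℝ × Sph d) : Path d (N + 1) :=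
  (z.1, z.2.1, Fin.cons (z.2.2.1, z.2.2.2) y)

/-- The state directly after the collision that ends the flight of `z`, if the next flight has
length `a.1` and is followed by the velocity `a.2`. -/
def collide (z : Phase d) (a : ℝ × Sph d) : Phase d :=
  (z.1 + z.2.2.1 • (z.2.1 : E d), z.2.2.2, a.1, a.2)

/-- The state reached from `z` after time `t` of free flight. -/
def flow (t : ℝ) (z : Phase d) : Phase d := (z.1 + t • (z.2.1 : E d), z.2.1, z.2.2.1 - t, z.2.2.2)

namespace Path

variable {N : ℕ}

@[simp] lemma vel_mkPath_zero (z : Phase d) (y : Fin N → ℝ × Sph d) :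
    (mkPath z y).vel 0 = z.2.1 := rfl

@[simp] lemma vel_mkPath_one (z : Phase d) (y : Fin N → ℝ × Sph d) :
    (mkPath z y).vel 1 = z.2.2.2 := rfl

@[simp] lemma len_mkPath_zero (z : Phase d) (y : Fin N → ℝ × Sph d) :
    (mkPath z y).len 0 = z.2.2.1 := rfl

lemma vel_mkPath_succ (z : Phase d) (y : Fin N → ℝ × Sph d) {k : ℕ} (h : k < N) :
    (mkPath z y).vel (k + 2) = (y ⟨k, h⟩).2 := by
  rw [vel, dif_pos (Nat.succ_lt_succ h)]
  rfl

lemma len_mkPath_succ (z : Phase d) (y : Fin N → ℝ × Sph d) {k : ℕ} (h : k < N) :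
    (mkPath z y).len (k + 1) = (y ⟨k, h⟩).1 := by
  rw [len, dif_pos (Nat.succ_lt_succ h)]
  rfl

lemma len_mkPath_of_le (z : Phase d) (y : Fin N → ℝ × Sph d) {k : ℕ} (h : N ≤ k) :
    (mkPath z y).len (k + 1) = 0 := by
  rw [len, dif_neg (by omega)]

lemma vel_cons (z : Phase d) (a : ℝ × Sph d) (y : Fin N → ℝ × Sph d) {k : ℕ} (h : k ≤ N + 1) :
    (mkPath z (Fin.cons a y : Fin (N + 1) → ℝ × Sph d)).vel (k + 1) =
      (mkPath (collide z a) y).vel k := by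
  match k with
  | 0 => rfl
  | 1 => rfl
  | k + 2 =>
    rw [vel_mkPath_succ _ _ (show k < N by omega),
      vel_mkPath_succ _ _ (show k + 1 < N + 1 by omega)]
    rfl

lemma len_cons (z : Phase d) (a : ℝ × Sph d) (y : Fin N → ℝ × Sph d) (k : ℕ) :
    (mkPath z (Fin.cons a y : Fin (N + 1) → ℝ × Sph d)).len (k + 1) =
      (mkPath (collide z a) y).len k := by
  match k with
  | 0 => rfl
  | k + 1 =>
    by_cases h : k < N
    · rw [len_mkPath_succ _ _ h, len_mkPath_succ _ _ (Nat.succ_lt_succ h)]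
      rfl
    · rw [len_mkPath_of_le _ _ (not_lt.1 h), len_mkPath_of_le _ _ (by omega)]

lemma time_cons (z : Phase d) (a : ℝ × Sph d) (y : Fin N → ℝ × Sph d) (k : ℕ) :
    (mkPath z (Fin.cons a y : Fin (N + 1) → ℝ × Sph d)).time (k + 1) =
      z.2.2.1 + (mkPath (collide z a) y).time k := by
  rw [time, Finset.sum_range_succ', len_mkPath_zero, add_comm]
  simp only [len_cons, time]

lemma time_mkPath_zero (x : Path d N) : x.time 0 = 0 := by simp [time]

lemma time_mkPath_one (z : Phase d) (y : Fin N → ℝ × Sph d) :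
    (mkPath z y).time 1 = z.2.2.1 := by simp [time]

lemma state_mkPath_zero (z : Phase d) (y : Fin N → ℝ × Sph d) (t : ℝ) :
    (mkPath z y).state 0 t = flow t z := by
  have h : (mkPath z y).1 = z.1 := rfl
  simp [state, flow, time_mkPath_one, time_mkPath_zero, h]

lemma state_cons (z : Phase d) (a : ℝ × Sph d) (y : Fin N → ℝ × Sph d) {k : ℕ} (h : k ≤ N)
    (t : ℝ) : (mkPath z (Fin.cons a y : Fin (N + 1) → ℝ × Sph d)).state (k + 1) t =
      (mkPath (collide z a) y).state k (t - z.2.2.1) := by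
  have hsum : ∑ j ∈ Finset.range (k + 1),
      (mkPath z (Fin.cons a y : Fin (N + 1) → ℝ × Sph d)).len j •
        ((mkPath z (Fin.cons a y : Fin (N + 1) → ℝ × Sph d)).vel j : E d) =
      ∑ j ∈ Finset.range k, (mkPath (collide z a) y).len j •
        ((mkPath (collide z a) y).vel j : E d) + z.2.2.1 • (z.2.1 : E d) := by
    rw [Finset.sum_range_succ']
    congr 1
    refine Finset.sum_congr rfl fun j hj => ?_
    rw [len_cons, vel_cons _ _ _ (by have := Finset.mem_range.1 hj; omega)]
  simp only [state]
  rw [hsum, time_cons, time_cons, vel_cons _ _ _ (by omega), vel_cons _ _ _ (by omega)]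
  refine Prod.ext ?_ (Prod.ext rfl (Prod.ext ?_ rfl))
  · simp only [mkPath, collide]
    rw [sub_sub]
    abel
  · simp only
    ring

lemma measurable_vel (k : ℕ) : Measurable fun x : Path d N => x.vel k := by
  match k with
  | 0 => exact measurable_fst.comp measurable_snd
  | k + 1 =>
    simp only [vel]
    split_ifs with h
    · exact measurable_snd.comp ((measurable_pi_apply _).comp (measurable_snd.comp measurable_snd))
    · exact measurable_fst.comp measurable_snd

lemma measurable_len (k : ℕ) : Measurable fun x : Path d N => x.len k := by
  simp only [len]
  split_ifs with h
  · exact measurable_fst.comp ((measurable_pi_apply _).comp (measurable_snd.comp measurable_snd))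
  · exact measurable_const

lemma measurable_time (k : ℕ) : Measurable fun x : Path d N => x.time k :=
  Finset.measurable_sum _ fun j _ => measurable_len j

lemma measurable_state (k : ℕ) (t : ℝ) : Measurable fun x : Path d N => x.state k t := by
  have hv : ∀ j, Measurable fun x : Path d N => (x.vel j : E d) := fun j =>
    measurable_subtype_coe.comp (measurable_vel j)
  refine Measurable.prodMk ?_ ((measurable_vel k).prodMk
    (((measurable_time (k + 1)).sub_const t).prodMk (measurable_vel (k + 1))))
  refine (measurable_fst.add
    (Finset.measurable_sum _ fun j _ => (measurable_len j).smul (hv j))).add ?_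
  exact (measurable_const.sub (measurable_time k)).smul (hv k)

end Path

lemma measurable_mkPath {N : ℕ} :
    Measurable fun p : Phase d × (Fin N → ℝ × Sph d) => mkPath p.1 p.2 := by
  refine Measurable.prodMk (by fun_prop) (Measurable.prodMk (by fun_prop) ?_)
  refine measurable_pi_iff.2 fun i => ?_
  refine Fin.cases ?_ (fun i => ?_) i
  · simp only [Fin.cons_zero]
    fun_prop
  · simp only [Fin.cons_succ]
    fun_prop

/-- Lebesgue measure times surface measure: the reference measure for a free path length and the
velocity that follows. -/
def stepMeasure (d : ℕ) : Measure (ℝ × Sph d) := (volume : Measure ℝ).prod (volSph d)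

instance (d : ℕ) : SigmaFinite (stepMeasure d) := by unfold stepMeasure; infer_instance

/-- The reference measure for the tails of paths. -/
def tailMeasure (d N : ℕ) : Measure (Fin N → ℝ × Sph d) := Measure.pi fun _ => stepMeasure d

instance (d N : ℕ) : SigmaFinite (tailMeasure d N) := by unfold tailMeasure; infer_instance

lemma lintegral_tailMeasure_succ {N : ℕ} {h : (Fin (N + 1) → ℝ × Sph d) → ℝ≥0∞}
    (hh : Measurable h) : ∫⁻ y, h y ∂tailMeasure d (N + 1) =
      ∫⁻ a, ∫⁻ y, h (Fin.cons a y) ∂tailMeasure d N ∂stepMeasure d := by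
  have hp := (measurePreserving_piFinSuccAbove (fun _ : Fin (N + 1) => stepMeasure d) 0).symm
    (MeasurableEquiv.piFinSuccAbove (fun _ : Fin (N + 1) => ℝ × Sph d) 0)
  have hm : Measurable fun p : (ℝ × Sph d) × (Fin N → ℝ × Sph d) =>
      h ((MeasurableEquiv.piFinSuccAbove (fun _ : Fin (N + 1) => ℝ × Sph d) 0).symm p) :=
    hh.comp (MeasurableEquiv.measurable _)
  rw [tailMeasure, ← hp.lintegral_comp hh, lintegral_prod _ hm.aemeasurable]
  refine lintegral_congr fun a => lintegral_congr fun y => ?_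
  simp [MeasurableEquiv.piFinSuccAbove, Fin.insertNthEquiv]

/-- The product of the transition densities along a path. -/
def tailWeight (q : Sph d → Sph d → ℝ → Sph d → ℝ≥0∞) {N : ℕ} (x : Path d (N + 1)) : ℝ≥0∞ :=
  ∏ j ∈ Finset.range N, q (x.vel j) (x.vel (j + 1)) (x.len (j + 1)) (x.vel (j + 2))

/-- The integral of `G` over all continuations of the free flight of `z` by `N` further free
flights, weighted by the transition densities. -/
def tailInt (q : Sph d → Sph d → ℝ → Sph d → ℝ≥0∞) (N : ℕ) (G : Path d (N + 1) → ℝ≥0∞)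
    (z : Phase d) : ℝ≥0∞ :=
  ∫⁻ y, tailWeight q (mkPath z y) * G (mkPath z y) ∂tailMeasure d N

/-- The properties of a transition density used in the construction of the process. -/
structure IsTransRate (Θ : Sph d × Sph d → Sph d × Sph d)
    (q : Sph d → Sph d → ℝ → Sph d → ℝ≥0∞) : Prop where
  measurableSet_outPairs : MeasurableSet (outPairs Θ)
  measurable : Measurable fun p : (Sph d × Sph d) × ℝ × Sph d => q p.1.1 p.1.2 p.2.1 p.2.2
  eq_zero_of_nonpos : ∀ v w ξ u, ξ ≤ 0 → q v w ξ u = 0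
  eq_zero_of_notMem : ∀ v w ξ u, ¬(w ∈ outVel Θ v ∧ u ∈ outVel Θ w) → q v w ξ u = 0
  lintegral_eq_one : ∀ v w, w ∈ outVel Θ v → ∫⁻ ξ, ∫⁻ u, q v w ξ u ∂volSph d = 1
  lintegral_le : ∀ v w ξ, ∫⁻ u, q v w ξ u ∂volSph d ≤ volSph d univ

variable {Θ : Sph d × Sph d → Sph d × Sph d} {q : Sph d → Sph d → ℝ → Sph d → ℝ≥0∞}

lemma IsTransRate.measurable_comp (hq : IsTransRate Θ q) {α : Type*} [MeasurableSpace α]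
    {v w u : α → Sph d} {ξ : α → ℝ} (hv : Measurable v) (hw : Measurable w) (hξ : Measurable ξ)
    (hu : Measurable u) : Measurable fun x => q (v x) (w x) (ξ x) (u x) :=
  Measurable.comp (g := fun p : (Sph d × Sph d) × ℝ × Sph d => q p.1.1 p.1.2 p.2.1 p.2.2)
    (f := fun x => ((v x, w x), (ξ x, u x))) hq.measurable ((hv.prodMk hw).prodMk (hξ.prodMk hu))

lemma IsTransRate.measurable_tailWeight (hq : IsTransRate Θ q) {N : ℕ} :
    Measurable fun x : Path d (N + 1) => tailWeight q x :=
  Finset.measurable_prod _ fun j _ => hq.measurable_comp (Path.measurable_vel j)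
    (Path.measurable_vel _) (Path.measurable_len _) (Path.measurable_vel _)

lemma tailWeight_cons {N : ℕ} (z : Phase d) (a : ℝ × Sph d) (y : Fin N → ℝ × Sph d) :
    tailWeight q (mkPath z (Fin.cons a y : Fin (N + 1) → ℝ × Sph d)) =
      q z.2.1 z.2.2.2 a.1 a.2 * tailWeight q (mkPath (collide z a) y) := by
  rw [tailWeight, Finset.prod_range_succ', mul_comm, tailWeight]
  refine congrArg₂ _ rfl (Finset.prod_congr rfl fun j hj => ?_)
  have := Finset.mem_range.1 hj
  rw [Path.vel_cons _ _ _ (by omega), Path.vel_cons _ _ _ (by omega),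
    Path.vel_cons _ _ _ (by omega), Path.len_cons]

lemma measurable_mkPath_left {N : ℕ} (z : Phase d) :
    Measurable fun y : Fin N → ℝ × Sph d => mkPath z y :=
  measurable_mkPath.comp measurable_prodMk_left

lemma IsTransRate.measurable_tailInt (hq : IsTransRate Θ q) {N : ℕ} {G : Path d (N + 1) → ℝ≥0∞}
    (hG : Measurable G) : Measurable (tailInt q N G) :=
  Measurable.lintegral_prod_right' (f := fun p : Phase d × (Fin N → ℝ × Sph d) =>
    tailWeight q (mkPath p.1 p.2) * G (mkPath p.1 p.2))
    ((hq.measurable_tailWeight.comp measurable_mkPath).mul (hG.comp measurable_mkPath))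

lemma tailInt_zero (G : Path d 1 → ℝ≥0∞) (z : Phase d) :
    tailInt q 0 G z = G (mkPath z default) := by
  rw [tailInt, tailMeasure, Measure.pi_of_empty _ default, lintegral_dirac]
  simp [tailWeight]

/-- Integration over the first of the remaining free flights. -/
lemma IsTransRate.tailInt_succ (hq : IsTransRate Θ q) {N : ℕ} {G : Path d (N + 2) → ℝ≥0∞}
    (hG : Measurable G) {G' : (ℝ × Sph d) → Path d (N + 1) → ℝ≥0∞} {z : Phase d}
    (hG' : ∀ a, Measurable (G' a)) (h : ∀ (a : ℝ × Sph d) (y : Fin N → ℝ × Sph d),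
      G (mkPath z (Fin.cons a y : Fin (N + 1) → ℝ × Sph d)) = G' a (mkPath (collide z a) y)) :
    tailInt q (N + 1) G z = ∫⁻ a, q z.2.1 z.2.2.2 a.1 a.2 *
      tailInt q N (G' a) (collide z a) ∂stepMeasure d := by
  have hm : Measurable fun y : Fin (N + 1) → ℝ × Sph d =>
      tailWeight q (mkPath z y) * G (mkPath z y) :=
    (hq.measurable_tailWeight.comp (measurable_mkPath_left z)).mul
      (hG.comp (measurable_mkPath_left z))
  rw [tailInt, lintegral_tailMeasure_succ hm]
  refine lintegral_congr fun a => ?_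
  rw [tailInt, ← lintegral_const_mul]
  · refine lintegral_congr fun y => ?_
    rw [tailWeight_cons, h, mul_assoc]
  · exact (hq.measurable_tailWeight.comp (measurable_mkPath_left _)).mul
      ((hG' a).comp (measurable_mkPath_left _))

lemma mkPath_mem_pathSpace_iff {N : ℕ} (z : Phase d) (y : Fin N → ℝ × Sph d) :
    mkPath z y ∈ pathSpace Θ (N + 1) ↔ z ∈ extPhase Θ ∧ ∀ j < N, 0 ≤ (mkPath z y).len (j + 1) ∧
      (mkPath z y).vel (j + 2) ∈ outVel Θ ((mkPath z y).vel (j + 1)) := by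
  constructor
  · intro h
    exact ⟨h 0 (Nat.succ_pos _), fun j hj => h (j + 1) (Nat.succ_lt_succ hj)⟩
  · rintro ⟨h0, h⟩ j hj
    match j with
    | 0 => exact h0
    | j + 1 => exact h j (Nat.lt_of_succ_lt_succ hj)

lemma IsTransRate.mem_pathSpace (hq : IsTransRate Θ q) {N : ℕ} {z : Phase d}
    {y : Fin N → ℝ × Sph d} (hz : z ∈ extPhase Θ) (h : tailWeight q (mkPath z y) ≠ 0) :
    mkPath z y ∈ pathSpace Θ (N + 1) := by
  refine (mkPath_mem_pathSpace_iff z y).2 ⟨hz, fun j hj => ?_⟩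
  have hj' := Finset.prod_ne_zero_iff.1 h j (Finset.mem_range.2 hj)
  constructor
  · by_contra hneg
    exact hj' (hq.eq_zero_of_nonpos _ _ _ _ (not_le.1 hneg).le)
  · by_contra hneg
    exact hj' (hq.eq_zero_of_notMem _ _ _ _ fun hh => hneg hh.2)

lemma IsTransRate.measurableSet_extPhase (hq : IsTransRate Θ q) : MeasurableSet (extPhase Θ) := by
  have h1 : Measurable fun z : Phase d => z.2.2.1 := by fun_prop
  have h2 : Measurable fun z : Phase d => (z.2.1, z.2.2.2) := by fun_prop
  exact (measurableSet_le measurable_const h1).inter (hq.measurableSet_outPairs.preimage h2)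

lemma IsTransRate.measurableSet_pathSpace (hq : IsTransRate Θ q) (N : ℕ) :
    MeasurableSet (pathSpace Θ N) := by
  have : pathSpace Θ N = ⋂ j, ⋂ (_ : j < N), {x : Path d N | 0 ≤ x.len j} ∩
      {x | (x.vel j, x.vel (j + 1)) ∈ outPairs Θ} := by
    ext x
    simp [pathSpace, outPairs]
  rw [this]
  exact MeasurableSet.iInter fun j => MeasurableSet.iInter fun _ =>
    (measurableSet_le measurable_const (Path.measurable_len j)).inter
      (hq.measurableSet_outPairs.preimage ((Path.measurable_vel j).prodMk (Path.measurable_vel _)))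

/-- The reference measure on all quadruples. -/
def phaseMeasure (d : ℕ) : Measure (Phase d) :=
  (volume : Measure (E d)).prod ((volSph d).prod (stepMeasure d))

instance (d : ℕ) : SigmaFinite (phaseMeasure d) := by unfold phaseMeasure; infer_instance

lemma sigma1_eq : sigma1 Θ = (phaseMeasure d).restrict (extPhase Θ) := rfl

instance : SigmaFinite (sigma1 Θ) := by rw [sigma1_eq]; infer_instance

lemma lintegral_phaseMeasure {F : Phase d → ℝ≥0∞} (hF : Measurable F) :
    ∫⁻ z, F z ∂phaseMeasure d =
      ∫⁻ Q, ∫⁻ v, ∫⁻ a, F (Q, v, a) ∂stepMeasure d ∂volSph d := by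
  rw [phaseMeasure, lintegral_prod _ hF.aemeasurable]
  refine lintegral_congr fun Q => ?_
  rw [lintegral_prod]
  exact (hF.comp measurable_prodMk_left).aemeasurable

/-- The first free flight `(Q₀, v₀, ξ₁, v₁)` of a path. -/
def Path.head {N : ℕ} (x : Path d (N + 1)) : Phase d := (x.1, x.vel 0, x.len 0, x.vel 1)

lemma Path.measurable_head {N : ℕ} : Measurable (Path.head (d := d) (N := N)) :=
  measurable_fst.prodMk ((measurable_vel 0).prodMk ((measurable_len 0).prodMk (measurable_vel 1)))

/-- Integrals over paths in terms of integrals over their tails. -/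
theorem IsTransRate.lintegral_sigmaN (hq : IsTransRate Θ q) {N : ℕ} {F : Phase d → ℝ≥0∞}
    (hF : Measurable F) {G : Path d (N + 1) → ℝ≥0∞} (hG : Measurable G) :
    ∫⁻ x, F x.head * tailWeight q x * G x ∂sigmaN Θ (N + 1) =
      ∫⁻ z, F z * tailInt q N G z ∂sigma1 Θ := by
  have hX := hq.measurableSet_extPhase
  have hX' := hq.measurableSet_pathSpace (N + 1)
  let H : Path d (N + 1) → ℝ≥0∞ := (pathSpace Θ (N + 1)).indicator fun x =>
    F x.head * tailWeight q x * G x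
  have hH : Measurable H :=
    (((hF.comp Path.measurable_head).mul hq.measurable_tailWeight).mul hG).indicator hX'
  -- off the path space the product of the transition densities vanishes
  have h1 : ∀ z (y : Fin N → ℝ × Sph d), H (mkPath z y) = (extPhase Θ).indicator F z *
      (tailWeight q (mkPath z y) * G (mkPath z y)) := by
    intro z y
    by_cases hz : z ∈ extPhase Θ
    · rw [indicator_of_mem hz]
      by_cases h0 : tailWeight q (mkPath z y) = 0
      · simp only [H]
        rw [h0, zero_mul, mul_zero, indicator_apply_eq_zero]
        intro _
        rw [h0, mul_zero, zero_mul]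
      · simp only [H]
        rw [indicator_of_mem (hq.mem_pathSpace hz h0), mul_assoc]
        rfl
    · rw [indicator_of_notMem hz, zero_mul]
      exact indicator_of_notMem (fun h => hz ((mkPath_mem_pathSpace_iff z y).1 h).1) _
  have hm : Measurable fun z => (extPhase Θ).indicator F z * tailInt q N G z :=
    (hF.indicator hX).mul (hq.measurable_tailInt hG)
  have h2 : ∫⁻ z, F z * tailInt q N G z ∂sigma1 Θ =
      ∫⁻ z, (extPhase Θ).indicator F z * tailInt q N G z ∂phaseMeasure d := by
    rw [sigma1_eq, ← lintegral_indicator hX]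
    refine lintegral_congr fun z => ?_
    by_cases hz : z ∈ extPhase Θ
    · rw [indicator_of_mem hz, indicator_of_mem hz]
    · rw [indicator_of_notMem hz, indicator_of_notMem hz, zero_mul]
  rw [h2, lintegral_phaseMeasure hm, sigmaN, ← lintegral_indicator hX']
  change ∫⁻ x, H x ∂(volume : Measure (E d)).prod ((volSph d).prod (tailMeasure d (N + 1))) = _
  rw [lintegral_prod _ hH.aemeasurable]
  refine lintegral_congr fun Q => ?_
  have hHQ : Measurable fun p : Sph d × (Fin (N + 1) → ℝ × Sph d) => H (Q, p) :=
    hH.comp measurable_prodMk_left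
  rw [lintegral_prod _ hHQ.aemeasurable]
  refine lintegral_congr fun v => ?_
  have hHv : Measurable fun p : Fin (N + 1) → ℝ × Sph d => H (Q, v, p) :=
    hHQ.comp measurable_prodMk_left
  rw [lintegral_tailMeasure_succ hHv]
  refine lintegral_congr fun a => ?_
  rw [tailInt, ← lintegral_const_mul]
  · exact lintegral_congr fun y => h1 (Q, v, a) y
  · exact (hq.measurable_tailWeight.comp (measurable_mkPath_left _)).mul
      (hG.comp (measurable_mkPath_left _))

end Tail

/-! ### The transition operators -/

section Evolve

variable {d : ℕ} {Θ : Sph d × Sph d → Sph d × Sph d} {q : Sph d → Sph d → ℝ → Sph d → ℝ≥0∞}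

/-- The states whose free flight lasts longer than `t`. -/
def freeSet (Θ : Sph d × Sph d → Sph d × Sph d) (t : ℝ) : Set (Phase d) :=
  extPhase Θ ∩ {z | t < z.2.2.1}

/-- The states whose free flight ends not later than at time `t`. -/
def hitSet (Θ : Sph d × Sph d → Sph d × Sph d) (t : ℝ) : Set (Phase d) :=
  extPhase Θ ∩ {z | z.2.2.1 ≤ t}

/-- The expectation of `g` at the state at time `t` of the process started at `z`, on the event that
exactly `n` collisions occur up to time `t`. -/
def evolveN (Θ : Sph d × Sph d → Sph d × Sph d) (q : Sph d → Sph d → ℝ → Sph d → ℝ≥0∞) :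
    ℕ → (Phase d → ℝ≥0∞) → ℝ → Phase d → ℝ≥0∞
  | 0, g, t, z => (freeSet Θ t).indicator (fun z => g (flow t z)) z
  | n + 1, g, t, z => (hitSet Θ t).indicator (fun z => ∫⁻ a, q z.2.1 z.2.2.2 a.1 a.2 *
      evolveN Θ q n g (t - z.2.2.1) (collide z a) ∂stepMeasure d) z

/-- The transition operator: the expectation of `g` at the state at time `t` of the process started
at `z`. -/
def evolve (Θ : Sph d × Sph d → Sph d × Sph d) (q : Sph d → Sph d → ℝ → Sph d → ℝ≥0∞)
    (g : Phase d → ℝ≥0∞) (t : ℝ) (z : Phase d) : ℝ≥0∞ := ∑' n, evolveN Θ q n g t z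

lemma evolveN_zero_of_mem {g : Phase d → ℝ≥0∞} {t : ℝ} {z : Phase d} (h : z ∈ freeSet Θ t) :
    evolveN Θ q 0 g t z = g (flow t z) := indicator_of_mem h _

lemma evolveN_zero_of_notMem {g : Phase d → ℝ≥0∞} {t : ℝ} {z : Phase d} (h : z ∉ freeSet Θ t) :
    evolveN Θ q 0 g t z = 0 := indicator_of_notMem h _

lemma evolveN_succ_of_mem {n : ℕ} {g : Phase d → ℝ≥0∞} {t : ℝ} {z : Phase d}
    (h : z ∈ hitSet Θ t) : evolveN Θ q (n + 1) g t z = ∫⁻ a, q z.2.1 z.2.2.2 a.1 a.2 *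
      evolveN Θ q n g (t - z.2.2.1) (collide z a) ∂stepMeasure d := indicator_of_mem h _

lemma evolveN_succ_of_notMem {n : ℕ} {g : Phase d → ℝ≥0∞} {t : ℝ} {z : Phase d}
    (h : z ∉ hitSet Θ t) : evolveN Θ q (n + 1) g t z = 0 := indicator_of_notMem h _

lemma notMem_freeSet_of_mem_hitSet {t : ℝ} {z : Phase d} (h : z ∈ hitSet Θ t) :
    z ∉ freeSet Θ t := by
  intro h'
  have h1 : t < z.2.2.1 := h'.2
  have h2 : z.2.2.1 ≤ t := h.2
  exact h1.not_ge h2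

lemma notMem_hitSet_of_mem_freeSet {t : ℝ} {z : Phase d} (h : z ∈ freeSet Θ t) :
    z ∉ hitSet Θ t := fun h' =>
  notMem_freeSet_of_mem_hitSet h' h

lemma mem_freeSet_or_mem_hitSet {z : Phase d} (hz : z ∈ extPhase Θ) (t : ℝ) :
    z ∈ freeSet Θ t ∨ z ∈ hitSet Θ t := by
  rcases lt_or_ge t z.2.2.1 with h | h
  · exact Or.inl ⟨hz, h⟩
  · exact Or.inr ⟨hz, h⟩

lemma evolveN_of_notMem {n : ℕ} {g : Phase d → ℝ≥0∞} {t : ℝ} {z : Phase d}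
    (h : z ∉ extPhase Θ) : evolveN Θ q n g t z = 0 := by
  cases n with
  | zero => exact evolveN_zero_of_notMem fun h' => h h'.1
  | succ n => exact evolveN_succ_of_notMem fun h' => h h'.1

lemma evolve_of_notMem {g : Phase d → ℝ≥0∞} {t : ℝ} {z : Phase d}
    (h : z ∉ extPhase Θ) : evolve Θ q g t z = 0 :=
  ENNReal.tsum_eq_zero.2 fun _ => evolveN_of_notMem h

@[fun_prop] lemma measurable_flow : Measurable fun p : ℝ × Phase d => flow p.1 p.2 := by
  unfold flow
  fun_prop

lemma measurable_flow_right (t : ℝ) : Measurable (flow (d := d) t) :=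
  measurable_flow.comp measurable_prodMk_left

@[fun_prop] lemma measurable_collide :
    Measurable fun p : Phase d × (ℝ × Sph d) => collide p.1 p.2 := by
  unfold collide
  fun_prop

lemma measurable_collide_right (z : Phase d) : Measurable (collide z) :=
  measurable_collide.comp measurable_prodMk_left

lemma flow_mem_extPhase {t : ℝ} {z : Phase d} (h : z ∈ freeSet Θ t) : flow t z ∈ extPhase Θ :=
  ⟨(sub_pos.2 h.2).le, h.1.2⟩

lemma collide_flow (t : ℝ) (z : Phase d) (a : ℝ × Sph d) :
    collide (flow t z) a = collide z a := by
  refine Prod.ext ?_ rfl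
  simp only [collide, flow]
  rw [add_assoc, ← add_smul, add_sub_cancel]

lemma flow_flow (s t : ℝ) (z : Phase d) : flow t (flow s z) = flow (s + t) z := by
  refine Prod.ext ?_ (Prod.ext rfl (Prod.ext ?_ rfl))
  · simp only [flow]
    rw [add_assoc, ← add_smul]
  · simp only [flow]
    ring

namespace IsTransRate

lemma measurable_step (hq : IsTransRate Θ q) (z : Phase d) :
    Measurable fun a : ℝ × Sph d => q z.2.1 z.2.2.2 a.1 a.2 :=
  hq.measurable_comp measurable_const measurable_const measurable_fst measurable_snd

lemma measurable_evolveN (hq : IsTransRate Θ q) (n : ℕ) {g : Phase d → ℝ≥0∞}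
    (hg : Measurable g) : Measurable fun p : ℝ × Phase d => evolveN Θ q n g p.1 p.2 := by
  have hξ : Measurable fun p : ℝ × Phase d => p.2.2.2.1 := by fun_prop
  have hX : MeasurableSet {p : ℝ × Phase d | p.2 ∈ extPhase Θ} :=
    hq.measurableSet_extPhase.preimage measurable_snd
  induction n with
  | zero =>
    have hS : MeasurableSet {p : ℝ × Phase d | p.2 ∈ freeSet Θ p.1} :=
      hX.inter (measurableSet_lt measurable_fst hξ)
    exact (hg.comp measurable_flow).indicator hS
  | succ n ih =>
    have hS : MeasurableSet {p : ℝ × Phase d | p.2 ∈ hitSet Θ p.1} :=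
      hX.inter (measurableSet_le hξ measurable_fst)
    refine Measurable.indicator (f := fun p : ℝ × Phase d => ∫⁻ a, q p.2.2.1 p.2.2.2.2 a.1 a.2 *
      evolveN Θ q n g (p.1 - p.2.2.2.1) (collide p.2 a) ∂stepMeasure d) ?_ hS
    refine Measurable.lintegral_prod_right' (f := fun x : (ℝ × Phase d) × (ℝ × Sph d) =>
      q x.1.2.2.1 x.1.2.2.2.2 x.2.1 x.2.2 *
        evolveN Θ q n g (x.1.1 - x.1.2.2.2.1) (collide x.1.2 x.2)) ?_
    refine (hq.measurable_comp (by fun_prop) (by fun_prop) (by fun_prop) (by fun_prop)).mul ?_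
    exact Measurable.comp (g := fun p : ℝ × Phase d => evolveN Θ q n g p.1 p.2)
      (f := fun x : (ℝ × Phase d) × (ℝ × Sph d) => (x.1.1 - x.1.2.2.2.1, collide x.1.2 x.2))
      ih (by fun_prop)

lemma measurable_evolveN_right (hq : IsTransRate Θ q) (n : ℕ) {g : Phase d → ℝ≥0∞}
    (hg : Measurable g) (t : ℝ) : Measurable (evolveN Θ q n g t) :=
  Measurable.comp (g := fun p : ℝ × Phase d => evolveN Θ q n g p.1 p.2) (f := fun z => (t, z))
    (hq.measurable_evolveN n hg) measurable_prodMk_left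

lemma measurable_evolve (hq : IsTransRate Θ q) {g : Phase d → ℝ≥0∞}
    (hg : Measurable g) (t : ℝ) : Measurable (evolve Θ q g t) :=
  Measurable.tsum fun n => hq.measurable_evolveN_right n hg t

lemma measurable_evolveN_step (hq : IsTransRate Θ q) (n : ℕ) {g : Phase d → ℝ≥0∞}
    (hg : Measurable g) (t : ℝ) (z : Phase d) : Measurable fun a : ℝ × Sph d =>
      q z.2.1 z.2.2.2 a.1 a.2 * evolveN Θ q n g t (collide z a) :=
  (hq.measurable_step z).mul
    ((hq.measurable_evolveN_right n hg t).comp (measurable_collide_right z))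

lemma evolveN_tsum (hq : IsTransRate Θ q) {ι : Type*} [Countable ι] (n : ℕ)
    {g : ι → Phase d → ℝ≥0∞} (hg : ∀ i, Measurable (g i)) (t : ℝ) (z : Phase d) :
    evolveN Θ q n (fun z => ∑' i, g i z) t z = ∑' i, evolveN Θ q n (g i) t z := by
  induction n generalizing t z with
  | zero =>
    by_cases h : z ∈ freeSet Θ t
    · simp_rw [evolveN_zero_of_mem h]
    · simp_rw [evolveN_zero_of_notMem h, tsum_zero]
  | succ n ih =>
    by_cases h : z ∈ hitSet Θ t
    · simp_rw [evolveN_succ_of_mem h, ih, ← ENNReal.tsum_mul_left]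
      exact lintegral_tsum fun i => (hq.measurable_evolveN_step n (hg i) _ z).aemeasurable
    · simp_rw [evolveN_succ_of_notMem h, tsum_zero]

lemma evolve_tsum (hq : IsTransRate Θ q) {ι : Type*} [Countable ι]
    {g : ι → Phase d → ℝ≥0∞} (hg : ∀ i, Measurable (g i)) (t : ℝ) (z : Phase d) :
    evolve Θ q (fun z => ∑' i, g i z) t z = ∑' i, evolve Θ q (g i) t z := by
  simp_rw [evolve, hq.evolveN_tsum _ hg]
  exact ENNReal.tsum_comm

lemma evolveN_const_mul (hq : IsTransRate Θ q) (n : ℕ) (c : ℝ≥0∞)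
    {g : Phase d → ℝ≥0∞} (hg : Measurable g) (t : ℝ) (z : Phase d) :
    evolveN Θ q n (fun z => c * g z) t z = c * evolveN Θ q n g t z := by
  induction n generalizing t z with
  | zero =>
    by_cases h : z ∈ freeSet Θ t
    · simp_rw [evolveN_zero_of_mem h]
    · simp_rw [evolveN_zero_of_notMem h, mul_zero]
  | succ n ih =>
    by_cases h : z ∈ hitSet Θ t
    · simp_rw [evolveN_succ_of_mem h, ih]
      rw [← lintegral_const_mul _ (hq.measurable_evolveN_step n hg _ z)]
      exact lintegral_congr fun a => mul_left_comm _ _ _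
    · simp_rw [evolveN_succ_of_notMem h, mul_zero]

end IsTransRate

lemma evolveN_mono {n : ℕ} {g h : Phase d → ℝ≥0∞} (hgh : ∀ z ∈ extPhase Θ, g z ≤ h z) (t : ℝ)
    (z : Phase d) : evolveN Θ q n g t z ≤ evolveN Θ q n h t z := by
  induction n generalizing t z with
  | zero =>
    by_cases hz : z ∈ freeSet Θ t
    · rw [evolveN_zero_of_mem hz, evolveN_zero_of_mem hz]
      exact hgh _ (flow_mem_extPhase hz)
    · rw [evolveN_zero_of_notMem hz, evolveN_zero_of_notMem hz]
  | succ n ih =>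
    by_cases hz : z ∈ hitSet Θ t
    · rw [evolveN_succ_of_mem hz, evolveN_succ_of_mem hz]
      exact lintegral_mono fun a => mul_le_mul_right (ih _ _) _
    · rw [evolveN_succ_of_notMem hz, evolveN_succ_of_notMem hz]

lemma evolve_mono {g h : Phase d → ℝ≥0∞} (hgh : ∀ z ∈ extPhase Θ, g z ≤ h z) (t : ℝ)
    (z : Phase d) : evolve Θ q g t z ≤ evolve Θ q h t z :=
  ENNReal.tsum_le_tsum fun _ => evolveN_mono hgh t z

lemma evolve_congr {g h : Phase d → ℝ≥0∞} (hgh : ∀ z ∈ extPhase Θ, g z = h z) (t : ℝ)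
    (z : Phase d) : evolve Θ q g t z = evolve Θ q h t z :=
  le_antisymm (evolve_mono (fun z hz => (hgh z hz).le) t z)
    (evolve_mono (fun z hz => (hgh z hz).ge) t z)

namespace IsTransRate

/-- The Chapman-Kolmogorov equation, sorted by the number of collisions. -/
lemma evolveN_add (hq : IsTransRate Θ q) (n : ℕ) {g : Phase d → ℝ≥0∞} (hg : Measurable g)
    {s t : ℝ} (hs : 0 ≤ s) (ht : 0 ≤ t) (z : Phase d) :
    evolveN Θ q n g (s + t) z =
      ∑ p ∈ Finset.HasAntidiagonal.antidiagonal n, evolveN Θ q p.1 (evolveN Θ q p.2 g t) s z := by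
  by_cases hz : z ∈ extPhase Θ
  swap
  · rw [evolveN_of_notMem hz]
    exact (Finset.sum_eq_zero fun p _ => evolveN_of_notMem hz).symm
  induction n generalizing s z with
  | zero =>
    rw [Finset.Nat.antidiagonal_zero, Finset.sum_singleton]
    by_cases h : z ∈ freeSet Θ (s + t)
    · have h2 : s + t < z.2.2.1 := h.2
      have hs' : z ∈ freeSet Θ s := ⟨hz, show s < z.2.2.1 by linarith⟩
      have ht' : flow s z ∈ freeSet Θ t :=
        ⟨flow_mem_extPhase hs', show t < z.2.2.1 - s by linarith⟩
      rw [evolveN_zero_of_mem h, evolveN_zero_of_mem hs', evolveN_zero_of_mem ht', flow_flow]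
    · rw [evolveN_zero_of_notMem h]
      by_cases hs' : z ∈ freeSet Θ s
      · rw [evolveN_zero_of_mem hs', evolveN_zero_of_notMem]
        intro h'
        have h2 : t < z.2.2.1 - s := h'.2
        exact h ⟨hz, show s + t < z.2.2.1 by linarith⟩
      · rw [evolveN_zero_of_notMem hs']
  | succ n ih =>
    rw [Finset.Nat.sum_antidiagonal_succ]
    -- no collision up to time `s`: all collisions fall in the second time interval; otherwise
    -- condition on the first one
    rcases mem_freeSet_or_mem_hitSet hz s with h | h
    · rw [evolveN_zero_of_mem h, Finset.sum_eq_zero fun p _ =>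
        evolveN_succ_of_notMem (notMem_hitSet_of_mem_freeSet h), add_zero]
      by_cases h' : z ∈ hitSet Θ (s + t)
      · have h3 : z.2.2.1 ≤ s + t := h'.2
        have h2 : flow s z ∈ hitSet Θ t :=
          ⟨flow_mem_extPhase h, show z.2.2.1 - s ≤ t by linarith⟩
        rw [evolveN_succ_of_mem h', evolveN_succ_of_mem h2]
        refine lintegral_congr fun a => ?_
        rw [collide_flow]
        simp only [flow]
        rw [show t - (z.2.2.1 - s) = s + t - z.2.2.1 by ring]
      · rw [evolveN_succ_of_notMem h', evolveN_succ_of_notMem]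
        intro h2
        have h3 : z.2.2.1 - s ≤ t := h2.2
        exact h' ⟨hz, show z.2.2.1 ≤ s + t by linarith⟩
    · have h4 : z.2.2.1 ≤ s := h.2
      have h' : z ∈ hitSet Θ (s + t) := ⟨hz, show z.2.2.1 ≤ s + t by linarith⟩
      rw [evolveN_zero_of_notMem (notMem_freeSet_of_mem_hitSet h), zero_add, evolveN_succ_of_mem h']
      have h3 : ∀ p ∈ Finset.HasAntidiagonal.antidiagonal n,
          evolveN Θ q (p.1 + 1) (evolveN Θ q p.2 g t) s z = ∫⁻ a, q z.2.1 z.2.2.2 a.1 a.2 *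
            evolveN Θ q p.1 (evolveN Θ q p.2 g t) (s - z.2.2.1) (collide z a) ∂stepMeasure d :=
        fun p _ => evolveN_succ_of_mem h
      rw [Finset.sum_congr rfl h3, ← lintegral_finsetSum]
      · refine lintegral_congr fun a => ?_
        rw [← Finset.mul_sum]
        by_cases ha : collide z a ∈ extPhase Θ
        · rw [← ih (sub_nonneg.2 h4) _ ha, show s + t - z.2.2.1 = s - z.2.2.1 + t by ring]
        · rw [evolveN_of_notMem ha, Finset.sum_eq_zero fun p _ => evolveN_of_notMem ha]
      · exact fun p _ => hq.measurable_evolveN_step _ (hq.measurable_evolveN_right _ hg t) _ z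

/-- The semigroup property of the transition operators. -/
theorem evolve_add (hq : IsTransRate Θ q) {g : Phase d → ℝ≥0∞} (hg : Measurable g)
    {s t : ℝ} (hs : 0 ≤ s) (ht : 0 ≤ t) (z : Phase d) :
    evolve Θ q g (s + t) z = evolve Θ q (evolve Θ q g t) s z := by
  have h1 : evolve Θ q g t = fun z => ∑' n, evolveN Θ q n g t z := rfl
  rw [h1, evolve, evolve]
  simp_rw [hq.evolveN_tsum _ (fun n => hq.measurable_evolveN_right n hg t),
    hq.evolveN_add _ hg hs ht]
  rw [← ENNReal.tsum_prod, ← (Finset.HasAntidiagonal.sigmaAntidiagonalEquivProd (A := ℕ)).tsum_eq,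
    ENNReal.tsum_sigma']
  refine tsum_congr fun n => ?_
  rw [tsum_fintype]
  exact (Finset.sum_coe_sort (Finset.HasAntidiagonal.antidiagonal n) fun p : ℕ × ℕ =>
    evolveN Θ q p.1 (evolveN Θ q p.2 g t) s z).symm

lemma collide_mem_extPhase (hq : IsTransRate Θ q) {z : Phase d} {a : ℝ × Sph d}
    (h : q z.2.1 z.2.2.2 a.1 a.2 ≠ 0) : collide z a ∈ extPhase Θ := by
  constructor
  · by_contra hneg
    exact h (hq.eq_zero_of_nonpos _ _ _ _ (not_le.1 hneg).le)
  · by_contra hneg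
    exact h (hq.eq_zero_of_notMem _ _ _ _ fun hh => hneg hh.2)

lemma lintegral_step (hq : IsTransRate Θ q) {z : Phase d} (hz : z ∈ extPhase Θ) :
    ∫⁻ a, q z.2.1 z.2.2.2 a.1 a.2 ∂stepMeasure d = 1 := by
  rw [stepMeasure, lintegral_prod _ (hq.measurable_step z).aemeasurable]
  exact hq.lintegral_eq_one _ _ hz.2

end IsTransRate

end Evolve

/-! ### Conservation of mass, null sets and finite speed of propagation -/

section Mass

variable {d : ℕ} {Θ : Sph d × Sph d → Sph d × Sph d} {q : Sph d → Sph d → ℝ → Sph d → ℝ≥0∞}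

/-- The probability that at least `n` collisions occur up to time `t`, for the process started
at `z`. -/
def atLeast (Θ : Sph d × Sph d → Sph d × Sph d) (q : Sph d → Sph d → ℝ → Sph d → ℝ≥0∞) :
    ℕ → ℝ → Phase d → ℝ≥0∞
  | 0, _, z => (extPhase Θ).indicator 1 z
  | n + 1, t, z => (hitSet Θ t).indicator (fun z => ∫⁻ a, q z.2.1 z.2.2.2 a.1 a.2 *
      atLeast Θ q n (t - z.2.2.1) (collide z a) ∂stepMeasure d) z

lemma atLeast_succ_of_mem {n : ℕ} {t : ℝ} {z : Phase d} (h : z ∈ hitSet Θ t) :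
    atLeast Θ q (n + 1) t z = ∫⁻ a, q z.2.1 z.2.2.2 a.1 a.2 *
      atLeast Θ q n (t - z.2.2.1) (collide z a) ∂stepMeasure d := indicator_of_mem h _

lemma atLeast_succ_of_notMem {n : ℕ} {t : ℝ} {z : Phase d} (h : z ∉ hitSet Θ t) :
    atLeast Θ q (n + 1) t z = 0 := indicator_of_notMem h _

namespace IsTransRate

/-- Either fewer than `n` collisions occur up to time `t`, or at least `n` do. -/
lemma sum_evolveN_add_atLeast (hq : IsTransRate Θ q) (n : ℕ) {t : ℝ} {z : Phase d}
    (hz : z ∈ extPhase Θ) :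
    ∑ k ∈ Finset.range n, evolveN Θ q k 1 t z + atLeast Θ q n t z = 1 := by
  induction n generalizing t z with
  | zero =>
    rw [Finset.sum_range_zero, zero_add, atLeast, indicator_of_mem hz]
    rfl
  | succ n ih =>
    rw [Finset.sum_range_succ']
    rcases mem_freeSet_or_mem_hitSet hz t with h | h
    · have h' := notMem_hitSet_of_mem_freeSet h
      rw [evolveN_zero_of_mem h, atLeast_succ_of_notMem h',
        Finset.sum_eq_zero fun k _ => evolveN_succ_of_notMem h', zero_add, add_zero]
      rfl
    · rw [evolveN_zero_of_notMem (notMem_freeSet_of_mem_hitSet h), add_zero,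
        atLeast_succ_of_mem h, Finset.sum_congr rfl fun k _ => evolveN_succ_of_mem h]
      have hm : ∀ k, Measurable fun a : ℝ × Sph d =>
          q z.2.1 z.2.2.2 a.1 a.2 * evolveN Θ q k 1 (t - z.2.2.1) (collide z a) := fun k =>
        hq.measurable_evolveN_step k measurable_one _ z
      rw [← lintegral_finsetSum _ fun k _ => hm k,
        ← lintegral_add_left (Finset.measurable_sum _ fun k _ => hm k), ← hq.lintegral_step hz]
      refine lintegral_congr fun a => ?_
      by_cases ha : q z.2.1 z.2.2.2 a.1 a.2 = 0
      · simp [ha]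
      · rw [← Finset.mul_sum, ← mul_add, ih (hq.collide_mem_extPhase ha), mul_one]

lemma atLeast_le_one (hq : IsTransRate Θ q) (n : ℕ) (t : ℝ) {z : Phase d} (hz : z ∈ extPhase Θ) :
    atLeast Θ q n t z ≤ 1 := by
  rw [← hq.sum_evolveN_add_atLeast (t := t) n hz]
  exact le_add_self

/-- Since the transition density is bounded, many collisions within a given time are unlikely: with
the weight `exp (-c ξ)` on the free path lengths, each step costs a factor of at most one half. -/
lemma atLeast_succ_le (hq : IsTransRate Θ q) {c : ℝ} (hc : 1 ≤ c)
    (hc' : 2 * volSph d univ ≤ ENNReal.ofReal c) (n : ℕ) {t : ℝ} {z : Phase d} :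
    atLeast Θ q (n + 1) t z ≤ ENNReal.ofReal (Real.exp (c * (t - z.2.2.1))) * 2⁻¹ ^ n := by
  induction n generalizing t z with
  | zero =>
    by_cases h : z ∈ hitSet Θ t
    · rw [pow_zero, mul_one]
      refine (hq.atLeast_le_one _ _ h.1).trans ?_
      rw [← ENNReal.ofReal_one]
      refine ENNReal.ofReal_le_ofReal (Real.one_le_exp ?_)
      have h2 : z.2.2.1 ≤ t := h.2
      exact mul_nonneg (by linarith) (by linarith)
    · rw [atLeast_succ_of_notMem h]
      exact bot_le
  | succ n ih =>
    by_cases h : z ∈ hitSet Θ t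
    swap
    · rw [atLeast_succ_of_notMem h]
      exact bot_le
    rw [atLeast_succ_of_mem h]
    let b : ℝ → ℝ≥0∞ := fun s =>
      (Ioi (0 : ℝ)).indicator (fun s => ENNReal.ofReal (Real.exp (-c * s))) s
    have hb : Measurable b := Measurable.indicator (by fun_prop) measurableSet_Ioi
    have hbi : ∫⁻ s, b s = ENNReal.ofReal c⁻¹ := by
      have h1 : (∫ s in Ioi (0 : ℝ), Real.exp (-c * s)) = c⁻¹ := by
        rw [integral_exp_mul_Ioi (by linarith)]
        rw [mul_zero, Real.exp_zero, div_neg, neg_div, neg_neg, one_div]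
      simp only [b]
      rw [lintegral_indicator measurableSet_Ioi, ← h1, ofReal_integral_eq_lintegral_ofReal
        (integrableOn_exp_mul_Ioi (by linarith) _)]
      exact Filter.Eventually.of_forall fun s => (Real.exp_pos _).le
    set K : ℝ≥0∞ := ENNReal.ofReal (Real.exp (c * (t - z.2.2.1))) * 2⁻¹ ^ n with hK
    have hle : ∀ a : ℝ × Sph d, q z.2.1 z.2.2.2 a.1 a.2 *
        atLeast Θ q (n + 1) (t - z.2.2.1) (collide z a) ≤
        K * (b a.1 * q z.2.1 z.2.2.2 a.1 a.2) := by
      intro a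
      by_cases ha : 0 < a.1
      · have hba : b a.1 = ENNReal.ofReal (Real.exp (-c * a.1)) :=
          indicator_of_mem (show a.1 ∈ Ioi (0 : ℝ) from ha) _
        have hih : atLeast Θ q (n + 1) (t - z.2.2.1) (collide z a) ≤
            ENNReal.ofReal (Real.exp (c * (t - z.2.2.1 - a.1))) * 2⁻¹ ^ n := ih
        calc q z.2.1 z.2.2.2 a.1 a.2 * atLeast Θ q (n + 1) (t - z.2.2.1) (collide z a)
            ≤ q z.2.1 z.2.2.2 a.1 a.2 *
              (ENNReal.ofReal (Real.exp (c * (t - z.2.2.1 - a.1))) * 2⁻¹ ^ n) :=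
              mul_le_mul_right hih _
          _ = K * (b a.1 * q z.2.1 z.2.2.2 a.1 a.2) := by
            rw [hba]
            rw [hK, show c * (t - z.2.2.1 - a.1) = c * (t - z.2.2.1) + -c * a.1 by ring,
              Real.exp_add, ENNReal.ofReal_mul (Real.exp_pos _).le]
            ring
      · rw [hq.eq_zero_of_nonpos _ _ _ _ (not_lt.1 ha)]
        simp
    have hmb : Measurable fun a : ℝ × Sph d => b a.1 * q z.2.1 z.2.2.2 a.1 a.2 :=
      (hb.comp measurable_fst).mul (hq.measurable_step z)
    refine (lintegral_mono hle).trans ?_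
    rw [lintegral_const_mul _ hmb, stepMeasure, lintegral_prod _ hmb.aemeasurable]
    have hin : ∀ s : ℝ, ∫⁻ u, b s * q z.2.1 z.2.2.2 s u ∂volSph d ≤ b s * volSph d univ := by
      intro s
      have hm : Measurable fun u => q z.2.1 z.2.2.2 s u :=
        hq.measurable_comp measurable_const measurable_const measurable_const measurable_id
      rw [lintegral_const_mul _ hm]
      exact mul_le_mul_right (hq.lintegral_le _ _ _) _
    have hhalf : ENNReal.ofReal c⁻¹ * volSph d univ ≤ 2⁻¹ := by
      rw [ENNReal.ofReal_inv_of_pos (by linarith), ENNReal.inv_mul_le_iff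
        (ENNReal.ofReal_pos.2 (by linarith)).ne' ENNReal.ofReal_ne_top]
      calc volSph d univ = 2 * volSph d univ * 2⁻¹ := by
            rw [mul_comm 2, mul_assoc, ENNReal.mul_inv_cancel (by simp) (by simp), mul_one]
        _ ≤ _ := mul_le_mul_left hc' _
    calc K * ∫⁻ s, ∫⁻ u, b s * q z.2.1 z.2.2.2 s u ∂volSph d
        ≤ K * ∫⁻ s, b s * volSph d univ := mul_le_mul_right (lintegral_mono hin) _
      _ = K * (ENNReal.ofReal c⁻¹ * volSph d univ) := by rw [lintegral_mul_const _ hb, hbi]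
      _ ≤ K * 2⁻¹ := mul_le_mul_right hhalf _
      _ = _ := by rw [hK, pow_succ, mul_assoc]

/-- Conservation of mass: almost surely only finitely many collisions occur in a finite time. -/
theorem evolve_one (hq : IsTransRate Θ q) (t : ℝ) {z : Phase d} (hz : z ∈ extPhase Θ) :
    evolve Θ q 1 t z = 1 := by
  refine le_antisymm (ENNReal.tsum_le_of_sum_range_le fun n => ?_) ?_
  · rw [← hq.sum_evolveN_add_atLeast (t := t) n hz]
    exact le_self_add
  · set c : ℝ := 2 * (volSph d univ).toReal + 1
    have hc : 1 ≤ c := by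
      have : 0 ≤ (volSph d univ).toReal := ENNReal.toReal_nonneg
      simp only [c]
      linarith
    have hc' : 2 * volSph d univ ≤ ENNReal.ofReal c := by
      rw [ENNReal.ofReal_add (by positivity) zero_le_one, ENNReal.ofReal_mul zero_le_two,
        ENNReal.ofReal_toReal (measure_ne_top _ _)]
      simp
    set K : ℝ≥0∞ := ENNReal.ofReal (Real.exp (c * (t - z.2.2.1)))
    have hlim : Filter.Tendsto (fun n : ℕ => evolve Θ q 1 t z + K * 2⁻¹ ^ n) Filter.atTop
        (nhds (evolve Θ q 1 t z + K * 0)) :=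
      tendsto_const_nhds.add (ENNReal.Tendsto.const_mul
        (ENNReal.tendsto_pow_atTop_nhds_zero_of_lt_one (by norm_num))
        (Or.inr ENNReal.ofReal_ne_top))
    rw [mul_zero, add_zero] at hlim
    refine ge_of_tendsto' hlim fun n => ?_
    rw [← hq.sum_evolveN_add_atLeast (t := t) (n + 1) hz]
    exact add_le_add (ENNReal.sum_le_tsum _) (hq.atLeast_succ_le hc hc' n)

lemma evolve_le_one (hq : IsTransRate Θ q) {g : Phase d → ℝ≥0∞} (hg : ∀ z, g z ≤ 1) (t : ℝ)
    (z : Phase d) : evolve Θ q g t z ≤ 1 := by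
  by_cases hz : z ∈ extPhase Θ
  · rw [← hq.evolve_one t hz]
    exact evolve_mono (fun z _ => hg z) t z
  · rw [evolve_of_notMem hz]
    exact bot_le

lemma evolve_const_mul (hq : IsTransRate Θ q) (c : ℝ≥0∞)
    {g : Phase d → ℝ≥0∞} (hg : Measurable g) (t : ℝ) (z : Phase d) :
    evolve Θ q (fun z => c * g z) t z = c * evolve Θ q g t z := by
  simp_rw [evolve, hq.evolveN_const_mul _ c hg, ENNReal.tsum_mul_left]

end IsTransRate

lemma lintegral_stepMeasure {F : ℝ × Sph d → ℝ≥0∞} (hF : Measurable F) :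
    ∫⁻ a, F a ∂stepMeasure d = ∫⁻ s, ∫⁻ u, F (s, u) ∂volSph d := by
  rw [stepMeasure, lintegral_prod _ hF.aemeasurable]

lemma lintegral_phaseMeasure_symm {F : Phase d → ℝ≥0∞} (hF : Measurable F) :
    ∫⁻ z, F z ∂phaseMeasure d =
      ∫⁻ p : Sph d × ℝ × Sph d, (∫⁻ Q : E d, F (Q, p)) ∂(volSph d).prod (stepMeasure d) := by
  rw [phaseMeasure, lintegral_prod_symm _ hF.aemeasurable]

lemma lintegral_flow {F : Phase d → ℝ≥0∞} (hF : Measurable F) (t : ℝ) :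
    ∫⁻ z, F (flow t z) ∂phaseMeasure d = ∫⁻ z, F z ∂phaseMeasure d := by
  have hm : Measurable fun z => F (flow t z) := hF.comp (measurable_flow_right t)
  have hm2 : Measurable fun p : Sph d × ℝ × Sph d => ∫⁻ Q : E d, F (Q, p) :=
    Measurable.lintegral_prod_left' hF
  rw [lintegral_phaseMeasure_symm hm, lintegral_phaseMeasure_symm hF]
  have h1 : ∀ p : Sph d × ℝ × Sph d, ∫⁻ Q : E d, F (flow t (Q, p)) =
      ∫⁻ Q : E d, F (Q, p.1, p.2.1 - t, p.2.2) := fun p =>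
    lintegral_add_right_eq_self (fun Q : E d => F (Q, p.1, p.2.1 - t, p.2.2)) (t • (p.1 : E d))
  simp_rw [h1]
  have hm3 : Measurable fun p : Sph d × ℝ × Sph d =>
      ∫⁻ Q : E d, F (Q, p.1, p.2.1 - t, p.2.2) :=
    Measurable.comp (g := fun p : Sph d × ℝ × Sph d => ∫⁻ Q : E d, F (Q, p))
      (f := fun p : Sph d × ℝ × Sph d => (p.1, p.2.1 - t, p.2.2)) hm2 (by fun_prop)
  rw [lintegral_prod _ hm3.aemeasurable, lintegral_prod _ hm2.aemeasurable]
  refine lintegral_congr fun v => ?_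
  have hm4 : Measurable fun p : ℝ × Sph d => ∫⁻ Q : E d, F (Q, v, p) :=
    hm2.comp measurable_prodMk_left
  have hm5 : Measurable fun p : ℝ × Sph d => ∫⁻ Q : E d, F (Q, v, p.1 - t, p.2) :=
    hm3.comp measurable_prodMk_left
  rw [stepMeasure, lintegral_prod _ hm5.aemeasurable, lintegral_prod _ hm4.aemeasurable]
  exact lintegral_sub_right_eq_self (fun s => ∫⁻ u, (∫⁻ Q : E d, F (Q, v, s, u)) ∂volSph d) t

namespace IsTransRate

lemma lintegral_sigma1 (hq : IsTransRate Θ q) {F : Phase d → ℝ≥0∞}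
    (hF : ∀ z ∉ extPhase Θ, F z = 0) : ∫⁻ z, F z ∂sigma1 Θ = ∫⁻ z, F z ∂phaseMeasure d := by
  rw [sigma1_eq, ← lintegral_indicator hq.measurableSet_extPhase]
  congr 1
  refine indicator_eq_self.2 fun z hz => ?_
  by_contra h
  exact hz (hF z h)

lemma ae_mem_extPhase (hq : IsTransRate Θ q) : ∀ᵐ z ∂sigma1 Θ, z ∈ extPhase Θ := by
  rw [sigma1_eq]
  exact ae_restrict_mem hq.measurableSet_extPhase

/-- The distribution of the state after `n` collisions is absolutely continuous: a collision
translates the position and draws the next path length and velocity from a density. -/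
lemma lintegral_evolveN_eq_zero (hq : IsTransRate Θ q) (n : ℕ) {g : Phase d → ℝ≥0∞}
    (hg : Measurable g) (h0 : ∫⁻ z, g z ∂sigma1 Θ = 0) {t : ℝ} (ht : 0 ≤ t) :
    ∫⁻ z, evolveN Θ q n g t z ∂phaseMeasure d = 0 := by
  have hX := hq.measurableSet_extPhase
  induction n generalizing t with
  | zero =>
    have h1 : ∀ z, evolveN Θ q 0 g t z ≤ (extPhase Θ).indicator g (flow t z) := by
      intro z
      by_cases h : z ∈ freeSet Θ t
      · rw [evolveN_zero_of_mem h, indicator_of_mem (flow_mem_extPhase h)]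
      · rw [evolveN_zero_of_notMem h]
        exact bot_le
    refine le_antisymm ((lintegral_mono h1).trans ?_) bot_le
    rw [lintegral_flow (hg.indicator hX), lintegral_indicator hX, ← sigma1_eq, h0]
  | succ n ih =>
    -- bound the transition density by `∞`, and integrate over the position first
    let B : Phase d → ℝ≥0∞ := fun z => (hitSet Θ t).indicator 1 z *
      ∫⁻ a, evolveN Θ q n g (t - z.2.2.1) (collide z a) ∂stepMeasure d
    have hA : Measurable fun x : Phase d × (ℝ × Sph d) =>
        evolveN Θ q n g (t - x.1.2.2.1) (collide x.1 x.2) :=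
      Measurable.comp (g := fun p : ℝ × Phase d => evolveN Θ q n g p.1 p.2)
        (f := fun x : Phase d × (ℝ × Sph d) => (t - x.1.2.2.1, collide x.1 x.2))
        (hq.measurable_evolveN n hg) (by fun_prop)
    have hS : MeasurableSet (hitSet Θ t) :=
      hX.inter (measurableSet_le (by fun_prop) measurable_const)
    have hB : Measurable B := (measurable_one.indicator hS).mul
      (Measurable.lintegral_prod_right' hA)
    have h1 : ∀ z, evolveN Θ q (n + 1) g t z ≤ ⊤ * B z := by
      intro z
      by_cases h : z ∈ hitSet Θ t
      · simp only [B]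
        have hm : Measurable fun a => evolveN Θ q n g (t - z.2.2.1) (collide z a) :=
          hA.comp measurable_prodMk_left
        rw [evolveN_succ_of_mem h, indicator_of_mem h, Pi.one_apply, one_mul,
          ← lintegral_const_mul _ hm]
        exact lintegral_mono fun a => mul_le_mul_left le_top _
      · rw [evolveN_succ_of_notMem h]
        exact bot_le
    suffices hB0 : ∫⁻ z, B z ∂phaseMeasure d = 0 by
      refine le_antisymm ((lintegral_mono h1).trans ?_) bot_le
      rw [lintegral_const_mul _ hB, hB0, mul_zero]
    have hAr : ∀ s, Measurable (evolveN Θ q n g s) := hq.measurable_evolveN_right n hg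
    -- for fixed velocities and path length, a collision acts on the position as a translation
    have h2 : ∀ p : Sph d × ℝ × Sph d, ∫⁻ Q : E d, B (Q, p) ≤
        (Icc 0 t).indicator 1 p.2.1 * ∫⁻ Q : E d, ∫⁻ a, evolveN Θ q n g (t - p.2.1)
          (Q, p.2.2, a) ∂stepMeasure d := by
      intro p
      have hm : Measurable fun Q : E d => ∫⁻ a, evolveN Θ q n g (t - p.2.1)
          (Q, p.2.2, a) ∂stepMeasure d := by
        refine Measurable.lintegral_prod_right' (f := fun x : E d × (ℝ × Sph d) =>
          evolveN Θ q n g (t - p.2.1) (x.1, p.2.2, x.2)) ?_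
        exact (hAr _).comp (by fun_prop)
      have h3 : ∀ Q : E d, B (Q, p) ≤ (Icc 0 t).indicator 1 p.2.1 *
          (fun Q : E d => ∫⁻ a, evolveN Θ q n g (t - p.2.1) (Q, p.2.2, a) ∂stepMeasure d)
            (Q + p.2.1 • (p.1 : E d)) := by
        intro Q
        refine mul_le_mul_left ?_ _
        by_cases h : (Q, p) ∈ hitSet Θ t
        · have h4 : p.2.1 ∈ Icc 0 t := ⟨h.1.1, h.2⟩
          rw [indicator_of_mem h, indicator_of_mem h4]
          rfl
        · rw [indicator_of_notMem h]
          exact bot_le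
      refine (lintegral_mono h3).trans (le_of_eq ?_)
      rw [lintegral_const_mul]
      · congr 1
        exact lintegral_add_right_eq_self
          (fun Q : E d => ∫⁻ a, evolveN Θ q n g (t - p.2.1) (Q, p.2.2, a) ∂stepMeasure d) _
      · exact hm.comp (measurable_add_const _)
    rw [lintegral_phaseMeasure_symm hB]
    refine le_antisymm ((lintegral_mono h2).trans (le_of_eq ?_)) bot_le
    have hm5 : Measurable fun p : Sph d × ℝ × Sph d => (Icc 0 t).indicator (1 : ℝ → ℝ≥0∞) p.2.1 *
        ∫⁻ Q : E d, ∫⁻ a, evolveN Θ q n g (t - p.2.1) (Q, p.2.2, a) ∂stepMeasure d := by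
      refine ((measurable_one.indicator measurableSet_Icc).comp (by fun_prop)).mul ?_
      refine Measurable.lintegral_prod_right' (f := fun x : (Sph d × ℝ × Sph d) × E d =>
        ∫⁻ a, evolveN Θ q n g (t - x.1.2.1) (x.2, x.1.2.2, a) ∂stepMeasure d) ?_
      refine Measurable.lintegral_prod_right' (f := fun x : ((Sph d × ℝ × Sph d) × E d) ×
        (ℝ × Sph d) => evolveN Θ q n g (t - x.1.1.2.1) (x.1.2, x.1.1.2.2, x.2)) ?_
      exact Measurable.comp (g := fun p : ℝ × Phase d => evolveN Θ q n g p.1 p.2)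
        (f := fun x : ((Sph d × ℝ × Sph d) × E d) × (ℝ × Sph d) =>
          (t - x.1.1.2.1, (x.1.2, x.1.1.2.2, x.2)))
        (hq.measurable_evolveN n hg) (by fun_prop)
    rw [lintegral_prod _ hm5.aemeasurable, lintegral_eq_zero_iff]
    swap
    · exact Measurable.lintegral_prod_right' hm5
    refine Filter.Eventually.of_forall fun v => ?_
    simp only [Pi.zero_apply]
    have hm6 : Measurable fun p : ℝ × Sph d => (Icc 0 t).indicator (1 : ℝ → ℝ≥0∞) p.1 *
        ∫⁻ Q : E d, ∫⁻ a, evolveN Θ q n g (t - p.1) (Q, p.2, a) ∂stepMeasure d :=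
      Measurable.comp (f := fun p : ℝ × Sph d => (v, p)) hm5 measurable_prodMk_left
    rw [lintegral_stepMeasure hm6, lintegral_eq_zero_iff]
    swap
    · exact Measurable.lintegral_prod_right' hm6
    refine Filter.Eventually.of_forall fun s => ?_
    simp only [Pi.zero_apply]
    by_cases hs : s ∈ Icc 0 t
    swap
    · simp [hs]
    simp only [indicator_of_mem hs, Pi.one_apply, one_mul]
    have h6 : Measurable fun x : Sph d × E d =>
        ∫⁻ a, evolveN Θ q n g (t - s) (x.2, x.1, a) ∂stepMeasure d := by
      refine Measurable.lintegral_prod_right' (f := fun x : (Sph d × E d) × (ℝ × Sph d) =>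
        evolveN Θ q n g (t - s) (x.1.2, x.1.1, x.2)) ?_
      exact (hAr _).comp (by fun_prop)
    have h7 := ih (t := t - s) (sub_nonneg.2 hs.2)
    rw [lintegral_phaseMeasure (hAr _), ← lintegral_lintegral_swap h6.aemeasurable] at h7
    exact h7

/-- The process does not charge null sets. -/
lemma ae_evolve_eq_zero (hq : IsTransRate Θ q) {g : Phase d → ℝ≥0∞}
    (hg : Measurable g) (h0 : ∫⁻ z, g z ∂sigma1 Θ = 0) {t : ℝ} (ht : 0 ≤ t) :
    ∀ᵐ z ∂sigma1 Θ, evolve Θ q g t z = 0 := by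
  have h1 : ∀ n, ∀ᵐ z ∂sigma1 Θ, evolveN Θ q n g t z = 0 := fun n => by
    refine (lintegral_eq_zero_iff (hq.measurable_evolveN_right n hg t)).1 ?_
    rw [hq.lintegral_sigma1 fun z hz => evolveN_of_notMem hz]
    exact hq.lintegral_evolveN_eq_zero n hg h0 ht
  filter_upwards [ae_all_iff.2 h1] with z hz
  exact ENNReal.tsum_eq_zero.2 hz

end IsTransRate

/-- The states with position in the ball of radius `r` and free path length at most `r`. -/
def phaseBox (d : ℕ) (r : ℝ) : Set (Phase d) := {z | ‖z.1‖ ≤ r ∧ |z.2.2.1| ≤ r}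

lemma measurableSet_phaseBox (r : ℝ) : MeasurableSet (phaseBox d r) :=
  (measurableSet_le (f := fun z : Phase d => ‖z.1‖) (by fun_prop) measurable_const).inter
    (measurableSet_le (f := fun z : Phase d => |z.2.2.1|) (by fun_prop) measurable_const)

/-- Speed one of propagation. -/
lemma evolveN_eq_zero_of_notMem_phaseBox {n : ℕ} {g : Phase d → ℝ≥0∞} {r t : ℝ} (hr : 0 ≤ r)
    (ht : 0 ≤ t) (hg : ∀ z ∈ extPhase Θ, z ∉ phaseBox d r → g z = 0) {z : Phase d}
    (hz : z ∉ phaseBox d (r + t)) : evolveN Θ q n g t z = 0 := by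
  induction n generalizing t z with
  | zero =>
    by_cases h : z ∈ freeSet Θ t
    · rw [evolveN_zero_of_mem h]
      refine hg _ (flow_mem_extPhase h) fun hb => hz ?_
      have h1 : ‖z.1 + t • (z.2.1 : E d)‖ ≤ r := hb.1
      have h2 : |z.2.2.1 - t| ≤ r := hb.2
      have h3 : ‖t • (z.2.1 : E d)‖ = t := by
        rw [norm_smul, norm_eq_of_mem_sphere, mul_one, Real.norm_of_nonneg ht]
      constructor
      · calc ‖z.1‖ = ‖z.1 + t • (z.2.1 : E d) - t • (z.2.1 : E d)‖ := by rw [add_sub_cancel_right]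
          _ ≤ ‖z.1 + t • (z.2.1 : E d)‖ + ‖t • (z.2.1 : E d)‖ := norm_sub_le _ _
          _ ≤ r + t := by rw [h3]; linarith
      · rw [abs_le] at h2 ⊢
        constructor <;> linarith [h2.1, h2.2]
    · exact evolveN_zero_of_notMem h
  | succ n ih =>
    by_cases h : z ∈ hitSet Θ t
    · have h2 : z.2.2.1 ≤ t := h.2
      have h0 : 0 ≤ z.2.2.1 := h.1.1
      rw [evolveN_succ_of_mem h]
      refine (lintegral_congr fun a => ?_).trans lintegral_zero
      rw [ih (sub_nonneg.2 h2), mul_zero]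
      intro hb
      have h1 : ‖z.1 + z.2.2.1 • (z.2.1 : E d)‖ ≤ r + (t - z.2.2.1) := hb.1
      refine hz ⟨?_, ?_⟩
      · have h3 : ‖z.2.2.1 • (z.2.1 : E d)‖ = z.2.2.1 := by
          rw [norm_smul, norm_eq_of_mem_sphere, mul_one, Real.norm_of_nonneg h0]
        calc ‖z.1‖ = ‖z.1 + z.2.2.1 • (z.2.1 : E d) - z.2.2.1 • (z.2.1 : E d)‖ := by
              rw [add_sub_cancel_right]
          _ ≤ ‖z.1 + z.2.2.1 • (z.2.1 : E d)‖ + ‖z.2.2.1 • (z.2.1 : E d)‖ := norm_sub_le _ _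
          _ ≤ r + t := by rw [h3]; linarith
      · rw [abs_of_nonneg h0]
        linarith
    · exact evolveN_succ_of_notMem h

lemma evolve_eq_zero_of_notMem_phaseBox {g : Phase d → ℝ≥0∞} {r t : ℝ} (hr : 0 ≤ r)
    (ht : 0 ≤ t) (hg : ∀ z ∈ extPhase Θ, z ∉ phaseBox d r → g z = 0) {z : Phase d}
    (hz : z ∉ phaseBox d (r + t)) : evolve Θ q g t z = 0 :=
  ENNReal.tsum_eq_zero.2 fun _ => evolveN_eq_zero_of_notMem_phaseBox hr ht hg hz

lemma evolve_of_mem_freeSet {g : Phase d → ℝ≥0∞} {t : ℝ} {z : Phase d} (h : z ∈ freeSet Θ t) :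
    evolve Θ q g t z = g (flow t z) := by
  rw [evolve, tsum_eq_single 0, evolveN_zero_of_mem h]
  intro n hn
  obtain ⟨n, rfl⟩ := Nat.exists_eq_succ_of_ne_zero hn
  exact evolveN_succ_of_notMem (notMem_hitSet_of_mem_freeSet h)

lemma flow_zero (z : Phase d) : flow 0 z = z := by
  simp [flow]

lemma ae_len_pos (hq : IsTransRate Θ q) : ∀ᵐ z ∂sigma1 Θ, 0 < z.2.2.1 := by
  have h0 : ∀ᵐ z ∂phaseMeasure d, z.2.2.1 ≠ 0 := by
    have h1 : ∀ᵐ a ∂stepMeasure d, a.1 ≠ 0 :=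
      Measure.quasiMeasurePreserving_fst.ae (Measure.ae_ne volume 0)
    exact (Measure.quasiMeasurePreserving_snd.comp Measure.quasiMeasurePreserving_snd).ae h1
  filter_upwards [hq.ae_mem_extPhase, ae_restrict_of_ae (s := extPhase Θ) h0] with z hz hz'
  exact lt_of_le_of_ne hz.1 (Ne.symm hz')

lemma ae_evolve_zero (hq : IsTransRate Θ q) (g : Phase d → ℝ≥0∞) :
    ∀ᵐ z ∂sigma1 Θ, evolve Θ q g 0 z = g z := by
  filter_upwards [hq.ae_mem_extPhase, ae_len_pos hq] with z hz hz'
  rw [evolve_of_mem_freeSet ⟨hz, hz'⟩, flow_zero]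

end Mass

/-! ### Finite-dimensional distributions in terms of the transition operators -/

section Hit

variable {d : ℕ} {Θ : Sph d × Sph d → Sph d × Sph d} {q : Sph d → Sph d → ℝ → Sph d → ℝ≥0∞}

/-- The event that exactly `k` collisions have occurred up to time `t`, and that the state at time
`t` lies in `D`. -/
def hit {N : ℕ} (k : ℕ) (t : ℝ) (D : Set (Phase d)) : Set (Path d N) :=
  {x | (∀ i < k, x.time (i + 1) ≤ t) ∧ t < x.time (k + 1) ∧ x.state k t ∈ D}

/-- The joint event `hit (n j) (t j) (D j)`, `j < M`. -/
def hits {N M : ℕ} (n : Fin M → ℕ) (t : Fin M → ℝ) (D : Fin M → Set (Phase d)) :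
    Set (Path d N) := {x | ∀ j, x ∈ hit (n j) (t j) (D j)}

lemma measurableSet_hit {N : ℕ} (k : ℕ) (t : ℝ) {D : Set (Phase d)} (hD : MeasurableSet D) :
    MeasurableSet (hit k t D : Set (Path d N)) := by
  have h1 : MeasurableSet {x : Path d N | ∀ i < k, x.time (i + 1) ≤ t} := by
    have : {x : Path d N | ∀ i < k, x.time (i + 1) ≤ t} =
        ⋂ i, ⋂ (_ : i < k), {x : Path d N | x.time (i + 1) ≤ t} := by
      ext x
      simp
    rw [this]
    exact MeasurableSet.iInter fun i => MeasurableSet.iInter fun _ =>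
      measurableSet_le (Path.measurable_time _) measurable_const
  exact h1.inter ((measurableSet_lt measurable_const (Path.measurable_time _)).inter
    (hD.preimage (Path.measurable_state k t)))

lemma measurableSet_hits {N M : ℕ} (n : Fin M → ℕ) (t : Fin M → ℝ) {D : Fin M → Set (Phase d)}
    (hD : ∀ j, MeasurableSet (D j)) : MeasurableSet (hits n t D : Set (Path d N)) := by
  have : (hits n t D : Set (Path d N)) = ⋂ j, hit (n j) (t j) (D j) := by
    ext x
    simp [hits]
  rw [this]
  exact MeasurableSet.iInter fun j => measurableSet_hit _ _ (hD j)

lemma mkPath_mem_hit_zero {N : ℕ} (z : Phase d) (y : Fin N → ℝ × Sph d) (t : ℝ)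
    (D : Set (Phase d)) : mkPath z y ∈ hit 0 t D ↔ t < z.2.2.1 ∧ flow t z ∈ D := by
  constructor
  · rintro ⟨-, h1, h2⟩
    rw [Path.state_mkPath_zero] at h2
    rw [zero_add, Path.time_mkPath_one] at h1
    exact ⟨h1, h2⟩
  · rintro ⟨h1, h2⟩
    refine ⟨fun i hi => absurd hi (Nat.not_lt_zero i), ?_, ?_⟩
    · rwa [zero_add, Path.time_mkPath_one]
    · rwa [Path.state_mkPath_zero]

lemma mkPath_cons_mem_hit_succ {N : ℕ} (z : Phase d) (a : ℝ × Sph d) (y : Fin N → ℝ × Sph d)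
    {k : ℕ} (hk : k ≤ N) (t : ℝ) (D : Set (Phase d)) :
    mkPath z (Fin.cons a y : Fin (N + 1) → ℝ × Sph d) ∈ hit (k + 1) t D ↔
      z.2.2.1 ≤ t ∧ mkPath (collide z a) y ∈ hit k (t - z.2.2.1) D := by
  constructor
  · rintro ⟨h1, h2, h3⟩
    rw [Path.state_cons _ _ _ hk] at h3
    rw [Path.time_cons] at h2
    refine ⟨?_, fun i hi => ?_, by linarith, h3⟩
    · have := h1 0 (Nat.succ_pos _)
      rwa [zero_add, Path.time_mkPath_one] at this
    · have := h1 (i + 1) (Nat.succ_lt_succ hi)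
      rw [Path.time_cons] at this
      linarith
  · rintro ⟨h0, h1, h2, h3⟩
    refine ⟨fun i hi => ?_, ?_, ?_⟩
    · match i with
      | 0 => rwa [zero_add, Path.time_mkPath_one]
      | i + 1 =>
        rw [Path.time_cons]
        have := h1 i (Nat.lt_of_succ_lt_succ hi)
        linarith
    · rw [Path.time_cons]
      linarith
    · rwa [Path.state_cons _ _ _ hk]

namespace Path

variable {N : ℕ}

lemma vel_mkPath_flow (s : ℝ) (z : Phase d) (y : Fin N → ℝ × Sph d) (k : ℕ) :
    (mkPath (flow s z) y).vel k = (mkPath z y).vel k := by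
  match k with
  | 0 => rfl
  | 1 => rfl
  | k + 2 =>
    by_cases h : k < N
    · rw [vel_mkPath_succ _ _ h, vel_mkPath_succ _ _ h]
    · rw [vel, dif_neg (by omega), vel, dif_neg (by omega)]
      rfl

lemma len_mkPath_flow (s : ℝ) (z : Phase d) (y : Fin N → ℝ × Sph d) (k : ℕ) :
    (mkPath (flow s z) y).len (k + 1) = (mkPath z y).len (k + 1) := by
  by_cases h : k < N
  · rw [len_mkPath_succ _ _ h, len_mkPath_succ _ _ h]
  · rw [len_mkPath_of_le _ _ (not_lt.1 h), len_mkPath_of_le _ _ (not_lt.1 h)]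

lemma time_mkPath_flow (s : ℝ) (z : Phase d) (y : Fin N → ℝ × Sph d) (k : ℕ) :
    (mkPath (flow s z) y).time (k + 1) = (mkPath z y).time (k + 1) - s := by
  rw [time, time, Finset.sum_range_succ', Finset.sum_range_succ', len_mkPath_zero,
    len_mkPath_zero, Finset.sum_congr rfl fun j _ => len_mkPath_flow s z y j]
  simp only [flow]
  ring

lemma state_mkPath_flow (s : ℝ) (z : Phase d) (y : Fin N → ℝ × Sph d) (k : ℕ) (t : ℝ) :
    (mkPath (flow s z) y).state k (t - s) = (mkPath z y).state k t := by
  match k with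
  | 0 => rw [state_mkPath_zero, state_mkPath_zero, flow_flow, add_sub_cancel]
  | k + 1 =>
    simp only [state, vel_mkPath_flow, time_mkPath_flow]
    refine Prod.ext ?_ (Prod.ext rfl (Prod.ext ?_ rfl))
    · simp only
      rw [Finset.sum_range_succ', Finset.sum_range_succ',
        Finset.sum_congr rfl fun j _ => by rw [len_mkPath_flow], len_mkPath_zero, len_mkPath_zero]
      change z.1 + s • (z.2.1 : E d) + (_ + (z.2.2.1 - s) • (z.2.1 : E d)) + _ =
        z.1 + (_ + z.2.2.1 • (z.2.1 : E d)) + _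
      rw [sub_sub_sub_cancel_right, sub_smul]
      abel
    · simp only
      ring

end Path

lemma mkPath_flow_mem_hit {N : ℕ} (s : ℝ) (z : Phase d) (y : Fin N → ℝ × Sph d) (k : ℕ) (t : ℝ)
    (D : Set (Phase d)) : mkPath (flow s z) y ∈ hit k (t - s) D ↔ mkPath z y ∈ hit k t D := by
  simp only [hit, mem_ofPred_eq, Path.time_mkPath_flow, Path.state_mkPath_flow,
    sub_le_sub_iff_right, sub_lt_sub_iff_right]

lemma tailWeight_mkPath_flow {N : ℕ} (s : ℝ) (z : Phase d) (y : Fin N → ℝ × Sph d) :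
    tailWeight q (mkPath (flow s z) y) = tailWeight q (mkPath z y) := by
  simp only [tailWeight, Path.vel_mkPath_flow, Path.len_mkPath_flow]

/-- Conditioning on the state at the earliest of several times. -/
lemma IsTransRate.tailInt_hit_inter_hits (hq : IsTransRate Θ q) {N M : ℕ} (n₀ : ℕ)
    {n : Fin M → ℕ} (hn : ∀ j, n j ≤ N) {t₀ : ℝ} {t : Fin M → ℝ} (ht : ∀ j, t₀ ≤ t j)
    {D₀ : Set (Phase d)} (hD₀ : MeasurableSet D₀) {D : Fin M → Set (Phase d)}
    (hD : ∀ j, MeasurableSet (D j)) {z : Phase d} (hz : z ∈ extPhase Θ) :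
    tailInt q (N + n₀) ((hit n₀ t₀ D₀ ∩ hits (fun j => n j + n₀) t D).indicator 1) z =
      evolveN Θ q n₀ (fun z => D₀.indicator 1 z *
        tailInt q N ((hits n (fun j => t j - t₀) D).indicator 1) z) t₀ z := by
  induction n₀ generalizing t₀ t z with
  -- no collision up to time `t₀`: shift the time origin along the free flight
  | zero =>
    by_cases h : z ∈ freeSet Θ t₀
    · rw [evolveN_zero_of_mem h]
      have hlt : t₀ < z.2.2.1 := h.2
      simp only [Nat.add_zero, tailInt, tailWeight_mkPath_flow]
      by_cases h0 : flow t₀ z ∈ D₀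
      · rw [indicator_of_mem h0, Pi.one_apply, one_mul]
        refine lintegral_congr fun y => ?_
        congr 1
        refine indicator_one_congr ?_
        constructor
        · rintro ⟨-, h2⟩ j
          exact (mkPath_flow_mem_hit t₀ z y _ _ _).2 (h2 j)
        · intro h2
          exact ⟨(mkPath_mem_hit_zero z y _ _).2 ⟨hlt, h0⟩,
            fun j => (mkPath_flow_mem_hit t₀ z y _ _ _).1 (h2 j)⟩
      · rw [indicator_of_notMem h0, zero_mul]
        refine (lintegral_congr fun y => ?_).trans lintegral_zero
        rw [indicator_of_notMem fun h2 => h0 ((mkPath_mem_hit_zero z y _ _).1 h2.1).2, mul_zero]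
    · rw [evolveN_zero_of_notMem h]
      refine (lintegral_congr fun y => ?_).trans lintegral_zero
      rw [indicator_of_notMem fun h2 => h ⟨hz, ((mkPath_mem_hit_zero z y _ _).1 h2.1).1⟩, mul_zero]
  | succ n₀ ih =>
    have hmeas : ∀ (k K : ℕ) (s : ℝ) (s' : Fin M → ℝ), Measurable
        ((hit k s D₀ ∩ hits (fun j => n j + k) s' D : Set (Path d K)).indicator
          (1 : Path d K → ℝ≥0∞)) := fun k K s s' =>
      measurable_one.indicator ((measurableSet_hit k s hD₀).inter (measurableSet_hits _ s' hD))
    -- shift the time origin to the first collision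
    by_cases h : z ∈ hitSet Θ t₀
    · have hle : z.2.2.1 ≤ t₀ := h.2
      rw [evolveN_succ_of_mem h]
      rw [show N + (n₀ + 1) = N + n₀ + 1 from rfl,
        hq.tailInt_succ (hmeas _ _ _ _) (G' := fun _ => (hit n₀ (t₀ - z.2.2.1) D₀ ∩
          hits (fun j => n j + n₀) (fun j => t j - z.2.2.1) D).indicator 1)
          (fun _ => hmeas _ _ _ _)]
      · refine lintegral_congr fun a => ?_
        by_cases ha : q z.2.1 z.2.2.2 a.1 a.2 = 0
        · rw [ha, zero_mul, zero_mul]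
        · rw [ih (fun j => sub_le_sub_right (ht j) _) (hq.collide_mem_extPhase ha)]
          simp only [sub_sub_sub_cancel_right]
      · intro a y
        refine indicator_one_congr ?_
        constructor
        · rintro ⟨h1, h2⟩
          exact ⟨((mkPath_cons_mem_hit_succ z a y (by omega) _ _).1 h1).2, fun j =>
            ((mkPath_cons_mem_hit_succ z a y (Nat.add_le_add_right (hn j) n₀) _ _).1 (h2 j)).2⟩
        · rintro ⟨h1, h2⟩
          exact ⟨(mkPath_cons_mem_hit_succ z a y (by omega) _ _).2 ⟨hle, h1⟩, fun j =>
            (mkPath_cons_mem_hit_succ z a y (Nat.add_le_add_right (hn j) n₀) _ _).2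
              ⟨hle.trans (ht j), h2 j⟩⟩
    · rw [evolveN_succ_of_notMem h, show N + (n₀ + 1) = N + n₀ + 1 from rfl,
        hq.tailInt_succ (hmeas _ _ _ _) (G' := fun _ _ => 0) (fun _ => measurable_const)]
      · simp [tailInt]
      · intro a y
        refine indicator_of_notMem (fun h2 => h ⟨hz, ?_⟩) _
        exact ((mkPath_cons_mem_hit_succ z a y (by omega) _ _).1 h2.1).1

/-- The probability, for the process started at `z`, that `n j` collisions have occurred up to time
`t j` and that the state at time `t j` lies in `D j`, for all `j < M`. -/
def hitProb (q : Sph d → Sph d → ℝ → Sph d → ℝ≥0∞) {M : ℕ} (n : Fin M → ℕ) (t : Fin M → ℝ)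
    (D : Fin M → Set (Phase d)) (z : Phase d) : ℝ≥0∞ :=
  tailInt q (Finset.univ.sup n) ((hits n t D).indicator 1) z

lemma IsTransRate.measurable_hitProb (hq : IsTransRate Θ q) {M : ℕ} (n : Fin M → ℕ)
    (t : Fin M → ℝ) {D : Fin M → Set (Phase d)} (hD : ∀ j, MeasurableSet (D j)) :
    Measurable (hitProb q n t D) :=
  hq.measurable_tailInt (measurable_one.indicator (measurableSet_hits n t hD))

lemma hitProb_fin_zero (n : Fin 0 → ℕ) (t : Fin 0 → ℝ) (D : Fin 0 → Set (Phase d))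
    (z : Phase d) : hitProb q n t D z = 1 := by
  have h : ∀ K, (hits n t D : Set (Path d K)) = univ := fun K =>
    eq_univ_of_forall fun x j => j.elim0
  have h0 : Finset.univ.sup n = 0 := rfl
  rw [hitProb, h, h0, tailInt_zero, indicator_univ]
  rfl

lemma hitProb_eq_zero {M : ℕ} {n : Fin (M + 1) → ℕ} {t : Fin (M + 1) → ℝ}
    {D : Fin (M + 1) → Set (Phase d)} {j : Fin (M + 1)} (hj : n j < n 0) (ht : t 0 ≤ t j)
    (z : Phase d) : hitProb q n t D z = 0 := by
  refine (lintegral_congr fun y => ?_).trans lintegral_zero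
  rw [indicator_of_notMem, mul_zero]
  intro h
  exact absurd ((h 0).1 _ hj) (not_le.2 (lt_of_le_of_lt ht (h j).2.1))

lemma IsTransRate.hitProb_cons (hq : IsTransRate Θ q) {M : ℕ} (n₀ : ℕ)
    (n : Fin M → ℕ) {t : Fin (M + 1) → ℝ} (ht : ∀ j, t 0 ≤ t j)
    {D : Fin (M + 1) → Set (Phase d)} (hD : ∀ j, MeasurableSet (D j)) {z : Phase d}
    (hz : z ∈ extPhase Θ) :
    hitProb q (Fin.cons n₀ fun j => n j + n₀ : Fin (M + 1) → ℕ) t D z =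
      evolveN Θ q n₀ (fun z => (D 0).indicator 1 z *
        hitProb q n (fun j => t j.succ - t 0) (fun j => D j.succ) z) (t 0) z := by
  have hsup : Finset.univ.sup (Fin.cons n₀ fun j => n j + n₀ : Fin (M + 1) → ℕ) =
      Finset.univ.sup n + n₀ := by
    refine le_antisymm (Finset.sup_le fun j _ => ?_) ?_
    · refine Fin.cases ?_ (fun j => ?_) j
      · simp
      · simpa using Finset.le_sup (f := n) (Finset.mem_univ j)
    · rcases Nat.eq_zero_or_pos M with rfl | hM
      · simp
      · have : Nonempty (Fin M) := ⟨⟨0, hM⟩⟩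
        obtain ⟨j, -, hj⟩ := Finset.exists_mem_eq_sup Finset.univ Finset.univ_nonempty n
        rw [hj]
        simpa using Finset.le_sup (f := (Fin.cons n₀ fun j => n j + n₀ : Fin (M + 1) → ℕ))
          (Finset.mem_univ j.succ)
  have hset : ∀ K, (hits (Fin.cons n₀ fun j => n j + n₀ : Fin (M + 1) → ℕ) t D :
      Set (Path d K)) = hit n₀ (t 0) (D 0) ∩
        hits (fun j => n j + n₀) (fun j => t j.succ) (fun j => D j.succ) := by
    intro K
    ext x
    simp [hits, Fin.forall_fin_succ]
  rw [hitProb, hset, hsup]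
  exact hq.tailInt_hit_inter_hits n₀ (fun j => Finset.le_sup (Finset.mem_univ j))
    (fun j => ht j.succ) (hD 0) (fun j => hD j.succ) hz

lemma IsTransRate.tsum_hitProb_succ (hq : IsTransRate Θ q) {M : ℕ}
    {t : Fin (M + 1) → ℝ} (ht : ∀ j, t 0 ≤ t j)
    {D : Fin (M + 1) → Set (Phase d)} (hD : ∀ j, MeasurableSet (D j)) {z : Phase d}
    (hz : z ∈ extPhase Θ) :
    ∑' n, hitProb q n t D z = evolve Θ q (fun z => (D 0).indicator 1 z *
      ∑' n, hitProb q n (fun j => t j.succ - t 0) (fun j => D j.succ) z) (t 0) z := by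
  have hm : ∀ n : Fin M → ℕ, Measurable fun z => (D 0).indicator (1 : Phase d → ℝ≥0∞) z *
      hitProb q n (fun j => t j.succ - t 0) (fun j => D j.succ) z := fun n =>
    (measurable_one.indicator (hD 0)).mul (hq.measurable_hitProb n _ fun j => hD j.succ)
  rw [← (Fin.consEquiv fun _ : Fin (M + 1) => ℕ).tsum_eq, ENNReal.tsum_prod', evolve]
  refine tsum_congr fun n₀ => ?_
  simp_rw [← ENNReal.tsum_mul_left]
  rw [hq.evolveN_tsum n₀ hm]
  have hinj : Function.Injective fun (n : Fin M → ℕ) j => n j + n₀ := fun n n' h =>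
    funext fun j => Nat.add_right_cancel (congrFun h j)
  rw [← hinj.tsum_eq]
  · exact tsum_congr fun n => hq.hitProb_cons n₀ n ht hD hz
  · intro n hn
    by_contra hne
    have : ∃ j, n j < n₀ := by
      by_contra! hge
      exact hne ⟨fun j => n j - n₀, funext fun j => Nat.sub_add_cancel (hge j)⟩
    obtain ⟨j, hj⟩ := this
    exact hn (hitProb_eq_zero (n := (Fin.cons n₀ n : Fin (M + 1) → ℕ)) (j := j.succ)
      (by simpa using hj) (ht _) z)

/-- The expectation of `h` at the state at time `t m` of the process started at `z`, on the event
that the state at time `t k` lies in `D k` for all `k < m`. -/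
def nest (Θ : Sph d × Sph d → Sph d × Sph d) (q : Sph d → Sph d → ℝ → Sph d → ℝ≥0∞)
    (t : ℕ → ℝ) (D : ℕ → Set (Phase d)) : ℕ → (Phase d → ℝ≥0∞) → Phase d → ℝ≥0∞
  | 0, h => evolve Θ q h (t 0)
  | m + 1, h => nest Θ q t D m fun z => (D m).indicator 1 z * evolve Θ q h (t (m + 1) - t m) z

lemma nest_succ (t : ℕ → ℝ) (D : ℕ → Set (Phase d)) (m : ℕ) (h : Phase d → ℝ≥0∞) :
    nest Θ q t D (m + 1) h = evolve Θ q (fun z => (D 0).indicator 1 z *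
      nest Θ q (fun j => t (j + 1) - t 0) (fun j => D (j + 1)) m h z) (t 0) := by
  induction m generalizing h with
  | zero => rfl
  | succ m ih =>
    rw [nest, ih]
    simp only [nest, sub_sub_sub_cancel_right]

/-- Summing over the numbers of collisions gives the probability that the process started at `z`
visits `D j` at time `t j`, for all `j ≤ m`. -/
theorem IsTransRate.tsum_hitProb (hq : IsTransRate Θ q) {t : ℕ → ℝ} (ht : Monotone t)
    {D : ℕ → Set (Phase d)} (hD : ∀ j, MeasurableSet (D j)) (m : ℕ) {z : Phase d}
    (hz : z ∈ extPhase Θ) :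
    ∑' n : Fin (m + 1) → ℕ, hitProb q n (fun j => t j) (fun j => D j) z =
      nest Θ q t D m ((D m).indicator 1) z := by
  induction m generalizing t D z with
  | zero =>
    rw [hq.tsum_hitProb_succ (fun j => ht (Nat.zero_le _)) (fun j => hD j) hz]
    refine evolve_congr (fun z _ => ?_) _ _
    simp_rw [hitProb_fin_zero, tsum_fintype, Finset.univ_unique, Finset.sum_singleton]
    exact mul_one _
  | succ m ih =>
    rw [hq.tsum_hitProb_succ (fun j => ht (Nat.zero_le _)) (fun j => hD j) hz, nest_succ]
    refine evolve_congr (fun z hz => ?_) _ _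
    congr 1
    exact ih (t := fun j => t (j + 1) - t 0) (D := fun j => D (j + 1))
      (fun i j hij => sub_le_sub_right (ht (Nat.succ_le_succ hij)) _) (fun j => hD _) hz

lemma IsTransRate.measurable_nest (hq : IsTransRate Θ q) (t : ℕ → ℝ)
    {D : ℕ → Set (Phase d)} (hD : ∀ j, MeasurableSet (D j)) (m : ℕ) {h : Phase d → ℝ≥0∞}
    (hh : Measurable h) : Measurable (nest Θ q t D m h) := by
  induction m generalizing h with
  | zero => exact hq.measurable_evolve hh _
  | succ m ih => exact ih ((measurable_one.indicator (hD m)).mul (hq.measurable_evolve hh _))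

lemma IsTransRate.nest_le_one (hq : IsTransRate Θ q) (t : ℕ → ℝ)
    (D : ℕ → Set (Phase d)) (m : ℕ) {h : Phase d → ℝ≥0∞}
    (hh : ∀ z, h z ≤ 1) (z : Phase d) : nest Θ q t D m h z ≤ 1 := by
  induction m generalizing h with
  | zero => exact hq.evolve_le_one hh _ z
  | succ m ih =>
    refine ih fun z => mul_le_one' ?_ (hq.evolve_le_one hh _ z)
    exact indicator_le_self' (fun _ _ => zero_le_one) z

/-- The time of a given collision has no atoms. -/
lemma IsTransRate.tailInt_time_eq (hq : IsTransRate Θ q) {N k : ℕ} (hk : k ≤ N) {t : ℝ}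
    {z : Phase d} (hz : z.2.2.1 ≠ t) :
    tailInt q N ({x | x.time (k + 1) = t}.indicator 1) z = 0 := by
  have hmeas : ∀ (j K : ℕ) (s : ℝ), Measurable
      ({x : Path d K | x.time j = s}.indicator (1 : Path d K → ℝ≥0∞)) := fun j K s =>
    measurable_one.indicator (measurableSet_eq_fun (Path.measurable_time j) measurable_const)
  induction k generalizing N t z with
  | zero =>
    refine (lintegral_congr fun y => ?_).trans lintegral_zero
    rw [indicator_of_notMem, mul_zero]
    intro h
    have h' : (mkPath z y).time 1 = t := h
    exact hz ((Path.time_mkPath_one z y).symm.trans h')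
  | succ k ih =>
    obtain ⟨N, rfl⟩ := Nat.exists_eq_succ_of_ne_zero (show N ≠ 0 by omega)
    rw [hq.tailInt_succ (hmeas _ _ _)
      (G' := fun _ => {x | x.time (k + 1) = t - z.2.2.1}.indicator 1) (fun _ => hmeas _ _ _)]
    · have h1 : ∀ᵐ a ∂stepMeasure d, a.1 ≠ t - z.2.2.1 :=
        Measure.quasiMeasurePreserving_fst.ae (Measure.ae_ne volume _)
      refine (lintegral_congr_ae ?_).trans lintegral_zero
      filter_upwards [h1] with a ha
      rw [ih (by omega) (by exact ha), mul_zero]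
    · intro a y
      refine indicator_one_congr ?_
      have := Path.time_cons z a y (k + 1)
      constructor
      · intro h
        have h' : (mkPath z (Fin.cons a y : Fin (N + 1) → ℝ × Sph d)).time (k + 1 + 1) = t := h
        show _ = _
        linarith
      · intro h
        have h' : (mkPath (collide z a) y).time (k + 1) = t - z.2.2.1 := h
        show _ = _
        linarith

end Hit

section FiniteDimensional

variable {d : ℕ} {Θ : Sph d × Sph d → Sph d × Sph d} {q : Sph d → Sph d → ℝ → Sph d → ℝ≥0∞}

namespace IsTransRate

lemma map_head_withDensity (hq : IsTransRate Θ q) {N : ℕ} {S : Set (Path d (N + 1))}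
    (hS : MeasurableSet S) :
    ((sigmaN Θ (N + 1)).withDensity fun x => tailWeight q x * S.indicator 1 x).map Path.head =
      (sigma1 Θ).withDensity (tailInt q N (S.indicator 1)) := by
  ext A hA
  have hA' : MeasurableSet (Path.head ⁻¹' A : Set (Path d (N + 1))) :=
    hA.preimage Path.measurable_head
  rw [Measure.map_apply Path.measurable_head hA, withDensity_apply _ hA', withDensity_apply _ hA,
    ← lintegral_indicator hA', ← lintegral_indicator hA]
  have h := hq.lintegral_sigmaN (F := A.indicator 1) (measurable_one.indicator hA)
    (G := S.indicator 1) (measurable_one.indicator hS)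
  have h1 : ∀ x : Path d (N + 1), (Path.head ⁻¹' A).indicator
      (fun x => tailWeight q x * S.indicator 1 x) x =
        A.indicator 1 x.head * tailWeight q x * S.indicator 1 x := by
    intro x
    by_cases hx : x.head ∈ A
    · rw [indicator_of_mem hx, indicator_of_mem (show x ∈ Path.head ⁻¹' A from hx)]
      simp
    · rw [indicator_of_notMem hx, indicator_of_notMem (show x ∉ Path.head ⁻¹' A from hx)]
      simp
  have h2 : ∀ z, A.indicator (tailInt q N (S.indicator 1)) z =
      A.indicator 1 z * tailInt q N (S.indicator 1) z := by
    intro z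
    by_cases hz : z ∈ A
    · simp [hz]
    · simp [hz]
  rw [lintegral_congr h1, lintegral_congr h2]
  exact h

lemma ae_len_pos_path (hq : IsTransRate Θ q) (N : ℕ) :
    ∀ᵐ x ∂sigmaN Θ N, ∀ j < N, 0 < x.len j := by
  have h0 : ∀ᵐ x ∂(volume : Measure (E d)).prod ((volSph d).prod (tailMeasure d N)),
      ∀ i : Fin N, (x.2.2 i).1 ≠ 0 := by
    refine ae_all_iff.2 fun i => ?_
    have h1 : ∀ᵐ a ∂stepMeasure d, a.1 ≠ 0 :=
      Measure.quasiMeasurePreserving_fst.ae (Measure.ae_ne volume 0)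
    have h2 : ∀ᵐ y ∂tailMeasure d N, (y i).1 ≠ 0 :=
      (Measure.quasiMeasurePreserving_eval (fun _ : Fin N => stepMeasure d) i).ae h1
    exact (Measure.quasiMeasurePreserving_snd.comp Measure.quasiMeasurePreserving_snd).ae h2
  have h1 : ∀ᵐ x ∂sigmaN Θ N, x ∈ pathSpace Θ N := ae_restrict_mem (hq.measurableSet_pathSpace N)
  filter_upwards [h1, ae_restrict_of_ae (s := pathSpace Θ N) h0] with x hx hx' j hj
  refine lt_of_le_of_ne (hx j hj).1 ?_
  rw [Path.len, dif_pos hj]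
  exact (hx' ⟨j, hj⟩).symm

/-- The value of the transition density at path length zero is irrelevant. -/
lemma ae_pathDens_eq [NeZero d] (hq : IsTransRate Θ q) {R : Sph d → (E d ≃ₗᵢ[ℝ] E d)}
    (hR : ∀ v w ξ u, 0 < ξ → (q v w ξ u).toReal = transDens Θ R v w ξ u) (f : Phase d → ℝ)
    (N : ℕ) : ∀ᵐ x ∂sigmaN Θ (N + 1), pathDens Θ R f N x = f x.head * (tailWeight q x).toReal := by
  filter_upwards [hq.ae_len_pos_path (N + 1)] with x hx
  rw [pathDens, tailWeight, ENNReal.toReal_prod]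
  refine congrArg₂ _ rfl (Finset.prod_congr rfl fun j hj => ?_)
  exact (hR _ _ _ _ (hx _ (Nat.succ_lt_succ (Finset.mem_range.1 hj)))).symm

/-- Almost surely, the event `visit` of the definition of the process is the event `hits`; the
condition that the state lies in the phase space forces the next collision to be later than
`t j`. -/
lemma ae_mem_visit_iff (hq : IsTransRate Θ q) {N M : ℕ} {n : Fin M → ℕ} (hn : ∀ j, n j ≤ N)
    (t : Fin M → ℝ≥0) {D : Fin M → Set (Phase d)} (hD : ∀ j, D j ⊆ extPhase Θ) :
    ∀ᵐ x ∂sigmaN Θ (N + 1), tailWeight q x ≠ 0 →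
      (x ∈ visit N n t D ↔ x ∈ hits n (fun j => (t j : ℝ)) D) := by
  have h1 : ∀ᵐ x ∂sigmaN Θ (N + 1), x ∈ pathSpace Θ (N + 1) :=
    ae_restrict_mem (hq.measurableSet_pathSpace _)
  -- the two events differ only by a collision at one of the times `t j`
  have h2 : ∀ᵐ x ∂sigmaN Θ (N + 1), ∀ j, tailWeight q x ≠ 0 → x.time (n j + 1) ≠ t j := by
    refine ae_all_iff.2 fun j => ?_
    have hm : Measurable ({x : Path d (N + 1) | x.time (n j + 1) = t j}.indicator
        (1 : Path d (N + 1) → ℝ≥0∞)) := measurable_one.indicator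
      (measurableSet_eq_fun (Path.measurable_time _) measurable_const)
    have h3 := hq.lintegral_sigmaN (F := 1) measurable_one hm
    have h4 : ∫⁻ z, (1 : Phase d → ℝ≥0∞) z * tailInt q N
        ({x : Path d (N + 1) | x.time (n j + 1) = t j}.indicator 1) z ∂sigma1 Θ = 0 := by
      have h5 : ∀ᵐ z ∂phaseMeasure d, z.2.2.1 ≠ (t j : ℝ) := by
        have h1 : ∀ᵐ a ∂stepMeasure d, a.1 ≠ (t j : ℝ) :=
          Measure.quasiMeasurePreserving_fst.ae (Measure.ae_ne volume _)
        exact (Measure.quasiMeasurePreserving_snd.comp Measure.quasiMeasurePreserving_snd).ae h1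
      refine (lintegral_congr_ae ?_).trans lintegral_zero
      filter_upwards [ae_restrict_of_ae (s := extPhase Θ) h5] with z hz
      rw [hq.tailInt_time_eq (hn j) hz, mul_zero]
    have hm' : Measurable fun x : Path d (N + 1) => (1 : Phase d → ℝ≥0∞) x.head * tailWeight q x *
        {x : Path d (N + 1) | x.time (n j + 1) = t j}.indicator (1 : Path d (N + 1) → ℝ≥0∞) x :=
      (measurable_const.mul hq.measurable_tailWeight).mul hm
    rw [h4, lintegral_eq_zero_iff hm'] at h3
    filter_upwards [h3] with x hx hw ht
    have hx' : 1 * tailWeight q x * ({x : Path d (N + 1) | x.time (n j + 1) = t j}.indicator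
      (1 : Path d (N + 1) → ℝ≥0∞)) x = 0 := hx
    rw [indicator_of_mem (show x ∈ {x : Path d (N + 1) | x.time (n j + 1) = t j} from ht)] at hx'
    simp [hw] at hx'
  filter_upwards [h1, h2] with x hx hne hw
  constructor
  · intro h j
    refine ⟨fun i hi => le_trans ?_ (h j).2, ?_, (h j).1⟩
    · refine Finset.sum_le_sum_of_subset_of_nonneg
        (Finset.range_subset_range.2 (Nat.succ_le_of_lt hi)) fun i hi' _ => ?_
      have h3 := Finset.mem_range.1 hi'
      exact (hx i (by have := hn j; omega)).1
    · have h3 : 0 ≤ x.time (n j + 1) - t j := (hD j (h j).1).1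
      exact lt_of_le_of_ne (sub_nonneg.1 h3) (Ne.symm (hne j hw))
  · intro h j
    refine ⟨(h j).2.2, ?_⟩
    rcases Nat.eq_zero_or_pos (n j) with h0 | h0
    · rw [h0, Path.time_mkPath_zero]
      exact (t j).2
    · have := (h j).1 (n j - 1) (by omega)
      rwa [Nat.sub_add_cancel h0] at this

end IsTransRate

lemma measurableSet_visit {M : ℕ} (N : ℕ) (n : Fin M → ℕ) (t : Fin M → ℝ≥0)
    {D : Fin M → Set (Phase d)} (hD : ∀ j, MeasurableSet (D j)) :
    MeasurableSet (visit N n t D) := by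
  have : visit N n t D = ⋂ j, ((fun x : Path d (N + 1) => x.state (n j) (t j)) ⁻¹' D j ∩
      {x : Path d (N + 1) | x.time (n j) ≤ t j}) := by
    ext x
    simp [visit]
  rw [this]
  exact MeasurableSet.iInter fun j => ((hD j).preimage (Path.measurable_state _ _)).inter
    (measurableSet_le (Path.measurable_time _) measurable_const)

/-- The finite-dimensional distributions of the process in terms of the transition operators. -/
theorem IsTransRate.hasProb [NeZero d] (hq : IsTransRate Θ q) {R : Sph d → (E d ≃ₗᵢ[ℝ] E d)}
    (hR : ∀ v w ξ u, 0 < ξ → (q v w ξ u).toReal = transDens Θ R v w ξ u)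
    (hfin : ∀ v w ξ u, q v w ξ u ≠ ⊤) {f : Phase d → ℝ} (hf : Measurable f)
    {t : ℕ → ℝ≥0} (ht : Monotone t) {D : ℕ → Set (Phase d)} (hD : ∀ j, MeasurableSet (D j))
    (hDX : ∀ j, D j ⊆ extPhase Θ) (m : ℕ)
    (hint : Integrable (fun z => f z *
      (nest Θ q (fun j => (t j : ℝ)) D m ((D m).indicator 1) z).toReal) (sigma1 Θ)) :
    HasProb Θ R f (fun j : Fin (m + 1) => t j) (fun j => D j)
      (∫ z, f z * (nest Θ q (fun j => (t j : ℝ)) D m ((D m).indicator 1) z).toReal ∂sigma1 Θ) := by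
  set V := nest Θ q (fun j => (t j : ℝ)) D m ((D m).indicator 1)
  have ht' : Monotone fun j => (t j : ℝ) := fun i j hij => NNReal.coe_le_coe.2 (ht hij)
  have hV1 : ∀ z, V z ≤ 1 := hq.nest_le_one _ _ _
    (indicator_le_self' (fun _ _ => zero_le_one))
  let T : (Fin (m + 1) → ℕ) → Phase d → ℝ≥0∞ := fun n =>
    hitProb q n (fun j => (t j : ℝ)) fun j => D j
  have hTm : ∀ n, Measurable (T n) := fun n => hq.measurable_hitProb n _ fun j => hD j
  have hTV : ∀ z ∈ extPhase Θ, ∑' n, T n z = V z := fun z hz => hq.tsum_hitProb ht' hD m hz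
  have hTle : ∀ z ∈ extPhase Θ, ∀ n, T n z ≤ V z := fun z hz n => by
    rw [← hTV z hz]
    exact ENNReal.le_tsum n
  have hT1 : ∀ᵐ z ∂sigma1 Θ, ∀ n, T n z < ⊤ := by
    filter_upwards [hq.ae_mem_extPhase] with z hz n
    exact lt_of_le_of_lt ((hTle z hz n).trans (hV1 z)) ENNReal.one_lt_top
  have hTint : ∀ n, Integrable (fun z => f z * (T n z).toReal) (sigma1 Θ) := by
    intro n
    refine hint.mono (hf.mul (hTm n).ennreal_toReal).aestronglyMeasurable ?_
    filter_upwards [hq.ae_mem_extPhase] with z hz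
    rw [norm_mul, norm_mul]
    refine mul_le_mul_of_nonneg_left ?_ (norm_nonneg _)
    rw [Real.norm_of_nonneg ENNReal.toReal_nonneg, Real.norm_of_nonneg ENNReal.toReal_nonneg]
    exact ENNReal.toReal_mono (lt_of_le_of_lt (hV1 z) ENNReal.one_lt_top).ne (hTle z hz n)
  -- the contribution of each vector of collision numbers
  have key : ∀ n : Fin (m + 1) → ℕ,
      IntegrableOn (pathDens Θ R f (Finset.univ.sup n))
        (visit (Finset.univ.sup n) n (fun j => t j) fun j => D j)
        (sigmaN Θ (Finset.univ.sup n + 1)) ∧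
      ∫ x in visit (Finset.univ.sup n) n (fun j => t j) fun j => D j,
        pathDens Θ R f (Finset.univ.sup n) x ∂(sigmaN Θ (Finset.univ.sup n + 1)) =
      ∫ z, f z * (T n z).toReal ∂sigma1 Θ := by
    intro n
    set N := Finset.univ.sup n with hN
    have hn : ∀ j, n j ≤ N := fun j => Finset.le_sup (Finset.mem_univ j)
    let S : Set (Path d (N + 1)) := hits n (fun j => (t j : ℝ)) fun j => D j
    have hS : MeasurableSet S := measurableSet_hits n _ fun j => hD j
    let W : Path d (N + 1) → ℝ≥0∞ := fun x => tailWeight q x * S.indicator 1 x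
    have hW : Measurable W := hq.measurable_tailWeight.mul (measurable_one.indicator hS)
    have hWfin : ∀ᵐ x ∂sigmaN Θ (N + 1), W x < ⊤ := Filter.Eventually.of_forall fun x => by
      refine ENNReal.mul_lt_top (ENNReal.prod_lt_top fun j _ => (hfin _ _ _ _).lt_top) ?_
      exact lt_of_le_of_lt (indicator_le_self' (fun _ _ => zero_le_one) x) ENNReal.one_lt_top
    have hvis : MeasurableSet (visit N n (fun j => t j) fun j => D j) :=
      measurableSet_visit N n _ fun j => hD j
    have hae : (visit N n (fun j => t j) fun j => D j).indicator (pathDens Θ R f N)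
        =ᵐ[sigmaN Θ (N + 1)] fun x => f x.head * (W x).toReal := by
      filter_upwards [hq.ae_pathDens_eq hR f N, hq.ae_mem_visit_iff hn (fun j => t j)
        (fun j => hDX j)] with x hx hx'
      simp only [W]
      by_cases hw : tailWeight q x = 0
      · rw [hw, zero_mul, ENNReal.toReal_zero, mul_zero, indicator_apply_eq_zero]
        intro _
        rw [hx, hw, ENNReal.toReal_zero, mul_zero]
      · by_cases hxS : x ∈ S
        · rw [indicator_of_mem hxS, indicator_of_mem ((hx' hw).2 hxS), hx]
          simp
        · rw [indicator_of_notMem hxS, indicator_of_notMem fun h => hxS ((hx' hw).1 h)]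
          simp
    -- push the weighted measure on paths forward to the first free flight
    have hmap := hq.map_head_withDensity hS
    have hTn : (sigma1 Θ).withDensity (tailInt q N (S.indicator 1)) =
      (sigma1 Θ).withDensity (T n) := rfl
    rw [hTn] at hmap
    have hTn1 : ∀ᵐ z ∂sigma1 Θ, T n z < ⊤ := by
      filter_upwards [hT1] with z hz using hz n
    constructor
    · rw [← integrable_indicator_iff hvis, integrable_congr hae]
      have h1 : Integrable f ((sigma1 Θ).withDensity (T n)) :=
        (integrable_withDensity_iff (hTm n) hTn1).2 (hTint n)
      rw [← hmap, integrable_map_measure hf.aestronglyMeasurable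
        Path.measurable_head.aemeasurable] at h1
      exact (integrable_withDensity_iff hW hWfin).1 h1
    · rw [← integral_indicator hvis, integral_congr_ae hae]
      have h1 : ∫ z, f z ∂((sigma1 Θ).withDensity (T n)) = ∫ z, f z * (T n z).toReal ∂sigma1 Θ := by
        rw [integral_withDensity_eq_integral_toReal_smul (hTm n) hTn1]
        simp_rw [smul_eq_mul, mul_comm]
      rw [← h1, ← hmap, integral_map Path.measurable_head.aemeasurable hf.aestronglyMeasurable,
        integral_withDensity_eq_integral_toReal_smul hW hWfin]
      simp_rw [smul_eq_mul, mul_comm]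
  refine ⟨fun n => (key n).1, ?_⟩
  simp_rw [fun n => (key n).2]
  have hsum : ∫ z, f z * (V z).toReal ∂sigma1 Θ =
      ∫ z, ∑' n, f z * (T n z).toReal ∂sigma1 Θ := by
    refine integral_congr_ae ?_
    filter_upwards [hq.ae_mem_extPhase, hT1] with z hz hz1
    rw [← hTV z hz, ENNReal.tsum_toReal_eq fun n => (hz1 n).ne, tsum_mul_left]
  rw [hsum]
  refine hasSum_integral_of_summable_integral_norm hTint ?_
  -- the absolute values are summed in `ℝ≥0∞`
  refine ENNReal.summable_toReal (f := fun n => ∫⁻ z, ‖f z * (T n z).toReal‖ₑ ∂sigma1 Θ) ?_ |>.congr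
    fun n => ?_
  · have hme : ∀ n, AEMeasurable (fun z => ‖f z * (T n z).toReal‖ₑ) (sigma1 Θ) := fun n =>
      (hf.mul (hTm n).ennreal_toReal).enorm.aemeasurable
    rw [← lintegral_tsum hme]
    refine ne_of_lt (lt_of_le_of_lt (lintegral_mono_ae ?_) hint.2)
    filter_upwards [hq.ae_mem_extPhase, hT1] with z hz hz1
    have h1 : ∀ n, ‖f z * (T n z).toReal‖ₑ = ‖f z‖ₑ * T n z := fun n => by
      rw [enorm_mul, Real.enorm_of_nonneg ENNReal.toReal_nonneg, ENNReal.ofReal_toReal (hz1 n).ne]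
    simp_rw [h1]
    rw [ENNReal.tsum_mul_left, hTV z hz, enorm_mul, Real.enorm_of_nonneg ENNReal.toReal_nonneg,
      ENNReal.ofReal_toReal (lt_of_le_of_lt (hV1 z) ENNReal.one_lt_top).ne]
  · rw [integral_norm_eq_lintegral_enorm (hTint n).1]

end FiniteDimensional

/-! ### The propagators on locally integrable densities -/

section Local

variable {d : ℕ} {Θ : Sph d × Sph d → Sph d × Sph d} {q : Sph d → Sph d → ℝ → Sph d → ℝ≥0∞}

lemma phaseBox_mono {r s : ℝ} (h : r ≤ s) : phaseBox d r ⊆ phaseBox d s :=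
  fun _ hz => ⟨hz.1.trans h, hz.2.trans h⟩

lemma isCompact_phaseBox (r : ℝ) : IsCompact (phaseBox d r) := by
  have h : phaseBox d r = Metric.closedBall 0 r ×ˢ univ ×ˢ Icc (-r) r ×ˢ univ := by
    ext z
    simp [phaseBox, abs_le]
  rw [h]
  exact (isCompact_closedBall 0 r).prod (isCompact_univ.prod (isCompact_Icc.prod isCompact_univ))

lemma exists_subset_phaseBox {D : Set (Phase d)} (hD : Bornology.IsBounded D) :
    ∃ n : ℕ, D ⊆ phaseBox d n := by
  have h1 : Bornology.IsBounded ((fun z : Phase d => z.1) '' D) := hD.image_fst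
  have h2 : Bornology.IsBounded ((fun z : Phase d => z.2.2.1) '' D) := by
    have := hD.image_snd.image_snd.image_fst
    simpa only [image_image] using this
  obtain ⟨a, ha⟩ := h1.exists_norm_le
  obtain ⟨b, hb⟩ := h2.exists_norm_le
  obtain ⟨n, hn⟩ := exists_nat_ge (max a b)
  refine ⟨n, fun z hz => ⟨?_, ?_⟩⟩
  · exact (ha _ (mem_image_of_mem _ hz)).trans ((le_max_left _ _).trans hn)
  · exact (hb _ (mem_image_of_mem _ hz)).trans ((le_max_right _ _).trans hn)

lemma isBounded_phaseBox (r : ℝ) : Bornology.IsBounded (phaseBox d r) :=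
  (isCompact_phaseBox r).isBounded

lemma iUnion_phaseBox : ⋃ n : ℕ, phaseBox d n = univ := by
  refine eq_univ_of_forall fun z => ?_
  obtain ⟨n, hn⟩ := exists_subset_phaseBox (Bornology.isBounded_singleton (x := z))
  exact mem_iUnion.2 ⟨n, hn rfl⟩

/-- Local integrability on the closure of the phase space amounts to integrability on boxes. -/
lemma IsTransRate.mem_L1loc_iff (hq : IsTransRate Θ q) {f : Phase d →ₘ[sigma1 Θ] ℝ} :
    f ∈ L1loc Θ ↔ ∀ n : ℕ, IntegrableOn f (phaseBox d n) (sigma1 Θ) := by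
  constructor
  · intro h n
    have h1 := h _ ((isCompact_phaseBox (d := d) n).inter_right isClosed_closure)
      (inter_subset_right (t := closure (extPhase Θ)))
    refine h1.congr_set_ae ?_
    filter_upwards [hq.ae_mem_extPhase] with z hz
    exact propext ⟨fun h => ⟨h, subset_closure hz⟩, fun h => h.1⟩
  · intro h C hC _
    obtain ⟨n, hn⟩ := exists_subset_phaseBox hC.isBounded
    exact (h n).mono_set hn

/-- A locally integrable density is determined by its integrals over bounded sets. -/
lemma IsTransRate.ae_eq_of_forall_setIntegral_eq (hq : IsTransRate Θ q) {f g : Phase d → ℝ}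
    (hf : ∀ n : ℕ, IntegrableOn f (phaseBox d n) (sigma1 Θ))
    (hg : ∀ n : ℕ, IntegrableOn g (phaseBox d n) (sigma1 Θ))
    (h : ∀ D, MeasurableSet D → Bornology.IsBounded D → D ⊆ extPhase Θ →
      ∫ z in D, f z ∂sigma1 Θ = ∫ z in D, g z ∂sigma1 Θ) : f =ᵐ[sigma1 Θ] g := by
  have h1 : ∀ n : ℕ, f =ᵐ[(sigma1 Θ).restrict (phaseBox d n)] g := fun n => by
    refine Integrable.ae_eq_of_forall_setIntegral_eq f g (hf n) (hg n) fun s hs _ => ?_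
    have h2 : (s ∩ phaseBox d n : Set (Phase d)) =ᵐ[sigma1 Θ]
        (s ∩ phaseBox d n ∩ extPhase Θ : Set (Phase d)) := by
      filter_upwards [hq.ae_mem_extPhase] with z hz
      exact propext ⟨fun h => ⟨h, hz⟩, fun h => h.1⟩
    rw [Measure.restrict_restrict hs, setIntegral_congr_set h2, setIntegral_congr_set h2]
    exact h _ ((hs.inter (measurableSet_phaseBox _)).inter hq.measurableSet_extPhase)
      ((isBounded_phaseBox (d := d) n).subset (inter_subset_left.trans inter_subset_right))
      inter_subset_right
  have h2 := (ae_restrict_iUnion_iff (fun n : ℕ => phaseBox d n) fun z => f z = g z).2 h1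
  rwa [iUnion_phaseBox, Measure.restrict_univ] at h2

lemma indicator_iUnion_one_eq_tsum {α : Type*} {D : ℕ → Set α}
    (hD : Pairwise (Function.onFun Disjoint D))
    (z : α) : (⋃ i, D i).indicator (1 : α → ℝ≥0∞) z = ∑' i, (D i).indicator 1 z := by
  by_cases hz : z ∈ ⋃ i, D i
  · obtain ⟨i, hi⟩ := mem_iUnion.1 hz
    rw [indicator_of_mem hz, tsum_eq_single i, indicator_of_mem hi]
    intro j hj
    exact indicator_of_notMem (fun h => disjoint_left.1 (hD hj) h hi) _
  · rw [indicator_of_notMem hz]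
    exact (ENNReal.tsum_eq_zero.2 fun i =>
      indicator_of_notMem (fun h => hz (mem_iUnion.2 ⟨i, h⟩)) _).symm

namespace IsTransRate

lemma evolveN_iSup (hq : IsTransRate Θ q) (n : ℕ) {g : ℕ → Phase d → ℝ≥0∞}
    (hg : ∀ i, Measurable (g i)) (hmono : Monotone g) (t : ℝ) (z : Phase d) :
    evolveN Θ q n (fun z => ⨆ i, g i z) t z = ⨆ i, evolveN Θ q n (g i) t z := by
  induction n generalizing t z with
  | zero =>
    by_cases h : z ∈ freeSet Θ t
    · simp_rw [evolveN_zero_of_mem h]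
    · simp_rw [evolveN_zero_of_notMem h, iSup_const]
  | succ n ih =>
    by_cases h : z ∈ hitSet Θ t
    · simp_rw [evolveN_succ_of_mem h, ih, ENNReal.mul_iSup]
      exact lintegral_iSup (fun i => hq.measurable_evolveN_step n (hg i) _ z) fun i j hij a =>
        mul_le_mul_right (evolveN_mono (fun z _ => hmono hij z) _ _) _
    · simp_rw [evolveN_succ_of_notMem h, iSup_const]

lemma evolve_iSup (hq : IsTransRate Θ q) {g : ℕ → Phase d → ℝ≥0∞}
    (hg : ∀ i, Measurable (g i)) (hmono : Monotone g) (t : ℝ) (z : Phase d) :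
    evolve Θ q (fun z => ⨆ i, g i z) t z = ⨆ i, evolve Θ q (g i) t z := by
  simp_rw [evolve, hq.evolveN_iSup _ hg hmono, ← lintegral_count]
  exact lintegral_iSup (fun i => measurable_from_top) fun i j hij n =>
    evolveN_mono (fun z _ => hmono hij z) _ _

lemma evolve_add_fun (hq : IsTransRate Θ q) {g h : Phase d → ℝ≥0∞} (hg : Measurable g)
    (hh : Measurable h) (t : ℝ) (z : Phase d) :
    evolve Θ q (fun z => g z + h z) t z = evolve Θ q g t z + evolve Θ q h t z := by
  have := hq.evolve_tsum (g := fun b : Bool => if b then g else h)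
    (fun b => by cases b <;> simpa) t z
  simpa [tsum_fintype, add_comm] using this

/-- The distribution at time `t` of the process with initial density `F`. -/
def law (hq : IsTransRate Θ q) {F : Phase d → ℝ≥0∞} (hF : Measurable F) (t : ℝ) :
    Measure (Phase d) :=
  Measure.ofMeasurable (fun D _ => ∫⁻ z, F z * evolve Θ q (D.indicator 1) t z ∂sigma1 Θ)
    (by
      have h : ∀ z, evolve Θ q ((∅ : Set (Phase d)).indicator 1) t z = 0 := fun z => by
        have := hq.evolve_const_mul 0 (g := 1) measurable_one t z
        rw [zero_mul] at this
        rw [← this]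
        exact evolve_congr (fun z _ => by simp) t z
      simp_rw [h, mul_zero, lintegral_zero])
    (by
      intro D hD hdisj
      have h : ∀ z, evolve Θ q ((⋃ i, D i).indicator 1) t z =
          ∑' i, evolve Θ q ((D i).indicator 1) t z := fun z => by
        rw [← hq.evolve_tsum fun i => measurable_one.indicator (hD i)]
        refine evolve_congr (fun z _ => ?_) t z
        exact indicator_iUnion_one_eq_tsum hdisj z
      simp_rw [h, ← ENNReal.tsum_mul_left]
      exact lintegral_tsum fun i =>
        (hF.mul (hq.measurable_evolve (measurable_one.indicator (hD i)) t)).aemeasurable)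

lemma law_apply (hq : IsTransRate Θ q) {F : Phase d → ℝ≥0∞} (hF : Measurable F) (t : ℝ)
    {D : Set (Phase d)} (hD : MeasurableSet D) :
    hq.law hF t D = ∫⁻ z, F z * evolve Θ q (D.indicator 1) t z ∂sigma1 Θ :=
  Measure.ofMeasurable_apply D hD

lemma lintegral_law (hq : IsTransRate Θ q) {F : Phase d → ℝ≥0∞} (hF : Measurable F) (t : ℝ)
    {h : Phase d → ℝ≥0∞} (hh : Measurable h) :
    ∫⁻ z, h z ∂hq.law hF t = ∫⁻ z, F z * evolve Θ q h t z ∂sigma1 Θ := by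
  refine Measurable.ennreal_induction (motive := fun h => ∫⁻ z, h z ∂hq.law hF t =
    ∫⁻ z, F z * evolve Θ q h t z ∂sigma1 Θ) ?_ ?_ ?_ hh
  · intro c s hs
    have h1 : s.indicator (fun _ => c) = fun z => c * s.indicator 1 z := by
      ext z
      by_cases hz : z ∈ s <;> simp [hz]
    have hm := hq.measurable_evolve (measurable_one.indicator hs) t
    have hm' : Measurable fun z => F z * evolve Θ q (s.indicator 1) t z := hF.mul hm
    rw [h1, lintegral_const_mul _ (measurable_one.indicator hs), lintegral_indicator_one hs,
      hq.law_apply hF t hs, ← lintegral_const_mul _ hm']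
    refine lintegral_congr fun z => ?_
    rw [hq.evolve_const_mul c (measurable_one.indicator hs), mul_left_comm]
  · intro f g _ hf hg ihf ihg
    have h1 : ∫⁻ z, (f + g) z ∂hq.law hF t = ∫⁻ z, f z ∂hq.law hF t + ∫⁻ z, g z ∂hq.law hF t :=
      lintegral_add_left hf g
    have hm : Measurable fun z => F z * evolve Θ q f t z := hF.mul (hq.measurable_evolve hf t)
    rw [h1, ihf, ihg, ← lintegral_add_left hm]
    refine lintegral_congr fun z => ?_
    rw [← mul_add, ← hq.evolve_add_fun hf hg]
    rfl
  · intro f hf hmono ih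
    rw [lintegral_iSup hf hmono]
    simp_rw [ih]
    have hm : ∀ i, Measurable fun z => F z * evolve Θ q (f i) t z := fun i =>
      hF.mul (hq.measurable_evolve (hf i) t)
    rw [← lintegral_iSup hm fun i j hij z =>
      mul_le_mul_right (evolve_mono (fun z _ => hmono hij z) _ _) _]
    refine lintegral_congr fun z => ?_
    rw [hq.evolve_iSup hf hmono, ENNReal.mul_iSup]

lemma law_absolutelyContinuous (hq : IsTransRate Θ q) {F : Phase d → ℝ≥0∞} (hF : Measurable F)
    {t : ℝ} (ht : 0 ≤ t) : hq.law hF t ≪ sigma1 Θ := by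
  refine Measure.AbsolutelyContinuous.mk fun D hD h0 => ?_
  rw [hq.law_apply hF t hD]
  refine (lintegral_congr_ae ?_).trans lintegral_zero
  filter_upwards [hq.ae_evolve_eq_zero (g := D.indicator 1) (measurable_one.indicator hD)
    (by rw [lintegral_indicator_one hD, h0]) ht] with z hz
  rw [hz, mul_zero]

lemma lintegral_mul_evolve_lt_top (hq : IsTransRate Θ q) {F h : Phase d → ℝ≥0∞}
    (hFfin : ∀ n : ℕ, ∫⁻ z in phaseBox d n, F z ∂sigma1 Θ < ⊤) {t : ℝ} (ht : 0 ≤ t)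
    (hh : ∀ z, h z ≤ 1) {n : ℕ} (hn : ∀ z ∉ phaseBox d n, h z = 0) :
    ∫⁻ z, F z * evolve Θ q h t z ∂sigma1 Θ < ⊤ := by
  obtain ⟨m, hm⟩ := exists_nat_ge (n + t)
  refine lt_of_le_of_lt (b := ∫⁻ z in phaseBox d m, F z ∂sigma1 Θ) ?_ (hFfin m)
  rw [← lintegral_indicator (measurableSet_phaseBox _)]
  refine lintegral_mono fun z => ?_
  by_cases hz : z ∈ phaseBox d m
  · rw [indicator_of_mem hz]
    exact (mul_le_mul_right (hq.evolve_le_one hh t z) _).trans_eq (mul_one _)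
  · rw [indicator_of_notMem hz, evolve_eq_zero_of_notMem_phaseBox (Nat.cast_nonneg n) ht
      (fun z _ hz => hn z hz) fun h => hz (phaseBox_mono hm h), mul_zero]

lemma sigmaFinite_law (hq : IsTransRate Θ q) {F : Phase d → ℝ≥0∞} (hF : Measurable F)
    (hFfin : ∀ n : ℕ, ∫⁻ z in phaseBox d n, F z ∂sigma1 Θ < ⊤) {t : ℝ} (ht : 0 ≤ t) :
    SigmaFinite (hq.law hF t) := by
  refine ⟨⟨⟨fun n : ℕ => phaseBox d n, fun _ => trivial, fun n => ?_, iUnion_phaseBox⟩⟩⟩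
  rw [hq.law_apply hF t (measurableSet_phaseBox _)]
  exact hq.lintegral_mul_evolve_lt_top hFfin ht
    (indicator_le_self' fun _ _ => zero_le_one) fun z hz => indicator_of_notMem hz _

/-- The density at time `t` of the process with a nonnegative initial density. -/
lemma exists_density (hq : IsTransRate Θ q) {F : Phase d → ℝ≥0∞} (hF : Measurable F)
    (hFfin : ∀ n : ℕ, ∫⁻ z in phaseBox d n, F z ∂sigma1 Θ < ⊤) {t : ℝ} (ht : 0 ≤ t) :
    ∃ G : Phase d → ℝ≥0∞, Measurable G ∧ (∀ᵐ z ∂sigma1 Θ, G z < ⊤) ∧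
      ∀ h, Measurable h →
        ∫⁻ z, G z * h z ∂sigma1 Θ = ∫⁻ z, F z * evolve Θ q h t z ∂sigma1 Θ := by
  have := hq.sigmaFinite_law hF hFfin ht
  refine ⟨(hq.law hF t).rnDeriv (sigma1 Θ), Measure.measurable_rnDeriv _ _,
    Measure.rnDeriv_lt_top _ _, fun h hh => ?_⟩
  rw [← hq.lintegral_law hF t hh]
  exact lintegral_rnDeriv_mul (hq.law_absolutelyContinuous hF ht) hh.aemeasurable

end IsTransRate

/-- `g` is the density at time `t` of the process with (signed) initial density `f`; the integrals
against test functions are required to agree whenever they converge absolutely. -/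
structure Propagates (Θ : Sph d × Sph d → Sph d × Sph d) (q : Sph d → Sph d → ℝ → Sph d → ℝ≥0∞)
    (t : ℝ) (f g : Phase d → ℝ) : Prop where
  lintegral_le : ∀ h : Phase d → ℝ≥0∞, Measurable h →
    ∫⁻ z, ‖g z‖ₑ * h z ∂sigma1 Θ ≤ ∫⁻ z, ‖f z‖ₑ * evolve Θ q h t z ∂sigma1 Θ
  integral_eq : ∀ h : Phase d → ℝ≥0∞, Measurable h → (∀ z, h z ≤ 1) →
    ∫⁻ z, ‖f z‖ₑ * evolve Θ q h t z ∂sigma1 Θ < ⊤ →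
    ∫ z, g z * (h z).toReal ∂sigma1 Θ = ∫ z, f z * (evolve Θ q h t z).toReal ∂sigma1 Θ
  nonneg : 0 ≤ᵐ[sigma1 Θ] f → 0 ≤ᵐ[sigma1 Θ] g

/-- The density is the difference of those for the positive and the negative part of `f`. -/
lemma IsTransRate.exists_propagates (hq : IsTransRate Θ q) {f : Phase d → ℝ} (hf : Measurable f)
    (hfint : ∀ n : ℕ, IntegrableOn f (phaseBox d n) (sigma1 Θ)) {t : ℝ} (ht : 0 ≤ t) :
    ∃ g : Phase d → ℝ, Measurable g ∧ Propagates Θ q t f g := by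
  have hpos : ∀ n : ℕ, ∫⁻ z in phaseBox d n, ENNReal.ofReal (f z) ∂sigma1 Θ < ⊤ := fun n =>
    lt_of_le_of_lt (lintegral_mono fun z => Real.ofReal_le_enorm _) (hfint n).2
  have hneg : ∀ n : ℕ, ∫⁻ z in phaseBox d n, ENNReal.ofReal (-f z) ∂sigma1 Θ < ⊤ := fun n =>
    lt_of_le_of_lt (lintegral_mono fun z => by
      rw [← enorm_neg]; exact Real.ofReal_le_enorm _) (hfint n).2
  obtain ⟨G, hG, hGfin, hGeq⟩ := hq.exists_density hf.ennreal_ofReal hpos ht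
  obtain ⟨H, hH, hHfin, hHeq⟩ := hq.exists_density
    (F := fun z => ENNReal.ofReal (-f z)) hf.neg.ennreal_ofReal hneg ht
  have hsplit : ∀ z, ‖f z‖ₑ = ENNReal.ofReal (f z) + ENNReal.ofReal (-f z) := by
    intro z
    rcases le_total 0 (f z) with h | h
    · rw [Real.enorm_of_nonneg h, ENNReal.ofReal_of_nonpos (neg_nonpos.2 h), add_zero]
    · rw [← enorm_neg, Real.enorm_of_nonneg (neg_nonneg.2 h), ENNReal.ofReal_of_nonpos h, zero_add]
  have hsum : ∀ h : Phase d → ℝ≥0∞, Measurable h →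
      ∫⁻ z, G z * h z ∂sigma1 Θ + ∫⁻ z, H z * h z ∂sigma1 Θ =
        ∫⁻ z, ‖f z‖ₑ * evolve Θ q h t z ∂sigma1 Θ := by
    intro h hh
    have hm : Measurable fun z => ENNReal.ofReal (f z) * evolve Θ q h t z :=
      hf.ennreal_ofReal.mul (hq.measurable_evolve hh t)
    rw [hGeq h hh, hHeq h hh, ← lintegral_add_left hm]
    refine lintegral_congr fun z => ?_
    rw [hsplit, add_mul]
  refine ⟨fun z => (G z).toReal - (H z).toReal, hG.ennreal_toReal.sub hH.ennreal_toReal, ?_, ?_, ?_⟩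
  · intro h hh
    have hm : Measurable fun z => G z * h z := hG.mul hh
    rw [← hsum h hh, ← lintegral_add_left hm]
    refine lintegral_mono_ae ?_
    filter_upwards [hGfin, hHfin] with z hz1 hz2
    rw [← add_mul]
    refine mul_le_mul_left ((enorm_sub_le).trans (le_of_eq ?_)) _
    rw [Real.enorm_of_nonneg ENNReal.toReal_nonneg, Real.enorm_of_nonneg ENNReal.toReal_nonneg,
      ENNReal.ofReal_toReal hz1.ne, ENNReal.ofReal_toReal hz2.ne]
  · intro h hh hh1 hfin
    have hfin' := hfin
    rw [← hsum h hh] at hfin'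
    have hfG := (ENNReal.add_lt_top.1 hfin').1
    have hfH := (ENNReal.add_lt_top.1 hfin').2
    have hmG : Measurable fun z => G z * h z := hG.mul hh
    have hmH : Measurable fun z => H z * h z := hH.mul hh
    have hev := hq.measurable_evolve hh t
    have hintf : Integrable (fun z => f z * (evolve Θ q h t z).toReal) (sigma1 Θ) := by
      refine ⟨(hf.mul hev.ennreal_toReal).aestronglyMeasurable, ?_⟩
      refine lt_of_le_of_lt (le_of_eq (lintegral_congr fun z => ?_)) hfin
      rw [enorm_mul, Real.enorm_of_nonneg ENNReal.toReal_nonneg, ENNReal.ofReal_toReal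
        (lt_of_le_of_lt (hq.evolve_le_one hh1 t z) ENNReal.one_lt_top).ne]
    have h1 : ∀ z, ((G z).toReal - (H z).toReal) * (h z).toReal =
        (G z * h z).toReal - (H z * h z).toReal := fun z => by
      rw [ENNReal.toReal_mul, ENNReal.toReal_mul, sub_mul]
    simp_rw [h1]
    rw [integral_sub (integrable_toReal_of_lintegral_ne_top hmG.aemeasurable hfG.ne)
      (integrable_toReal_of_lintegral_ne_top hmH.aemeasurable hfH.ne),
      integral_toReal hmG.aemeasurable (ae_lt_top hmG hfG.ne),
      integral_toReal hmH.aemeasurable (ae_lt_top hmH hfH.ne), hGeq h hh, hHeq h hh,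
      integral_eq_lintegral_pos_part_sub_lintegral_neg_part hintf]
    congr 2
    · refine lintegral_congr fun z => ?_
      rw [ENNReal.ofReal_mul' ENNReal.toReal_nonneg, ENNReal.ofReal_toReal
        (lt_of_le_of_lt (hq.evolve_le_one hh1 t z) ENNReal.one_lt_top).ne]
    · refine lintegral_congr fun z => ?_
      rw [← neg_mul, ENNReal.ofReal_mul' ENNReal.toReal_nonneg, ENNReal.ofReal_toReal
        (lt_of_le_of_lt (hq.evolve_le_one hh1 t z) ENNReal.one_lt_top).ne]
  · intro h0
    have h1 : ∫⁻ z, H z * 1 ∂sigma1 Θ = 0 := by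
      refine (hHeq 1 measurable_one).trans ((lintegral_congr_ae ?_).trans lintegral_zero)
      filter_upwards [h0] with z hz
      have hz' : 0 ≤ f z := hz
      have : ENNReal.ofReal (-f z) = 0 := ENNReal.ofReal_of_nonpos (neg_nonpos.2 hz')
      rw [this, zero_mul]
    simp_rw [mul_one] at h1
    filter_upwards [(lintegral_eq_zero_iff hH).1 h1] with z hz
    have hz' : H z = 0 := hz
    simp [hz']

end Local

section Propagator

variable {d : ℕ} {Θ : Sph d × Sph d → Sph d × Sph d} {q : Sph d → Sph d → ℝ → Sph d → ℝ≥0∞}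

namespace IsTransRate

lemma lintegral_phaseBox_lt_top (hq : IsTransRate Θ q) (f : L1loc Θ) (n : ℕ) :
    ∫⁻ z in phaseBox d n, ‖(f : Phase d →ₘ[sigma1 Θ] ℝ) z‖ₑ ∂sigma1 Θ < ⊤ :=
  (hq.mem_L1loc_iff.1 f.2 n).2

lemma lintegral_enorm_mul_evolve_lt_top (hq : IsTransRate Θ q) (f : L1loc Θ) (t : ℝ≥0)
    {D : Set (Phase d)} (hD : Bornology.IsBounded D) :
    ∫⁻ z, ‖(f : Phase d →ₘ[sigma1 Θ] ℝ) z‖ₑ * evolve Θ q (D.indicator 1) t z ∂sigma1 Θ < ⊤ := by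
  obtain ⟨n, hn⟩ := exists_subset_phaseBox hD
  exact hq.lintegral_mul_evolve_lt_top (hq.lintegral_phaseBox_lt_top f) t.2
    (indicator_le_self' fun _ _ => zero_le_one)
    fun z hz => indicator_of_notMem (fun h => hz (hn h)) _

lemma integrable_mul_toReal_evolve (hq : IsTransRate Θ q) {f : Phase d → ℝ} {μ : Measure (Phase d)}
    (hf : AEStronglyMeasurable f μ) {h : Phase d → ℝ≥0∞} (hh : Measurable h) (hh1 : ∀ z, h z ≤ 1)
    {t : ℝ} (hfin : ∫⁻ z, ‖f z‖ₑ * evolve Θ q h t z ∂μ < ⊤) :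
    Integrable (fun z => f z * (evolve Θ q h t z).toReal) μ := by
  refine ⟨hf.mul (hq.measurable_evolve hh t).ennreal_toReal.aestronglyMeasurable, ?_⟩
  refine lt_of_le_of_lt (le_of_eq (lintegral_congr fun z => ?_)) hfin
  rw [enorm_mul, Real.enorm_of_nonneg ENNReal.toReal_nonneg, ENNReal.ofReal_toReal
    (lt_of_le_of_lt (hq.evolve_le_one hh1 t z) ENNReal.one_lt_top).ne]

end IsTransRate

lemma Propagates.congr_right {t : ℝ} {f g g' : Phase d → ℝ} (h : Propagates Θ q t f g)
    (hg : g =ᵐ[sigma1 Θ] g') : Propagates Θ q t f g' where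
  lintegral_le k hk := by
    refine le_trans (le_of_eq (lintegral_congr_ae ?_)) (h.lintegral_le k hk)
    filter_upwards [hg] with z hz
    rw [hz]
  integral_eq k hk hk1 hfin := by
    refine Eq.trans (integral_congr_ae ?_) (h.integral_eq k hk hk1 hfin)
    filter_upwards [hg] with z hz
    rw [hz]
  nonneg h0 := by
    filter_upwards [h.nonneg h0, hg] with z hz hz'
    rwa [← hz']

lemma mul_toReal_indicator_one (f : Phase d → ℝ) (D : Set (Phase d)) (z : Phase d) :
    f z * (D.indicator (1 : Phase d → ℝ≥0∞) z).toReal = D.indicator f z := by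
  by_cases hz : z ∈ D
  · rw [indicator_of_mem hz, indicator_of_mem hz]
    simp
  · rw [indicator_of_notMem hz, indicator_of_notMem hz]
    simp

lemma Propagates.setIntegral_eq {t : ℝ} {f g : Phase d → ℝ} (h : Propagates Θ q t f g)
    {D : Set (Phase d)} (hD : MeasurableSet D)
    (hfin : ∫⁻ z, ‖f z‖ₑ * evolve Θ q (D.indicator 1) t z ∂sigma1 Θ < ⊤) :
    ∫ z in D, g z ∂sigma1 Θ =
      ∫ z, f z * (evolve Θ q (D.indicator 1) t z).toReal ∂sigma1 Θ := by
  rw [← h.integral_eq _ (measurable_one.indicator hD)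
    (indicator_le_self' fun _ _ => zero_le_one) hfin, ← integral_indicator hD]
  simp_rw [mul_toReal_indicator_one]

namespace IsTransRate

lemma exists_propagates_L1loc (hq : IsTransRate Θ q) (t : ℝ≥0) (f : L1loc Θ) :
    ∃ g : L1loc Θ, Propagates Θ q t (f : Phase d →ₘ[sigma1 Θ] ℝ)
      (g : Phase d →ₘ[sigma1 Θ] ℝ) := by
  obtain ⟨g, hg, hP⟩ := hq.exists_propagates (AEEqFun.measurable f.1)
    (hq.mem_L1loc_iff.1 f.2) t.2
  have hae : (AEEqFun.mk g hg.aestronglyMeasurable : Phase d →ₘ[sigma1 Θ] ℝ) =ᵐ[sigma1 Θ] g :=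
    AEEqFun.coeFn_mk _ _
  have hP' := hP.congr_right hae.symm
  refine ⟨⟨AEEqFun.mk g hg.aestronglyMeasurable, hq.mem_L1loc_iff.2 fun n => ?_⟩, hP'⟩
  refine ⟨(AEEqFun.aestronglyMeasurable _).restrict, ?_⟩
  have h1 := hP'.lintegral_le ((phaseBox d n).indicator 1)
    (measurable_one.indicator (measurableSet_phaseBox _))
  refine lt_of_le_of_lt (le_trans (le_of_eq ?_) h1)
    (hq.lintegral_enorm_mul_evolve_lt_top f t (isBounded_phaseBox (d := d) n))
  rw [← lintegral_indicator (measurableSet_phaseBox _)]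
  refine lintegral_congr fun z => ?_
  by_cases hz : z ∈ phaseBox d n
  · rw [indicator_of_mem hz, indicator_of_mem hz, Pi.one_apply, mul_one]
  · rw [indicator_of_notMem hz, indicator_of_notMem hz, mul_zero]

lemma L1loc_ext (hq : IsTransRate Θ q) {f g : L1loc Θ}
    (h : ∀ D, MeasurableSet D → Bornology.IsBounded D → D ⊆ extPhase Θ →
      ∫ z in D, (f : Phase d →ₘ[sigma1 Θ] ℝ) z ∂sigma1 Θ =
        ∫ z in D, (g : Phase d →ₘ[sigma1 Θ] ℝ) z ∂sigma1 Θ) : f = g :=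
  Subtype.ext (AEEqFun.ext (hq.ae_eq_of_forall_setIntegral_eq (hq.mem_L1loc_iff.1 f.2)
    (hq.mem_L1loc_iff.1 g.2) h))

lemma integrableOn_L1loc (hq : IsTransRate Θ q) (f : L1loc Θ) {D : Set (Phase d)}
    (hD : Bornology.IsBounded D) :
    IntegrableOn (f : Phase d →ₘ[sigma1 Θ] ℝ) D (sigma1 Θ) := by
  obtain ⟨n, hn⟩ := exists_subset_phaseBox hD
  exact (hq.mem_L1loc_iff.1 f.2 n).mono_set hn

/-- The propagator `K_t` on locally integrable densities; it is linear because a density is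
determined by its integrals over bounded sets. -/
def propagator (hq : IsTransRate Θ q) (t : ℝ≥0) : L1loc Θ →ₗ[ℝ] L1loc Θ where
  toFun f := (hq.exists_propagates_L1loc t f).choose
  map_add' f g := by
    refine hq.L1loc_ext fun D hD hDb _ => ?_
    have hspec := fun f : L1loc Θ => (hq.exists_propagates_L1loc t f).choose_spec
    have hint := fun f : L1loc Θ => hq.integrable_mul_toReal_evolve f.1.aestronglyMeasurable
      (measurable_one.indicator hD) (indicator_le_self' fun _ _ => zero_le_one)
      (hq.lintegral_enorm_mul_evolve_lt_top f t hDb)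
    have hset := fun f : L1loc Θ => (hspec f).setIntegral_eq hD
      (hq.lintegral_enorm_mul_evolve_lt_top f t hDb)
    set kf := (hq.exists_propagates_L1loc t f).choose
    set kg := (hq.exists_propagates_L1loc t g).choose
    have h1 : ∫ z in D, ((kf + kg : L1loc Θ) : Phase d →ₘ[sigma1 Θ] ℝ) z ∂sigma1 Θ =
        ∫ z in D, ((kf : Phase d →ₘ[sigma1 Θ] ℝ) z + (kg : Phase d →ₘ[sigma1 Θ] ℝ) z)
          ∂sigma1 Θ := by
      refine integral_congr_ae (ae_restrict_of_ae ?_)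
      exact AEEqFun.coeFn_add kf.1 kg.1
    rw [h1, integral_add (hq.integrableOn_L1loc kf hDb) (hq.integrableOn_L1loc kg hDb),
      hset f, hset g, hset (f + g), ← integral_add (hint f) (hint g)]
    refine integral_congr_ae ?_
    filter_upwards [AEEqFun.coeFn_add f.1 g.1] with z hz
    have hz' : ((f + g : L1loc Θ) : Phase d →ₘ[sigma1 Θ] ℝ) z =
      (f : Phase d →ₘ[sigma1 Θ] ℝ) z + (g : Phase d →ₘ[sigma1 Θ] ℝ) z := hz
    rw [hz', add_mul]
  map_smul' c f := by
    refine hq.L1loc_ext fun D hD hDb _ => ?_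
    have hset := fun f : L1loc Θ => (hq.exists_propagates_L1loc t f).choose_spec.setIntegral_eq hD
      (hq.lintegral_enorm_mul_evolve_lt_top f t hDb)
    set kf := (hq.exists_propagates_L1loc t f).choose
    have h1 : ∫ z in D, ((c • kf : L1loc Θ) : Phase d →ₘ[sigma1 Θ] ℝ) z ∂sigma1 Θ =
        ∫ z in D, c * (kf : Phase d →ₘ[sigma1 Θ] ℝ) z ∂sigma1 Θ := by
      refine integral_congr_ae (ae_restrict_of_ae ?_)
      exact AEEqFun.coeFn_smul c kf.1
    rw [RingHom.id_apply, h1, integral_const_mul, hset f, hset (c • f), ← integral_const_mul]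
    refine integral_congr_ae ?_
    filter_upwards [AEEqFun.coeFn_smul c f.1] with z hz
    have hz' : ((c • f : L1loc Θ) : Phase d →ₘ[sigma1 Θ] ℝ) z =
      c * (f : Phase d →ₘ[sigma1 Θ] ℝ) z := hz
    rw [hz', mul_assoc]

lemma propagates_propagator (hq : IsTransRate Θ q) (t : ℝ≥0) (f : L1loc Θ) :
    Propagates Θ q t (f : Phase d →ₘ[sigma1 Θ] ℝ)
      (hq.propagator t f : Phase d →ₘ[sigma1 Θ] ℝ) :=
  (hq.exists_propagates_L1loc t f).choose_spec

lemma setIntegral_propagator (hq : IsTransRate Θ q) (t : ℝ≥0) (f : L1loc Θ) {D : Set (Phase d)}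
    (hD : MeasurableSet D) (hDb : Bornology.IsBounded D) :
    ∫ z in D, (hq.propagator t f : Phase d →ₘ[sigma1 Θ] ℝ) z ∂sigma1 Θ =
      ∫ z, (f : Phase d →ₘ[sigma1 Θ] ℝ) z *
        (evolve Θ q (D.indicator 1) t z).toReal ∂sigma1 Θ :=
  (hq.propagates_propagator t f).setIntegral_eq hD
    (hq.lintegral_enorm_mul_evolve_lt_top f t hDb)

/-- The defining property of the propagators in terms of the process. -/
theorem isPropagated_iff [NeZero d] (hq : IsTransRate Θ q) {R : Sph d → (E d ≃ₗᵢ[ℝ] E d)}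
    (hR : ∀ v w ξ u, 0 < ξ → (q v w ξ u).toReal = transDens Θ R v w ξ u)
    (hfin : ∀ v w ξ u, q v w ξ u ≠ ⊤) (t : ℝ≥0) (f g : L1loc Θ) :
    IsPropagated Θ R t f g ↔ g = hq.propagator t f := by
  have key : ∀ D : Set (Phase d), MeasurableSet D → Bornology.IsBounded D → D ⊆ extPhase Θ →
      HasProb Θ R (f : Phase d →ₘ[sigma1 Θ] ℝ) (fun _ : Fin 1 => t) (fun _ => D)
        (∫ z in D, (hq.propagator t f : Phase d →ₘ[sigma1 Θ] ℝ) z ∂(sigma1 Θ)) := by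
    intro D hD hDb hDX
    rw [hq.setIntegral_propagator t f hD hDb]
    exact hq.hasProb hR hfin (AEEqFun.measurable f.1) (t := fun _ => t) monotone_const
      (D := fun _ => D) (fun _ => hD) (fun _ => hDX) 0
      (hq.integrable_mul_toReal_evolve f.1.aestronglyMeasurable
        (measurable_one.indicator hD) (indicator_le_self' fun _ _ => zero_le_one)
        (hq.lintegral_enorm_mul_evolve_lt_top f t hDb))
  constructor
  · intro h
    refine hq.L1loc_ext fun D hD hDb hDX => ?_
    exact (h D hD hDb hDX).2.unique (key D hD hDb hDX).2
  · rintro rfl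
    exact key

lemma propagator_zero (hq : IsTransRate Θ q) : hq.propagator 0 = LinearMap.id := by
  ext1 f
  refine hq.L1loc_ext fun D hD hDb _ => ?_
  rw [hq.setIntegral_propagator 0 f hD hDb, LinearMap.id_apply, ← integral_indicator hD]
  refine integral_congr_ae ?_
  filter_upwards [ae_evolve_zero hq (D.indicator 1)] with z hz
  rw [NNReal.coe_zero, hz, mul_toReal_indicator_one]

lemma propagator_add (hq : IsTransRate Θ q) (s t : ℝ≥0) :
    hq.propagator (s + t) = (hq.propagator s).comp (hq.propagator t) := by
  ext1 f
  refine hq.L1loc_ext fun D hD hDb _ => ?_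
  have hm : Measurable (D.indicator (1 : Phase d → ℝ≥0∞)) := measurable_one.indicator hD
  have h1 : ∀ z, evolve Θ q (evolve Θ q (D.indicator 1) s) t z =
      evolve Θ q (D.indicator 1) (s + t : ℝ≥0) z := fun z => by
    rw [← hq.evolve_add hm t.coe_nonneg s.coe_nonneg, NNReal.coe_add, add_comm]
  rw [hq.setIntegral_propagator _ f hD hDb, LinearMap.comp_apply,
    hq.setIntegral_propagator _ _ hD hDb, (hq.propagates_propagator t f).integral_eq _
      (hq.measurable_evolve hm s)
      (hq.evolve_le_one (indicator_le_self' fun _ _ => zero_le_one) s)]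
  · simp_rw [h1]
  · simp_rw [h1]
    exact hq.lintegral_enorm_mul_evolve_lt_top f _ hDb

end IsTransRate

end Propagator

/-! ### The contraction semigroup on integrable densities -/

section Contraction

variable {d : ℕ} {Θ : Sph d × Sph d → Sph d × Sph d} {q : Sph d → Sph d → ℝ → Sph d → ℝ≥0∞}

namespace IsTransRate

lemma lintegral_enorm_mul_evolve_le (hq : IsTransRate Θ q) (f : Phase d → ℝ)
    {h : Phase d → ℝ≥0∞} (hh : ∀ z, h z ≤ 1) (t : ℝ) :
    ∫⁻ z, ‖f z‖ₑ * evolve Θ q h t z ∂sigma1 Θ ≤ ∫⁻ z, ‖f z‖ₑ ∂sigma1 Θ :=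
  lintegral_mono fun z =>
    (mul_le_mul_right (hq.evolve_le_one hh t z) _).trans_eq (mul_one _)

lemma lintegral_enorm_lt_top (f : L1 Θ) : ∫⁻ z, ‖f z‖ₑ ∂sigma1 Θ < ⊤ :=
  (memLp_one_iff_integrable.1 (Lp.memLp f)).2

lemma lintegral_enorm_propagator_le (hq : IsTransRate Θ q) (t : ℝ≥0) (f : L1 Θ) :
    ∫⁻ z, ‖(hq.propagator t (toLoc f) : Phase d →ₘ[sigma1 Θ] ℝ) z‖ₑ ∂sigma1 Θ ≤
      ∫⁻ z, ‖f z‖ₑ ∂sigma1 Θ := by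
  have h := (hq.propagates_propagator t (toLoc f)).lintegral_le 1 measurable_one
  simp only [Pi.one_apply, mul_one] at h
  exact h.trans (hq.lintegral_enorm_mul_evolve_le _ (fun _ => le_rfl) t)

/-- The propagator `K_t f` of an integrable density. -/
def propagatorFun (hq : IsTransRate Θ q) (t : ℝ≥0) (f : L1 Θ) : L1 Θ :=
  ⟨(hq.propagator t (toLoc f)).1, by
    rw [Lp.mem_Lp_iff_memLp, memLp_one_iff_integrable]
    exact ⟨AEEqFun.aestronglyMeasurable _,
      lt_of_le_of_lt (hq.lintegral_enorm_propagator_le t f) (lintegral_enorm_lt_top f)⟩⟩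

lemma toLoc_injective : Function.Injective (toLoc (Θ := Θ)) := fun _ _ h =>
  Subtype.ext (congrArg (fun g : L1loc Θ => (g : Phase d →ₘ[sigma1 Θ] ℝ)) h)

/-- The propagator as a contraction on integrable densities. -/
def propagatorL1 (hq : IsTransRate Θ q) (t : ℝ≥0) : L1 Θ →L[ℝ] L1 Θ :=
  LinearMap.mkContinuous
    { toFun := hq.propagatorFun t
      map_add' := fun f g => toLoc_injective ((hq.propagator t).map_add (toLoc f) (toLoc g))
      map_smul' := fun c f => toLoc_injective ((hq.propagator t).map_smul c (toLoc f)) } 1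
    (fun f => by
      rw [one_mul, L1.norm_def, L1.norm_def]
      exact ENNReal.toReal_mono (lintegral_enorm_lt_top f).ne
        (hq.lintegral_enorm_propagator_le t f))

lemma toLoc_propagatorL1 (hq : IsTransRate Θ q) (t : ℝ≥0) (f : L1 Θ) :
    toLoc (hq.propagatorL1 t f) = hq.propagator t (toLoc f) := rfl

lemma norm_propagatorL1_le (hq : IsTransRate Θ q) (t : ℝ≥0) : ‖hq.propagatorL1 t‖ ≤ 1 :=
  LinearMap.mkContinuous_norm_le _ zero_le_one _

lemma propagates_propagatorL1 (hq : IsTransRate Θ q) (t : ℝ≥0) (f : L1 Θ) :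
    Propagates Θ q t f (hq.propagatorL1 t f) := hq.propagates_propagator t (toLoc f)

lemma propagatorL1_zero (hq : IsTransRate Θ q) :
    hq.propagatorL1 0 = ContinuousLinearMap.id ℝ (L1 Θ) := by
  ext1 f
  refine toLoc_injective ?_
  rw [toLoc_propagatorL1, hq.propagator_zero]
  rfl

lemma propagatorL1_add (hq : IsTransRate Θ q) (s t : ℝ≥0) :
    hq.propagatorL1 (s + t) = (hq.propagatorL1 s).comp (hq.propagatorL1 t) := by
  ext1 f
  refine toLoc_injective ?_
  rw [toLoc_propagatorL1, hq.propagator_add]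
  rfl

lemma integral_propagatorL1_mul (hq : IsTransRate Θ q) (t : ℝ≥0) (f : L1 Θ)
    {h : Phase d → ℝ≥0∞} (hh : Measurable h) (hh1 : ∀ z, h z ≤ 1) :
    ∫ z, hq.propagatorL1 t f z * (h z).toReal ∂sigma1 Θ =
      ∫ z, f z * (evolve Θ q h t z).toReal ∂sigma1 Θ :=
  (hq.propagates_propagatorL1 t f).integral_eq h hh hh1
    (lt_of_le_of_lt (hq.lintegral_enorm_mul_evolve_le _ hh1 t) (lintegral_enorm_lt_top f))

lemma integral_propagatorL1 (hq : IsTransRate Θ q) (t : ℝ≥0) (f : L1 Θ) :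
    ∫ z, hq.propagatorL1 t f z ∂sigma1 Θ = ∫ z, f z ∂sigma1 Θ := by
  have h := hq.integral_propagatorL1_mul t f measurable_one fun _ => le_rfl
  simp only [Pi.one_apply, ENNReal.toReal_one, mul_one] at h
  rw [h]
  refine integral_congr_ae ?_
  filter_upwards [hq.ae_mem_extPhase] with z hz
  rw [hq.evolve_one t hz, ENNReal.toReal_one, mul_one]

lemma propagatorL1_nonneg (hq : IsTransRate Θ q) (t : ℝ≥0) {f : L1 Θ} (hf : 0 ≤ f) :
    0 ≤ hq.propagatorL1 t f :=
  (Lp.coeFn_nonneg _).1 ((hq.propagates_propagatorL1 t f).nonneg ((Lp.coeFn_nonneg _).2 hf))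

end IsTransRate

lemma measurePreserving_flow (t : ℝ) :
    MeasurePreserving (flow t) (phaseMeasure d) (phaseMeasure d) := by
  refine ⟨measurable_flow_right t, Measure.ext_of_lintegral _ fun F hF => ?_⟩
  rw [lintegral_map hF (measurable_flow_right t), lintegral_flow hF]

lemma continuous_flow : Continuous fun p : ℝ × Phase d => flow p.1 p.2 := by
  unfold flow
  fun_prop

instance (d : ℕ) : IsLocallyFiniteMeasure (phaseMeasure d) := by
  unfold phaseMeasure stepMeasure
  infer_instance

/-- Translation along the free flow is continuous in the mean. -/
lemma tendsto_integral_flow_sub {F : Phase d → ℝ} (hF : Integrable F (phaseMeasure d)) :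
    Filter.Tendsto (fun t : ℝ≥0 => ∫ z, ‖F (flow (-t) z) - F z‖ ∂phaseMeasure d)
      (nhds 0) (nhds 0) := by
  have hF1 : MemLp F 1 (phaseMeasure d) := memLp_one_iff_integrable.2 hF
  let c : C(ℝ≥0, C(Phase d, Phase d)) := ContinuousMap.curry
    ⟨fun p : ℝ≥0 × Phase d => flow (-(p.1 : ℝ)) p.2, continuous_flow.comp
      (by fun_prop : Continuous fun p : ℝ≥0 × Phase d => (-(p.1 : ℝ), p.2))⟩
  have hc : ∀ t, MeasurePreserving (c t) (phaseMeasure d) (phaseMeasure d) := fun t =>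
    show MeasurePreserving (flow (-(t : ℝ))) _ _ from measurePreserving_flow _
  have hcont : Continuous fun t => Lp.compMeasurePreserving (c t) (hc t) (hF1.toLp F) :=
    Continuous.compMeasurePreservingLp continuous_const c.continuous hc (by simp)
  have h0 : Lp.compMeasurePreserving (c 0) (hc 0) (hF1.toLp F) = hF1.toLp F := by
    rw [Lp.toLp_compMeasurePreserving]
    refine (MemLp.toLp_eq_toLp_iff _ _).2 (Filter.Eventually.of_forall fun z => ?_)
    change F (flow (-((0 : ℝ≥0) : ℝ)) z) = F z
    rw [NNReal.coe_zero, neg_zero, flow_zero]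
  have h1 := ((hcont.tendsto 0).sub_const (hF1.toLp F)).norm
  rw [h0, sub_self, norm_zero] at h1
  refine h1.congr fun t => ?_
  rw [Lp.toLp_compMeasurePreserving, ← MemLp.toLp_sub, L1.norm_eq_integral_norm]
  refine integral_congr_ae ?_
  filter_upwards [MemLp.coeFn_toLp ((hF1.comp_measurePreserving (hc t)).sub hF1)] with z hz
  rw [hz]
  rfl

namespace IsTransRate

lemma integral_sigma1 (hq : IsTransRate Θ q) (G : Phase d → ℝ) :
    ∫ z, G z ∂sigma1 Θ = ∫ z, (extPhase Θ).indicator G z ∂phaseMeasure d :=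
  (integral_indicator hq.measurableSet_extPhase).symm

/-- Within a short time most states move by free flight, so that the dual of the transition operator
is close to translation along the flow. -/
lemma abs_integral_mul_evolve_sub_le (hq : IsTransRate Θ q) {u : Phase d → ℝ}
    (hu : Measurable u) (hui : Integrable u (sigma1 Θ)) (t : ℝ≥0) {D : Set (Phase d)}
    (hD : MeasurableSet D) :
    |∫ z, u z * (evolve Θ q (D.indicator 1) t z).toReal ∂sigma1 Θ - ∫ z in D, u z ∂sigma1 Θ| ≤
      ∫ z, ‖(extPhase Θ).indicator u (flow (-t) z) - (extPhase Θ).indicator u z‖ ∂phaseMeasure d +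
        ∫ z, (hitSet Θ t).indicator (fun z => ‖u z‖) z ∂sigma1 Θ := by
  have hX := hq.measurableSet_extPhase
  have hD2 : ∀ z, D.indicator (1 : Phase d → ℝ≥0∞) z ≤ 1 :=
    indicator_le_self' fun _ _ => zero_le_one
  set e : Phase d → ℝ := fun z => (evolve Θ q (D.indicator 1) t z).toReal with he
  have he0 : ∀ z, 0 ≤ e z := fun z => ENNReal.toReal_nonneg
  have he1 : ∀ z, e z ≤ 1 := fun z =>
    ENNReal.toReal_le_of_le_ofReal zero_le_one (by simpa using hq.evolve_le_one hD2 t z)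
  have hem : Measurable e := (hq.measurable_evolve (measurable_one.indicator hD) t).ennreal_toReal
  have hw : Measurable ((extPhase Θ).indicator u) := hu.indicator hX
  have hiF : Integrable ((extPhase Θ).indicator u) (phaseMeasure d) :=
    (integrable_indicator_iff hX).2 hui
  have hflow := measurePreserving_flow (d := d) (-t)
  have hiG : Integrable (fun z => (extPhase Θ).indicator u (flow (-t) z)) (phaseMeasure d) :=
    hflow.integrable_comp_of_integrable hiF
  have hhit : MeasurableSet (hitSet Θ t) :=
    hX.inter (measurableSet_le (by fun_prop) measurable_const)
  let P : Set (Phase d) := {z | 0 < z.2.2.1} ∩ D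
  have hP : MeasurableSet P :=
    (measurableSet_lt measurable_const
      (by fun_prop : Measurable fun z : Phase d => z.2.2.1)).inter hD
  have hfl : MeasurableSet (flow t ⁻¹' P) := hP.preimage (measurable_flow_right _)
  let a : Phase d → ℝ := (flow t ⁻¹' P).indicator ((extPhase Θ).indicator u)
  have ham : Measurable a := hw.indicator hfl
  have hai : Integrable a (phaseMeasure d) := hiF.indicator hfl
  have hue : Integrable (fun z => u z * e z) (sigma1 Θ) := by
    refine hui.mono (hu.mul hem).aestronglyMeasurable (Filter.Eventually.of_forall fun z => ?_)
    rw [norm_mul, Real.norm_of_nonneg (he0 z)]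
    exact mul_le_of_le_one_right (norm_nonneg _) (he1 z)
  -- the contribution of the states which suffer a collision
  have h1 : ∫ z, u z * e z ∂sigma1 Θ = ∫ z, a z ∂sigma1 Θ +
      ∫ z, (hitSet Θ t).indicator (fun z => u z * e z) z ∂sigma1 Θ := by
    have hai' : Integrable a (sigma1 Θ) := hai.mono_measure Measure.restrict_le_self
    rw [← integral_add hai' (hue.indicator hhit)]
    refine integral_congr_ae ?_
    filter_upwards [hq.ae_mem_extPhase] with z hz
    rcases mem_freeSet_or_mem_hitSet hz (t : ℝ) with h | h
    · have hlt : (t : ℝ) < z.2.2.1 := h.2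
      rw [indicator_of_notMem (notMem_hitSet_of_mem_freeSet h), add_zero]
      simp only [he, a]
      rw [evolve_of_mem_freeSet h]
      by_cases hzD : flow t z ∈ D
      · have hzP : z ∈ flow t ⁻¹' P := ⟨sub_pos.2 hlt, hzD⟩
        rw [indicator_of_mem hzP, indicator_of_mem hz]
        simp [hzD]
      · have hzP : z ∉ flow t ⁻¹' P := fun h => hzD h.2
        rw [indicator_of_notMem hzP]
        simp [hzD]
    · have hzP : z ∉ flow t ⁻¹' P := by
        intro h'
        have h2 : z.2.2.1 ≤ t := h.2
        have h3 : 0 < z.2.2.1 - t := h'.1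
        linarith
      simp only [a]
      rw [indicator_of_notMem hzP, indicator_of_mem h, zero_add]
  -- substitute along the flow in the contribution of the other states
  have h2 : ∫ z, a z ∂sigma1 Θ =
      ∫ z, P.indicator (fun z => (extPhase Θ).indicator u (flow (-t) z)) z ∂phaseMeasure d := by
    have h3 : (extPhase Θ).indicator a = a := by
      refine indicator_eq_self.2 fun z hz => ?_
      by_contra hzX
      refine hz ?_
      simp only [a]
      rw [indicator_apply_eq_zero]
      exact fun _ => indicator_of_notMem hzX _
    have h4 : ∫ z, a z ∂phaseMeasure d = ∫ z, a (flow (-t) z) ∂phaseMeasure d := by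
      conv_lhs => rw [← hflow.map_eq]
      exact integral_map hflow.measurable.aemeasurable ham.aestronglyMeasurable
    rw [hq.integral_sigma1, h3, h4]
    refine integral_congr_ae (Filter.Eventually.of_forall fun z => ?_)
    have h5 : flow t (flow (-t) z) = z := by rw [flow_flow, neg_add_cancel, flow_zero]
    by_cases hz : z ∈ P
    · have hz' : flow (-t) z ∈ flow t ⁻¹' P := by rwa [mem_preimage, h5]
      simp only [a]
      rw [indicator_of_mem hz', indicator_of_mem hz]
    · have hz' : flow (-t) z ∉ flow t ⁻¹' P := by rwa [mem_preimage, h5]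
      simp only [a]
      rw [indicator_of_notMem hz', indicator_of_notMem hz]
  have h3 : ∫ z in D, u z ∂sigma1 Θ =
      ∫ z, P.indicator ((extPhase Θ).indicator u) z ∂phaseMeasure d := by
    have h4 : P.indicator ((extPhase Θ).indicator u) = (extPhase Θ).indicator (P.indicator u) := by
      rw [indicator_indicator, indicator_indicator, inter_comm]
    rw [← integral_indicator hD, h4, ← hq.integral_sigma1]
    refine integral_congr_ae ?_
    filter_upwards [ae_len_pos hq] with z hz
    by_cases hzD : z ∈ D
    · rw [indicator_of_mem hzD, indicator_of_mem (show z ∈ P from ⟨hz, hzD⟩)]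
    · rw [indicator_of_notMem hzD, indicator_of_notMem fun h : z ∈ P => hzD h.2]
  rw [h1, h2, h3, add_sub_right_comm, ← integral_sub (hiG.indicator hP) (hiF.indicator hP)]
  refine (abs_add_le _ _).trans (add_le_add ?_ ?_)
  · have hn : Integrable (fun z => ‖(extPhase Θ).indicator u (flow (-t) z) -
        (extPhase Θ).indicator u z‖) (phaseMeasure d) := (hiG.sub hiF).norm
    rw [← Real.norm_eq_abs]
    refine norm_integral_le_of_norm_le hn
      (Filter.Eventually.of_forall fun z => ?_)
    by_cases hz : z ∈ P
    · simp only [indicator_of_mem hz]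
      exact le_rfl
    · simp only [indicator_of_notMem hz, sub_self, norm_zero]
      exact norm_nonneg _
  · rw [← Real.norm_eq_abs]
    refine norm_integral_le_of_norm_le (hui.norm.indicator hhit)
      (Filter.Eventually.of_forall fun z => ?_)
    by_cases hz : z ∈ hitSet Θ t
    · simp only [indicator_of_mem hz]
      rw [norm_mul, Real.norm_of_nonneg (he0 z)]
      exact mul_le_of_le_one_right (norm_nonneg _) (he1 z)
    · simp only [indicator_of_notMem hz, norm_zero]
      exact le_rfl

lemma tendsto_integral_hitSet (hq : IsTransRate Θ q) {u : Phase d → ℝ}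
    (hui : Integrable u (sigma1 Θ)) :
    Filter.Tendsto (fun t : ℝ≥0 => ∫ z, (hitSet Θ t).indicator (fun z => ‖u z‖) z ∂sigma1 Θ)
      (nhds 0) (nhds 0) := by
  have hhit : ∀ t : ℝ≥0, MeasurableSet (hitSet Θ t) := fun t =>
    hq.measurableSet_extPhase.inter (measurableSet_le (by fun_prop) measurable_const)
  have h := tendsto_integral_filter_of_dominated_convergence (μ := sigma1 Θ) (l := nhds (0 : ℝ≥0))
    (F := fun t z => (hitSet Θ t).indicator (fun z => ‖u z‖) z) (f := fun _ => 0) (fun z => ‖u z‖)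
    (Filter.Eventually.of_forall fun t => (hui.norm.indicator (hhit t)).1)
    (Filter.Eventually.of_forall fun t => Filter.Eventually.of_forall fun z => by
      by_cases hz : z ∈ hitSet Θ t
      · rw [indicator_of_mem hz, norm_norm]
      · rw [indicator_of_notMem hz, norm_zero]
        exact norm_nonneg _) hui.norm ?_
  · rwa [integral_zero] at h
  · filter_upwards [ae_len_pos hq] with z hz
    refine tendsto_const_nhds.congr' ?_
    have hnhds : ∀ᶠ t : ℝ≥0 in nhds 0, (t : ℝ) < z.2.2.1 :=
      NNReal.continuous_coe.continuousAt.eventually (gt_mem_nhds (by simpa using hz))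
    filter_upwards [hnhds] with t ht
    refine (indicator_of_notMem (fun h => ?_) _).symm
    have h2 : z.2.2.1 ≤ t := h.2
    linarith

/-- Strong continuity at time zero: test `K_t f - f` against the sets where it is positive or
negative. -/
lemma tendsto_propagatorL1_zero (hq : IsTransRate Θ q) (f : L1 Θ) :
    Filter.Tendsto (fun t => ‖hq.propagatorL1 t f - f‖) (nhds 0) (nhds 0) := by
  have hmf : Measurable f := (Lp.stronglyMeasurable f).measurable
  have hif : Integrable f (sigma1 Θ) := memLp_one_iff_integrable.1 (Lp.memLp f)
  have hiF : Integrable ((extPhase Θ).indicator f) (phaseMeasure d) :=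
    (integrable_indicator_iff hq.measurableSet_extPhase).2 hif
  have hlim := ((tendsto_integral_flow_sub hiF).add (hq.tendsto_integral_hitSet hif)).const_mul 2
  rw [add_zero, mul_zero] at hlim
  refine squeeze_zero (fun t => norm_nonneg _) (fun t => ?_) hlim
  set g := hq.propagatorL1 t f
  have hig : Integrable g (sigma1 Θ) := memLp_one_iff_integrable.1 (Lp.memLp g)
  have hmg : Measurable g := (Lp.stronglyMeasurable g).measurable
  have key : ∀ D, MeasurableSet D → |∫ z in D, (g z - f z) ∂sigma1 Θ| ≤
      ∫ z, ‖(extPhase Θ).indicator f (flow (-t) z) - (extPhase Θ).indicator f z‖ ∂phaseMeasure d +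
        ∫ z, (hitSet Θ t).indicator (fun z => ‖f z‖) z ∂sigma1 Θ := by
    intro D hD
    have h1 := (hq.propagates_propagatorL1 t f).setIntegral_eq hD
      (lt_of_le_of_lt (hq.lintegral_enorm_mul_evolve_le _
        (indicator_le_self' fun _ _ => zero_le_one) t) (lintegral_enorm_lt_top f))
    rw [integral_sub hig.integrableOn hif.integrableOn, h1]
    exact hq.abs_integral_mul_evolve_sub_le hmf hif t hD
  -- split according to the sign of `g - f`
  let D : Set (Phase d) := {z | 0 ≤ g z - f z}
  have hD : MeasurableSet D := measurableSet_le measurable_const (hmg.sub hmf)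
  have h1 : ‖g - f‖ = ∫ z, ‖g z - f z‖ ∂sigma1 Θ := by
    rw [L1.norm_eq_integral_norm]
    refine integral_congr_ae ?_
    filter_upwards [Lp.coeFn_sub g f] with z hz
    rw [hz, Pi.sub_apply]
  have h2 : ∫ z, ‖g z - f z‖ ∂sigma1 Θ =
      ∫ z in D, (g z - f z) ∂sigma1 Θ - ∫ z in Dᶜ, (g z - f z) ∂sigma1 Θ := by
    have hn : Integrable (fun z => ‖g z - f z‖) (sigma1 Θ) := (hig.sub hif).norm
    rw [← integral_add_compl hD hn, sub_eq_add_neg, ← integral_neg]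
    congr 1
    · refine setIntegral_congr_fun hD fun z hz => ?_
      exact Real.norm_of_nonneg hz
    · refine setIntegral_congr_fun hD.compl fun z hz => ?_
      have hz' : ¬0 ≤ g z - f z := hz
      exact Real.norm_of_nonpos (not_le.1 hz').le
  rw [h1, h2, two_mul]
  refine le_trans (le_abs_self _) ((abs_sub _ _).trans (add_le_add (key D hD) (key _ hD.compl)))

/-- The propagators form a strongly continuous semigroup of contractions. -/
theorem isContractionSemigroup (hq : IsTransRate Θ q) :
    IsContractionSemigroup hq.propagatorL1 where
  zero := hq.propagatorL1_zero
  add := hq.propagatorL1_add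
  norm_le_one := hq.norm_propagatorL1_le
  strongly_continuous f := by
    have hle : ∀ s t : ℝ≥0, s ≤ t → dist (hq.propagatorL1 t f) (hq.propagatorL1 s f) ≤
        ‖hq.propagatorL1 (t - s) f - f‖ := by
      intro s t hst
      have h1 : hq.propagatorL1 t f = hq.propagatorL1 s (hq.propagatorL1 (t - s) f) := by
        rw [← ContinuousLinearMap.comp_apply, ← hq.propagatorL1_add, add_tsub_cancel_of_le hst]
      rw [dist_eq_norm, h1, ← map_sub]
      exact ((hq.propagatorL1 s).le_of_opNorm_le (hq.norm_propagatorL1_le s) _).trans_eq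
        (one_mul _)
    refine continuous_iff_continuousAt.2 fun s => tendsto_iff_dist_tendsto_zero.2 ?_
    have hc : Filter.Tendsto (fun t : ℝ≥0 => (t - s) + (s - t)) (nhds s) (nhds 0) := by
      have : Continuous fun t : ℝ≥0 => (t - s) + (s - t) := by fun_prop
      simpa using this.tendsto s
    refine squeeze_zero (fun _ => dist_nonneg) (fun t => ?_)
      ((hq.tendsto_propagatorL1_zero f).comp hc)
    rcases le_total s t with h | h
    · simpa [tsub_eq_zero_of_le h] using hle s t h
    · rw [dist_comm]
      simpa [tsub_eq_zero_of_le h] using hle t s h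

/-- The iterated propagators are dual to the iterated transition operators. -/
lemma integral_markovChain_mul (hq : IsTransRate Θ q) (f : L1 Θ) {t : ℕ → ℝ≥0} (ht : Monotone t)
    {D : ℕ → Set (Phase d)} (hD : ∀ k, MeasurableSet (D k)) (m : ℕ)
    {h : Phase d → ℝ≥0∞} (hh : Measurable h) (hh1 : ∀ z, h z ≤ 1) :
    ∫ z, markovChain hq.propagatorL1 f t hD m z * (h z).toReal ∂sigma1 Θ =
      ∫ z, f z * (nest Θ q (fun j => (t j : ℝ)) D m h z).toReal ∂sigma1 Θ := by
  induction m generalizing h with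
  | zero => exact hq.integral_propagatorL1_mul (t 0) f hh hh1
  | succ m ih =>
    have hts : ((t (m + 1) - t m : ℝ≥0) : ℝ) = t (m + 1) - t m :=
      NNReal.coe_sub (ht (Nat.le_succ m))
    have hem := hq.measurable_evolve hh (t (m + 1) - t m)
    rw [markovChain, hq.integral_propagatorL1_mul _ _ hh hh1, nest, ← ih
      (h := fun z => (D m).indicator 1 z * evolve Θ q h (t (m + 1) - t m) z)
      ((measurable_one.indicator (hD m)).mul hem)
      (fun z => mul_le_one' (indicator_le_self' (fun _ _ => zero_le_one) z)
        (hq.evolve_le_one hh1 _ z)), hts]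
    refine integral_congr_ae ?_
    have hcut : cut (hD m) (markovChain hq.propagatorL1 f t hD m) =ᵐ[sigma1 Θ]
        (D m).indicator (markovChain hq.propagatorL1 f t hD m) := MemLp.coeFn_toLp _
    filter_upwards [hcut] with z hz
    rw [hz]
    by_cases hzD : z ∈ D m
    · simp [hzD]
    · simp [hzD]

/-- The Markov property: the finite-dimensional distributions are iterated integrals of the
propagators. -/
theorem hasProb_markovChain [NeZero d] (hq : IsTransRate Θ q) {R : Sph d → (E d ≃ₗᵢ[ℝ] E d)}
    (hR : ∀ v w ξ u, 0 < ξ → (q v w ξ u).toReal = transDens Θ R v w ξ u)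
    (hfin : ∀ v w ξ u, q v w ξ u ≠ ⊤) (f : L1 Θ) {t : ℕ → ℝ≥0} (ht : Monotone t)
    {D : ℕ → Set (Phase d)} (hD : ∀ k, MeasurableSet (D k)) (hDX : ∀ k, D k ⊆ extPhase Θ)
    (m : ℕ) : HasProb Θ R f (fun j : Fin (m + 1) => t j) (fun j => D j)
      (∫ z in D m, markovChain hq.propagatorL1 f t hD m z ∂sigma1 Θ) := by
  have hm1 : Measurable ((D m).indicator (1 : Phase d → ℝ≥0∞)) := measurable_one.indicator (hD m)
  have hle1 : ∀ z, (D m).indicator (1 : Phase d → ℝ≥0∞) z ≤ 1 :=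
    indicator_le_self' fun _ _ => zero_le_one
  have hmf : Measurable f := (Lp.stronglyMeasurable f).measurable
  have hif : Integrable f (sigma1 Θ) := memLp_one_iff_integrable.1 (Lp.memLp f)
  have h1 : ∫ z in D m, markovChain hq.propagatorL1 f t hD m z ∂sigma1 Θ =
      ∫ z, f z * (nest Θ q (fun j => (t j : ℝ)) D m ((D m).indicator 1) z).toReal ∂sigma1 Θ := by
    rw [← hq.integral_markovChain_mul f ht hD m hm1 hle1, ← integral_indicator (hD m)]
    simp_rw [mul_toReal_indicator_one]
  rw [h1]
  refine hq.hasProb hR hfin hmf ht hD hDX m (hif.mono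
    (hmf.mul (hq.measurable_nest _ hD m hm1).ennreal_toReal).aestronglyMeasurable
    (Filter.Eventually.of_forall fun z => ?_))
  rw [norm_mul, Real.norm_of_nonneg ENNReal.toReal_nonneg]
  refine mul_le_of_le_one_right (norm_nonneg _) ?_
  exact ENNReal.toReal_le_of_le_ofReal zero_le_one
    (by simpa using hq.nest_le_one _ D m hle1 z)

end IsTransRate

end Contraction

/-! ### The periodic Lorentz gas -/

section Lorentz

variable {n : ℕ} [NeZero n] {Θ : Sph (n + 1) × Sph (n + 1) → Sph (n + 1) × Sph (n + 1)}
  {R : Sph (n + 1) → (E (n + 1) ≃ₗᵢ[ℝ] E (n + 1))}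

/-- The transition density of the periodic Lorentz gas defines a process. -/
lemma isTransRate_transRate (hΘ : IsScatteringMap Θ) (hR : IsFrame R) :
    IsTransRate Θ (transRate Θ R) where
  measurableSet_outPairs := hΘ.measurableSet_outPairs
  measurable := measurable_transRate hΘ hR
  eq_zero_of_nonpos _ _ _ _ h := transRate_of_nonpos h
  eq_zero_of_notMem _ _ _ _ h := transRate_of_notMem h
  lintegral_eq_one _ _ h := lintegral_transRate hΘ hR h
  lintegral_le v w ξ := lintegral_transRate_le hΘ hR v w ξ

lemma toReal_transRate (v w : Sph (n + 1)) (ξ : ℝ) (u : Sph (n + 1)) (hξ : 0 < ξ) :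
    (transRate Θ R v w ξ u).toReal = transDens Θ R v w ξ u := by
  rw [transRate_of_pos hξ, ENNReal.toReal_ofReal (transDens_nonneg _ _ _ _)]

lemma transRate_ne_top (v w : Sph (n + 1)) (ξ : ℝ) (u : Sph (n + 1)) :
    transRate Θ R v w ξ u ≠ ⊤ := by
  rcases le_or_gt ξ 0 with h | h
  · rw [transRate_of_nonpos h]
    exact ENNReal.zero_ne_top
  · rw [transRate_of_pos h]
    exact ENNReal.ofReal_ne_top

end Lorentz

end LorentzGas

end

theorem mainTheorem10 (d : ℕ) [NeZero d] (hd : 2 ≤ d)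
    (Θ : LorentzGas.Sph d × LorentzGas.Sph d → LorentzGas.Sph d × LorentzGas.Sph d)
    (hΘ : LorentzGas.IsScatteringMap Θ)
    (R : LorentzGas.Sph d → (LorentzGas.E d ≃ₗᵢ[ℝ] LorentzGas.E d))
    (hR : LorentzGas.IsFrame R) :
    ∃ K : ℝ≥0 → (LorentzGas.L1loc Θ →ₗ[ℝ] LorentzGas.L1loc Θ),
      -- the propagators are well defined on all of `L¹_loc`
      (∀ (t : ℝ≥0) (f g : LorentzGas.L1loc Θ),
        LorentzGas.IsPropagated Θ R t f g ↔ g = K t f) ∧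
      -- they form a semigroup on `L¹_loc`
      K 0 = LinearMap.id ∧
      (∀ s t : ℝ≥0, K (s + t) = (K s).comp (K t)) ∧
      -- they restrict to a strongly continuous contraction semigroup on `L¹`
      ∃ U : ℝ≥0 → (LorentzGas.L1 Θ →L[ℝ] LorentzGas.L1 Θ),
        (∀ (t : ℝ≥0) (f : LorentzGas.L1 Θ),
          K t (LorentzGas.toLoc f) = LorentzGas.toLoc (U t f)) ∧
        LorentzGas.IsContractionSemigroup U ∧
        -- the process is Markovian: the propagators preserve positivity and total mass, and the
        -- finite-dimensional distributions are those of a Markov process with these propagators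
        (∀ (t : ℝ≥0) (f : LorentzGas.L1 Θ), 0 ≤ f → 0 ≤ U t f) ∧
        (∀ (t : ℝ≥0) (f : LorentzGas.L1 Θ),
          ∫ z, U t f z ∂(LorentzGas.sigma1 Θ) = ∫ z, f z ∂(LorentzGas.sigma1 Θ)) ∧
        (∀ (f : LorentzGas.L1 Θ) (t : ℕ → ℝ≥0), Monotone t →
          ∀ (D : ℕ → Set (LorentzGas.Phase d)) (hD : ∀ k, MeasurableSet (D k)),
          (∀ k, D k ⊆ LorentzGas.extPhase Θ) → ∀ m : ℕ,
          LorentzGas.HasProb Θ R f (fun j : Fin (m + 1) => t j) (fun j => D j)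
            (∫ z in D m, LorentzGas.markovChain U f t hD m z ∂(LorentzGas.sigma1 Θ))) := by
  obtain ⟨n, rfl⟩ : ∃ n, d = n + 1 := Nat.exists_eq_succ_of_ne_zero (NeZero.ne d)
  have : NeZero n := ⟨by omega⟩
  have hq := LorentzGas.isTransRate_transRate hΘ hR
  exact ⟨hq.propagator, hq.isPropagated_iff LorentzGas.toReal_transRate LorentzGas.transRate_ne_top,
    hq.propagator_zero, hq.propagator_add, hq.propagatorL1,
    fun t f => (hq.toLoc_propagatorL1 t f).symm,
    hq.isContractionSemigroup, fun t f hf => hq.propagatorL1_nonneg t hf, hq.integral_propagatorL1,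
    fun f t ht D hD hDX m => hq.hasProb_markovChain LorentzGas.toReal_transRate
      LorentzGas.transRate_ne_top f ht hD hDX m⟩
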